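/- **Setting.** Let $q>\tfrac12$ and let $p=p(\tau)$ be a smooth equation of state on $\tau>0$ with $0<p'<1$. Einstein–Euler means $\mathrm{Ric}_{\mu\nu}-\tfrac12Rg_{\mu\nu}=T_{\mu\nu}$ and $D_\alpha T^{\alpha\mu}=0$ with $T_{\mu\nu}=(\tau+p)v_\mu v_\nu+pg_{\mu\nu}$ and $g(v,v)=-1$. Coordinates are $(u,\underline u,\theta)$ with $\theta\in\mathbb T^2=\mathbb R^2/\mathbb Z^2$, and the metric has the double null form $$g=-2\Omega^2(du\otimes d\underline u+d\underline u\otimes du)+\gamma_{AB}(d\theta^A-b^Adu)\otimes(d\theta^B-b^Bdu).$$ The frame is $e_A=\partial_{\theta^A}$, $e_3=\partial_u+b^A\partial_{\theta^A}$, $e_4=\Omega^{-2}\partial_{\underline u}$ (so $g(e_3,e_4)=-2$), and $v=v^Ae_A+v^3e_3+v^4e_4$. The Ricci coefficients are $\chi_{AB}=g(D_Ae_4,e_B)=\tfrac12\Omega^{-2}\partial_{\underline u}\gamma_{AB}$, $\underline\chi_{AB}=g(D_Ae_3,e_B)=\tfrac12(\partial_u\gamma+\mathcal L_b\gamma)_{AB}$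 and $\zeta_A=\tfrac12g(D_Ae_4,e_3)=-\tfrac14\Omega^{-2}\gamma_{AB}\partial_{\underline u}b^B$; hats denote traceless parts. $K$, $\nabla$ and $\mathrm{div}$ refer to $\gamma$ on the tori $S_{u,\underline u}$, $\underline\alpha_{AB}=W(e_A,e_3,e_B,e_3)$ with $W$ the Weyl tensor, $H_0=\{u=0,\ 0\le\underline u<\underline u_*\}$, $\underline H_0=\{\underline u=0,\ 0\le u<u_*\}$, and $$f(u)=(u_*-u)^{1/2}\log^q\tfrac1{u_*-u}.$$ For $\varepsilon>0$ put $\partial_\nu\in\{\varepsilon\partial_{\underline u},\partial_{\theta^1},\partial_{\theta^2}\}$. $L^2(S)$ norms are taken componentwise with respect to $\sqrt{\det\gamma}\,d\theta$, and $\partial_\nu^i$ stands for all multi-indices of length $i$. *Smooth characteristic initial data, compatible at the corner,* are smooth $(\gamma,\Omega,b,v,\tau)$ on $H_0\cup\underline H_0$ together with their transversal derivatives of all orders (the jets along $H_0\cup\underline H_0$ of smooth fields on a neighbourhood), with $\gamma$ positive definite, $\tau>0$, $v^3,v^4>0$, $\Omega=1$ on $H_0\cup\underline H_0$ and $b^A=0$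 on $\underline H_0$, such that the Einstein equations, the Euler equations and $g(v,v)=-1$ hold to infinite order along $H_0\cup\underline H_0$. (Thus transversal derivatives are those given by the equations.) **Proposition.** There are constants $0<d\le D$, $c,C>0$ and $0<\varepsilon_0<1$, depending only on $q$ and the equation of state, such that for all $0<\varepsilon\le\varepsilon_0$ and all $0<u_*,\underline u_*\le\varepsilon$ with $\|f^{-1}\|_{L^2(0,u_*)}<\varepsilon$ there is a one-parameter family, indexed by $s\in[0,1]$, of smooth characteristic initial data compatible at the corner, any two members of which differ in $\gamma$, $v$ or $\tau$ at some point of $H_0\cup\underline H_0$, each of which has the following properties. 1. On $S_{0,0}$: $d\le\det\gamma\le D$, and $|\partial_\nu^a\gamma_{AB}|\le D$ for $|a|\le6$. 2. The null constraint equations hold, with $\mathrm{Ric}$ and $R$ given by the matter ($\mathrm{Ric}=T-\tfrac12(\mathrm{tr}\,T)g$, $R=-\mathrm{tr}\,T$). On $\underline H_0$: $$\partial_u\mathrm{tr}\underline\chi=-\tfrac12(\mathrm{tr}\underline\chi)^2-|\hat{\underline\chi}|^2-\mathrm{Ric}_{33},$$ $$\partial_u\mathrm{tr}\chi+\mathrm{tr}\underline\chi\,\mathrm{tr}\chi=-2K+2\,\mathrm{div}\zeta+2|\zeta|^2+\mathrm{Ric}_{34}+R,$$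 $$\partial_u\zeta_A+\mathrm{tr}\underline\chi\,\zeta_A=-(\mathrm{div}\underline\chi)_A+\partial_A\mathrm{tr}\underline\chi+\mathrm{Ric}_{3A};$$ on $H_0$: $$\partial_{\underline u}\mathrm{tr}\chi=-\tfrac12(\mathrm{tr}\chi)^2-|\hat\chi|^2-\mathrm{Ric}_{44},$$ $$\partial_{\underline u}\mathrm{tr}\underline\chi+\mathrm{tr}\chi\,\mathrm{tr}\underline\chi=-2K-2\,\mathrm{div}\zeta+2|\zeta|^2+\mathrm{Ric}_{43}+R,$$ $$\partial_{\underline u}\zeta_A+\mathrm{tr}\chi\,\zeta_A=(\mathrm{div}\chi)_A-\partial_A\mathrm{tr}\chi-\mathrm{Ric}_{4A}.$$ 3. The Ricci coefficients and the fluid satisfy $$\sum_{i\le5}\sup_{\underline u}\|\partial_\nu^i\chi\|_{L^2(S_{0,\underline u})}+\sum_{i\le4}\sup_{\underline u}\|\partial_\nu^i(\zeta,\mathrm{tr}\underline\chi,v,\log\tau)\|_{L^2(S_{0,\underline u})}\le D,$$ $$\sum_{i\le5}\sup_{u}\|f(u)^2\partial_\nu^i\underline\chi\|_{L^2(S_{u,0})}+\sum_{i\le4}\sup_{u}\|\partial_\nu^i(\zeta,\mathrm{tr}\chi,v,\log\tau)\|_{L^2(S_{u,0})}\le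 D.$$ 4. The fluid data stay bounded: $$\sum_{i\le4}\sup_{\underline u}\|\partial_\nu^i\partial_u(v,\log\tau)\|_{L^2(S_{0,\underline u})}\le D,\qquad \sum_{i\le5}\sup_{\underline u}\|\partial_\nu^i(v,\log\tau)\|_{L^2(S_{0,\underline u})}\le D,$$ $$\sum_{i\le4}\sup_u\|f(u)^2\partial_\nu^i\partial_u(v,\log\tau)\|_{L^2(S_{u,0})}\le D,\qquad \sum_{i\le5}\sup_u\|\partial_\nu^i(v,\log\tau)\|_{L^2(S_{u,0})}\le D.$$ 5. Exact blow-up rate: $c\,f(u)^{-2}\le|\hat{\underline\chi}|_\gamma(u,0,\theta)\le C\,f(u)^{-2}$ for all $0\le u<u_*$ and all $\theta$. 6. Curvature blow-up: for all $0\le u<u_*$ and all $\theta$, $$|\underline\alpha_{11}|,\ |\underline\alpha_{22}|\ \ge\ \frac{c}{(u_*-u)^2\log^{2q}\frac1{u_*-u}},\qquad |\underline\alpha_{12}|\ \le\ \frac{C}{(u_*-u)^2\log^{4q}\frac1{u_*-u}}\qquad\text{at }(u,0,\theta).$$ -/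

import Mathlib

open scoped ContDiff

noncomputable section

namespace EinsteinEuler

/-! ### Coordinate calculus

Points are `x = (u, ubar, θ¹, θ²)`.  The torus is `ℝ²/ℤ²`, and functions on it are functions of
`(θ¹, θ²)` with period `1` in each variable. -/

/-- A point in the coordinates `(u, ubar, θ¹, θ²)`. -/
abbrev Pt := Fin 4 → ℝ

/-- The point with coordinates `(u, ubar, θ)`. -/
def pt (u ub : ℝ) (θ : ℝ × ℝ) : Pt := ![u, ub, θ.1, θ.2]

/-- The coordinate index of `θ^A`. -/
def ang : Fin 2 → Fin 4 := ![2, 3]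

/-- The coordinate derivative `∂_μ F`. -/
def pd (μ : Fin 4) (F : Pt → ℝ) : Pt → ℝ := fun x => fderiv ℝ F x (Pi.single μ 1)

/-- Christoffel symbols `Γ^i_{jk}` of the Levi-Civita connection of the (pseudo-)Riemannian metric
`h`, whose indices correspond to the coordinates `x^{dir 0}, …, x^{dir (n-1)}`.  With `dir = id` this
is the spacetime connection, with `dir = ang` the induced connection of the tori of constant
`(u, ubar)`. -/
def christoffel {n : ℕ} (dir : Fin n → Fin 4) (h : Pt → Matrix (Fin n) (Fin n) ℝ)
    (i j k : Fin n) (x : Pt) : ℝ :=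
  (1 / 2) * ∑ l, (h x)⁻¹ i l *
    (pd (dir j) (fun y => h y l k) x + pd (dir k) (fun y => h y l j) x
      - pd (dir l) (fun y => h y j k) x)

/-- Riemann tensor
`R^i_{jkl} = ∂_k Γ^i_{lj} - ∂_l Γ^i_{kj} + Γ^i_{km} Γ^m_{lj} - Γ^i_{lm} Γ^m_{kj}`. -/
def riemannUp {n : ℕ} (dir : Fin n → Fin 4) (h : Pt → Matrix (Fin n) (Fin n) ℝ)
    (i j k l : Fin n) (x : Pt) : ℝ :=
  pd (dir k) (christoffel dir h i l j) x - pd (dir l) (christoffel dir h i k j) x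
    + ∑ m, (christoffel dir h i k m x * christoffel dir h m l j x
      - christoffel dir h i l m x * christoffel dir h m k j x)

/-- `R_{ijkl} = h_{im} R^m_{jkl}`. -/
def riemann {n : ℕ} (dir : Fin n → Fin 4) (h : Pt → Matrix (Fin n) (Fin n) ℝ)
    (i j k l : Fin n) (x : Pt) : ℝ :=
  ∑ m, h x i m * riemannUp dir h m j k l x

/-- Ricci tensor `Ric_{jl} = R^i_{jil}`. -/
def ricci {n : ℕ} (dir : Fin n → Fin 4) (h : Pt → Matrix (Fin n) (Fin n) ℝ)
    (j l : Fin n) (x : Pt) : ℝ :=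
  ∑ i, riemannUp dir h i j i l x

/-- Scalar curvature. -/
def scalarCurv {n : ℕ} (dir : Fin n → Fin 4) (h : Pt → Matrix (Fin n) (Fin n) ℝ) (x : Pt) : ℝ :=
  ∑ j, ∑ l, (h x)⁻¹ j l * ricci dir h j l x

/-- `B(X, Y) = X^μ B_{μν} Y^ν`. -/
def contract (B : Fin 4 → Fin 4 → ℝ) (X Y : Fin 4 → ℝ) : ℝ := ∑ μ, ∑ ν, X μ * B μ ν * Y ν

/-- All partial derivatives of `F`, of every order (including order `0`), vanish at `x`. -/
def VanishesToInfiniteOrder (F : Pt → ℝ) (x : Pt) : Prop :=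
  ∀ k : ℕ, iteratedFDeriv ℝ k F x = 0

/-! ### Metric and fluid in a double null gauge -/

/-- Lapse `Ω`, shift `b^A`, metric `γ_{AB}` of the tori, and the fluid: the components of the
velocity `v = v^A e_A + v³ e₃ + v⁴ e₄` with `e_A = ∂_{θ^A}`, `e₃ = ∂_u + b^A ∂_{θ^A}`,
`e₄ = Ω⁻² ∂_ubar`, and the proper energy density `τ`. -/
structure Fields where
  Ω : Pt → ℝ
  b : Fin 2 → Pt → ℝ
  γ : Fin 2 → Fin 2 → Pt → ℝ
  vA : Fin 2 → Pt → ℝ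
  v3 : Pt → ℝ
  v4 : Pt → ℝ
  τ : Pt → ℝ

namespace Fields

/-- `γ` as a matrix. -/
def γMat (X : Fields) (x : Pt) : Matrix (Fin 2) (Fin 2) ℝ := Matrix.of fun A B => X.γ A B x

/-- The components of the one-form `dθ^A - b^A du`. -/
def form (X : Fields) (A : Fin 2) (μ : Fin 4) (x : Pt) : ℝ :=
  (if μ = ang A then 1 else 0) - X.b A x * (if μ = 0 then 1 else 0)

/-- `g = -2Ω²(du ⊗ dubar + dubar ⊗ du) + γ_{AB}(dθ^A - b^A du) ⊗ (dθ^B - b^B du)`. -/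
def metric (X : Fields) (x : Pt) : Matrix (Fin 4) (Fin 4) ℝ :=
  Matrix.of fun μ ν =>
    -2 * X.Ω x ^ 2 *
        ((if μ = 0 ∧ ν = 1 then 1 else 0) + (if μ = 1 ∧ ν = 0 then 1 else 0))
      + ∑ A, ∑ B, X.γ A B x * X.form A μ x * X.form B ν x

def e3 (X : Fields) (x : Pt) : Fin 4 → ℝ := ![1, 0, X.b 0 x, X.b 1 x]

def e4 (X : Fields) (x : Pt) : Fin 4 → ℝ := ![0, (X.Ω x ^ 2)⁻¹, 0, 0]

def eA (A : Fin 2) : Fin 4 → ℝ := Pi.single (ang A) 1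

/-- Coordinate components of the fluid velocity. -/
def vel (X : Fields) (x : Pt) (μ : Fin 4) : ℝ :=
  X.v3 x * X.e3 x μ + X.v4 x * X.e4 x μ + ∑ A, X.vA A x * eA A μ

def velLow (X : Fields) (x : Pt) (μ : Fin 4) : ℝ := ∑ ν, X.metric x μ ν * X.vel x ν

def logτ (X : Fields) (x : Pt) : ℝ := Real.log (X.τ x)

/-! The matter model; `P` is the equation of state `p = P(τ)`. -/

/-- `T_{μν} = (τ + p) v_μ v_ν + p g_{μν}`. -/
def stress (P : ℝ → ℝ) (X : Fields) (x : Pt) (μ ν : Fin 4) : ℝ :=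
  (X.τ x + P (X.τ x)) * X.velLow x μ * X.velLow x ν + P (X.τ x) * X.metric x μ ν

/-- `T^{μν} = (τ + p) v^μ v^ν + p g^{μν}`. -/
def stressUp (P : ℝ → ℝ) (X : Fields) (x : Pt) (μ ν : Fin 4) : ℝ :=
  (X.τ x + P (X.τ x)) * X.vel x μ * X.vel x ν + P (X.τ x) * (X.metric x)⁻¹ μ ν

/-- `Ric_{μν} - R g_{μν} / 2 - T_{μν}`. -/
def einsteinRes (P : ℝ → ℝ) (X : Fields) (μ ν : Fin 4) (x : Pt) : ℝ :=
  ricci id X.metric μ ν x - (1 / 2) * scalarCurv id X.metric x * X.metric x μ ν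
    - X.stress P x μ ν

/-- `D_α T^{αμ} = ∂_α T^{αμ} + Γ^α_{αβ} T^{βμ} + Γ^μ_{αβ} T^{αβ}`. -/
def eulerRes (P : ℝ → ℝ) (X : Fields) (μ : Fin 4) (x : Pt) : ℝ :=
  ∑ α, (pd α (fun y => X.stressUp P y α μ) x
    + ∑ β, (christoffel id X.metric α α β x * X.stressUp P x β μ
      + christoffel id X.metric μ α β x * X.stressUp P x α β))

/-- `g(v, v) + 1`. -/
def normRes (X : Fields) (x : Pt) : ℝ := contract (X.metric x) (X.vel x) (X.vel x) + 1

/-! The null second fundamental forms and the torsion: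
`χ_{AB} = g(D_A e₄, e_B)`, `χbar_{AB} = g(D_A e₃, e_B)`, `ζ_A = g(D_A e₄, e₃)/2`,
written out for the metric and the frame above. -/

/-- `χ = (1/2) Ω⁻² ∂_ubar γ`. -/
def χ (X : Fields) (A B : Fin 2) (x : Pt) : ℝ :=
  (1 / 2) * (X.Ω x ^ 2)⁻¹ * pd 1 (X.γ A B) x

/-- `χbar = (1/2) (∂_u γ + ℒ_b γ)`; where `b = 0` this is `(1/2) ∂_u γ`. -/
def χb (X : Fields) (A B : Fin 2) (x : Pt) : ℝ :=
  (1 / 2) * (pd 0 (X.γ A B) x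
    + ∑ C, (X.b C x * pd (ang C) (X.γ A B) x
      + X.γ C B x * pd (ang A) (X.b C) x + X.γ A C x * pd (ang B) (X.b C) x))

/-- `ζ_A = -(1/4) Ω⁻² γ_{AB} ∂_ubar b^B`. -/
def ζ (X : Fields) (A : Fin 2) (x : Pt) : ℝ :=
  -(1 / 4) * (X.Ω x ^ 2)⁻¹ * ∑ B, X.γ A B x * pd 1 (X.b B) x

/-- Trace with respect to `γ`. -/
def tr (X : Fields) (h : Fin 2 → Fin 2 → Pt → ℝ) (x : Pt) : ℝ :=
  ∑ A, ∑ B, (X.γMat x)⁻¹ A B * h A B x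

def trχ (X : Fields) : Pt → ℝ := X.tr X.χ

def trχb (X : Fields) : Pt → ℝ := X.tr X.χb

/-- The traceless part of a symmetric two-tensor. -/
def hat (X : Fields) (h : Fin 2 → Fin 2 → Pt → ℝ) (A B : Fin 2) (x : Pt) : ℝ :=
  h A B x - (1 / 2) * X.tr h x * X.γ A B x

/-- `|h|²_γ` for a two-tensor. -/
def normSq₂ (X : Fields) (h : Fin 2 → Fin 2 → Pt → ℝ) (x : Pt) : ℝ :=
  ∑ A, ∑ B, ∑ C, ∑ D, (X.γMat x)⁻¹ A C * (X.γMat x)⁻¹ B D * h A B x * h C D x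

/-- `|ξ|²_γ` for a one-form. -/
def normSq₁ (X : Fields) (ξ : Fin 2 → Pt → ℝ) (x : Pt) : ℝ :=
  ∑ A, ∑ B, (X.γMat x)⁻¹ A B * ξ A x * ξ B x

/-- Gauss curvature of the tori. -/
def K (X : Fields) (x : Pt) : ℝ := (1 / 2) * scalarCurv ang X.γMat x

/-- Divergence of a one-form on the tori. -/
def div₁ (X : Fields) (ξ : Fin 2 → Pt → ℝ) (x : Pt) : ℝ :=
  ∑ A, ∑ B, (X.γMat x)⁻¹ A B *
    (pd (ang A) (ξ B) x - ∑ C, christoffel ang X.γMat C A B x * ξ C x)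

/-- Divergence `∇^B h_{BA}` of a two-tensor on the tori. -/
def div₂ (X : Fields) (h : Fin 2 → Fin 2 → Pt → ℝ) (A : Fin 2) (x : Pt) : ℝ :=
  ∑ B, ∑ C, (X.γMat x)⁻¹ B C *
    (pd (ang B) (h C A) x
      - ∑ D, (christoffel ang X.γMat D B C x * h D A x
        + christoffel ang X.γMat D B A x * h C D x))

/-- Trace of the energy-momentum tensor. -/
def stressTr (P : ℝ → ℝ) (X : Fields) (x : Pt) : ℝ :=
  ∑ μ, ∑ ν, (X.metric x)⁻¹ μ ν * X.stress P x μ ν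

/-- The Ricci tensor prescribed by the matter, `T_{μν} - (tr T) g_{μν} / 2`, on two vectors. -/
def matterRic (P : ℝ → ℝ) (X : Fields) (x : Pt) (Y Z : Fin 4 → ℝ) : ℝ :=
  contract (fun μ ν => X.stress P x μ ν - (1 / 2) * X.stressTr P x * X.metric x μ ν) Y Z

/-- The scalar curvature prescribed by the matter. -/
def matterScal (P : ℝ → ℝ) (X : Fields) (x : Pt) : ℝ := -X.stressTr P x

/-- The Weyl tensor `W_{abcd}` of the spacetime metric. -/
def weyl (X : Fields) (x : Pt) (a b c d : Fin 4) : ℝ :=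
  riemann id X.metric a b c d x
    - (1 / 2) * (X.metric x a c * ricci id X.metric b d x - X.metric x a d * ricci id X.metric b c x
      - X.metric x b c * ricci id X.metric a d x + X.metric x b d * ricci id X.metric a c x)
    + (1 / 6) * scalarCurv id X.metric x *
      (X.metric x a c * X.metric x b d - X.metric x a d * X.metric x b c)

/-- `αbar_{AB} = W(e_A, e₃, e_B, e₃)`. -/
def αb (X : Fields) (A B : Fin 2) (x : Pt) : ℝ :=
  ∑ m, ∑ n, X.e3 x m * X.e3 x n * X.weyl x (ang A) m (ang B) n

end Fields

/-! ### Norms -/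

/-- `∂_ν^a = (ε ∂_ubar)^{a 0} ∂_{θ¹}^{a 1} ∂_{θ²}^{a 2}`. -/
def dν (ε : ℝ) (a : Fin 3 → ℕ) (φ : Pt → ℝ) : Pt → ℝ :=
  fun x => ε ^ a 0 * (pd 1)^[a 0] ((pd 2)^[a 1] ((pd 3)^[a 2] φ)) x

/-- `‖∂_ν^i φ‖_{L²(S_{u,ubar})}` for a tuple `φ` of components, with respect to the area measure
`√(det γ) dθ¹ dθ²`; the sum runs over all multi-indices of length `i`. -/
def l2S (X : Fields) (ε : ℝ) (i : ℕ) (φ : List (Pt → ℝ)) (u ub : ℝ) : ENNReal :=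
  (∫⁻ θ in Set.Icc (0 : ℝ) 1 ×ˢ Set.Icc (0 : ℝ) 1,
    ENNReal.ofReal
      ((φ.map fun ψ => ∑ a ∈ Finset.Nat.antidiagonalTuple 3 i, dν ε a ψ (pt u ub θ) ^ 2).sum
        * Real.sqrt (X.γMat (pt u ub θ)).det)) ^ (1 / 2 : ℝ)

/-- `∑_{i ≤ m} sup_{0 ≤ ubar < ubar_*} ‖∂_ν^i φ‖_{L²(S_{0,ubar})}`. -/
def normH0 (X : Fields) (ε ubs : ℝ) (m : ℕ) (φ : List (Pt → ℝ)) : ENNReal :=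
  ∑ i ∈ Finset.range (m + 1), ⨆ ub ∈ Set.Ico 0 ubs, l2S X ε i φ 0 ub

/-- `∑_{i ≤ m} sup_{0 ≤ u < u_*} w(u) ‖∂_ν^i φ‖_{L²(S_{u,0})}`. -/
def normHb0 (X : Fields) (ε us : ℝ) (w : ℝ → ℝ) (m : ℕ) (φ : List (Pt → ℝ)) : ENNReal :=
  ∑ i ∈ Finset.range (m + 1), ⨆ u ∈ Set.Ico 0 us, ENNReal.ofReal (w u) * l2S X ε i φ u 0

/-- All components of a two-tensor. -/
def comps (h : Fin 2 → Fin 2 → Pt → ℝ) : List (Pt → ℝ) := [h 0 0, h 0 1, h 1 0, h 1 1]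

/-- The components of `(v, log τ)`. -/
def fluid (X : Fields) : List (Pt → ℝ) := [X.vA 0, X.vA 1, X.v3, X.v4, X.logτ]

/-- The weight `f(u) = (u_* - u)^{1/2} log^q (1 / (u_* - u))`. -/
def wt (q us u : ℝ) : ℝ := (us - u) ^ (1 / 2 : ℝ) * Real.log (1 / (us - u)) ^ q

/-! ### Characteristic initial data -/

/-- `H₀ ∩ {0 ≤ ubar < ubar_*}`. -/
def H0 (ubs : ℝ) : Set Pt := {x | x 0 = 0 ∧ 0 ≤ x 1 ∧ x 1 < ubs}

/-- `Hbar₀ ∩ {0 ≤ u < u_*}`. -/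
def Hb0 (us : ℝ) : Set Pt := {x | x 1 = 0 ∧ 0 ≤ x 0 ∧ x 0 < us}

/-- An open set containing `H₀ ∪ Hbar₀` and not meeting the singular boundary. -/
def region (us ubs : ℝ) : Set Pt := {x | x 0 < us ∧ x 1 < ubs}

/-- Smooth characteristic initial data for the Einstein–Euler system on `H₀ ∪ Hbar₀`, compatible
at the corner.  The data consist of the restrictions to `H₀ ∪ Hbar₀` of the fields and of their
transversal derivatives of all orders, and are represented by smooth fields on a neighbourhood
(only whose jets along `H₀ ∪ Hbar₀` matter).  That the transversal derivatives are the ones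
determined by the equations, and that the data on the two hypersurfaces are compatible to every
order at the corner, is the requirement that the Einstein equations, the Euler equations and the
normalization of the velocity hold to infinite order along `H₀ ∪ Hbar₀`. -/
structure IsCharData (P : ℝ → ℝ) (us ubs : ℝ) (X : Fields) : Prop where
  smooth_Ω : ContDiffOn ℝ ∞ X.Ω (region us ubs)
  smooth_b : ∀ A, ContDiffOn ℝ ∞ (X.b A) (region us ubs)
  smooth_γ : ∀ A B, ContDiffOn ℝ ∞ (X.γ A B) (region us ubs)
  smooth_vA : ∀ A, ContDiffOn ℝ ∞ (X.vA A) (region us ubs)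
  smooth_v3 : ContDiffOn ℝ ∞ X.v3 (region us ubs)
  smooth_v4 : ContDiffOn ℝ ∞ X.v4 (region us ubs)
  smooth_τ : ContDiffOn ℝ ∞ X.τ (region us ubs)
  /-- The fields are functions on the torus. -/
  periodic : ∀ x ∈ region us ubs, ∀ C : Fin 2,
    let y : Pt := x + Pi.single (ang C) 1
    X.Ω y = X.Ω x ∧ (∀ A, X.b A y = X.b A x) ∧ (∀ A B, X.γ A B y = X.γ A B x) ∧
      (∀ A, X.vA A y = X.vA A x) ∧ X.v3 y = X.v3 x ∧ X.v4 y = X.v4 x ∧ X.τ y = X.τ x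
  symm_γ : ∀ A B, X.γ A B = X.γ B A
  pos_γ : ∀ x ∈ H0 ubs ∪ Hb0 us, (X.γMat x).PosDef
  pos_τ : ∀ x ∈ H0 ubs ∪ Hb0 us, 0 < X.τ x
  /-- The velocity is future directed. -/
  pos_v : ∀ x ∈ H0 ubs ∪ Hb0 us, 0 < X.v3 x ∧ 0 < X.v4 x
  gauge_Ω : ∀ x ∈ H0 ubs ∪ Hb0 us, X.Ω x = 1
  gauge_b : ∀ x ∈ Hb0 us, ∀ A, X.b A x = 0
  einstein : ∀ x ∈ H0 ubs ∪ Hb0 us, ∀ μ ν, VanishesToInfiniteOrder (X.einsteinRes P μ ν) x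
  euler : ∀ x ∈ H0 ubs ∪ Hb0 us, ∀ μ, VanishesToInfiniteOrder (X.eulerRes P μ) x
  normalized : ∀ x ∈ H0 ubs ∪ Hb0 us, VanishesToInfiniteOrder X.normRes x

/-- The null constraint equations.  On `Hbar₀` one has `e₃ = ∂_u`, and on `H₀` one has
`e₄ = ∂_ubar`, so that the projected Lie derivatives are coordinate derivatives of components. -/
structure NullConstraints (P : ℝ → ℝ) (us ubs : ℝ) (X : Fields) : Prop where
  trχb_Hb0 : ∀ x ∈ Hb0 us,
    pd 0 X.trχb x = -(1 / 2) * X.trχb x ^ 2 - X.normSq₂ (X.hat X.χb) x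
      - X.matterRic P x (X.e3 x) (X.e3 x)
  trχ_Hb0 : ∀ x ∈ Hb0 us,
    pd 0 X.trχ x + X.trχb x * X.trχ x = -2 * X.K x + 2 * X.div₁ X.ζ x + 2 * X.normSq₁ X.ζ x
      + (X.matterRic P x (X.e3 x) (X.e4 x) + X.matterScal P x)
  ζ_Hb0 : ∀ x ∈ Hb0 us, ∀ A,
    pd 0 (X.ζ A) x + X.trχb x * X.ζ A x = -X.div₂ X.χb A x + pd (ang A) X.trχb x
      + X.matterRic P x (X.e3 x) (Fields.eA A)
  trχ_H0 : ∀ x ∈ H0 ubs,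
    pd 1 X.trχ x = -(1 / 2) * X.trχ x ^ 2 - X.normSq₂ (X.hat X.χ) x
      - X.matterRic P x (X.e4 x) (X.e4 x)
  trχb_H0 : ∀ x ∈ H0 ubs,
    pd 1 X.trχb x + X.trχ x * X.trχb x = -2 * X.K x - 2 * X.div₁ X.ζ x + 2 * X.normSq₁ X.ζ x
      + (X.matterRic P x (X.e4 x) (X.e3 x) + X.matterScal P x)
  ζ_H0 : ∀ x ∈ H0 ubs, ∀ A,
    pd 1 (X.ζ A) x + X.trχ x * X.ζ A x = X.div₂ X.χ A x - pd (ang A) X.trχ x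
      - X.matterRic P x (X.e4 x) (Fields.eA A)

/-- The quantitative hypotheses on the initial data, with constants `0 < d ≤ D`. -/
structure DataBounds (q ε us ubs d D : ℝ) (X : Fields) : Prop where
  det_γ : ∀ θ, d ≤ (X.γMat (pt 0 0 θ)).det ∧ (X.γMat (pt 0 0 θ)).det ≤ D
  deriv_γ : ∀ i ≤ 6, ∀ a ∈ Finset.Nat.antidiagonalTuple 3 i, ∀ A B θ,
    |dν ε a (X.γ A B) (pt 0 0 θ)| ≤ D
  /-- Ricci coefficients and fluid variables on `H₀`. -/
  bound_H0 : normH0 X ε ubs 5 (comps X.χ)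
      + normH0 X ε ubs 4 ([X.ζ 0, X.ζ 1, X.trχb] ++ fluid X) ≤ ENNReal.ofReal D
  /-- Ricci coefficients and fluid variables on `Hbar₀`. -/
  bound_Hb0 : normHb0 X ε us (fun u => wt q us u ^ 2) 5 (comps X.χb)
      + normHb0 X ε us (fun _ => 1) 4 ([X.ζ 0, X.ζ 1, X.trχ] ++ fluid X) ≤ ENNReal.ofReal D
  /-- Higher and `∂_u` derivatives of the fluid variables. -/
  fluid_u_H0 : normH0 X ε ubs 4 ((fluid X).map (pd 0)) ≤ ENNReal.ofReal D
  fluid_H0 : normH0 X ε ubs 5 (fluid X) ≤ ENNReal.ofReal D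
  fluid_u_Hb0 : normHb0 X ε us (fun u => wt q us u ^ 2) 4 ((fluid X).map (pd 0))
      ≤ ENNReal.ofReal D
  fluid_Hb0 : normHb0 X ε us (fun _ => 1) 5 (fluid X) ≤ ENNReal.ofReal D

/-- The exact blow-up rate `c f(u)⁻² ≤ |χbar-hat|(u, 0, θ) ≤ C f(u)⁻²`. -/
def ExactBlowup (q us c C : ℝ) (X : Fields) : Prop :=
  ∀ u ∈ Set.Ico 0 us, ∀ θ,
    c * (wt q us u ^ 2)⁻¹ ≤ Real.sqrt (X.normSq₂ (X.hat X.χb) (pt u 0 θ)) ∧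
      Real.sqrt (X.normSq₂ (X.hat X.χb) (pt u 0 θ)) ≤ C * (wt q us u ^ 2)⁻¹

/-- The curvature blow-up condition on `Hbar₀`; the logarithmic exponent `2q` is the one in
`f(u)⁻² = (u_* - u)⁻¹ log^{-2q}(1 / (u_* - u))`. -/
def CurvatureBlowup (q us c C : ℝ) (X : Fields) : Prop :=
  ∀ u ∈ Set.Ico 0 us, ∀ θ,
    (∀ A : Fin 2, c / ((us - u) ^ 2 * Real.log (1 / (us - u)) ^ (2 * q))
      ≤ |X.αb A A (pt u 0 θ)|) ∧
    |X.αb 0 1 (pt u 0 θ)| ≤ C / ((us - u) ^ 2 * Real.log (1 / (us - u)) ^ (4 * q))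

/-- Two sets of data have different metric or fluid on the initial hypersurfaces. -/
def DataDiffer (us ubs : ℝ) (X Y : Fields) : Prop :=
  ∃ x ∈ H0 ubs ∪ Hb0 us,
    (∃ A B, X.γ A B x ≠ Y.γ A B x) ∨ (∃ μ, X.vel x μ ≠ Y.vel x μ) ∨ X.τ x ≠ Y.τ x

end EinsteinEuler

end

/-! The data are sought in plane symmetry: b = 0 and everything depends on (u, ubar) only. Write γ =
diag(e^{2(ρ+w)}, e^{2(ρ-w)}), Ω = e^l, τ = e^t, v³ = e^{ψ-l}/2, v⁴ = e^{l-ψ}/2. Then g(v,v) = -1 is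
automatic, the tori are flat, ζ = 0, and the Einstein–Euler system becomes five evolution equations
`evol` for (ρ, w, l, t, ψ) together with the two Raychaudhuri constraints `exx` and `eyy`. The
evolution equations propagate the constraints (`dy_exx`, `dx_eyy`): `exx` is needed only pointwise
on a line y = 0, and `eyy` only to infinite order at the corner.

Singular hypersurface. The coordinate x = -log(1 - u/u_*) sends u = u_* to infinity. With u_* =
e^{-t₀}, T = log(1/(u_* - u)) = t₀ + x and θ = T^{2q}, the weighted derivative f²∂_u is θ∂_x.
Instead of prescribing the shear and integrating Raychaudhuri's equation, ρ_x is prescribed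
explicitly (`rS`) and the equation is solved algebraically for w_x: θw_x is the square root of a
quantity close to 1. As |χbar-hat|² = 2(∂_u w)², this is the exact rate f^{-2}. As αbar₁₁ =
-γ₁₁(∂_u²w + 2∂_uρ ∂_u w), with the opposite sign for αbar₂₂ and αbar₁₂ = 0, a lower bound for
θ(w_xx + w_x + 2ρ_x w_x) gives the curvature blow-up (`le_curvature`).

Uniform bounds. The y-derivatives of order at most eight along y = 0 form a curve Y solving Y' =
T^{-2q} V(c(x), Y) with V smooth and c(x) in a fixed compact set. Since 2q > 1 the weight is
integrable up to x = ∞, so for t₀ large, that is for ε small, Y exists for all x ≥ 0 and stays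
within distance one of its initial value (`exists_weighted_flow`). All norms are functions of such
jets (`exists_dataBounds`).

Equations to infinite order. The coefficient of y^{n+1} is found from the residual of order n by
linear transport equations in x and two algebraic equations (`exists_corr`), and the formal series
is summed by Borel's lemma (`borel`, `exists_formal_sum`). The free initial value of the transport
equation for ρ is spent on `eyy` at the corner (`exists_extension`).

Regular hypersurface. The jets of ρ and t at the corner are now determined to all orders. They are
realized by functions whose first eight derivatives are close to those of fixed base data
(`exists_small_jet`), ψ is read off from the constraint, and the system, which is symmetric under
the exchange of x and y, is solved to infinite order along x = 0 without altering anything for y ≤ 0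
(`exists_regular_extension`). The parameter s of the family is the value of w at the corner. -/

noncomputable section

namespace EinsteinEuler

/-! ### Rings of smooth functions -/

section Smooth

variable {E F : Type*} [NormedAddCommGroup E] [NormedSpace ℝ E]
  [NormedAddCommGroup F] [NormedSpace ℝ F]

/-- The subalgebra of smooth real functions on `E`. -/
def smoothSubalgebra (E : Type*) [NormedAddCommGroup E] [NormedSpace ℝ E] :
    Subalgebra ℝ (E → ℝ) where
  carrier := {f | ContDiff ℝ ∞ f}
  mul_mem' {f g} (hf : ContDiff ℝ ∞ f) (hg : ContDiff ℝ ∞ g) := hf.mul hg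
  add_mem' {f g} (hf : ContDiff ℝ ∞ f) (hg : ContDiff ℝ ∞ g) := hf.add hg
  algebraMap_mem' r := (contDiff_const : ContDiff ℝ ∞ fun _ : E => r)

/-- The algebra of smooth real functions on `E`. -/
def Sm (E : Type*) [NormedAddCommGroup E] [NormedSpace ℝ E] : Type _ := smoothSubalgebra E

instance : CommRing (Sm E) := inferInstanceAs (CommRing (smoothSubalgebra E))
instance : Algebra ℝ (Sm E) := inferInstanceAs (Algebra ℝ (smoothSubalgebra E))

namespace Sm

/-- A smooth function as an element of `Sm E`. -/
def mk (f : E → ℝ) (hf : ContDiff ℝ ∞ f) : Sm E := ⟨f, hf⟩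

@[simp] theorem mk_apply (f : E → ℝ) (hf : ContDiff ℝ ∞ f) (x : E) : (mk f hf).1 x = f x := rfl

theorem smooth (f : Sm E) : ContDiff ℝ ∞ f.1 := f.2

theorem differentiable (f : Sm E) : Differentiable ℝ f.1 :=
  f.smooth.differentiable (by simp)

theorem continuous (f : Sm E) : Continuous f.1 := f.smooth.continuous

@[ext] theorem ext {f g : Sm E} (h : ∀ x, f.1 x = g.1 x) : f = g := Subtype.ext (funext h)

@[simp] theorem add_apply (f g : Sm E) (x : E) : (f + g).1 x = f.1 x + g.1 x := rfl
@[simp] theorem sub_apply (f g : Sm E) (x : E) : (f - g).1 x = f.1 x - g.1 x := rfl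
@[simp] theorem neg_apply (f : Sm E) (x : E) : (-f).1 x = -f.1 x := rfl
@[simp] theorem mul_apply (f g : Sm E) (x : E) : (f * g).1 x = f.1 x * g.1 x := rfl
@[simp] theorem pow_apply (f : Sm E) (n : ℕ) (x : E) : (f ^ n).1 x = f.1 x ^ n := rfl
@[simp] theorem zero_apply (x : E) : (0 : Sm E).1 x = 0 := rfl
@[simp] theorem one_apply (x : E) : (1 : Sm E).1 x = 1 := rfl
@[simp] theorem smul_apply (r : ℝ) (f : Sm E) (x : E) : (r • f).1 x = r * f.1 x := rfl
@[simp] theorem natCast_apply (n : ℕ) (x : E) : (n : Sm E).1 x = n := by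
  induction n with
  | zero => simp
  | succ n ih => simp [ih]
@[simp] theorem ofNat_apply (n : ℕ) [n.AtLeastTwo] (x : E) :
    (ofNat(n) : Sm E).1 x = OfNat.ofNat n := natCast_apply n x
@[simp] theorem algebraMap_apply (r : ℝ) (x : E) : (algebraMap ℝ (Sm E) r).1 x = r := rfl
@[simp] theorem sum_apply {ι : Type*} (s : Finset ι) (f : ι → Sm E) (x : E) :
    (∑ i ∈ s, f i).1 x = ∑ i ∈ s, (f i).1 x := by
  classical
  induction s using Finset.induction_on with
  | empty => simp
  | insert a s ha ih => simp [Finset.sum_insert ha, ih]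

/-- Constant functions. -/
def const (r : ℝ) : Sm E := mk (fun _ => r) contDiff_const

@[simp] theorem const_apply (r : ℝ) (x : E) : (const r : Sm E).1 x = r := rfl

/-- Composition with a smooth map. -/
def comp (Q : Sm F) (φ : E → F) (hφ : ContDiff ℝ ∞ φ) : Sm E := ⟨Q.1 ∘ φ, Q.smooth.comp hφ⟩

@[simp] theorem comp_apply (Q : Sm F) (φ : E → F) (hφ : ContDiff ℝ ∞ φ) (x : E) :
    (Q.comp φ hφ).1 x = Q.1 (φ x) := rfl

/-- The derivative along a smooth vector field. -/
def lie (v : E → E) (hv : ContDiff ℝ ∞ v) : Derivation ℝ (Sm E) (Sm E) where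
  toFun f := ⟨fun x => fderiv ℝ f.1 x (v x),
    (f.smooth.fderiv_right (m := ∞) (by simp)).clm_apply hv⟩
  map_add' f g := by
    ext x
    change fderiv ℝ (fun y => f.1 y + g.1 y) x (v x) = _
    rw [fderiv_fun_add (f.differentiable x) (g.differentiable x)]; rfl
  map_smul' r f := by
    ext x
    change fderiv ℝ (fun y => r * f.1 y) x (v x) = _
    rw [fderiv_const_mul (f.differentiable x)]; rfl
  map_one_eq_zero' := by
    ext x
    change fderiv ℝ (fun _ => (1 : ℝ)) x (v x) = _
    simp
  leibniz' f g := by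
    ext x
    change fderiv ℝ (fun y => f.1 y * g.1 y) x (v x) = _
    rw [fderiv_fun_mul (f.differentiable x) (g.differentiable x)]; rfl

theorem lie_apply (v : E → E) (hv : ContDiff ℝ ∞ v) (f : Sm E) (x : E) :
    (lie v hv f).1 x = fderiv ℝ f.1 x (v x) := rfl

theorem lie_const (v : E → E) (hv : ContDiff ℝ ∞ v) (r : ℝ) : lie v hv (const r) = 0 := by
  ext x
  change fderiv ℝ (fun _ => r) x (v x) = 0
  simp

/-- Composition of a function of one real variable with a smooth function. -/
def of (Q : Sm ℝ) (f : Sm E) : Sm E := Q.comp f.1 f.smooth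

@[simp] theorem of_apply (Q : Sm ℝ) (f : Sm E) (x : E) : (Q.of f).1 x = Q.1 (f.1 x) := rfl

/-- The derivative of a function of one real variable. -/
def der : Derivation ℝ (Sm ℝ) (Sm ℝ) := lie (fun _ => 1) contDiff_const

@[simp] theorem der_apply (f : Sm ℝ) (x : ℝ) : (der f).1 x = deriv f.1 x := rfl

theorem hasDerivAt (f : Sm ℝ) (x : ℝ) : HasDerivAt f.1 ((der f).1 x) x :=
  (f.differentiable x).hasDerivAt

theorem lie_of (v : E → E) (hv : ContDiff ℝ ∞ v) (Q : Sm ℝ) (f : Sm E) :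
    lie v hv (Q.of f) = (der Q).of f * lie v hv f := by
  ext x
  change fderiv ℝ (Q.1 ∘ f.1) x (v x) = _
  rw [((Q.hasDerivAt (f.1 x)).comp_hasFDerivAt x (f.differentiable x).hasFDerivAt).fderiv]
  simp [lie_apply]

theorem deriv_ofNat (D : Derivation ℝ (Sm E) (Sm E)) (n : ℕ) [n.AtLeastTwo] :
    D (ofNat(n) : Sm E) = 0 := D.map_natCast n

/-- The exponential function. -/
def expS : Sm ℝ := mk Real.exp Real.contDiff_exp

@[simp] theorem expS_apply (x : ℝ) : expS.1 x = Real.exp x := rfl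

theorem der_expS : der expS = expS := by
  ext x
  change deriv Real.exp x = _
  simp

/-- `exp f`. -/
def exp (f : Sm E) : Sm E := expS.of f

@[simp] theorem exp_apply (f : Sm E) (x : E) : (exp f).1 x = Real.exp (f.1 x) := rfl

theorem lie_exp (v : E → E) (hv : ContDiff ℝ ∞ v) (f : Sm E) :
    lie v hv (exp f) = exp f * lie v hv f := by
  rw [exp, lie_of, der_expS]

theorem exp_add (f g : Sm E) : exp (f + g) = exp f * exp g := by
  ext x; simp [Real.exp_add]

theorem exp_neg_mul (f : Sm E) : exp (-f) * exp f = 1 := by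
  ext x; simp [← Real.exp_add]

end Sm

end Smooth

/-! ### Functions of two variables -/

/-- Smooth functions on the plane. -/
abbrev S2 := Sm (ℝ × ℝ)

open Sm

/-- The derivative in the first variable. -/
def dx : Derivation ℝ S2 S2 := lie (fun _ => (1, 0)) contDiff_const
/-- The derivative in the second variable. -/
def dy : Derivation ℝ S2 S2 := lie (fun _ => (0, 1)) contDiff_const

theorem dx_apply (f : S2) (p : ℝ × ℝ) : (dx f).1 p = fderiv ℝ f.1 p (1, 0) := rfl
theorem dy_apply (f : S2) (p : ℝ × ℝ) : (dy f).1 p = fderiv ℝ f.1 p (0, 1) := rfl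

theorem lie_const_comm {E : Type*} [NormedAddCommGroup E] [NormedSpace ℝ E] (a b : E) (f : Sm E) :
    lie (fun _ => a) contDiff_const (lie (fun _ => b) contDiff_const f)
      = lie (fun _ => b) contDiff_const (lie (fun _ => a) contDiff_const f) := by
  ext x
  have hd : DifferentiableAt ℝ (fderiv ℝ f.1) x :=
    (f.smooth.fderiv_right (m := ∞) (by simp)).differentiable (by simp) x
  have h : ∀ c d : E, (lie (fun _ => c) contDiff_const (lie (fun _ => d) contDiff_const f)).1 x
      = fderiv ℝ (fderiv ℝ f.1) x c d := by
    intro c d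
    rw [lie_apply]
    change fderiv ℝ (fun y => fderiv ℝ f.1 y d) x c = _
    rw [fderiv_clm_apply hd (differentiableAt_const d)]
    simp
  rw [h, h]
  exact (f.smooth.contDiffAt.isSymmSndFDerivAt (by
    simp only [minSmoothness_of_isRCLikeNormedField]; exact WithTop.coe_le_coe.2 le_top)) a b

theorem dx_dy_comm (f : S2) : dx (dy f) = dy (dx f) := lie_const_comm _ _ f

@[simp] theorem dx_of (Q : Sm ℝ) (f : S2) : dx (Q.of f) = (der Q).of f * dx f := lie_of _ _ _ _
@[simp] theorem dy_of (Q : Sm ℝ) (f : S2) : dy (Q.of f) = (der Q).of f * dy f := lie_of _ _ _ _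
@[simp] theorem dx_exp (f : S2) : dx (Sm.exp f) = Sm.exp f * dx f := lie_exp _ _ _
@[simp] theorem dy_exp (f : S2) : dy (Sm.exp f) = Sm.exp f * dy f := lie_exp _ _ _
@[simp] theorem dx_mul (f g : S2) : dx (f * g) = f * dx g + g * dx f := dx.leibniz f g
@[simp] theorem dy_mul (f g : S2) : dy (f * g) = f * dy g + g * dy f := dy.leibniz f g
@[simp] theorem dx_ofNat (n : ℕ) [n.AtLeastTwo] : dx (ofNat(n) : S2) = 0 := deriv_ofNat _ n
@[simp] theorem dy_ofNat (n : ℕ) [n.AtLeastTwo] : dy (ofNat(n) : S2) = 0 := deriv_ofNat _ n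
@[simp] theorem dx_const (r : ℝ) : dx (Sm.const r) = 0 := lie_const _ _ r

/-- A function of the first variable. -/
def X (c : Sm ℝ) : S2 := c.comp Prod.fst contDiff_fst
/-- A function of the second variable. -/
def Y (c : Sm ℝ) : S2 := c.comp Prod.snd contDiff_snd

@[simp] theorem X_apply (c : Sm ℝ) (p : ℝ × ℝ) : (X c).1 p = c.1 p.1 := rfl
@[simp] theorem Y_apply (c : Sm ℝ) (p : ℝ × ℝ) : (Y c).1 p = c.1 p.2 := rfl

@[simp] theorem dx_X (c : Sm ℝ) : dx (X c) = X (der c) := by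
  ext p
  rw [dx_apply]
  change fderiv ℝ (c.1 ∘ Prod.fst) p (1, 0) = _
  rw [((c.hasDerivAt p.1).comp_hasFDerivAt p hasFDerivAt_fst).fderiv]
  simp

@[simp] theorem dy_X (c : Sm ℝ) : dy (X c) = 0 := by
  ext p
  rw [dy_apply]
  change fderiv ℝ (c.1 ∘ Prod.fst) p (0, 1) = _
  rw [((c.hasDerivAt p.1).comp_hasFDerivAt p hasFDerivAt_fst).fderiv]
  simp

@[simp] theorem dy_Y (c : Sm ℝ) : dy (Y c) = Y (der c) := by
  ext p
  rw [dy_apply]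
  change fderiv ℝ (c.1 ∘ Prod.snd) p (0, 1) = _
  rw [((c.hasDerivAt p.2).comp_hasFDerivAt p hasFDerivAt_snd).fderiv]
  simp

theorem hasDerivAt_fst (f : S2) (x y : ℝ) :
    HasDerivAt (fun s => f.1 (s, y)) ((dx f).1 (x, y)) x := by
  have h := (f.differentiable (x, y)).hasFDerivAt.comp_hasDerivAt x
    ((hasDerivAt_id x).prodMk (hasDerivAt_const x y))
  exact h

theorem hasDerivAt_snd (f : S2) (x y : ℝ) :
    HasDerivAt (fun s => f.1 (x, s)) ((dy f).1 (x, y)) y := by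
  have h := (f.differentiable (x, y)).hasFDerivAt.comp_hasDerivAt y
    ((hasDerivAt_const y x).prodMk (hasDerivAt_id y))
  exact h

/-- The restriction of a function to the line `y = 0`. -/
def restr (f : S2) : Sm ℝ := f.comp (fun x => (x, 0)) (by fun_prop)
/-- The restriction of a function to the line `x = 0`. -/
def restr' (f : S2) : Sm ℝ := f.comp (fun y => (0, y)) (by fun_prop)

@[simp] theorem restr_apply (f : S2) (x : ℝ) : (restr f).1 x = f.1 (x, 0) := rfl
@[simp] theorem restr'_apply (f : S2) (y : ℝ) : (restr' f).1 y = f.1 (0, y) := rfl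

theorem der_restr (f : S2) : der (restr f) = restr (dx f) := by
  ext x; exact (hasDerivAt_fst f x 0).deriv

theorem der_restr' (f : S2) : der (restr' f) = restr' (dy f) := by
  ext x; exact (hasDerivAt_snd f 0 x).deriv

/-- Exchange of the two variables. -/
def sw (f : S2) : S2 := f.comp Prod.swap (contDiff_snd.prodMk contDiff_fst)

@[simp] theorem sw_apply (f : S2) (x y : ℝ) : (sw f).1 (x, y) = f.1 (y, x) := rfl

@[simp] theorem sw_sw (f : S2) : sw (sw f) = f := by ext ⟨x, y⟩; rfl

@[simp] theorem dx_sw (f : S2) : dx (sw f) = sw (dy f) := by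
  ext ⟨x, y⟩
  exact (hasDerivAt_fst (sw f) x y).unique (hasDerivAt_snd f y x)

@[simp] theorem dy_sw (f : S2) : dy (sw f) = sw (dx f) := by
  ext ⟨x, y⟩
  exact (hasDerivAt_snd (sw f) x y).unique (hasDerivAt_fst f y x)

/-! ### Vanishing orders in the second variable -/

theorem iterate_add (D : Derivation ℝ S2 S2) (n : ℕ) (f g : S2) :
    D^[n] (f + g) = D^[n] f + D^[n] g := by
  induction n generalizing f g with
  | zero => rfl
  | succ n ih => simp only [Function.iterate_succ, Function.comp_apply, map_add, ih]

theorem iterate_zero' (D : Derivation ℝ S2 S2) (n : ℕ) : D^[n] (0 : S2) = 0 := by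
  induction n with
  | zero => rfl
  | succ n ih => simp only [Function.iterate_succ, Function.comp_apply, map_zero, ih]

theorem iterate_neg (D : Derivation ℝ S2 S2) (n : ℕ) (f : S2) : D^[n] (-f) = -D^[n] f := by
  induction n generalizing f with
  | zero => rfl
  | succ n ih => simp only [Function.iterate_succ, Function.comp_apply, map_neg, ih]

theorem iterate_sub (D : Derivation ℝ S2 S2) (n : ℕ) (f g : S2) :
    D^[n] (f - g) = D^[n] f - D^[n] g := by
  rw [sub_eq_add_neg, iterate_add, iterate_neg, ← sub_eq_add_neg]

theorem dx_iterate_dy (n : ℕ) (f : S2) : dx (dy^[n] f) = dy^[n] (dx f) := by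
  induction n generalizing f with
  | zero => rfl
  | succ n ih => simp [ih, dx_dy_comm]

/-- Auxiliary predicate: the `dy`-derivatives of order `< n` vanish on `A`. -/
def Van (A : Set (ℝ × ℝ)) (n : ℕ) (f : S2) : Prop := ∀ j < n, ∀ p ∈ A, (dy^[j] f).1 p = 0

theorem Van.mono {A : Set (ℝ × ℝ)} {m n : ℕ} {f : S2} (h : Van A n f) (hmn : m ≤ n) : Van A m f :=
  fun j hj => h j (hj.trans_le hmn)

theorem van_succ {A : Set (ℝ × ℝ)} {n : ℕ} {f : S2} :
    Van A (n + 1) f ↔ (∀ p ∈ A, f.1 p = 0) ∧ Van A n (dy f) := by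
  constructor
  · exact fun h => ⟨h 0 (by omega), fun j hj => h (j + 1) (by omega)⟩
  · rintro ⟨h0, h1⟩ (_ | j) hj
    · exact h0
    · exact h1 j (by omega)

theorem Van.mul_left {A : Set (ℝ × ℝ)} {n : ℕ} (g : S2) {f : S2} (h : Van A n f) :
    Van A n (g * f) := by
  -- The Leibniz rule replaces the multiplier g by `dy g`, so the induction has to run over all
  -- multipliers.
  induction n generalizing f g with
  | zero => exact fun j hj => absurd hj (by omega)
  | succ n ih =>
    have h' := van_succ.1 h
    refine van_succ.2 ⟨fun p hp => by simp [h'.1 p hp], ?_⟩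
    rw [dy_mul]
    intro j hj p hp
    rw [iterate_add, Sm.add_apply, ih g h'.2 j hj p hp, mul_comm,
      ih (dy g) (h.mono (Nat.le_succ n)) j hj p hp, add_zero]

/-- The ideal of functions whose `dy`-derivatives of order `< n` vanish on `A`. -/
def van (A : Set (ℝ × ℝ)) (n : ℕ) : Ideal S2 where
  carrier := {f | Van A n f}
  add_mem' {f g} hf hg j hj p hp := by
    rw [iterate_add, Sm.add_apply, hf j hj p hp, hg j hj p hp, add_zero]
  zero_mem' j _ p _ := by rw [iterate_zero', Sm.zero_apply]
  smul_mem' g f hf := Van.mul_left g hf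

theorem mem_van {A : Set (ℝ × ℝ)} {n : ℕ} {f : S2} :
    f ∈ van A n ↔ ∀ j < n, ∀ p ∈ A, (dy^[j] f).1 p = 0 := Iff.rfl

theorem mem_van_succ {A : Set (ℝ × ℝ)} {n : ℕ} {f : S2} :
    f ∈ van A (n + 1) ↔ (∀ p ∈ A, f.1 p = 0) ∧ dy f ∈ van A n := van_succ

theorem mem_van_succ' {A : Set (ℝ × ℝ)} {n : ℕ} {f : S2} :
    f ∈ van A (n + 1) ↔ f ∈ van A n ∧ ∀ p ∈ A, (dy^[n] f).1 p = 0 := by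
  constructor
  · exact fun h => ⟨fun j hj => h j (by omega), h n (by omega)⟩
  · rintro ⟨h, h'⟩ j hj
    rcases Nat.lt_succ_iff_lt_or_eq.1 hj with hj | rfl
    · exact h j hj
    · exact h'

@[simp] theorem van_zero (A : Set (ℝ × ℝ)) (f : S2) : f ∈ van A 0 :=
  fun j hj => absurd hj (by omega)

theorem van_mono (A : Set (ℝ × ℝ)) {m n : ℕ} (h : m ≤ n) : van A n ≤ van A m :=
  fun _ hf => Van.mono hf h

theorem van_anti {A B : Set (ℝ × ℝ)} (h : A ⊆ B) (n : ℕ) : van B n ≤ van A n :=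
  fun _ hf j hj p hp => hf j hj p (h hp)

theorem dy_mem_van {A : Set (ℝ × ℝ)} {n : ℕ} {f : S2} (h : f ∈ van A (n + 1)) : dy f ∈ van A n :=
  (mem_van_succ.1 h).2

/-- Congruence modulo `van A n` is respected by composition, so the nonlinear terms of the equations
can be computed in the quotient ring. -/
theorem of_sub_of_mem_van {A : Set (ℝ × ℝ)} {n : ℕ} (Q : Sm ℝ) {f g : S2} (h : f - g ∈ van A n) :
    Q.of f - Q.of g ∈ van A n := by
  induction n generalizing Q with
  | zero => simp
  | succ n ih =>
    have h' := mem_van_succ.1 h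
    refine mem_van_succ.2 ⟨fun p hp => ?_, ?_⟩
    · have := h'.1 p hp
      rw [Sm.sub_apply, sub_eq_zero] at this
      simp [this]
    · have e : dy (Q.of f - Q.of g)
          = ((der Q).of f - (der Q).of g) * dy f + (der Q).of g * dy (f - g) := by
        simp only [map_sub, dy_of]; ring
      rw [e]
      exact add_mem (Ideal.mul_mem_right _ _ (ih _ (van_mono A (Nat.le_succ n) h)))
        (Ideal.mul_mem_left _ _ h'.2)

/-- Openness of U makes `der Q` vanish on U as well. This transfers identities that hold only on an
open range of values, such as `hi * h = 1` above `ℓ`. -/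
theorem of_mem_van {A : Set (ℝ × ℝ)} (n : ℕ) {Q : Sm ℝ} {U : Set ℝ} (hU : IsOpen U)
    (hQ : ∀ s ∈ U, Q.1 s = 0) {f : S2} (hf : ∀ p ∈ A, f.1 p ∈ U) : Q.of f ∈ van A n := by
  induction n generalizing Q with
  | zero => simp
  | succ n ih =>
    refine mem_van_succ.2 ⟨fun p hp => hQ _ (hf p hp), ?_⟩
    rw [dy_of]
    refine Ideal.mul_mem_right _ _ (ih fun s hs => ?_)
    have : Q.1 =ᶠ[nhds s] fun _ => 0 := by
      filter_upwards [hU.mem_nhds hs] with r hr using hQ r hr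
    rw [der_apply, this.deriv_eq, deriv_const]

/-- Vanishing orders add under multiplication. The case of an extra order one permits freezing the
coefficient of a leading monomial at its value on the line. -/
theorem mul_mem_van_succ {A : Set (ℝ × ℝ)} {n : ℕ} {f g : S2} (hf : f ∈ van A n)
    (hg : g ∈ van A 1) : f * g ∈ van A (n + 1) := by
  induction n generalizing f with
  | zero => exact Ideal.mul_mem_left _ _ hg
  | succ n ih =>
    refine mem_van_succ.2 ⟨fun p hp => by simp [(mem_van_succ.1 hg).1 p hp], ?_⟩
    rw [dy_mul]
    refine add_mem (Ideal.mul_mem_right _ _ hf) ?_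
    rw [mul_comm]
    exact ih (dy_mem_van hf)

/-- The points of the line `y = 0` over `I`. -/
def line (I : Set ℝ) : Set (ℝ × ℝ) := {p | p.1 ∈ I ∧ p.2 = 0}

theorem mem_van_line {I : Set ℝ} {n : ℕ} {f : S2} :
    f ∈ van (line I) n ↔ ∀ j < n, ∀ x ∈ I, (dy^[j] f).1 (x, 0) = 0 := by
  rw [mem_van]
  constructor
  · exact fun h j hj x hx => h j hj (x, 0) ⟨hx, rfl⟩
  · rintro h j hj ⟨x, y⟩ ⟨hx, rfl⟩
    exact h j hj x hx

/-- The derivative is tangential to the line, and I open makes the function of x vanish in a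
neighbourhood. -/
theorem dx_mem_van {I : Set ℝ} (hI : IsOpen I) {n : ℕ} {f : S2} (h : f ∈ van (line I) n) :
    dx f ∈ van (line I) n := by
  rw [mem_van_line] at h ⊢
  intro j hj x hx
  rw [← dx_iterate_dy]
  have h1 := hasDerivAt_fst (dy^[j] f) x 0
  have h2 : (fun s => (dy^[j] f).1 (s, 0)) =ᶠ[nhds x] fun _ => 0 := by
    filter_upwards [hI.mem_nhds hx] with s hs using h j hj s hs
  exact h1.unique ((hasDerivAt_const x (0 : ℝ)).congr_of_eventuallyEq h2)

/-- The monomial `y ^ k / k!`. -/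
def Mu (k : ℕ) : S2 := Sm.mk (fun p => p.2 ^ k / (k.factorial : ℝ)) (by fun_prop)

@[simp] theorem Mu_apply (k : ℕ) (p : ℝ × ℝ) : (Mu k).1 p = p.2 ^ k / (k.factorial : ℝ) := rfl

theorem Mu_zero : Mu 0 = 1 := by ext p; simp

@[simp] theorem dx_Mu (k : ℕ) : dx (Mu k) = 0 := by
  ext ⟨x, y⟩
  exact (hasDerivAt_fst (Mu k) x y).unique (hasDerivAt_const x (y ^ k / (k.factorial : ℝ)))

@[simp] theorem dy_Mu_succ (k : ℕ) : dy (Mu (k + 1)) = Mu k := by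
  ext ⟨x, y⟩
  refine (hasDerivAt_snd (Mu (k + 1)) x y).unique ?_
  have h := (hasDerivAt_pow (k + 1) y).div_const ((k + 1).factorial : ℝ)
  have hk : (k.factorial : ℝ) ≠ 0 := by positivity
  have e : ((k + 1 : ℕ) : ℝ) * y ^ (k + 1 - 1) / ((k + 1).factorial : ℝ) = (Mu k).1 (x, y) := by
    rw [Mu_apply, Nat.factorial_succ]
    push_cast
    field_simp
  exact e ▸ h

@[simp] theorem dy_Mu_zero : dy (Mu 0) = 0 := by
  rw [Mu_zero]; exact dy.map_one_eq_zero

theorem Mu_mem_van (I : Set ℝ) (k : ℕ) : Mu k ∈ van (line I) k := by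
  induction k with
  | zero => simp
  | succ k ih =>
    refine mem_van_succ.2 ⟨?_, by simpa using ih⟩
    rintro ⟨x, y⟩ ⟨-, rfl⟩
    simp

theorem iterate_dy_X_mul (c : Sm ℝ) (n : ℕ) (f : S2) : dy^[n] (X c * f) = X c * dy^[n] f := by
  induction n generalizing f with
  | zero => rfl
  | succ n ih => simp [ih]

theorem iterate_dy_Mu (n : ℕ) : dy^[n] (Mu n) = 1 := by
  induction n with
  | zero => simp [Mu_zero]
  | succ n ih => simp [ih]

theorem iterate_dy_Mu_apply (j k : ℕ) (x : ℝ) :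
    (dy^[j] (Mu k)).1 (x, 0) = if j = k then 1 else 0 := by
  induction j generalizing k with
  | zero =>
    rcases k with _ | k
    · simp only [Function.iterate_zero, id_eq, Mu_apply]; simp
    · simp only [Function.iterate_zero, id_eq, Mu_apply]; simp
  | succ j ih =>
    rcases k with _ | k
    · simp
    · simp [ih]

theorem sub_restr_mem_van (I : Set ℝ) (f : S2) : f - X (restr f) ∈ van (line I) 1 := by
  rw [mem_van_line]
  intro j hj x _
  obtain rfl : j = 0 := by omega
  simp

/-- The leading Taylor coefficient. -/
theorem sub_leading_mem_van {I : Set ℝ} {n : ℕ} {f : S2} (h : f ∈ van (line I) n) {s : Sm ℝ}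
    (hs : ∀ x ∈ I, s.1 x = (dy^[n] f).1 (x, 0)) : f - X s * Mu n ∈ van (line I) (n + 1) := by
  rw [mem_van_succ']
  refine ⟨sub_mem h (Ideal.mul_mem_left _ _ (Mu_mem_van I n)), ?_⟩
  rintro ⟨x, y⟩ ⟨hx, rfl⟩
  rw [iterate_sub, iterate_dy_X_mul, iterate_dy_Mu]
  simp [hs x hx]

end EinsteinEuler
end

/-! ### Formal solution of the reduced system in powers of y -/

noncomputable section

namespace EinsteinEuler

open Sm

/-! ### The plane symmetric Einstein–Euler system -/

/-- An equation of state in terms of `t = log τ`: `h = τ + p`, `σ = τ - p`, together with global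
smooth inverses of `h` (on `t > ℓ`) and of `σ'`. -/
structure Eos where
  h : Sm ℝ
  σ : Sm ℝ
  hi : Sm ℝ
  si : Sm ℝ
  ℓ : ℝ
  si_mul : si * der σ = 1
  hi_mul : ∀ t, ℓ < t → hi.1 t * h.1 t = 1

/-- The unknowns `(ρ, w, l, t, ψ)`. -/
abbrev Fl := Fin 5 → S2

variable (e : Eos) (Φ : Fl)

/-- The first two terms are e^{-2ρ} ∂_x∂_y e^{2ρ}, so this is a wave equation for the area density.
It is the mixed null component of Einstein's equations; `e1`, `e2`, `e3` together span the two
angular components. -/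
def e1 : S2 := 2 * dx (dy (Φ 0)) + 4 * dx (Φ 0) * dy (Φ 0) - exp (2 * Φ 2) * e.σ.of (Φ 3)

def e2 : S2 := dx (dy (Φ 1)) + dx (Φ 0) * dy (Φ 1) + dy (Φ 0) * dx (Φ 1)

def e3 : S2 := 2 * dx (dy (Φ 2)) - 2 * dx (Φ 0) * dy (Φ 0) + 2 * dx (Φ 1) * dy (Φ 1)
  + exp (2 * Φ 2) * e.h.of (Φ 3)

/-- `ea` and `eb` are, up to nonzero factors, the components 1 and 0 of the divergence of T. They
are triangular in the y-derivatives: `eb` contains ∂_y t but neither ∂_y l nor ∂_y ψ, and `ea` then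
gives ∂_y ψ. In the x-derivatives the roles are reversed. -/
def ea : S2 := (der e.σ).of (Φ 3) * dx (Φ 3)
  + exp (-(2 * Φ 4)) * ((der e.h).of (Φ 3) * dy (Φ 3)
    + e.h.of (Φ 3) * (2 * dy (Φ 2) - 2 * dy (Φ 4) + 2 * dy (Φ 0)))
  + 2 * dx (Φ 0) * e.h.of (Φ 3)

def eb : S2 := (der e.σ).of (Φ 3) * dy (Φ 3)
  + exp (2 * Φ 4) * ((der e.h).of (Φ 3) * dx (Φ 3)
    + e.h.of (Φ 3) * (2 * dx (Φ 2) + 2 * dx (Φ 4) + 2 * dx (Φ 0)))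
  + 2 * dy (Φ 0) * e.h.of (Φ 3)

/-- `exx` and `eyy` are the Raychaudhuri equations along the two null directions, that is, the
diagonal null components of Einstein's equations up to sign. -/
def exx : S2 := 2 * dx (dx (Φ 0)) + 2 * dx (Φ 0) ^ 2 - 4 * dx (Φ 2) * dx (Φ 0) + 2 * dx (Φ 1) ^ 2
  + exp (2 * Φ 2) * exp (-(2 * Φ 4)) * e.h.of (Φ 3)

def eyy : S2 := 2 * dy (dy (Φ 0)) + 2 * dy (Φ 0) ^ 2 - 4 * dy (Φ 2) * dy (Φ 0) + 2 * dy (Φ 1) ^ 2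
  + exp (2 * Φ 2) * exp (2 * Φ 4) * e.h.of (Φ 3)

/-- The evolution equations. -/
def evol : Fin 5 → S2 := ![e1 e Φ, e2 Φ, e3 e Φ, ea e Φ, eb e Φ]

/-- Propagation of the constraint `exx`. -/
theorem dy_exx : dy (exx e Φ) = -(2 * dy (Φ 0)) * exx e Φ + exp (2 * Φ 2) * ea e Φ + dx (e1 e Φ)
    - 2 * dx (Φ 2) * e1 e Φ - 2 * dx (Φ 0) * e3 e Φ + 4 * dx (Φ 1) * e2 Φ := by
  simp only [exx, ea, e1, e2, e3, map_add, map_sub, map_neg, dx_mul, dy_mul, dx_ofNat, dy_ofNat,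
    dx_exp, dy_exp, dx_of, dy_of, pow_two, dx_dy_comm]
  ring

/-- Propagation of the constraint `eyy`. -/
theorem dx_eyy : dx (eyy e Φ) = -(2 * dx (Φ 0)) * eyy e Φ + exp (2 * Φ 2) * eb e Φ + dy (e1 e Φ)
    - 2 * dy (Φ 2) * e1 e Φ - 2 * dy (Φ 0) * e3 e Φ + 4 * dy (Φ 1) * e2 Φ := by
  simp only [eyy, eb, e1, e2, e3, map_add, map_sub, dx_mul, dy_mul, dx_ofNat, dy_ofNat,
    dx_exp, dy_exp, dx_of, dy_of, pow_two, dx_dy_comm]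
  ring

/-- The system with the roles of the two variables exchanged. -/
def swF : Fl := ![sw (Φ 0), sw (Φ 1), sw (Φ 2), sw (Φ 3), -sw (Φ 4)]

theorem sw_add (f g : S2) : sw (f + g) = sw f + sw g := rfl
theorem sw_sub (f g : S2) : sw (f - g) = sw f - sw g := rfl
theorem sw_mul (f g : S2) : sw (f * g) = sw f * sw g := rfl
theorem sw_neg (f : S2) : sw (-f) = -sw f := rfl
theorem sw_pow (f : S2) (n : ℕ) : sw (f ^ n) = sw f ^ n := rfl
theorem sw_two : sw 2 = 2 := rfl
theorem sw_four : sw 4 = 4 := rfl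
theorem sw_exp (f : S2) : sw (exp f) = exp (sw f) := rfl
theorem sw_of (Q : Sm ℝ) (f : S2) : sw (Q.of f) = Q.of (sw f) := rfl

/-- ψ changes sign under the exchange because e^{2ψ} is, up to the gauge, the ratio of the two null
components of the velocity. For the same reason the two Euler equations are interchanged. -/
theorem evol_swF : evol e (swF Φ)
    = ![sw (e1 e Φ), sw (e2 Φ), sw (e3 e Φ), sw (eb e Φ), sw (ea e Φ)] := by
  simp only [evol, swF, e1, e2, e3, ea, eb, sw_add, sw_sub, sw_mul, sw_neg, sw_two, sw_four, sw_exp,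
    sw_of, dx_sw, dy_sw, map_neg, Matrix.cons_val, dx_dy_comm]
  refine congrArg₂ _ ?_ (congrArg₂ _ ?_ (congrArg₂ _ ?_ (congrArg₂ _ ?_ (congrArg₂ _ ?_ rfl)))) <;>
    ring_nf

theorem exx_swF : exx e (swF Φ) = sw (eyy e Φ) := by
  simp only [exx, eyy, swF, sw_add, sw_sub, sw_mul, sw_pow, sw_two, sw_four, sw_exp,
    sw_of, dx_sw, Matrix.cons_val]
  ring_nf

theorem eyy_swF : eyy e (swF Φ) = sw (exx e Φ) := by
  simp only [exx, eyy, swF, sw_add, sw_sub, sw_mul, sw_neg, sw_pow, sw_two, sw_four, sw_exp,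
    sw_of, dy_sw, Matrix.cons_val]
  ring_nf

/-! ### Congruences modulo the vanishing ideals -/

variable {e Φ}

theorem mk_of_eq {A : Set (ℝ × ℝ)} {n : ℕ} (Q : Sm ℝ) {f g : S2}
    (h : Ideal.Quotient.mk (van A n) f = Ideal.Quotient.mk (van A n) g) :
    Ideal.Quotient.mk (van A n) (Q.of f) = Ideal.Quotient.mk (van A n) (Q.of g) :=
  Ideal.Quotient.eq.2 (of_sub_of_mem_van Q (Ideal.Quotient.eq.1 h))

theorem mk_exp_eq {A : Set (ℝ × ℝ)} {n : ℕ} {f g : S2}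
    (h : Ideal.Quotient.mk (van A n) f = Ideal.Quotient.mk (van A n) g) :
    Ideal.Quotient.mk (van A n) (exp f) = Ideal.Quotient.mk (van A n) (exp g) := mk_of_eq _ h

/-- The evolution equations contain each unknown with at most one y-derivative, so only one order is
lost. The estimate carries the residuals of partial sums over to the Borel sum. -/
theorem evol_congr {I : Set ℝ} (hI : IsOpen I) {n : ℕ} {Φ Ψ : Fl}
    (h : ∀ i, Ψ i - Φ i ∈ van (line I) (n + 1)) (k : Fin 5) :
    evol e Ψ k - evol e Φ k ∈ van (line I) n := by
  have h0 : ∀ i, Ideal.Quotient.mk (van (line I) n) (Ψ i)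
      = Ideal.Quotient.mk (van (line I) n) (Φ i) := fun i =>
    Ideal.Quotient.eq.2 (van_mono _ (Nat.le_succ n) (h i))
  have hx : ∀ i, Ideal.Quotient.mk (van (line I) n) (dx (Ψ i))
      = Ideal.Quotient.mk (van (line I) n) (dx (Φ i)) := fun i => Ideal.Quotient.eq.2 (by
    rw [← map_sub]; exact dx_mem_van hI (van_mono _ (Nat.le_succ n) (h i)))
  have hy : ∀ i, Ideal.Quotient.mk (van (line I) n) (dy (Ψ i))
      = Ideal.Quotient.mk (van (line I) n) (dy (Φ i)) := fun i => Ideal.Quotient.eq.2 (by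
    rw [← map_sub]; exact dy_mem_van (h i))
  have hxy : ∀ i, Ideal.Quotient.mk (van (line I) n) (dx (dy (Ψ i)))
      = Ideal.Quotient.mk (van (line I) n) (dx (dy (Φ i))) := fun i => Ideal.Quotient.eq.2 (by
    rw [← map_sub, ← map_sub]; exact dx_mem_van hI (dy_mem_van (h i)))
  have hq : ∀ (Q : Sm ℝ) i, Ideal.Quotient.mk (van (line I) n) (Q.of (Ψ i))
      = Ideal.Quotient.mk (van (line I) n) (Q.of (Φ i)) := fun Q i => mk_of_eq Q (h0 i)
  have h2 : ∀ i, Ideal.Quotient.mk (van (line I) n) (exp (2 * Ψ i))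
      = Ideal.Quotient.mk (van (line I) n) (exp (2 * Φ i)) := fun i => mk_exp_eq (by
    rw [map_mul, map_mul, h0])
  have h3 : ∀ i, Ideal.Quotient.mk (van (line I) n) (exp (-(2 * Ψ i)))
      = Ideal.Quotient.mk (van (line I) n) (exp (-(2 * Φ i))) := fun i => mk_exp_eq (by
    rw [map_neg, map_neg, map_mul, map_mul, h0])
  rw [← Ideal.Quotient.eq]
  fin_cases k <;>
  simp [evol, e1, e2, e3, ea, eb, hx, hy, hxy, hq, h2, h3]

/-! ### Linear ordinary differential equations in one variable -/

theorem exists_primitive (g : Sm ℝ) : ∃ G : Sm ℝ, der G = g ∧ G.1 0 = 0 ∧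
    ((∀ x ≤ 0, g.1 x = 0) → ∀ x ≤ 0, G.1 x = 0) := by
  have hd : ∀ x, HasDerivAt (fun x => ∫ s in (0 : ℝ)..x, g.1 s) (g.1 x) x := fun x =>
    intervalIntegral.integral_hasDerivAt_right (g.continuous.intervalIntegrable _ _)
      (g.continuous.stronglyMeasurableAtFilter _ _) g.continuous.continuousAt
  have hs : ContDiff ℝ ∞ (fun x => ∫ s in (0 : ℝ)..x, g.1 s) := by
    rw [contDiff_infty_iff_deriv]
    refine ⟨fun x => (hd x).differentiableAt, ?_⟩
    rw [show deriv (fun x => ∫ s in (0 : ℝ)..x, g.1 s) = g.1 from funext fun x => (hd x).deriv]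
    exact g.smooth
  refine ⟨Sm.mk _ hs, ?_, ?_, ?_⟩
  · ext x; exact (hd x).deriv
  · simp
  · intro h x hx
    rw [Sm.mk_apply, intervalIntegral.integral_congr (g := fun _ => 0), intervalIntegral.integral_zero]
    intro s hs
    rw [Set.uIcc_of_ge hx] at hs
    exact h s hs.2

/-- Integrating factor e^R. The last clause keeps the solution zero for x ≤ 0, which is what gluing
at the origin needs. -/
theorem exists_linear_ode (R s : Sm ℝ) (a : ℝ) : ∃ c : Sm ℝ, der c + der R * c = s ∧ c.1 0 = a ∧
    ((∀ x ≤ 0, s.1 x = 0) → a = 0 → ∀ x ≤ 0, c.1 x = 0) := by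
  obtain ⟨G, hG, hG0, hGn⟩ := exists_primitive (exp R * s)
  have hder : ∀ f g : Sm ℝ, der (f * g) = f * der g + g * der f := der.leibniz
  have he : ∀ f : Sm ℝ, der (exp f) = exp f * der f := fun f => lie_exp _ _ f
  have hc : ∀ r : ℝ, der (Sm.const r) = 0 := fun r => lie_const _ _ r
  refine ⟨exp (-R) * (G + Sm.const (Real.exp (R.1 0) * a)), ?_, ?_, ?_⟩
  · have h1 := exp_neg_mul R
    simp only [hder, he, hc, map_add, map_neg, hG]
    linear_combination s * h1
  · simp [hG0, ← mul_assoc, ← Real.exp_add]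
  · intro hs ha x hx
    simp [ha, hGn (fun y hy => by simp [hs y hy]) x hx]

/-! ### One step of the formal solution -/

theorem X_add (f g : Sm ℝ) : X (f + g) = X f + X g := rfl
theorem X_mul (f g : Sm ℝ) : X (f * g) = X f * X g := rfl
theorem X_neg (f : Sm ℝ) : X (-f) = -X f := rfl
theorem X_two : X 2 = 2 := rfl

/-- `Φ` corrected by `c(x) y ^ (n + 1) / (n + 1)!`. -/
def corr (Φ : Fl) (n : ℕ) (c : Fin 5 → Sm ℝ) : Fl := fun i => Φ i + X (c i) * Mu (n + 1)

/-- Adding c y^{n+1}/(n+1)! changes the coefficient of y^n in the residuals by an expression linear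
in c. For ρ, w, l this gives a triangular system of linear ordinary differential equations in x; for
t and ψ the equations are algebraic, solvable because σ' is invertible and h is invertible above
`ℓ`. The value a of the ρ-coefficient at x = 0 stays free and is later used for the constraint
`eyy`. -/
theorem exists_corr (e : Eos) {I : Set ℝ} {n : ℕ} {Φ : Fl}
    (ht : ∀ x ∈ I, e.ℓ < (Φ 3).1 (x, 0)) (hΦ : ∀ k, evol e Φ k ∈ van (line I) n)
    (s : Fin 5 → Sm ℝ) (hs : ∀ k, ∀ x ∈ I, (s k).1 x = (dy^[n] (evol e Φ k)).1 (x, 0)) (a : ℝ) :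
    ∃ c : Fin 5 → Sm ℝ, (c 0).1 0 = a ∧ (c 1).1 0 = 0 ∧ (c 2).1 0 = 0 ∧
      (∀ k, evol e (corr Φ n c) k ∈ van (line I) (n + 1)) ∧
      ((∀ k, ∀ x ≤ 0, (s k).1 x = 0) → a = 0 → ∀ i, ∀ x ≤ 0, (c i).1 x = 0) := by
  set H : Sm ℝ := Sm.const (1 / 2) with hH
  have hH2 : 2 * H = 1 := by ext x; simp [hH]
  have hd2 : der (2 : Sm ℝ) = 0 := deriv_ofNat _ 2
  have hdm : ∀ f g : Sm ℝ, der (f * g) = f * der g + g * der f := der.leibniz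
  set R := restr (Φ 0)
  set W := restr (Φ 1)
  set T := restr (Φ 3)
  obtain ⟨c0, h0, h00, h0n⟩ := exists_linear_ode (2 * R) (-(H * s 0)) a
  obtain ⟨c1, h1, h10, h1n⟩ := exists_linear_ode R (-(c0 * der W) - s 1) 0
  obtain ⟨c2, h2, h20, h2n⟩ := exists_linear_ode 0 (der R * c0 - der W * c1 - H * s 2) 0
  simp only [hdm, hd2, map_zero, mul_zero, zero_mul, add_zero] at h0 h1 h2
  -- `eb` has no y-derivative of l or ψ and fixes the coefficient of t; `ea` then fixes that of ψ.
  set c3 : Sm ℝ := -(e.si.of T * (2 * e.h.of T * c0 + s 4)) with h3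
  set c4 : Sm ℝ := c2 + c0 + H * e.hi.of T * ((der e.h).of T * c3
    + exp (2 * restr (Φ 4)) * s 3) with h4
  refine ⟨![c0, c1, c2, c3, c4], h00, h10, h20, ?_, ?_⟩
  swap
  · intro hsn ha
    have k0 := h0n (fun x hx => by simp [hsn 0 x hx]) ha
    have k1 := h1n (fun x hx => by simp [hsn 1 x hx, k0 x hx]) rfl
    have k2 := h2n (fun x hx => by simp [hsn 2 x hx, k0 x hx, k1 x hx]) rfl
    have k3 : ∀ x ≤ 0, c3.1 x = 0 := fun x hx => by simp [h3, hsn 4 x hx, k0 x hx]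
    have k4 : ∀ x ≤ 0, c4.1 x = 0 := fun x hx => by
      simp [h4, hsn 3 x hx, k0 x hx, k2 x hx, k3 x hx]
    intro i
    fin_cases i
    exacts [k0, k1, k2, k3, k4]
  set c : Fin 5 → Sm ℝ := ![c0, c1, c2, c3, c4] with hc
  set q := Ideal.Quotient.mk (van (line I) (n + 1)) with hq
  have hM1 : q (Mu (n + 1)) = 0 := Ideal.Quotient.eq_zero_iff_mem.2 (Mu_mem_van I _)
  -- Modulo order n + 1, a factor in front of y^n may be replaced by its restriction to y = 0.
  have hM : ∀ f : S2, q f * q (Mu n) = q (X (restr f)) * q (Mu n) := fun f => by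
    rw [← map_mul, ← map_mul, Ideal.Quotient.eq, ← sub_mul, mul_comm]
    exact mul_mem_van_succ (Mu_mem_van I n) (sub_restr_mem_van I f)
  have hΨ0 : ∀ i, q (corr Φ n c i) = q (Φ i) := fun i => by simp [corr, hM1]
  have hΨx : ∀ i, q (dx (corr Φ n c i)) = q (dx (Φ i)) := fun i => by simp [corr, hM1]
  have hΨy : ∀ i, q (dy (corr Φ n c i)) = q (dy (Φ i)) + q (X (c i)) * q (Mu n) := fun i => by
    simp [corr]
  have hΨxy : ∀ i, q (dx (dy (corr Φ n c i)))
      = q (dx (dy (Φ i))) + q (X (der (c i))) * q (Mu n) := fun i => by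
    simp [corr, mul_comm]
  have hQ : ∀ (Q : Sm ℝ) i, q (Q.of (corr Φ n c i)) = q (Q.of (Φ i)) := fun Q i => mk_of_eq Q (hΨ0 i)
  have hE : ∀ i, q (exp (2 * corr Φ n c i)) = q (exp (2 * Φ i)) := fun i => mk_exp_eq (by
    rw [map_mul, map_mul]; exact congrArg _ (hΨ0 i))
  have hE' : ∀ i, q (exp (-(2 * corr Φ n c i))) = q (exp (-(2 * Φ i))) := fun i => mk_exp_eq (by
    rw [map_neg, map_neg, map_mul, map_mul]; exact congrArg _ (congrArg _ (hΨ0 i)))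
  have hlead : ∀ k, q (evol e Φ k) = q (X (s k)) * q (Mu n) := fun k => by
    rw [← map_mul, Ideal.Quotient.eq]; exact sub_leading_mem_van (hΦ k) (hs k)
  -- `hi` inverts `h` only for t > `ℓ`; an open condition on the values suffices for the identity
  -- modulo every vanishing order.
  have hhi : q (e.hi.of (Φ 3)) * q (e.h.of (Φ 3)) = 1 := by
    rw [← map_mul, ← map_one q, Ideal.Quotient.eq]
    exact of_mem_van (Q := e.hi * e.h - 1) _ isOpen_Ioi (fun t ht => by simp [e.hi_mul t ht])
      (by rintro ⟨x, y⟩ ⟨hx, rfl⟩; exact ht x hx)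
  have hone : q (X 1) = 1 := map_one q
  have hHq : 2 * q (X H) = 1 := by
    rw [← hone, ← hH2, X_mul, X_two, map_mul, map_ofNat]
  have hD0 := congrArg (fun f => q (X f)) h0
  have hD1 := congrArg (fun f => q (X f)) h1
  have hD2 := congrArg (fun f => q (X f)) h2
  have hD3 := congrArg (fun f => q (X f)) h3
  have hD4 := congrArg (fun f => q (X f)) h4
  simp only [sub_eq_add_neg, X_add, X_mul, X_neg, X_two, map_add, map_mul, map_neg, map_ofNat]
    at hD0 hD1 hD2 hD3 hD4
  have hr0 := hM (dx (Φ 0))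
  have hr1 := hM (dx (Φ 1))
  rw [← der_restr] at hr0 hr1
  have hqM : ∀ (Q : Sm ℝ) i, q (Q.of (Φ i)) * q (Mu n) = q (X (Q.of (restr (Φ i)))) * q (Mu n) :=
    fun Q i => hM (Q.of (Φ i))
  have hqE : q (exp (2 * Φ 4)) * q (Mu n) = q (X (exp (2 * restr (Φ 4)))) * q (Mu n) :=
    hM (exp (2 * Φ 4))
  have hsi : q (e.si.of (Φ 3)) * q ((der e.σ).of (Φ 3)) = 1 := by
    rw [← map_mul, ← map_one q]
    congr 1
    ext p
    exact congrFun (congrArg Subtype.val e.si_mul) _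
  have hee : q (exp (-(2 * Φ 4))) * q (exp (2 * Φ 4)) = 1 := by
    rw [← map_mul, exp_neg_mul, map_one]
  suffices h : q (e1 e (corr Φ n c)) = 0 ∧ q (e2 (corr Φ n c)) = 0 ∧ q (e3 e (corr Φ n c)) = 0 ∧
      q (ea e (corr Φ n c)) = 0 ∧ q (eb e (corr Φ n c)) = 0 by
    intro k
    rw [← Ideal.Quotient.eq_zero_iff_mem]
    obtain ⟨a0, a1, a2, a3, a4⟩ := h
    fin_cases k
    exacts [a0, a1, a2, a3, a4]
  have hl0 : q (e1 e Φ) = _ := hlead 0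
  have hl1 : q (e2 Φ) = _ := hlead 1
  have hl2 : q (e3 e Φ) = _ := hlead 2
  have hl3 : q (ea e Φ) = _ := hlead 3
  have hl4 : q (eb e Φ) = _ := hlead 4
  have g0 : c 0 = c0 := rfl
  have g1 : c 1 = c1 := rfl
  have g2 : c 2 = c2 := rfl
  have g3 : c 3 = c3 := rfl
  have g4 : c 4 = c4 := rfl
  refine ⟨?_, ?_, ?_, ?_, ?_⟩
  · simp only [e1, map_add, map_sub, map_mul, map_ofNat] at hl0
    simp only [e1, map_add, map_sub, map_mul, map_ofNat, hΨx, hΨy, hΨxy, hQ, hE, g0]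
    linear_combination hl0 + 4 * q (X c0) * hr0 + 2 * q (Mu n) * hD0
      - q (Mu n) * q (X (s 0)) * hHq
  · simp only [e2, map_add, map_mul] at hl1
    simp only [e2, map_add, map_mul, hΨx, hΨy, hΨxy, g0, g1]
    linear_combination hl1 + q (X c1) * hr0 + q (X c0) * hr1 + q (Mu n) * hD1
  · simp only [e3, map_add, map_sub, map_mul, map_ofNat] at hl2
    simp only [e3, map_add, map_sub, map_mul, map_ofNat, hΨx, hΨy, hΨxy, hQ, hE, g0, g1, g2]
    linear_combination hl2 - 2 * q (X c0) * hr0 + 2 * q (X c1) * hr1 + 2 * q (Mu n) * hD2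
      - q (Mu n) * q (X (s 2)) * hHq
  · simp only [ea, map_add, map_sub, map_mul, map_ofNat] at hl3
    simp only [ea, map_add, map_sub, map_mul, map_ofNat, hΨx, hΨy, hQ, hE', g0, g2, g3, g4]
    linear_combination hl3 - 2 * q (exp (-(2 * Φ 4))) * q (e.h.of (Φ 3)) * q (Mu n) * hD4
      - q (exp (-(2 * Φ 4))) * q (e.h.of (Φ 3)) * q (X (e.hi.of T)) * (q (X ((der e.h).of T)) *
        q (X c3) + q (X (exp (2 * restr (Φ 4)))) * q (X (s 3))) * q (Mu n) * hHq
      + q (exp (-(2 * Φ 4))) * q (e.h.of (Φ 3)) * (q (X ((der e.h).of T)) *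
        q (X c3) + q (X (exp (2 * restr (Φ 4)))) * q (X (s 3))) * hqM e.hi 3
      - q (exp (-(2 * Φ 4))) * (q (X ((der e.h).of T)) *
        q (X c3) + q (X (exp (2 * restr (Φ 4)))) * q (X (s 3))) * q (Mu n) * hhi
      + q (exp (-(2 * Φ 4))) * q (X c3) * hqM (der e.h) 3
      + q (exp (-(2 * Φ 4))) * q (X (s 3)) * hqE - q (X (s 3)) * q (Mu n) * hee
  · simp only [eb, map_add, map_mul, map_ofNat] at hl4
    simp only [eb, map_add, map_mul, map_ofNat, hΨx, hΨy, hQ, hE, g0, g3]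
    linear_combination hl4 + q ((der e.σ).of (Φ 3)) * q (Mu n) * hD3
      + q ((der e.σ).of (Φ 3)) * (2 * q (X (e.h.of T)) * q (X c0) + q (X (s 4))) * hqM e.si 3
      - (2 * q (X (e.h.of T)) * q (X c0) + q (X (s 4))) * q (Mu n) * hsi
      + 2 * q (X c0) * hqM e.h 3

end EinsteinEuler
end

noncomputable section

namespace EinsteinEuler

open Sm

/-! ### Partial derivatives and iterated Fréchet derivatives -/

theorem iterate_dy_eq_iteratedFDeriv (f : S2) (j : ℕ) (p : ℝ × ℝ) :
    (dy^[j] f).1 p = iteratedFDeriv ℝ j f.1 p (fun _ => (0, 1)) := by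
  induction j generalizing p with
  | zero => simp
  | succ j ih =>
    rw [Function.iterate_succ_apply', dy_apply, iteratedFDeriv_succ_apply_left]
    rw [show (dy^[j] f).1 = fun p => iteratedFDeriv ℝ j f.1 p (fun _ => (0, 1)) from funext ih]
    have hd : DifferentiableAt ℝ (iteratedFDeriv ℝ j f.1) p :=
      f.smooth.differentiable_iteratedFDeriv (by exact_mod_cast WithTop.coe_lt_top _) p
    rw [fderiv_continuousMultilinear_apply_const_apply hd]
    rfl

theorem fderiv_eq (f : S2) : fderiv ℝ f.1 = fun q =>
    (dx f).1 q • ContinuousLinearMap.fst ℝ ℝ ℝ + (dy f).1 q • ContinuousLinearMap.snd ℝ ℝ ℝ := by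
  funext q
  ext <;> simp [dx_apply, dy_apply]

/-- The Fréchet derivative is `dx f` times one projection plus `dy f` times the other, so an
induction on the order reduces the claim to the two partial derivatives. -/
theorem iteratedFDeriv_eq_zero (j : ℕ) (f : S2) (p : ℝ × ℝ)
    (h : ∀ a b, a + b ≤ j → (dx^[a] (dy^[b] f)).1 p = 0) : iteratedFDeriv ℝ j f.1 p = 0 := by
  induction j generalizing f with
  | zero =>
    have := h 0 0 le_rfl
    ext m
    simpa using this
  | succ j ih =>
    rw [← norm_eq_zero, ← norm_iteratedFDeriv_fderiv, fderiv_eq, norm_eq_zero]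
    have hs : ∀ (g : S2) (ℓ : ℝ × ℝ →L[ℝ] ℝ),
        ContDiff ℝ ∞ (fun q => g.1 q • ℓ) := fun g ℓ => g.smooth.smul contDiff_const
    have hz : ∀ (g : S2) (ℓ : ℝ × ℝ →L[ℝ] ℝ), iteratedFDeriv ℝ j g.1 p = 0 →
        iteratedFDeriv ℝ j (fun q => g.1 q • ℓ) p = 0 := fun g ℓ hg => by
      have := (ContinuousLinearMap.toSpanSingleton ℝ ℓ).iteratedFDeriv_comp_left
        (g.smooth.contDiffAt (x := p)) (i := j) (by exact_mod_cast le_top)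
      rw [hg] at this
      change iteratedFDeriv ℝ j ((ContinuousLinearMap.toSpanSingleton ℝ ℓ) ∘ g.1) p = 0
      rw [this]
      refine ContinuousMultilinearMap.ext fun m => ?_
      change (ContinuousLinearMap.toSpanSingleton ℝ ℓ) 0 = 0
      simp
    have hj : ((j : ℕ) : WithTop ℕ∞) ≤ ∞ := by exact_mod_cast le_top
    rw [fun_iteratedFDeriv_add_apply ((hs _ _).of_le hj).contDiffAt ((hs _ _).of_le hj).contDiffAt,
      hz _ _ (ih (dx f) fun a b hab => ?_), hz _ _ (ih (dy f) fun a b hab => ?_), add_zero]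
    · have := h a (b + 1) (by omega)
      exact this
    · have := h (a + 1) b (by omega)
      rw [Function.iterate_succ_apply, dx_iterate_dy] at this
      exact this

/-! ### Borel's lemma with a parameter -/

theorem exists_bound_iteratedFDeriv {f : ℝ × ℝ → ℝ} (hf : ContDiff ℝ ∞ f) (hc : HasCompactSupport f)
    (k : ℕ) : ∃ C : ℝ, 0 ≤ C ∧ ∀ j < k, ∀ p, ‖iteratedFDeriv ℝ j f p‖ ≤ C := by
  have h : ∀ j : ℕ, ∃ C : ℝ, ∀ p, ‖iteratedFDeriv ℝ j f p‖ ≤ C := fun j =>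
    (hf.continuous_iteratedFDeriv (m := j) (by exact_mod_cast le_top)).bounded_above_of_compact_support
      (hc.iteratedFDeriv j)
  choose C hC using h
  refine ⟨∑ j ∈ Finset.range k, |C j|, by positivity, fun j hj p => ?_⟩
  exact (hC j p).trans ((le_abs_self _).trans
    (Finset.single_le_sum (f := fun j => |C j|) (fun _ _ => abs_nonneg _) (Finset.mem_range.2 hj)))

/-- The dilation `(x, y) ↦ (x, M y)`. -/
def dil (M : ℝ) : ℝ × ℝ →L[ℝ] ℝ × ℝ :=
  (ContinuousLinearMap.fst ℝ ℝ ℝ).prod (M • ContinuousLinearMap.snd ℝ ℝ ℝ)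

theorem norm_dil_le {M : ℝ} (hM : 1 ≤ M) : ‖dil M‖ ≤ M := by
  refine ContinuousLinearMap.opNorm_le_bound _ (by linarith) fun p => ?_
  rw [dil, ContinuousLinearMap.prod_apply, Prod.norm_def]
  refine max_le ?_ ?_
  · calc ‖p.1‖ ≤ ‖p‖ := norm_fst_le p
      _ ≤ M * ‖p‖ := le_mul_of_one_le_left (norm_nonneg _) hM
  · simp only [_root_.smul_apply, ContinuousLinearMap.coe_snd', norm_smul,
      Real.norm_of_nonneg (zero_le_one.trans hM)]
    exact mul_le_mul_of_nonneg_left (norm_snd_le p) (by linarith)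

theorem norm_iteratedFDeriv_dil_le {f : ℝ × ℝ → ℝ} (hf : ContDiff ℝ ∞ f) {M : ℝ} (hM : 1 ≤ M)
    (j : ℕ) (p : ℝ × ℝ) :
    ‖iteratedFDeriv ℝ j (f ∘ dil M) p‖ ≤ M ^ j * ‖iteratedFDeriv ℝ j f (dil M p)‖ := by
  rw [(dil M).iteratedFDeriv_comp_right hf p (i := j) (by exact_mod_cast le_top), mul_comm]
  refine (ContinuousMultilinearMap.norm_compContinuousLinearMap_le _ _).trans ?_
  gcongr
  rw [Finset.prod_const, Finset.card_univ, Fintype.card_fin]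
  exact pow_le_pow_left₀ (norm_nonneg _) (norm_dil_le hM) j

theorem dy_congr_of_eventuallyEq {f g : S2} {p : ℝ × ℝ} (h : f.1 =ᶠ[nhds p] g.1) (j : ℕ) :
    (dy^[j] f).1 =ᶠ[nhds p] (dy^[j] g).1 := by
  induction j generalizing f g with
  | zero => exact h
  | succ j ih =>
    refine ih (f := dy f) (g := dy g) ?_
    filter_upwards [h.eventuallyEq_nhds] with q hq
    rw [dy_apply, dy_apply, hq.fderiv_eq]

/-- The unit bump function in one variable. -/
def bump : ContDiffBump (0 : ℝ) := ⟨1, 2, one_pos, one_lt_two⟩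

/-- The bump function equal to one on `[-(k + 1), k + 1]`. -/
def bumps (k : ℕ) : ContDiffBump (0 : ℝ) :=
  ⟨k + 1, k + 2, by positivity, by linarith⟩

/-- The term c_k y^k/k! is cut off at |y| of size 1/M_k. A y-derivative of order j < k of M^{-k}
H(x, M y) is of size M^{j-k}, so M_k large makes it at most η 2^{-k-1}. The coefficients need not be
bounded in x, so the estimates are made after a cutoff in x which equals one for |x| ≤ k + 1; on |x|
≤ m + 1 the terms with k ≥ m do not see this cutoff, and smoothness is local. The last clause holds
because only terms with k > N are then present, and their derivatives of order at most N are bounded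
by a geometric series of sum η. -/
theorem borel (c : ℕ → Sm ℝ) (N : ℕ) {η : ℝ} (hη : 0 < η) : ∃ F : S2,
    (∀ n, F - ∑ k ∈ Finset.range n, X (c k) * Mu k ∈ van (line Set.univ) n) ∧
    (∀ x, (∀ k, (c k).1 x = 0) → ∀ y, F.1 (x, y) = 0) ∧
    ((∀ k ≤ N, c k = 0) → ∀ j ≤ N, ∀ y, |(dy^[j] F).1 (0, y)| ≤ η) := by
  set H : ℕ → S2 := fun k => X (Sm.mk (bumps k) (bumps k).contDiff * c k) *
    (Y (Sm.mk bump bump.contDiff) * Mu k) with hH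
  have hHc : ∀ k, HasCompactSupport (H k).1 := fun k => by
    refine HasCompactSupport.intro
      (K := Metric.closedBall (0 : ℝ) (k + 2) ×ˢ Metric.closedBall (0 : ℝ) 2)
      ((isCompact_closedBall _ _).prod (isCompact_closedBall _ _)) fun p hp => ?_
    rw [Set.mem_prod, not_and_or] at hp
    rcases hp with hp | hp
    · have : (bumps k) p.1 = 0 := (bumps k).zero_of_le_dist
        (by rw [Metric.mem_closedBall, not_le] at hp; exact hp.le)
      simp [hH, this]
    · have : bump p.2 = 0 := bump.zero_of_le_dist
        (by rw [Metric.mem_closedBall, not_le] at hp; exact hp.le)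
      simp [hH, this]
  choose C hC0 hC using fun k => exists_bound_iteratedFDeriv (H k).smooth (hHc k) k
  -- Chosen so that C_k ≤ M_k · η/2^{k+1}: a single spare power of M_k absorbs the derivative
  -- bounds.
  set M : ℕ → ℝ := fun k => 1 + C k / (η / 2 / 2 ^ k) with hM
  have hM1 : ∀ k, 1 ≤ M k := fun k => by
    have : 0 ≤ C k / (η / 2 / 2 ^ k) := div_nonneg (hC0 k) (by positivity)
    simp only [hM]; linarith
  have hM0 : ∀ k, 0 < M k := fun k => one_pos.trans_le (hM1 k)
  set G : ℕ → S2 := fun k => Sm.const ((M k ^ k)⁻¹) * (H k).comp (dil (M k)) (dil (M k)).contDiff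
    with hG
  have hGd : ∀ k, ∀ j < k, ∀ p, ‖iteratedFDeriv ℝ j (G k).1 p‖ ≤ η / 2 / 2 ^ k := fun k j hj p => by
    change ‖iteratedFDeriv ℝ j ((M k ^ k)⁻¹ • ((H k).1 ∘ dil (M k))) p‖ ≤ _
    rw [iteratedFDeriv_const_smul_apply
      (((H k).smooth.comp (dil (M k)).contDiff).of_le (by exact_mod_cast le_top)).contDiffAt,
      norm_smul, norm_inv, norm_pow, Real.norm_of_nonneg (hM0 k).le]
    have h1 := norm_iteratedFDeriv_dil_le (H k).smooth (hM1 k) j p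
    have h2 := hC k j hj (dil (M k) p)
    have h3 : M k ^ (j + 1) ≤ M k ^ k := pow_le_pow_right₀ (hM1 k) hj
    have h4 : C k ≤ M k * (η / 2 / 2 ^ k) := by
      have : (0 : ℝ) < η / 2 / 2 ^ k := by positivity
      simp only [hM]; rw [add_mul, div_mul_cancel₀ _ this.ne']; linarith
    rw [inv_mul_le_iff₀ (pow_pos (hM0 k) k)]
    calc _ ≤ M k ^ j * C k := h1.trans (mul_le_mul_of_nonneg_left h2 (pow_nonneg (hM0 k).le j))
      _ ≤ M k ^ j * (M k * (η / 2 / 2 ^ k)) :=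
        mul_le_mul_of_nonneg_left h4 (pow_nonneg (hM0 k).le j)
      _ = M k ^ (j + 1) * (η / 2 / 2 ^ k) := by ring
      _ ≤ _ := mul_le_mul_of_nonneg_right h3 (by positivity)
  set f : ℕ → S2 := fun k => X (c k) * (Sm.const ((M k ^ k)⁻¹) *
    (Y (Sm.mk bump bump.contDiff) * Mu k).comp (dil (M k)) (dil (M k)).contDiff) with hf
  have hfG : ∀ (k : ℕ) (p : ℝ × ℝ), |p.1| ≤ (k : ℝ) + 1 → (f k).1 p = (G k).1 p := fun k p hp => by
    have : (bumps k) p.1 = 1 := (bumps k).one_of_mem_closedBall (by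
      rw [Metric.mem_closedBall, dist_zero_right]; exact hp)
    simp [hf, hG, hH, dil, this]
    ring
  have hfMu : ∀ k (p : ℝ × ℝ), |M k * p.2| ≤ 1 → (f k).1 p = (X (c k) * Mu k).1 p := fun k p hp => by
    have : bump (M k * p.2) = 1 := bump.one_of_mem_closedBall (by
      rw [Metric.mem_closedBall, dist_zero_right]; exact hp)
    have hne : M k ^ k ≠ 0 := (pow_pos (hM0 k) k).ne'
    simp [hf, dil, this, mul_pow]
    field_simp
    simp
  -- the tails of the series
  have hsum : Summable fun k : ℕ => η / 2 / 2 ^ k := summable_geometric_two' η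
  set G' : ℕ → ℕ → S2 := fun m k => if m ≤ k then G k else 0 with hG'
  have hGd' : ∀ m k, ∀ j < m, ∀ p, ‖iteratedFDeriv ℝ j (G' m k).1 p‖ ≤ η / 2 / 2 ^ k := by
    intro m k j hj p
    by_cases hk : m ≤ k
    · simp only [hG', hk, if_true]; exact hGd k j (hj.trans_le hk) p
    · simp only [hG', hk, if_false]
      change ‖iteratedFDeriv ℝ j (fun _ => (0 : ℝ)) p‖ ≤ _
      rw [iteratedFDeriv_fun_zero]
      simp; positivity
  have hT : ∀ m, ContDiff ℝ ∞ fun p => ∑' k, (G' m k).1 p := fun m => by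
    refine contDiff_tsum_of_eventually (N := ⊤) (v := fun _ k => η / 2 / 2 ^ k)
      (fun k => (G' m k).smooth) (fun _ _ => hsum) fun j _ => ?_
    rw [Nat.cofinite_eq_atTop]
    filter_upwards [Filter.eventually_gt_atTop (max j m)] with k hk p
    simp only [hG', (le_max_right j m).trans hk.le, if_true]
    exact hGd k j ((le_max_left j m).trans_lt hk) p
  set T : ℕ → S2 := fun m => Sm.mk _ (hT m) with hTdef
  have hTd : ∀ m, ∀ j < m, ∀ p, iteratedFDeriv ℝ j (T m).1 p = ∑' k, iteratedFDeriv ℝ j (G' m k).1 p := by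
    intro m j hj p
    refine iteratedFDeriv_tsum_apply (N := ((m - 1 : ℕ) : ℕ∞)) (v := fun _ k => η / 2 / 2 ^ k)
      (fun k => (G' m k).smooth.of_le (by exact_mod_cast le_top)) (fun _ _ => hsum)
      (fun i k x hi => hGd' m k i (by have : i ≤ m - 1 := by exact_mod_cast hi
                                      omega) x)
      (by have : j ≤ m - 1 := by omega
          exact_mod_cast this) p
  have hdec : ∀ (m : ℕ) (p : ℝ × ℝ), |p.1| ≤ (m : ℝ) + 1 →
      HasSum (fun k => (f k).1 p) ((∑ k ∈ Finset.range m, (f k).1 p) + (T m).1 p) := by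
    intro m p hp
    have hs : Summable fun k => (G' m (k + (m+1))).1 p := by
      refine Summable.of_norm_bounded (hsum.comp_injective (add_left_injective (m+1))) fun k => ?_
      have := hGd (k + (m + 1)) 0 (by omega) p
      simp only [hG', show m ≤ k + (m+1) by omega, if_true]
      simpa using this
    have hs' : Summable fun k => (G' m k).1 p := (summable_nat_add_iff (m+1)).1 hs
    have h1 : HasSum (fun k => (G' m k).1 p) ((T m).1 p) := hs'.hasSum
    have h2 : HasSum (fun k => if k ∈ Finset.range m then (f k).1 p else 0)
        (∑ k ∈ Finset.range m, (f k).1 p) := by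
      have := hasSum_sum_of_ne_finset_zero (f := fun k => if k ∈ Finset.range m then (f k).1 p else 0)
        (s := Finset.range m) (L := SummationFilter.unconditional ℕ) (fun k hk => by simp [hk])
      rwa [Finset.sum_congr rfl (fun k hk => if_pos hk)] at this
    convert h2.add h1 using 2 with k
    by_cases hk : m ≤ k
    · have : |p.1| ≤ k + 1 := hp.trans (by gcongr)
      simp [hG', hk, hfG k p this, not_lt.2 hk]
    · simp [hG', hk, not_le.1 hk]
  have hdec' : ∀ (m : ℕ) (p : ℝ × ℝ), |p.1| ≤ (m : ℝ) + 1 →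
      ∑' k, (f k).1 p = (∑ k ∈ Finset.range m, f k + T m).1 p := fun m p hp => by
    rw [(hdec m p hp).tsum_eq]; simp
  have hnhds : ∀ (m : ℕ) (p : ℝ × ℝ), |p.1| < m + 1 → ∀ᶠ q in nhds p, |q.1| ≤ (m : ℝ) + 1 := by
    intro m p hp
    have : ContinuousAt (fun q : ℝ × ℝ => |q.1|) p := by fun_prop
    filter_upwards [this.eventually_lt continuousAt_const hp] with q hq using hq.le
  have hF : ContDiff ℝ ∞ fun p => ∑' k, (f k).1 p := contDiff_iff_contDiffAt.2 fun p => by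
    obtain ⟨m, hm⟩ := exists_nat_gt |p.1|
    refine ((∑ k ∈ Finset.range m, f k + T m).smooth.contDiffAt).congr_of_eventuallyEq ?_
    filter_upwards [hnhds m p (by linarith)] with q hq using hdec' m q hq
  refine ⟨Sm.mk _ hF, fun n => ?_, fun x hx y => ?_, fun hc j hj y => ?_⟩
  · rw [mem_van_line]
    intro j hj x _
    obtain ⟨m, hm⟩ := exists_nat_gt (max |x| n)
    have hmx : |x| < m := (le_max_left _ _).trans_lt hm
    have hmn : n < m := by exact_mod_cast (le_max_right |x| (n : ℝ)).trans_lt hm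
    have hev : (Sm.mk _ hF - ∑ k ∈ Finset.range n, X (c k) * Mu k : S2).1 =ᶠ[nhds (x, 0)]
        (∑ k ∈ Finset.Ico n m, X (c k) * Mu k + T m : S2).1 := by
      have h1 : ∀ᶠ q : ℝ × ℝ in nhds (x, 0), ∀ k ∈ Finset.range m, |M k * q.2| ≤ 1 := by
        rw [Filter.eventually_all_finset]
        intro k _
        have : ContinuousAt (fun q : ℝ × ℝ => |M k * q.2|) (x, 0) := by fun_prop
        filter_upwards [this.eventually_lt (continuousAt_const (y := (1 : ℝ))) (by simp)] with q hq
          using hq.le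
      filter_upwards [h1, hnhds m (x, 0) (by simp only; linarith)] with q hq1 hq2
      rw [Sm.sub_apply, Sm.mk_apply, hdec' m q hq2, Sm.add_apply, Sm.add_apply, Sm.sum_apply,
        Finset.sum_congr rfl (fun k hk => hfMu k q (hq1 k hk)), ← Sm.sum_apply,
        ← Finset.sum_range_add_sum_Ico _ hmn.le, Sm.add_apply]
      ring
    rw [(dy_congr_of_eventuallyEq hev j).eq_of_nhds, iterate_add, Sm.add_apply]
    have h2 : (∑ k ∈ Finset.Ico n m, X (c k) * Mu k) ∈ van (line Set.univ) n :=
      sum_mem fun k hk => Ideal.mul_mem_left _ _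
        (van_mono _ (Finset.mem_Ico.1 hk).1 (Mu_mem_van _ k))
    rw [mem_van_line.1 h2 j hj x (Set.mem_univ x), zero_add, iterate_dy_eq_iteratedFDeriv,
      hTd m j (hj.trans hmn)]
    have h3 : ∀ k, iteratedFDeriv ℝ j (G' m k).1 (x, 0) = 0 := fun k => by
      by_cases hk : m ≤ k
      swap
      · simp only [hG', hk, if_false]
        change iteratedFDeriv ℝ j (fun _ => (0 : ℝ)) _ = 0
        rw [iteratedFDeriv_fun_zero]; rfl
      have hjk : j < k := hj.trans (hmn.trans_le hk)
      simp only [hG', hk, if_true]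
      -- `G k` is a multiple of y^k with k > j, and tangential derivatives preserve the vanishing
      -- order, so every mixed derivative of order at most j is zero on the line.
      refine iteratedFDeriv_eq_zero j _ _ fun a b hab => ?_
      have hGk : G k ∈ van (line Set.univ) k := by
        have : G k = Sm.const ((M k ^ k)⁻¹) * (X (Sm.mk (bumps k) (bumps k).contDiff * c k) *
            ((Y (Sm.mk bump bump.contDiff)).comp (dil (M k)) (dil (M k)).contDiff *
              (Sm.const (M k ^ k) * Mu k))) := by
          ext q; simp only [hG, hH, Sm.mul_apply, const_apply, comp_apply, X_apply, Y_apply, Mu_apply,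
            mk_apply, dil, ContinuousLinearMap.prod_apply, ContinuousLinearMap.coe_fst',
            ContinuousLinearMap.coe_snd', _root_.smul_apply, smul_eq_mul, mul_pow]
          ring
        rw [this]
        exact Ideal.mul_mem_left _ _ (Ideal.mul_mem_left _ _ (Ideal.mul_mem_left _ _
          (Ideal.mul_mem_left _ _ (Mu_mem_van _ k))))
      have : ∀ a, dx^[a] (G k) ∈ van (line Set.univ) k := fun a => by
        induction a with
        | zero => exact hGk
        | succ a ih => rw [Function.iterate_succ_apply']; exact dx_mem_van isOpen_univ ih
      have hcomm : dx^[a] (dy^[b] (G k)) = dy^[b] (dx^[a] (G k)) := by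
        clear hab this
        induction a with
        | zero => rfl
        | succ a ih => rw [Function.iterate_succ_apply', Function.iterate_succ_apply', ih,
            dx_iterate_dy]
      rw [hcomm]
      exact mem_van_line.1 (this a) b (by omega) x (Set.mem_univ x)
    rw [tsum_congr h3, tsum_zero]
    rfl
  · rw [Sm.mk_apply, tsum_congr (fun k => ?_), tsum_zero]
    simp [hf, hx k]
  · have hev : (Sm.mk _ hF).1 =ᶠ[nhds (0, y)] (T (N + 1)).1 := by
      filter_upwards [hnhds (N + 1) (0, y) (by simp; positivity)] with q hq
      rw [Sm.mk_apply, hdec' (N + 1) q hq, Sm.add_apply, Sm.sum_apply,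
        Finset.sum_eq_zero (fun k hk => ?_), zero_add]
      have : c k = 0 := hc k (by have := Finset.mem_range.1 hk; omega)
      simp [hf, this]
    rw [(dy_congr_of_eventuallyEq hev j).eq_of_nhds, iterate_dy_eq_iteratedFDeriv, ← Real.norm_eq_abs]
    have h1 : ‖iteratedFDeriv ℝ j (T (N + 1)).1 (0, y)‖ ≤ η := by
      rw [hTd (N + 1) j (by omega)]
      exact tsum_of_norm_bounded (hasSum_geometric_two' η) fun k => hGd' (N + 1) k j (by omega) _
    refine (ContinuousMultilinearMap.le_opNorm _ _).trans ?_
    simpa using h1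

end EinsteinEuler
end

/-! ### Solutions to infinite order along a line, propagation of constraints, gluing -/

noncomputable section

namespace EinsteinEuler

open Sm

/-! ### Summation of formal corrections -/

/-- The iterated corrections define a formal series in y. Its Borel sum agrees with the n-th iterate
to order n + 1 and so inherits every property that is stable under such a congruence. `Good` serves
to record points x where all coefficients vanish; there the Borel sum vanishes for every y. -/
theorem exists_formal_sum (Inv : ℕ → Fl → Prop) (Good : (Fin 5 → Sm ℝ) → Prop) {N : ℕ} {Φ : Fl}
    (h0 : Inv N Φ)
    (step : ∀ n, N ≤ n → ∀ Ψ, Inv n Ψ → ∃ c, Good c ∧ Inv (n + 1) (corr Ψ n c)) :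
    ∃ F : Fl, (∀ n, N ≤ n → ∃ Ψ, Inv n Ψ ∧ ∀ i, Φ i + F i - Ψ i ∈ van (line Set.univ) (n + 1)) ∧
      (∀ i x, (∀ c, Good c → (c i).1 x = 0) → ∀ y, (F i).1 (x, y) = 0) ∧
      ∀ i, F i ∈ van (line Set.univ) (N + 1) := by
  choose! cor hgood hinv using step
  let S : ∀ n : ℕ, {Ψ : Fl // Inv (N + n) Ψ} := fun n => n.rec ⟨Φ, h0⟩ fun n Ψ =>
    ⟨corr Ψ.1 (N + n) (cor (N + n) Ψ.1), hinv _ (Nat.le_add_right _ _) _ Ψ.2⟩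
  -- The coefficient of y^k is produced at step k - 1; orders up to N are left untouched.
  let C : ℕ → Fin 5 → Sm ℝ := fun k => if N + 1 ≤ k then cor (k - 1) (S (k - 1 - N)).1 else 0
  have hC : ∀ n, C (N + n + 1) = cor (N + n) (S n).1 := fun n => by
    simp only [C, show N + 1 ≤ N + n + 1 by omega, if_true]
    rw [show N + n + 1 - 1 = N + n by omega, show N + n - N = n by omega]
  have hC0 : ∀ k ≤ N, C k = 0 := fun k hk => by
    simp only [C, show ¬ N + 1 ≤ k by omega, if_false]
  have hS : ∀ n i, (S n).1 i = Φ i + ∑ k ∈ Finset.range (N + n + 1), X (C k i) * Mu k := by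
    intro n i
    induction n with
    | zero =>
      have : ∑ k ∈ Finset.range (N + 0 + 1), X (C k i) * Mu k = 0 := Finset.sum_eq_zero fun k hk => by
        rw [hC0 k (by have := Finset.mem_range.1 hk; omega)]
        exact zero_mul _
      rw [this]
      exact (add_zero _).symm
    | succ n ih =>
      change (S n).1 i + X (cor (N + n) (S n).1 i) * Mu (N + n + 1) = _
      rw [ih, ← hC n, show N + (n + 1) + 1 = N + n + 1 + 1 by omega, Finset.sum_range_succ _ (N + n + 1)]
      ring
  -- No smallness of the sum is wanted here, so the order 0 and the bound 1 are arbitrary.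
  choose F hF hF0 _ using fun i : Fin 5 => borel (fun k => C k i) 0 one_pos
  refine ⟨F, fun n hn => ⟨(S (n - N)).1, ?_, fun i => ?_⟩, fun i x h y => ?_, fun i => ?_⟩
  · obtain ⟨m, rfl⟩ : ∃ m, n = N + m := ⟨n - N, by omega⟩
    rw [Nat.add_sub_cancel_left]
    exact (S m).2
  · rw [hS, show N + (n - N) = n by omega, add_sub_add_left_eq_sub]
    exact hF i (n + 1)
  · refine hF0 i x (fun k => ?_) y
    by_cases hk : N + 1 ≤ k
    · obtain ⟨n, rfl⟩ : ∃ n, k = N + n + 1 := ⟨k - N - 1, by omega⟩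
      rw [hC]
      exact h _ (hgood _ (by omega) _ (S n).2)
    · rw [hC0 k (by omega)]; rfl
  · have := hF i (N + 1)
    rwa [Finset.sum_eq_zero fun k hk => ?_, sub_zero] at this
    rw [hC0 k (by have := Finset.mem_range.1 hk; omega)]
    exact zero_mul _

/-! ### Extension from the line `y = 0` -/

theorem eyy_congr (e : Eos) {A : Set (ℝ × ℝ)} {n : ℕ} {Φ Ψ : Fl}
    (h : ∀ i, Ψ i - Φ i ∈ van A (n + 2)) : eyy e Ψ - eyy e Φ ∈ van A n := by
  have h0 : ∀ i, Ideal.Quotient.mk (van A n) (Ψ i) = Ideal.Quotient.mk (van A n) (Φ i) := fun i =>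
    Ideal.Quotient.eq.2 (van_mono _ (by omega) (h i))
  have hy : ∀ i, Ideal.Quotient.mk (van A n) (dy (Ψ i))
      = Ideal.Quotient.mk (van A n) (dy (Φ i)) := fun i => Ideal.Quotient.eq.2 (by
    rw [← map_sub]; exact van_mono _ (Nat.le_succ n) (dy_mem_van (h i)))
  have hyy : ∀ i, Ideal.Quotient.mk (van A n) (dy (dy (Ψ i)))
      = Ideal.Quotient.mk (van A n) (dy (dy (Φ i))) := fun i => Ideal.Quotient.eq.2 (by
    rw [← map_sub, ← map_sub]; exact dy_mem_van (dy_mem_van (h i)))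
  have hq : ∀ (Q : Sm ℝ) i, Ideal.Quotient.mk (van A n) (Q.of (Ψ i))
      = Ideal.Quotient.mk (van A n) (Q.of (Φ i)) := fun Q i => mk_of_eq Q (h0 i)
  have h2 : ∀ i, Ideal.Quotient.mk (van A n) (exp (2 * Ψ i))
      = Ideal.Quotient.mk (van A n) (exp (2 * Φ i)) := fun i => mk_exp_eq (by
    rw [map_mul, map_mul, h0])
  rw [← Ideal.Quotient.eq]
  simp [eyy, hy, hyy, hq, h2]

/-- A correction of order n + 2 enters at order n only through the second y-derivative of ρ, the
only second derivative in `eyy`. -/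
theorem eyy_corr (e : Eos) (Φ : Fl) (n : ℕ) (c : Fin 5 → Sm ℝ) :
    eyy e (corr Φ (n + 1) c) - (eyy e Φ + 2 * (X (c 0) * Mu n)) ∈ van {(0, 0)} (n + 1) := by
  have hsub : ({(0, 0)} : Set (ℝ × ℝ)) ⊆ line Set.univ := by rintro _ rfl; exact ⟨trivial, rfl⟩
  have hM1 : Ideal.Quotient.mk (van {(0, 0)} (n + 1)) (Mu (n + 2)) = 0 :=
    Ideal.Quotient.eq_zero_iff_mem.2 (van_anti hsub _ (van_mono _ (by omega) (Mu_mem_van _ _)))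
  have hM2 : Ideal.Quotient.mk (van {(0, 0)} (n + 1)) (Mu (n + 1)) = 0 :=
    Ideal.Quotient.eq_zero_iff_mem.2 (van_anti hsub _ (Mu_mem_van _ _))
  have h0 : ∀ i, Ideal.Quotient.mk (van {(0, 0)} (n + 1)) (corr Φ (n + 1) c i)
      = Ideal.Quotient.mk (van {(0, 0)} (n + 1)) (Φ i) := fun i => by simp [corr, hM1]
  have hy : ∀ i, Ideal.Quotient.mk (van {(0, 0)} (n + 1)) (dy (corr Φ (n + 1) c i))
      = Ideal.Quotient.mk (van {(0, 0)} (n + 1)) (dy (Φ i)) := fun i => by simp [corr, hM2]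
  have hyy : Ideal.Quotient.mk (van {(0, 0)} (n + 1)) (dy (dy (corr Φ (n + 1) c 0)))
      = Ideal.Quotient.mk (van {(0, 0)} (n + 1)) (dy (dy (Φ 0)) + X (c 0) * Mu n) := by simp [corr]
  have hq : ∀ (Q : Sm ℝ) i, Ideal.Quotient.mk (van {(0, 0)} (n + 1)) (Q.of (corr Φ (n + 1) c i))
      = Ideal.Quotient.mk (van {(0, 0)} (n + 1)) (Q.of (Φ i)) := fun Q i => mk_of_eq Q (h0 i)
  have h2 : ∀ i, Ideal.Quotient.mk (van {(0, 0)} (n + 1)) (exp (2 * corr Φ (n + 1) c i))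
      = Ideal.Quotient.mk (van {(0, 0)} (n + 1)) (exp (2 * Φ i)) := fun i => mk_exp_eq (by
    rw [map_mul, map_mul, h0])
  rw [← Ideal.Quotient.eq]
  simp only [eyy, map_add, map_sub, map_mul, map_pow, hyy, hy, hq, h2]
  ring

/-- A solution of the evolution equations to order `N` on `y = 0` extends to a solution to infinite
order; the constraint in the `y`-direction holds to infinite order at the origin. -/
theorem exists_extension (e : Eos) {I : Set ℝ} (hI : IsOpen I) {N : ℕ} {Φ : Fl}
    (ht : ∀ x ∈ I, e.ℓ < (Φ 3).1 (x, 0)) (hΦ : ∀ k, evol e Φ k ∈ van (line I) (N + 1))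
    (hy : eyy e Φ ∈ van {(0, 0)} N) :
    ∃ Ψ : Fl, (∀ i, Ψ i - Φ i ∈ van (line Set.univ) (N + 2)) ∧
      (∀ y, (Ψ 1).1 (0, y) = (Φ 1).1 (0, y)) ∧ (∀ y, (Ψ 2).1 (0, y) = (Φ 2).1 (0, y)) ∧
      (∀ n k, evol e Ψ k ∈ van (line I) n) ∧ ∀ n, eyy e Ψ ∈ van {(0, 0)} n := by
  -- The constraint has two y-derivatives and the evolution equations one, so the constraint is
  -- carried one order behind; n ≥ N + 1 makes n - 1 a genuine subtraction. Vanishing of c₁ and c₂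
  -- at x = 0 keeps w and l unchanged on the regular hypersurface.
  obtain ⟨F, hF, hF0, hFN⟩ := exists_formal_sum
    (fun n Ψ => (∀ x ∈ I, e.ℓ < (Ψ 3).1 (x, 0)) ∧ (∀ k, evol e Ψ k ∈ van (line I) n) ∧
      eyy e Ψ ∈ van {(0, 0)} (n - 1))
    (fun c => (c 1).1 0 = 0 ∧ (c 2).1 0 = 0) (N := N + 1) (Φ := Φ) ⟨ht, hΦ, hy⟩ (by
      rintro n hn Ψ ⟨h1, h2, h3⟩
      obtain ⟨n, rfl⟩ : ∃ m, n = m + 1 := ⟨n - 1, by omega⟩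
      -- By `eyy_corr`, c₀(0) enters the coefficient of y^n in `eyy` with the factor 2; the choice
      -- of a below cancels that coefficient.
      obtain ⟨c, hc0, hc1, hc2, hc, -⟩ := exists_corr e h1 h2
        (fun k => restr (dy^[n + 1] (evol e Ψ k))) (fun k x _ => rfl)
        (-(1 / 2) * (dy^[n] (eyy e Ψ)).1 (0, 0))
      refine ⟨c, ⟨hc1, hc2⟩, fun x hx => ?_, hc, ?_⟩
      · simpa [corr] using h1 x hx
      · simp only [Nat.add_sub_cancel] at h3 ⊢
        have hsub : ({(0, 0)} : Set (ℝ × ℝ)) ⊆ line Set.univ := by rintro _ rfl; exact ⟨trivial, rfl⟩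
        have h4 := eyy_corr e Ψ n c
        have h5 : eyy e Ψ + 2 * (X (c 0) * Mu n) ∈ van {(0, 0)} (n + 1) := by
          rw [mem_van_succ']
          refine ⟨add_mem h3 (Ideal.mul_mem_left _ _ (Ideal.mul_mem_left _ _ (van_anti hsub _
            (Mu_mem_van Set.univ n)))), ?_⟩
          rintro _ rfl
          rw [two_mul, iterate_add, iterate_add, iterate_dy_X_mul, iterate_dy_Mu]
          simp [hc0]
          ring
        simpa using add_mem h4 h5)
  have hz : ∀ {x y : ℝ} {i}, (F i).1 (x, y) = 0 → (Φ i + F i).1 (x, y) = (Φ i).1 (x, y) :=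
    fun h => by simp [h]
  refine ⟨fun i => Φ i + F i, fun i => by simpa using hFN i, fun y => hz (hF0 1 0 (fun c h => h.1) y),
    fun y => hz (hF0 2 0 (fun c h => h.2) y), fun n k => ?_, fun n => ?_⟩
  · obtain ⟨Ψ, hΨ, hd⟩ := hF (max n (N + 1)) (le_max_right _ _)
    have h1 := evol_congr (e := e) hI (n := max n (N + 1)) (Φ := Ψ) (Ψ := fun i => Φ i + F i)
      (fun i => van_anti (fun p (hp : p ∈ line _) => (⟨trivial, hp.2⟩ : p ∈ line Set.univ)) _ (hd i)) k
    have h2 := add_mem h1 (hΨ.2.1 k)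
    rw [sub_add_cancel] at h2
    exact van_mono _ (le_max_left _ _) h2
  · obtain ⟨Ψ, hΨ, hd⟩ := hF (n + N + 1) (by omega)
    have h1 := eyy_congr e (A := {(0, 0)}) (n := n) (Φ := Ψ) (Ψ := fun i => Φ i + F i)
      (fun i => van_anti (by rintro _ rfl; exact ⟨trivial, rfl⟩) _
        (van_mono _ (by omega) (hd i)))
    have h2 := add_mem h1 (van_mono _ (show n ≤ n + N + 1 - 1 by omega) hΨ.2.2)
    rwa [sub_add_cancel] at h2

/-! ### Constraint propagation -/

/-- Modulo the evolution equations, `dy_exx` is a linear homogeneous equation in the direction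
transversal to the line, so vanishing on the line gives vanishing to every order. -/
theorem exx_mem_van (e : Eos) {I : Set ℝ} {Φ : Fl}
    (hΦ : ∀ n k, evol e Φ k ∈ van (line I) n) (hdx : ∀ n, dx (e1 e Φ) ∈ van (line I) n)
    (h : ∀ x ∈ I, (exx e Φ).1 (x, 0) = 0) (n : ℕ) : exx e Φ ∈ van (line I) n := by
  induction n with
  | zero => simp
  | succ n ih =>
    refine mem_van_succ.2 ⟨?_, ?_⟩
    · rintro ⟨x, y⟩ ⟨hx, rfl⟩; exact h x hx
    · rw [dy_exx]
      exact add_mem (sub_mem (sub_mem (add_mem (add_mem (Ideal.mul_mem_left _ _ ih)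
        (Ideal.mul_mem_left _ _ (hΦ n 3))) (hdx n)) (Ideal.mul_mem_left _ _ (hΦ n 0)))
        (Ideal.mul_mem_left _ _ (hΦ n 2))) (Ideal.mul_mem_left _ _ (hΦ n 1))

/-- Here the propagation is along the line. By `dx_eyy` the x-derivative of e^{2ρ} `eyy` is a
combination of evolution residuals, so each y-derivative of this product is constant on I and is
determined by its value at x = 0. -/
theorem eyy_mem_van (e : Eos) {I : Set ℝ} (hI : Convex ℝ I) (h0 : (0 : ℝ) ∈ I) {Φ : Fl}
    (hΦ : ∀ n k, evol e Φ k ∈ van (line I) n) (h : ∀ n, eyy e Φ ∈ van {(0, 0)} n) (n : ℕ) :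
    eyy e Φ ∈ van (line I) n := by
  have hd : dx (exp (2 * Φ 0) * eyy e Φ) ∈ van (line I) n := by
    have : dx (exp (2 * Φ 0) * eyy e Φ) = exp (2 * Φ 0) * (exp (2 * Φ 2) * eb e Φ + dy (e1 e Φ)
        - 2 * dy (Φ 2) * e1 e Φ - 2 * dy (Φ 0) * e3 e Φ + 4 * dy (Φ 1) * e2 Φ) := by
      rw [dx_mul, dx_eyy, dx_exp, dx_mul, dx_ofNat]; ring
    rw [this]
    exact Ideal.mul_mem_left _ _ (add_mem (sub_mem (sub_mem (add_mem
      (Ideal.mul_mem_left _ _ (hΦ n 4)) (dy_mem_van (hΦ (n + 1) 0))) (Ideal.mul_mem_left _ _ (hΦ n 0)))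
      (Ideal.mul_mem_left _ _ (hΦ n 2))) (Ideal.mul_mem_left _ _ (hΦ n 1)))
  have hH : exp (2 * Φ 0) * eyy e Φ ∈ van (line I) n := by
    rw [mem_van_line] at hd ⊢
    intro j hj x hx
    set f := dy^[j] (exp (2 * Φ 0) * eyy e Φ) with hf
    have h1 : ∀ s ∈ I, HasDerivAt (fun s => f.1 (s, 0)) 0 s := fun s hs => by
      have := hasDerivAt_fst f s 0
      rwa [hf, dx_iterate_dy, hd j hj s hs] at this
    have h2 := hI.is_const_of_fderivWithin_eq_zero (𝕜 := ℝ) (f := fun s => f.1 (s, 0))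
      (fun s hs => (h1 s hs).differentiableAt.differentiableWithinAt)
      (fun s hs => (by
        by_cases hu : UniqueDiffWithinAt ℝ I s
        · rw [(h1 s hs).hasFDerivAt.hasFDerivWithinAt.fderivWithin hu]; ext; simp
        · rw [fderivWithin_zero_of_not_uniqueDiffWithinAt hu])) h0 hx
    rw [← h2]
    exact (Ideal.mul_mem_left (van {(0, 0)} n) (exp (2 * Φ 0)) (h n)) j hj _ rfl
  have := Ideal.mul_mem_left _ (exp (-(2 * Φ 0))) hH
  rwa [← mul_assoc, exp_neg_mul, one_mul] at this

/-! ### Functions vanishing on a half plane -/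

/-- The ideal of functions vanishing for `x ≤ 0`. -/
def half : Ideal S2 where
  carrier := {f | ∀ p : ℝ × ℝ, p.1 ≤ 0 → f.1 p = 0}
  add_mem' {f g} hf hg p hp := by rw [Sm.add_apply, hf p hp, hg p hp, add_zero]
  zero_mem' p _ := rfl
  smul_mem' g f hf p hp := by rw [smul_eq_mul, Sm.mul_apply, hf p hp, mul_zero]

theorem mem_half_of_lt {f : S2} (h : ∀ p : ℝ × ℝ, p.1 < 0 → f.1 p = 0) : f ∈ half := by
  rintro ⟨x, y⟩ hp
  have hc : ContinuousWithinAt (fun s => f.1 (x + s, y)) (Set.Iio 0) 0 :=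
    (f.continuous.comp (by fun_prop : Continuous fun s : ℝ => (x + s, y))).continuousWithinAt
  have h1 : Filter.Tendsto (fun s => f.1 (x + s, y)) (nhdsWithin 0 (Set.Iio 0)) (nhds 0) :=
    tendsto_const_nhds.congr' (by
      filter_upwards [self_mem_nhdsWithin] with s hs
      exact (h _ (by simp only [Set.mem_Iio] at hs; simp only at hp ⊢; linarith)).symm)
  have := tendsto_nhds_unique hc h1
  simpa using this

theorem lie_mem_half (v : ℝ × ℝ) {f : S2} (h : f ∈ half) : lie (fun _ => v) contDiff_const f ∈ half := by
  refine mem_half_of_lt fun p hp => ?_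
  have : f.1 =ᶠ[nhds p] fun _ => 0 := by
    filter_upwards [continuousAt_fst.eventually_lt continuousAt_const hp] with q hq using h q hq.le
  rw [lie_apply, this.fderiv_eq]
  simp

theorem dx_mem_half {f : S2} (h : f ∈ half) : dx f ∈ half := lie_mem_half _ h
theorem dy_mem_half {f : S2} (h : f ∈ half) : dy f ∈ half := lie_mem_half _ h

theorem iterate_mem_half {f : S2} (h : f ∈ half) (a b : ℕ) : dx^[a] (dy^[b] f) ∈ half := by
  have : dy^[b] f ∈ half := by
    induction b with
    | zero => exact h
    | succ b ih => rw [Function.iterate_succ_apply']; exact dy_mem_half ih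
  induction a with
  | zero => exact this
  | succ a ih => rw [Function.iterate_succ_apply']; exact dx_mem_half ih

theorem half_congr (e : Eos) {Φ Ψ : Fl} (h : ∀ i, Ψ i - Φ i ∈ half) :
    (∀ k, evol e Ψ k - evol e Φ k ∈ half) ∧ exx e Ψ - exx e Φ ∈ half ∧ eyy e Ψ - eyy e Φ ∈ half := by
  have h0 : ∀ i, Ideal.Quotient.mk half (Ψ i) = Ideal.Quotient.mk half (Φ i) := fun i =>
    Ideal.Quotient.eq.2 (h i)
  have hx : ∀ i, Ideal.Quotient.mk half (dx (Ψ i)) = Ideal.Quotient.mk half (dx (Φ i)) :=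
    fun i => Ideal.Quotient.eq.2 (by rw [← map_sub]; exact dx_mem_half (h i))
  have hy : ∀ i, Ideal.Quotient.mk half (dy (Ψ i)) = Ideal.Quotient.mk half (dy (Φ i)) :=
    fun i => Ideal.Quotient.eq.2 (by rw [← map_sub]; exact dy_mem_half (h i))
  have hxy : ∀ i, Ideal.Quotient.mk half (dx (dy (Ψ i))) = Ideal.Quotient.mk half (dx (dy (Φ i))) :=
    fun i => Ideal.Quotient.eq.2 (by rw [← map_sub, ← map_sub]; exact dx_mem_half (dy_mem_half (h i)))
  have hxx : ∀ i, Ideal.Quotient.mk half (dx (dx (Ψ i))) = Ideal.Quotient.mk half (dx (dx (Φ i))) :=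
    fun i => Ideal.Quotient.eq.2 (by rw [← map_sub, ← map_sub]; exact dx_mem_half (dx_mem_half (h i)))
  have hyy : ∀ i, Ideal.Quotient.mk half (dy (dy (Ψ i))) = Ideal.Quotient.mk half (dy (dy (Φ i))) :=
    fun i => Ideal.Quotient.eq.2 (by rw [← map_sub, ← map_sub]; exact dy_mem_half (dy_mem_half (h i)))
  have ho : ∀ (Q : Sm ℝ) (f g : S2), Ideal.Quotient.mk half f = Ideal.Quotient.mk half g →
      Ideal.Quotient.mk half (Q.of f) = Ideal.Quotient.mk half (Q.of g) := fun Q f g hfg =>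
    Ideal.Quotient.eq.2 fun p hp => by
      have := Ideal.Quotient.eq.1 hfg p hp
      rw [Sm.sub_apply, sub_eq_zero] at this
      simp [this]
  have hq : ∀ (Q : Sm ℝ) i, Ideal.Quotient.mk half (Q.of (Ψ i)) = Ideal.Quotient.mk half (Q.of (Φ i)) :=
    fun Q i => ho Q _ _ (h0 i)
  have h2 : ∀ i, Ideal.Quotient.mk half (exp (2 * Ψ i)) = Ideal.Quotient.mk half (exp (2 * Φ i)) :=
    fun i => ho _ _ _ (by rw [map_mul, map_mul, h0])
  have h3 : ∀ i, Ideal.Quotient.mk half (exp (-(2 * Ψ i)))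
      = Ideal.Quotient.mk half (exp (-(2 * Φ i))) :=
    fun i => ho _ _ _ (by rw [map_neg, map_neg, map_mul, map_mul, h0])
  refine ⟨fun k => ?_, ?_, ?_⟩
  · rw [← Ideal.Quotient.eq]
    fin_cases k <;>
    simp [evol, e1, e2, e3, ea, eb, hx, hy, hxy, hq, h2, h3]
  · rw [← Ideal.Quotient.eq]
    simp [exx, hx, hxx, hq, h2, h3]
  · rw [← Ideal.Quotient.eq]
    simp [eyy, hy, hyy, hq, h2]

/-! ### Gluing at the origin -/

/-- Extension by zero of a function flat at the origin: the derivatives of the extension are the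
extensions of the derivatives, hence again continuous and differentiable at 0. -/
theorem exists_glue (c : Sm ℝ) (h : ∀ j, (der^[j] c).1 0 = 0) :
    ∃ g : Sm ℝ, (∀ x ≤ 0, g.1 x = 0) ∧ ∀ x, 0 ≤ x → g.1 x = c.1 x := by
  set f : ℕ → ℝ → ℝ := fun j x => if x ≤ 0 then 0 else (der^[j] c).1 x with hf
  have hneg : ∀ j x, x ≤ 0 → f j x = 0 := fun j x hx => by simp [hf, hx]
  have hpos : ∀ j x, 0 ≤ x → f j x = (der^[j] c).1 x := fun j x hx => by
    rcases hx.eq_or_lt with rfl | hx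
    · rw [hneg j 0 le_rfl, h j]
    · simp [hf, hx]
  have hder : ∀ j x, HasDerivAt (f j) (f (j + 1) x) x := fun j x => by
    have hc := (der^[j] c).hasDerivAt x
    rw [← Function.iterate_succ_apply' der] at hc
    rcases lt_trichotomy x 0 with hx | rfl | hx
    · rw [hneg _ _ hx.le]
      refine (hasDerivAt_const x (0 : ℝ)).congr_of_eventuallyEq ?_
      filter_upwards [Iio_mem_nhds hx] with s hs using hneg j s (le_of_lt hs)
    · rw [hneg _ _ le_rfl]
      rw [h (j + 1)] at hc
      have h1 : HasDerivWithinAt (f j) 0 (Set.Iic 0) 0 :=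
        (hasDerivAt_const (0 : ℝ) (0 : ℝ)).hasDerivWithinAt.congr (fun s hs => hneg j s hs)
          (hneg j 0 le_rfl)
      have h2 : HasDerivWithinAt (f j) 0 (Set.Ici 0) 0 :=
        hc.hasDerivWithinAt.congr (fun s hs => hpos j s hs) (hpos j 0 le_rfl)
      have := h1.union h2
      rwa [Set.Iic_union_Ici, hasDerivWithinAt_univ] at this
    · rw [hpos _ _ hx.le]
      refine hc.congr_of_eventuallyEq ?_
      filter_upwards [Ioi_mem_nhds hx] with s hs using hpos j s (le_of_lt hs)
  have hsm : ∀ n : ℕ, ∀ j, ContDiff ℝ n (f j) := by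
    intro n
    induction n with
    | zero =>
      intro j
      have hc : Continuous (f j) := continuous_iff_continuousAt.2 fun x => (hder j x).continuousAt
      exact_mod_cast contDiff_zero.2 hc
    | succ n ih =>
      intro j
      rw [Nat.cast_add, Nat.cast_one, contDiff_succ_iff_deriv]
      refine ⟨fun x => (hder j x).differentiableAt,
        fun h => absurd h (WithTop.coe_ne_top (a := (n : ℕ∞))), ?_⟩
      rw [show deriv (f j) = f (j + 1) from funext fun x => (hder j x).deriv]
      exact ih _
  exact ⟨Sm.mk (f 0) (contDiff_infty.2 fun n => hsm n 0), hneg 0, hpos 0⟩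

theorem iterate_der_restr (f : S2) (j : ℕ) : der^[j] (restr f) = restr (dx^[j] f) := by
  induction j generalizing f with
  | zero => rfl
  | succ j ih => rw [Function.iterate_succ_apply, der_restr, ih]; rfl

/-! ### Extension from a half line -/

/-- Tangential derivatives need an open interval, so the equations are solved on one; the end point
is recovered by continuity. -/
theorem mem_van_Ico {b : ℝ} {n : ℕ} {f : S2} (h : f ∈ van (line (Set.Ioo 0 b)) n) :
    f ∈ van (line (Set.Ico 0 b)) n := by
  rw [mem_van_line] at h ⊢
  rintro j hj x ⟨h0, hxb⟩
  rcases h0.eq_or_lt with rfl | h0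
  · have hc : ContinuousWithinAt (fun s => (dy^[j] f).1 (s, 0)) (Set.Ioi 0) 0 :=
      ((dy^[j] f).continuous.comp (by fun_prop : Continuous fun s : ℝ => (s, (0 : ℝ)))).continuousWithinAt
    have h1 : Filter.Tendsto (fun s => (dy^[j] f).1 (s, 0)) (nhdsWithin 0 (Set.Ioi 0)) (nhds 0) :=
      tendsto_const_nhds.congr' (by
        filter_upwards [Ioo_mem_nhdsGT hxb] with s hs
        exact (h j hj s hs).symm)
    exact tendsto_nhds_unique hc h1
  · exact h j hj x ⟨h0, hxb⟩

/-- Given a solution to infinite order at the origin and data on `0 ≤ x < b`, `y = 0` with the same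
jets at the origin, there is a solution to infinite order along `0 ≤ x < b`, `y = 0` which agrees
with the given one for `x ≤ 0`. -/
theorem exists_extension_right (e : Eos) {b : ℝ} {G : Fl}
    (hG : ∀ k a c, (dx^[a] (dy^[c] (evol e G k))).1 (0, 0) = 0) (d : Fin 5 → Sm ℝ)
    (hd : ∀ i j, (der^[j] (d i - restr (G i))).1 0 = 0) (ht : ∀ x ∈ Set.Ioo 0 b, e.ℓ < (d 3).1 x) :
    ∃ Ψ : Fl, (∀ i, Ψ i - G i ∈ half) ∧ (∀ i, ∀ x, 0 ≤ x → (Ψ i).1 (x, 0) = (d i).1 x) ∧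
      ∀ n k, evol e Ψ k ∈ van (line (Set.Ioo 0 b)) n := by
  choose g hg0 hg1 using fun i => exists_glue _ (hd i)
  obtain ⟨F, hF, hF0, hFN⟩ := exists_formal_sum
    (fun n Ψ => (∀ x ∈ Set.Ioo 0 b, e.ℓ < (Ψ 3).1 (x, 0)) ∧
      (∀ k, evol e Ψ k ∈ van (line (Set.Ioo 0 b)) n) ∧ ∀ i, Ψ i - G i ∈ half)
    (fun c => ∀ i, ∀ x ≤ 0, (c i).1 x = 0) (N := 0) (Φ := fun i => G i + X (g i))
    ⟨fun x hx => by simp [hg1 3 x hx.1.le, ht x hx], fun k => van_zero _ _,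
      fun i p hp => by simp [hg0 i p.1 hp]⟩ (by
      rintro n - Ψ ⟨h1, h2, h3⟩
      have hflat : ∀ k j, (der^[j] (restr (dy^[n] (evol e Ψ k)))).1 0 = 0 := fun k j => by
        rw [iterate_der_restr, restr_apply]
        refine Eq.trans ?_ (hG k j n)
        have := iterate_mem_half ((half_congr e h3).1 k) j n (0, 0) le_rfl
        rwa [iterate_sub, iterate_sub, Sm.sub_apply, sub_eq_zero] at this
      -- The residual coefficients are flat at the origin, so their extension by zero to x ≤ 0 is
      -- smooth. With these sources and a = 0 the corrections vanish for x ≤ 0, and the given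
      -- solution is kept there.
      choose s hs0 hs1 using fun k => exists_glue _ (hflat k)
      obtain ⟨c, -, -, -, hc, hcz⟩ := exists_corr e h1 h2 s
        (fun k x hx => by rw [hs1 k x hx.1.le]; rfl) 0
      have hcz := hcz hs0 rfl
      refine ⟨c, hcz, fun x hx => ?_, hc, fun i p hp => ?_⟩
      · simpa [corr] using h1 x hx
      · have := h3 i p hp
        simp only [Sm.sub_apply] at this
        simp [corr, hcz i p.1 hp, this])
  refine ⟨fun i => G i + X (g i) + F i, fun i p hp => ?_, fun i x hx => ?_, fun n k => ?_⟩
  · simp [hg0 i p.1 hp, hF0 i p.1 (fun c h => h i _ hp) p.2]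
  · have h0 : (F i).1 (x, 0) = 0 := mem_van_line.1 (hFN i) 0 (by omega) x trivial
    simp [h0, hg1 i x hx]
  · obtain ⟨Ψ, hΨ, hd⟩ := hF n (Nat.zero_le n)
    have h1 := evol_congr (e := e) (isOpen_Ioo (a := 0) (b := b)) (n := n) (Φ := Ψ)
      (Ψ := fun i => G i + X (g i) + F i) (fun i => van_anti (fun p (hp : p ∈ line _) => (⟨trivial, hp.2⟩ : p ∈ line Set.univ)) _ (hd i)) k
    have h2 := add_mem h1 (hΨ.2.1 k)
    rwa [sub_add_cancel] at h2

end EinsteinEuler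
end

/-! ### The weighted first-order system satisfied by the y-jets -/

noncomputable section

namespace EinsteinEuler

open Sm

/-! ### The jet space -/

/-- Jets of order eight of the five unknowns. -/
abbrev YS := Fin 5 → Fin 9 → ℝ

/-- Jets, weighted `x`-derivatives of `ρ, w, l`, and the square of the weight. -/
abbrev St := YS × (Fin 3 → ℝ) × ℝ

def yc (i : Fin 5) (k : Fin 9) : Sm St := Sm.mk (fun p => p.1 i k) (by fun_prop)
def zc (i : Fin 3) : Sm St := Sm.mk (fun p => p.2.1 i) (by fun_prop)
def mc : Sm St := Sm.mk (fun p => p.2.2) (by fun_prop)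

@[simp] theorem yc_apply (i : Fin 5) (k : Fin 9) (p : St) : (yc i k).1 p = p.1 i k := rfl
@[simp] theorem zc_apply (i : Fin 3) (p : St) : (zc i).1 p = p.2.1 i := rfl
@[simp] theorem mc_apply (p : St) : mc.1 p = p.2.2 := rfl

variable (e : Eos)

/-- The `y`-derivatives of the weighted `x`-derivatives of `ρ, w, l`. -/
def zdot : Fin 3 → Sm St := ![
  -(2 * zc 0 * yc 0 1) + Sm.const (1 / 2) * mc * exp (2 * yc 2 0) * e.σ.of (yc 3 0),
  -(yc 0 1 * zc 1) - yc 1 1 * zc 0,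
  yc 0 1 * zc 0 - yc 1 1 * zc 1 - Sm.const (1 / 2) * mc * e.h.of (yc 3 0) * exp (2 * yc 2 0)]

/-- The weighted `x`-derivative of `t`. -/
def qt : Sm St := -(e.si.of (yc 3 0) * (mc * exp (-(2 * yc 4 0)) * ((der e.h).of (yc 3 0) * yc 3 1
  + e.h.of (yc 3 0) * (2 * yc 2 1 - 2 * yc 4 1 + 2 * yc 0 1)) + 2 * zc 0 * e.h.of (yc 3 0)))

/-- The weighted `x`-derivative of `ψ`. -/
def qψ : Sm St := -zc 2 - zc 0 - Sm.const (1 / 2) * e.hi.of (yc 3 0) * ((der e.h).of (yc 3 0) * qt e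
  + mc * exp (-(2 * yc 4 0)) * ((der e.σ).of (yc 3 0) * yc 3 1
    + 2 * yc 0 1 * e.h.of (yc 3 0)))

/-- The total `y`-derivative as a vector field on the jet space. -/
def vf (p : St) : St :=
  -- Jets are cut off at order eight, so this is the true total derivative only on functions of the
  -- slots of order less than eight. `Dep` keeps track of the order.
  (fun i k => if h : (k : ℕ) < 8 then p.1 i ⟨k + 1, by omega⟩ else 0, fun i => (zdot e i).1 p, 0)

theorem contDiff_vf : ContDiff ℝ ∞ (vf e) := by
  refine ContDiff.prodMk (contDiff_pi.2 fun i => contDiff_pi.2 fun k => ?_)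
    ((contDiff_pi.2 fun i => (zdot e i).smooth).prodMk contDiff_const)
  by_cases h : (k : ℕ) < 8
  · simp only [h, dite_true]; fun_prop
  · simp only [h, dite_false]; fun_prop

/-- The total `y`-derivative. -/
def LL : Derivation ℝ (Sm St) (Sm St) := lie (vf e) (contDiff_vf e)

theorem LL_apply (g : Sm St) (p : St) : (LL e g).1 p = fderiv ℝ g.1 p (vf e p) := rfl

theorem LL_zc (i : Fin 3) : LL e (zc i) = zdot e i := by
  ext p
  rw [LL_apply]
  have : HasFDerivAt (zc i).1 _ p := ((ContinuousLinearMap.proj (R := ℝ) (φ := fun _ => ℝ) i).comp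
    ((ContinuousLinearMap.fst ℝ (Fin 3 → ℝ) ℝ).comp
      (ContinuousLinearMap.snd ℝ YS ((Fin 3 → ℝ) × ℝ)))).hasFDerivAt
  rw [this.fderiv]
  rfl

/-- Equality of states up to the slots of order at least `s`. -/
def Sim (s : ℕ) (p p' : St) : Prop := (∀ i, ∀ k : Fin 9, (k : ℕ) < s → p.1 i k = p'.1 i k) ∧ p.2 = p'.2

/-- Functions of the jets of order less than `s`. -/
def Dep (s : ℕ) (g : Sm St) : Prop := ∀ p p', Sim s p p' → g.1 p = g.1 p'

theorem Sim.mono {s s' : ℕ} (h : s ≤ s') {p p' : St} (hp : Sim s' p p') : Sim s p p' :=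
  ⟨fun i k hk => hp.1 i k (hk.trans_le h), hp.2⟩

theorem Dep.mono {s s' : ℕ} (h : s ≤ s') {g : Sm St} (hg : Dep s g) : Dep s' g :=
  fun p p' hp => hg p p' (hp.mono h)

/-- The projection to the slots of order less than `s`. -/
def trunc (s : ℕ) : St →L[ℝ] St :=
  (ContinuousLinearMap.pi fun i => ContinuousLinearMap.pi fun k : Fin 9 =>
    (if (k : ℕ) < s then (1 : ℝ) else 0) • (ContinuousLinearMap.proj (R := ℝ) (φ := fun _ : Fin 9 => ℝ) k ∘L
      ContinuousLinearMap.proj (R := ℝ) (φ := fun _ : Fin 5 => Fin 9 → ℝ) i ∘L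
        ContinuousLinearMap.fst ℝ YS ((Fin 3 → ℝ) × ℝ))).prod
    (ContinuousLinearMap.snd ℝ YS ((Fin 3 → ℝ) × ℝ))

theorem trunc_apply (s : ℕ) (p : St) :
    trunc s p = (fun i (k : Fin 9) => if (k : ℕ) < s then p.1 i k else 0, p.2) := by
  refine Prod.ext (funext fun i => funext fun k => ?_) rfl
  change (if (k : ℕ) < s then (1 : ℝ) else 0) * p.1 i k = if (k : ℕ) < s then p.1 i k else 0
  split_ifs
  · rw [one_mul]
  · rw [zero_mul]

theorem trunc_eq {s : ℕ} {p p' : St} (h : Sim s p p') : trunc s p = trunc s p' := by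
  rw [trunc_apply, trunc_apply, h.2]
  congr 1
  funext i k
  split_ifs with hk
  · exact h.1 i k hk
  · rfl

theorem Dep.fderiv_eq {s : ℕ} {g : Sm St} (hg : Dep s g) {p p' v v' : St} (hp : Sim s p p')
    (hv : Sim s v v') : fderiv ℝ g.1 p v = fderiv ℝ g.1 p' v' := by
  have h : ∀ p v, fderiv ℝ g.1 p v = fderiv ℝ g.1 (trunc s p) (trunc s v) := fun p v => by
    have h1 : g.1 = g.1 ∘ trunc s := funext fun q => hg _ _ ⟨fun i k hk => by
      rw [trunc_apply]; simp [hk], by rw [trunc_apply]⟩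
    conv_lhs => rw [h1]
    rw [((g.differentiable _).hasFDerivAt.comp p (trunc s).hasFDerivAt).fderiv]
    rfl
  rw [h, h p', trunc_eq hp, trunc_eq hv]

variable {e}

/-- A total derivative raises the jet order by one. The condition 1 ≤ s is there because `zdot`
already involves the slots of order 0 and 1. -/
theorem Dep.LL {s : ℕ} (hs : 1 ≤ s) {g : Sm St} (hg : Dep s g) : Dep (s + 1) (LL e g) := by
  intro p p' hp
  refine hg.fderiv_eq (hp.mono (Nat.le_succ s)) ⟨fun i k hk => ?_, ?_⟩
  · simp only [vf]
    split_ifs with h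
    · exact hp.1 i _ (by simp only; omega)
    · rfl
  · have hz : ∀ i, (zdot e i).1 p = (zdot e i).1 p' := fun i => by
      have h0 := fun i => hp.1 i 0 (by simp)
      have h1 := fun i => hp.1 i 1 (by simp; omega)
      have hm : p.2.2 = p'.2.2 := by rw [hp.2]
      have hz : ∀ j, p.2.1 j = p'.2.1 j := fun j => by rw [hp.2]
      fin_cases i <;> simp [zdot, h0, h1, hm, hz]
    simp only [vf, hz]

theorem Dep.iterate {s : ℕ} (hs : 1 ≤ s) {g : Sm St} (hg : Dep s g) (k : ℕ) :
    Dep (s + k) ((EinsteinEuler.LL e)^[k] g) := by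
  induction k with
  | zero => exact hg
  | succ k ih => rw [Function.iterate_succ_apply']; exact ih.LL (by omega)

/-! ### Pulling back to the plane -/

/-- The jet of `Φ` in the `y`-direction. -/
def jet (Φ : Fl) (z : Fin 3 → S2) (m : Sm ℝ) (p : ℝ × ℝ) : St :=
  (fun i (k : Fin 9) => (dy^[k] (Φ i)).1 p, fun i => (z i).1 p, m.1 p.1)

theorem contDiff_jet (Φ : Fl) (z : Fin 3 → S2) (m : Sm ℝ) : ContDiff ℝ ∞ (jet Φ z m) :=
  (contDiff_pi.2 fun i => contDiff_pi.2 fun k : Fin 9 => (dy^[k] (Φ i)).smooth).prodMk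
    ((contDiff_pi.2 fun i => (z i).smooth).prodMk (m.smooth.comp contDiff_fst))

def pull (Φ : Fl) (z : Fin 3 → S2) (m : Sm ℝ) (g : Sm St) : S2 :=
  g.comp (jet Φ z m) (contDiff_jet Φ z m)

theorem pull_apply (Φ : Fl) (z : Fin 3 → S2) (m : Sm ℝ) (g : Sm St) (p : ℝ × ℝ) :
    (pull Φ z m g).1 p = g.1 (jet Φ z m p) := rfl

/-- The residuals of the evolution of the weighted `x`-derivatives. -/
def zres (e : Eos) (Φ : Fl) (z : Fin 3 → S2) (m : Sm ℝ) (i : Fin 3) : S2 :=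
  dy (z i) - pull Φ z m (zdot e i)

/-- Chain rule. The jets and the weight have the y-derivatives prescribed by `vf`; the components
z_i have them only up to `zres`. Thus `LL` computes y-derivatives modulo these residuals. -/
theorem dy_pull (Φ : Fl) (z : Fin 3 → S2) (m : Sm ℝ) {g : Sm St} (hg : Dep 8 g) :
    dy (pull Φ z m g) = pull Φ z m (LL e g) + ∑ i, zres e Φ z m i *
      pull Φ z m (lie (fun _ => ((0, Pi.single i 1, 0) : St)) contDiff_const g) := by
  ext p
  have h1 : ∀ q : S2, HasFDerivAt q.1 (fderiv ℝ q.1 p) p := fun q => (q.differentiable p).hasFDerivAt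
  have hj : HasFDerivAt (jet Φ z m)
      ((ContinuousLinearMap.pi fun i => ContinuousLinearMap.pi fun k : Fin 9 =>
        fderiv ℝ (dy^[k] (Φ i)).1 p).prod
        ((ContinuousLinearMap.pi fun i => fderiv ℝ (z i).1 p).prod (fderiv ℝ (X m).1 p))) p :=
    (hasFDerivAt_pi.2 fun i => hasFDerivAt_pi.2 fun k => h1 _).prodMk
      ((hasFDerivAt_pi.2 fun i => h1 _).prodMk (h1 (X m)))
  have hd : (dy (pull Φ z m g)).1 p = fderiv ℝ g.1 (jet Φ z m p)
      (fun i k => (dy^[k + 1] (Φ i)).1 p, fun i => (dy (z i)).1 p, 0) := by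
    rw [dy_apply]
    change fderiv ℝ (g.1 ∘ jet Φ z m) p (0, 1) = _
    rw [((g.differentiable _).hasFDerivAt.comp p hj).fderiv]
    change fderiv ℝ g.1 (jet Φ z m p) (fun i k => (dy (dy^[k] (Φ i))).1 p,
      fun i => (dy (z i)).1 p, (dy (X m)).1 p) = _
    rw [dy_X]
    simp only [← Function.iterate_succ_apply' dy]
    rfl
  rw [hd, Sm.add_apply, pull_apply, LL_apply, Sm.sum_apply]
  simp only [Sm.mul_apply, pull_apply, lie_apply]
  have hsum : ∑ i, (zres e Φ z m i).1 p * fderiv ℝ g.1 (jet Φ z m p) ((0, Pi.single i 1, 0) : St)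
      = fderiv ℝ g.1 (jet Φ z m p) ((0, fun i => (zres e Φ z m i).1 p, 0) : St) := by
    have : ((0, fun i => (zres e Φ z m i).1 p, 0) : St)
        = ∑ i, (zres e Φ z m i).1 p • ((0, Pi.single i 1, 0) : St) := by
      simp only [Fin.sum_univ_three]
      refine Prod.ext (by simp) (Prod.ext ?_ (by simp))
      funext j
      fin_cases j <;> simp
    rw [this, map_sum]
    simp only [map_smul, smul_eq_mul]
  rw [hsum, ← map_add]
  refine hg.fderiv_eq ⟨fun _ _ _ => rfl, rfl⟩ ⟨fun i k hk => ?_, ?_⟩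
  · simp [vf, jet, hk]
  · refine Prod.ext (funext fun i => ?_) (by simp [vf])
    simp [vf, zres, pull_apply]

/-- The k-th derivative brings in at most k - 1 derivatives of the residuals, which accounts for the
order j + 1 - k. -/
theorem iterate_dy_pull {A : Set (ℝ × ℝ)} {Φ : Fl} {z : Fin 3 → S2} {m : Sm ℝ} {j : ℕ}
    (hres : ∀ i, zres e Φ z m i ∈ van A j) {s : ℕ} (hs : 1 ≤ s) {g : Sm St} (hg : Dep s g) (k : ℕ)
    (hk : s + k ≤ 9) : dy^[k] (pull Φ z m g) - pull Φ z m ((LL e)^[k] g) ∈ van A (j + 1 - k) := by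
  induction k with
  | zero => simp
  | succ k ih =>
    have h1 := ih (by omega)
    have h2 : dy (dy^[k] (pull Φ z m g) - pull Φ z m ((LL e)^[k] g)) ∈ van A (j + 1 - (k + 1)) := by
      rcases Nat.lt_or_ge j k with h | h
      · rw [show j + 1 - (k + 1) = 0 by omega]; exact van_zero _ _
      · refine dy_mem_van ?_
        rwa [show j + 1 - (k + 1) + 1 = j + 1 - k by omega]
    have h3 : dy (pull Φ z m ((LL e)^[k] g)) - pull Φ z m ((LL e)^[k + 1] g)
        ∈ van A (j + 1 - (k + 1)) := by
      rw [dy_pull (e := e) Φ z m ((hg.iterate hs k).mono (by omega)), Function.iterate_succ_apply',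
        add_sub_cancel_left]
      exact sum_mem fun i _ => Ideal.mul_mem_right _ _ (van_mono _ (by omega) (hres i))
    have := add_mem h2 h3
    rw [map_sub, sub_add_sub_cancel] at this
    rwa [Function.iterate_succ_apply']

theorem iterate_dy_pull_apply {A : Set (ℝ × ℝ)} {Φ : Fl} {z : Fin 3 → S2} {m : Sm ℝ}
    (hres : ∀ i, zres e Φ z m i ∈ van A 8) {s : ℕ} (hs : 1 ≤ s) {g : Sm St} (hg : Dep s g) (k : ℕ)
    (hk : s + k ≤ 9) {p : ℝ × ℝ} (hp : p ∈ A) :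
    (dy^[k] (pull Φ z m g)).1 p = ((LL e)^[k] g).1 (jet Φ z m p) := by
  have := iterate_dy_pull hres hs hg k hk 0 (by omega) p hp
  simpa [sub_eq_zero, pull_apply] using this

variable (e)

theorem dep_zdot (i : Fin 3) : Dep 2 (zdot e i) := by
  rw [← LL_zc]
  exact Dep.LL le_rfl fun p p' hp => by simp [hp.2]

theorem dep_qt : Dep 2 (qt e) := by
  intro p p' hp
  have h0 := fun i => hp.1 i 0 (by simp)
  have h1 := fun i => hp.1 i 1 (by simp)
  have hm : p.2.2 = p'.2.2 := by rw [hp.2]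
  have hz : ∀ j, p.2.1 j = p'.2.1 j := fun j => by rw [hp.2]
  simp [qt, h0, h1, hm, hz]

theorem dep_qψ : Dep 2 (qψ e) := by
  intro p p' hp
  have hq := dep_qt e p p' hp
  have h0 := fun i => hp.1 i 0 (by simp)
  have h1 := fun i => hp.1 i 1 (by simp)
  have hm : p.2.2 = p'.2.2 := by rw [hp.2]
  have hz : ∀ j, p.2.1 j = p'.2.1 j := fun j => by rw [hp.2]
  simp [qψ, hq, h0, h1, hm, hz]

/-! ### The evolution equations in terms of jets -/

/-- The change of gauge for the lapse and the fluid velocity. -/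
def hatF (Φ : Fl) (φ : Sm ℝ) : Fl := ![Φ 0, Φ 1, Φ 2 + X φ, Φ 3, Φ 4 - X φ]

/-- The residuals of the fluid equations solved for the `x`-derivatives. -/
def ft (Φ : Fl) (z : Fin 3 → S2) (θ m : Sm ℝ) : S2 := X θ * dx (Φ 3) - pull Φ z m (qt e)
def fψ (Φ : Fl) (z : Fin 3 → S2) (θ m : Sm ℝ) : S2 := X θ * dx (Φ 4) - pull Φ z m (qψ e)

theorem two_mul_half : (2 : S2) * Sm.const (1 / 2) = 1 := by ext p; simp

section Identities

variable (Φ : Fl) (z : Fin 3 → S2) (θ φ : Sm ℝ)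

theorem pull_zdot_zero (m : Sm ℝ) : pull Φ z m (zdot e 0) = -(2 * z 0 * dy (Φ 0))
    + Sm.const (1 / 2) * X m * exp (2 * Φ 2) * e.σ.of (Φ 3) := rfl

theorem pull_zdot_one (m : Sm ℝ) : pull Φ z m (zdot e 1) = -(dy (Φ 0) * z 1) - dy (Φ 1) * z 0 := rfl

theorem pull_zdot_two (m : Sm ℝ) : pull Φ z m (zdot e 2) = dy (Φ 0) * z 0 - dy (Φ 1) * z 1
    - Sm.const (1 / 2) * X m * e.h.of (Φ 3) * exp (2 * Φ 2) := rfl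

theorem pull_qt (m : Sm ℝ) : pull Φ z m (qt e) = -(e.si.of (Φ 3) * (X m * exp (-(2 * Φ 4)) *
    ((der e.h).of (Φ 3) * dy (Φ 3) + e.h.of (Φ 3) * (2 * dy (Φ 2) - 2 * dy (Φ 4) + 2 * dy (Φ 0)))
      + 2 * z 0 * e.h.of (Φ 3))) := rfl

theorem pull_qψ (m : Sm ℝ) : pull Φ z m (qψ e) = -z 2 - z 0 - Sm.const (1 / 2) * e.hi.of (Φ 3) *
    ((der e.h).of (Φ 3) * pull Φ z m (qt e) + X m * exp (-(2 * Φ 4)) *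
      ((der e.σ).of (Φ 3) * dy (Φ 3) + 2 * dy (Φ 0) * e.h.of (Φ 3))) := rfl

theorem exp_two_mul_add (f g : S2) : exp (2 * (f + g)) = exp (2 * f) * exp (2 * g) := by
  rw [mul_add, exp_add]

theorem exp_X (f : Sm ℝ) : exp (2 * X f) = X (exp (2 * f)) := rfl

/-- This and the following identities turn the evolution equations in the logarithmic gauge into
residuals of the weighted system z = θ∂_x. The weight m is θe^{2φ}, because the change of gauge
multiplies Ω² by e^{2φ}. -/
theorem mul_e1 (h0 : z 0 = X θ * dx (Φ 0)) :
    X θ * e1 e (hatF Φ φ) = 2 * zres e Φ z (θ * exp (2 * φ)) 0 := by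
  rw [zres, pull_zdot_zero, h0]
  simp only [e1, hatF, Matrix.cons_val, exp_two_mul_add, exp_X, X_mul, dy_mul, dy_X, dx_dy_comm]
  linear_combination (X θ * X (exp (2 * φ)) * exp (2 * Φ 2) * e.σ.of (Φ 3)) * two_mul_half

theorem mul_e2 (h0 : z 0 = X θ * dx (Φ 0)) (h1 : z 1 = X θ * dx (Φ 1)) :
    X θ * e2 (hatF Φ φ) = zres e Φ z (θ * exp (2 * φ)) 1 := by
  rw [zres, pull_zdot_one, h0, h1]
  simp only [e2, hatF, Matrix.cons_val, dy_mul, dy_X, dx_dy_comm]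
  ring

theorem mul_e3 (h0 : z 0 = X θ * dx (Φ 0)) (h2 : z 2 = X θ * dx (Φ 2)) :
    X θ * e3 e (hatF Φ φ) = 2 * zres e Φ z (θ * exp (2 * φ)) 2
      + 2 * dy (Φ 1) * (X θ * dx (Φ 1) - z 1) := by
  rw [zres, pull_zdot_two, h0, h2]
  simp only [e3, hatF, Matrix.cons_val, exp_two_mul_add, exp_X, X_mul, dy_mul, dy_X, dx_dy_comm,
    map_add, mul_zero, add_zero]
  linear_combination -(X θ * X (exp (2 * φ)) * exp (2 * Φ 2) * e.h.of (Φ 3)) * two_mul_half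

theorem si_mul_of (f : S2) : e.si.of f * (der e.σ).of f = 1 := by
  ext p
  exact congrFun (congrArg Subtype.val e.si_mul) _

theorem exp_neg_hat (f : S2) : exp (-(2 * (f - X φ))) = exp (-(2 * f)) * X (exp (2 * φ)) := by
  rw [← exp_X, ← exp_add]; congr 1; ring

theorem exp_hat_mul (f : S2) :
    exp (2 * (f - X φ)) * (exp (-(2 * f)) * X (exp (2 * φ))) = 1 := by
  rw [← exp_neg_hat, mul_comm, exp_neg_mul]

theorem mul_ea (h0 : z 0 = X θ * dx (Φ 0)) :
    X θ * ea e (hatF Φ φ) = (der e.σ).of (Φ 3) * ft e Φ z θ (θ * exp (2 * φ)) := by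
  rw [ft, pull_qt, h0]
  simp only [ea, hatF, Matrix.cons_val, exp_neg_hat, X_mul, map_add, map_sub, dy_X, sub_zero,
    add_zero]
  linear_combination -(X θ * (exp (-(2 * Φ 4)) * X (exp (2 * φ)) *
    ((der e.h).of (Φ 3) * dy (Φ 3) + e.h.of (Φ 3) * (2 * dy (Φ 2) - 2 * dy (Φ 4) + 2 * dy (Φ 0)))
      + 2 * dx (Φ 0) * e.h.of (Φ 3))) * si_mul_of e (Φ 3)

/-- The last term carries the factor 1 - `hi` · `h` and so disappears wherever t > `ℓ`. -/
theorem mul_eb (h0 : z 0 = X θ * dx (Φ 0)) (h2 : z 2 = X θ * dx (Φ 2)) :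
    X (θ * exp (2 * φ)) * exp (-(2 * Φ 4)) * eb e (hatF Φ φ)
      = (der e.h).of (Φ 3) * ft e Φ z θ (θ * exp (2 * φ))
        + 2 * e.h.of (Φ 3) * fψ e Φ z θ (θ * exp (2 * φ))
        + (1 - e.hi * e.h).of (Φ 3) * ((der e.h).of (Φ 3) * pull Φ z (θ * exp (2 * φ)) (qt e)
          + X (θ * exp (2 * φ)) * exp (-(2 * Φ 4)) *
            ((der e.σ).of (Φ 3) * dy (Φ 3) + 2 * dy (Φ 0) * e.h.of (Φ 3))) := by
  have hu : (1 - e.hi * e.h).of (Φ 3) = 1 - e.hi.of (Φ 3) * e.h.of (Φ 3) := rfl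
  rw [ft, fψ, pull_qψ, h0, h2, hu]
  simp only [eb, hatF, Matrix.cons_val, X_mul, map_add, map_sub, dx_X]
  linear_combination X θ * ((der e.h).of (Φ 3) * dx (Φ 3) + e.h.of (Φ 3) *
    (2 * dx (Φ 2) + 2 * dx (Φ 4) + 2 * dx (Φ 0))) * exp_hat_mul φ (Φ 4)
    - e.h.of (Φ 3) * e.hi.of (Φ 3) * ((der e.h).of (Φ 3) * pull Φ z (θ * exp (2 * φ)) (qt e)
      + X θ * X (exp (2 * φ)) * exp (-(2 * Φ 4)) *
        ((der e.σ).of (Φ 3) * dy (Φ 3) + 2 * dy (Φ 0) * e.h.of (Φ 3))) * two_mul_half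

end Identities

variable {e}

theorem mem_of_mul_mem {A : Set (ℝ × ℝ)} {n : ℕ} {f g gi : S2} (hg : gi * g = 1)
    (h : g * f ∈ van A n) : f ∈ van A n := by
  have := Ideal.mul_mem_left _ gi h
  rwa [← mul_assoc, hg, one_mul] at this

theorem one_sub_hi_mem {A : Set (ℝ × ℝ)} (n : ℕ) {f : S2} (h : ∀ p ∈ A, e.ℓ < f.1 p) :
    (1 - e.hi * e.h).of f ∈ van A n :=
  of_mem_van n isOpen_Ioi (fun t ht => by simp [e.hi_mul t ht]) h

theorem X_mul_eq_one {f g : Sm ℝ} (h : f * g = 1) : X f * X g = 1 := by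
  rw [← X_mul, h]; rfl

theorem exp_mul_neg {E : Type*} [NormedAddCommGroup E] [NormedSpace ℝ E] (f : Sm E) :
    exp f * exp (-f) = 1 := by rw [mul_comm, exp_neg_mul]

/-- The evolution equations hold to the order to which the residuals of the jets vanish. -/
theorem evol_mem_of_res {A : Set (ℝ × ℝ)} {n : ℕ} {Φ : Fl} {z : Fin 3 → S2} {θ θi φ : Sm ℝ}
    (hθ : θi * θ = 1) (h0 : z 0 = X θ * dx (Φ 0)) (h1 : z 1 = X θ * dx (Φ 1))
    (h2 : z 2 = X θ * dx (Φ 2)) (ht : ∀ p ∈ A, e.ℓ < (Φ 3).1 p)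
    (hres : ∀ i, zres e Φ z (θ * exp (2 * φ)) i ∈ van A n)
    (hft : ft e Φ z θ (θ * exp (2 * φ)) ∈ van A n) (hfψ : fψ e Φ z θ (θ * exp (2 * φ)) ∈ van A n)
    (k : Fin 5) : evol e (hatF Φ φ) k ∈ van A n := by
  have hθ' := X_mul_eq_one hθ
  have hE : X (exp (-(2 * φ))) * X (exp (2 * φ)) = 1 := X_mul_eq_one (exp_neg_mul _)
  fin_cases k
  · refine mem_of_mul_mem hθ' ?_
    change X θ * e1 e (hatF Φ φ) ∈ _
    rw [mul_e1 e Φ z θ φ h0]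
    exact Ideal.mul_mem_left _ _ (hres 0)
  · refine mem_of_mul_mem hθ' ?_
    change X θ * e2 (hatF Φ φ) ∈ _
    rw [mul_e2 e Φ z θ φ h0 h1]
    exact hres 1
  · refine mem_of_mul_mem hθ' ?_
    change X θ * e3 e (hatF Φ φ) ∈ _
    rw [mul_e3 e Φ z θ φ h0 h2, h1, sub_self, mul_zero, add_zero]
    exact Ideal.mul_mem_left _ _ (hres 2)
  · refine mem_of_mul_mem hθ' ?_
    change X θ * ea e (hatF Φ φ) ∈ _
    rw [mul_ea e Φ z θ φ h0]
    exact Ideal.mul_mem_left _ _ hft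
  · refine mem_of_mul_mem (g := X (θ * exp (2 * φ)) * exp (-(2 * Φ 4)))
      (gi := X θi * X (exp (-(2 * φ))) * exp (2 * Φ 4)) ?_ ?_
    · rw [X_mul]
      linear_combination X (exp (-(2 * φ))) * X (exp (2 * φ)) * (exp (2 * Φ 4) * exp (-(2 * Φ 4))) * hθ'
        + exp (2 * Φ 4) * exp (-(2 * Φ 4)) * hE + exp_mul_neg (2 * Φ 4)
    · change _ * eb e (hatF Φ φ) ∈ _
      rw [mul_eb e Φ z θ φ h0 h2]
      exact add_mem (add_mem (Ideal.mul_mem_left _ _ hft) (Ideal.mul_mem_left _ _ hfψ))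
        (Ideal.mul_mem_right _ _ (one_sub_hi_mem n ht))

/-- The residuals of the jets vanish to the order to which the evolution equations hold, at points
where `w` is independent of `y`. -/
theorem res_mem_of_evol {A : Set (ℝ × ℝ)} {n : ℕ} {Φ : Fl} {z : Fin 3 → S2} {θ φ : Sm ℝ}
    (h0 : z 0 = X θ * dx (Φ 0)) (h1 : z 1 = 0)
    (h2 : z 2 = X θ * dx (Φ 2)) (ht : ∀ p ∈ A, e.ℓ < (Φ 3).1 p) (hw : dy (Φ 1) ∈ van A n)
    (hev : ∀ k, evol e (hatF Φ φ) k ∈ van A n) :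
    (∀ i, zres e Φ z (θ * exp (2 * φ)) i ∈ van A n) ∧
    ft e Φ z θ (θ * exp (2 * φ)) ∈ van A n ∧ fψ e Φ z θ (θ * exp (2 * φ)) ∈ van A n := by
  have htwo : (Sm.const (1 / 2) : S2) * 2 = 1 := by rw [mul_comm, two_mul_half]
  have hft : ft e Φ z θ (θ * exp (2 * φ)) ∈ van A n := by
    refine mem_of_mul_mem (si_mul_of e (Φ 3)) ?_
    rw [← mul_ea e Φ z θ φ h0]
    exact Ideal.mul_mem_left _ _ (hev 3)
  refine ⟨fun i => ?_, hft, ?_⟩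
  · fin_cases i
    · refine mem_of_mul_mem htwo ?_
      change 2 * zres e Φ z (θ * exp (2 * φ)) 0 ∈ _
      rw [← mul_e1 e Φ z θ φ h0]
      exact Ideal.mul_mem_left _ _ (hev 0)
    -- Where ∂_y w vanishes, z₁ = 0 solves its own transport equation, so ∂_x w need not be
    -- controlled on the regular hypersurface.
    · change zres e Φ z (θ * exp (2 * φ)) 1 ∈ _
      rw [zres, pull_zdot_one, h1, map_zero, mul_zero]
      have := Ideal.mul_mem_right (z 0) _ hw
      convert this using 1
      ring
    · refine mem_of_mul_mem htwo ?_
      change 2 * zres e Φ z (θ * exp (2 * φ)) 2 ∈ _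
      rw [← add_sub_cancel_right (2 * zres e Φ z (θ * exp (2 * φ)) 2)
        (2 * dy (Φ 1) * (X θ * dx (Φ 1) - z 1)), ← mul_e3 e Φ z θ φ h0 h2]
      exact sub_mem (Ideal.mul_mem_left _ _ (hev 2))
        (Ideal.mul_mem_right _ _ (Ideal.mul_mem_left _ _ hw))
  · have h3 := mul_eb e Φ z θ φ h0 h2
    have h4 : 2 * e.h.of (Φ 3) * fψ e Φ z θ (θ * exp (2 * φ)) ∈ van A n := by
      have h5 := sub_mem (sub_mem (Ideal.mul_mem_left _ (X (θ * exp (2 * φ)) * exp (-(2 * Φ 4)))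
        (hev 4)) (Ideal.mul_mem_left _ ((der e.h).of (Φ 3)) hft))
        (Ideal.mul_mem_right ((der e.h).of (Φ 3) * pull Φ z (θ * exp (2 * φ)) (qt e)
          + X (θ * exp (2 * φ)) * exp (-(2 * Φ 4)) *
            ((der e.σ).of (Φ 3) * dy (Φ 3) + 2 * dy (Φ 0) * e.h.of (Φ 3))) _
          (one_sub_hi_mem (e := e) n ht))
      change X (θ * exp (2 * φ)) * exp (-(2 * Φ 4)) * eb e (hatF Φ φ) - _ - _ ∈ _ at h5
      rw [h3] at h5
      convert h5 using 1
      ring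
    have h6 := add_mem (Ideal.mul_mem_left _ (Sm.const (1 / 2) * e.hi.of (Φ 3)) h4)
      (Ideal.mul_mem_right (fψ e Φ z θ (θ * exp (2 * φ))) _ (one_sub_hi_mem (e := e) n ht))
    have hu : (1 - e.hi * e.h).of (Φ 3) = 1 - e.hi.of (Φ 3) * e.h.of (Φ 3) := rfl
    rw [hu] at h6
    convert h6 using 1
    linear_combination -(e.hi.of (Φ 3) * e.h.of (Φ 3) * fψ e Φ z θ (θ * exp (2 * φ))) * htwo

/-- Fields whose jets satisfy the system of ordinary differential equations along `y = 0` have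
residuals vanishing to order eight. -/
theorem res_mem_of_ode {I : Set ℝ} {Φ : Fl} {z : Fin 3 → S2} {θ m : Sm ℝ}
    (hz : ∀ i : Fin 3, z i = X θ * dx (Φ (Fin.castLE (by omega) i)))
    (h : ∀ i : Fin 3, ∀ k ≤ 8, ∀ x ∈ I, θ.1 x * (dx (dy^[k] (Φ (Fin.castLE (by omega) i)))).1 (x, 0)
      = ((LL e)^[k] (zc i)).1 (jet Φ z m (x, 0)))
    (ht : ∀ k < 8, ∀ x ∈ I, θ.1 x * (dx (dy^[k] (Φ 3))).1 (x, 0)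
      = ((LL e)^[k] (qt e)).1 (jet Φ z m (x, 0)))
    (hψ : ∀ k < 8, ∀ x ∈ I, θ.1 x * (dx (dy^[k] (Φ 4))).1 (x, 0)
      = ((LL e)^[k] (qψ e)).1 (jet Φ z m (x, 0))) :
    (∀ i, zres e Φ z m i ∈ van (line I) 8) ∧ ft e Φ z θ m ∈ van (line I) 8 ∧
      fψ e Φ z θ m ∈ van (line I) 8 := by
  have hdz : ∀ k i, dy^[k] (X θ * dx (Φ i)) = X θ * dx (dy^[k] (Φ i)) := fun k i => by
    rw [iterate_dy_X_mul, dx_iterate_dy]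
  -- Once the residuals vanish to order j, the j-th y-derivative of the right-hand side is computed
  -- by `LL`; the equation for the slot of order j + 1 then says that the j-th y-derivative of the
  -- residual vanishes too.
  have hres : ∀ j ≤ 8, ∀ i, zres e Φ z m i ∈ van (line I) j := by
    intro j
    induction j with
    | zero => simp
    | succ j ih =>
      intro hj i
      have ih := ih (by omega)
      rw [mem_van_succ']
      refine ⟨ih i, ?_⟩
      rintro ⟨x, y⟩ ⟨hx, rfl⟩
      have h1 := iterate_dy_pull ih (by omega) (dep_zdot e i) j (by omega) 0 (by omega) (x, 0)
        ⟨hx, rfl⟩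
      have h2 := h i (j + 1) hj x hx
      rw [Function.iterate_succ_apply (EinsteinEuler.LL e), LL_zc] at h2
      have h3 : dy^[j] (dy (z i)) = X θ * dx (dy^[j + 1] (Φ (Fin.castLE (by omega) i))) := by
        rw [← Function.iterate_succ_apply dy, hz, hdz]
      simp only [Function.iterate_zero, id_eq, Sm.sub_apply, pull_apply, sub_eq_zero] at h1
      rw [zres, iterate_sub, h3, Sm.sub_apply, h1, Sm.mul_apply, X_apply, h2, sub_self]
  have hf : ∀ {i : Fin 5} {g : Sm St}, Dep 2 g → (∀ k < 8, ∀ x ∈ I,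
      θ.1 x * (dx (dy^[k] (Φ i))).1 (x, 0) = ((LL e)^[k] g).1 (jet Φ z m (x, 0))) →
      X θ * dx (Φ i) - pull Φ z m g ∈ van (line I) 8 := by
    intro i g hg hi
    rw [mem_van_line]
    intro j hj x hx
    rw [iterate_sub, hdz, Sm.sub_apply, Sm.mul_apply, X_apply, hi j hj x hx,
      iterate_dy_pull_apply (hres 8 le_rfl) (by omega) hg j (by omega) ⟨hx, rfl⟩, sub_self]
  exact ⟨hres 8 le_rfl, hf (dep_qt e) ht, hf (dep_qψ e) hψ⟩

end EinsteinEuler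
end

/-! ### Einstein and Euler tensors in a ring with two commuting derivations -/

noncomputable section

namespace EinsteinEuler

open Sm

/-! ### Curvature of plane symmetric metrics, algebraically -/

section Tensors

variable {R : Type*} [CommRing R] [Algebra ℝ R] {n : ℕ}
  (κ : R) (d : Fin n → Derivation ℝ R R) (gi g : Matrix (Fin n) (Fin n) R)

/-- Christoffel symbols; `κ` is one half, `gi` the inverse of `g`. -/
def chrR (i j k : Fin n) : R :=
  κ * ∑ l, gi i l * (d j (g l k) + d k (g l j) - d l (g j k))

/-- The curvature tensor of the connection with coefficients `Γ`. -/
def riemR (Γ : Fin n → Fin n → Fin n → R) (i j k l : Fin n) : R :=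
  d k (Γ i l j) - d l (Γ i k j) + ∑ m, (Γ i k m * Γ m l j - Γ i l m * Γ m k j)

def ricR (Γ : Fin n → Fin n → Fin n → R) (j l : Fin n) : R := ∑ i, riemR d Γ i j i l

end Tensors

/-- The functions determining a plane symmetric metric: `O = Ω²`, the components `A`, `B` of `γ`,
their inverses, and half their logarithms. -/
structure Plane (R : Type*) [CommRing R] [Algebra ℝ R] where
  κ : R
  d0 : Derivation ℝ R R
  d1 : Derivation ℝ R R
  l : R
  a : R
  b : R
  O : R
  Oi : R
  A : R
  Ai : R
  B : R
  Bi : R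
  hκ : 2 * κ = 1
  comm : ∀ f, d0 (d1 f) = d1 (d0 f)
  hO : Oi * O = 1
  hA : Ai * A = 1
  hB : Bi * B = 1
  d0O : d0 O = 2 * O * d0 l
  d1O : d1 O = 2 * O * d1 l
  d0A : d0 A = 2 * A * d0 a
  d1A : d1 A = 2 * A * d1 a
  d0B : d0 B = 2 * B * d0 b
  d1B : d1 B = 2 * B * d1 b

namespace Plane

variable {R : Type*} [CommRing R] [Algebra ℝ R] (S : Plane R)

def d : Fin 4 → Derivation ℝ R R := ![S.d0, S.d1, 0, 0]

def g : Matrix (Fin 4) (Fin 4) R :=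
  !![0, -2 * S.O, 0, 0; -2 * S.O, 0, 0, 0; 0, 0, S.A, 0; 0, 0, 0, S.B]

def gi : Matrix (Fin 4) (Fin 4) R :=
  !![0, -S.κ * S.Oi, 0, 0; -S.κ * S.Oi, 0, 0, 0; 0, 0, S.Ai, 0; 0, 0, 0, S.Bi]

theorem g_mul_gi : S.g * S.gi = 1 := by
  have h := S.hκ
  have hO := S.hO
  have hA := S.hA
  have hB := S.hB
  ext i j
  fin_cases i <;> fin_cases j <;> simp [g, gi, Matrix.mul_apply, Fin.sum_univ_four]
  · linear_combination S.O * S.Oi * h + hO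
  · linear_combination S.O * S.Oi * h + hO
  · linear_combination hA
  · linear_combination hB

/-- The nonvanishing Christoffel symbols. -/
def Γ : Fin 4 → Matrix (Fin 4) (Fin 4) R := ![
  !![2 * S.d0 S.l, 0, 0, 0; 0, 0, 0, 0; 0, 0, S.κ * S.Oi * S.A * S.d1 S.a, 0;
    0, 0, 0, S.κ * S.Oi * S.B * S.d1 S.b],
  !![0, 0, 0, 0; 0, 2 * S.d1 S.l, 0, 0; 0, 0, S.κ * S.Oi * S.A * S.d0 S.a, 0;
    0, 0, 0, S.κ * S.Oi * S.B * S.d0 S.b],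
  !![0, 0, S.d0 S.a, 0; 0, 0, S.d1 S.a, 0; S.d0 S.a, S.d1 S.a, 0, 0; 0, 0, 0, 0],
  !![0, 0, 0, S.d0 S.b; 0, 0, 0, S.d1 S.b; 0, 0, 0, 0; S.d0 S.b, S.d1 S.b, 0, 0]]

theorem d_two (D : Derivation ℝ R R) : D 2 = 0 := D.map_natCast 2

theorem d_κ (D : Derivation ℝ R R) : D S.κ = 0 := by
  have h := congrArg D S.hκ
  rw [D.leibniz, d_two, D.map_one_eq_zero, smul_zero, add_zero, smul_eq_mul] at h
  linear_combination S.κ * h - D S.κ * S.hκ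

theorem d_inv (D : Derivation ℝ R R) {x xi f : R} (h : xi * x = 1) (hx : D x = 2 * x * f) :
    D xi = -(2 * xi * f) := by
  have h1 := congrArg D h
  rw [D.leibniz, hx, D.map_one_eq_zero, smul_eq_mul, smul_eq_mul] at h1
  linear_combination xi * h1 - (2 * xi * f + D xi) * h

theorem chr_eq (i j k : Fin 4) : chrR S.κ S.d S.gi S.g i j k = S.Γ i j k := by
  have h := S.hκ
  have hO := S.hO
  have hA := S.hA
  have hB := S.hB
  have h0 := S.d0O
  have h1 := S.d1O
  have h2 := S.d0A
  have h3 := S.d1A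
  have h4 := S.d0B
  have h5 := S.d1B
  have t0 := d_two S.d0
  have t1 := d_two S.d1
  fin_cases i <;> fin_cases j <;> fin_cases k <;>
    simp [chrR, Γ, g, gi, d, Fin.sum_univ_four, h0, h1, h2, h3, h4, h5, t0, t1] <;>
    -- Apart from the components settled by `ring1`, the alternatives are, in order, Γ⁰₀₀, Γ¹₁₁,
    -- Γ⁰₂₂, Γ¹₂₂, Γ⁰₃₃, Γ¹₃₃, Γ²₀₂, Γ²₁₂, Γ³₀₃, Γ³₁₃.
    first
    | ring1
    | linear_combination S.d0 S.l * 2 * (S.O * S.Oi) * (2 * S.κ + 1) * h + 2 * S.d0 S.l * hO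
    | linear_combination S.d1 S.l * 2 * (S.O * S.Oi) * (2 * S.κ + 1) * h + 2 * S.d1 S.l * hO
    | linear_combination S.κ * S.Oi * S.A * S.d1 S.a * h
    | linear_combination S.κ * S.Oi * S.A * S.d0 S.a * h
    | linear_combination S.κ * S.Oi * S.B * S.d1 S.b * h
    | linear_combination S.κ * S.Oi * S.B * S.d0 S.b * h
    | linear_combination S.d0 S.a * S.Ai * S.A * h + S.d0 S.a * hA
    | linear_combination S.d1 S.a * S.Ai * S.A * h + S.d1 S.a * hA
    | linear_combination S.d0 S.b * S.Bi * S.B * h + S.d0 S.b * hB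
    | linear_combination S.d1 S.b * S.Bi * S.B * h + S.d1 S.b * hB

def ric00 : R := -(S.d0 (S.d0 S.a) + S.d0 (S.d0 S.b) + S.d0 S.a ^ 2 + S.d0 S.b ^ 2
  - 2 * S.d0 S.l * (S.d0 S.a + S.d0 S.b))

def ric11 : R := -(S.d1 (S.d1 S.a) + S.d1 (S.d1 S.b) + S.d1 S.a ^ 2 + S.d1 S.b ^ 2
  - 2 * S.d1 S.l * (S.d1 S.a + S.d1 S.b))

def ric01 : R := -(2 * S.d1 (S.d0 S.l) + S.d1 (S.d0 S.a) + S.d1 (S.d0 S.b) + S.d0 S.a * S.d1 S.a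
  + S.d0 S.b * S.d1 S.b)

def ric22 : R := S.Oi * S.A * (S.d1 (S.d0 S.a) + S.κ * (S.d0 S.a + S.d0 S.b) * S.d1 S.a
  + S.κ * (S.d1 S.a + S.d1 S.b) * S.d0 S.a)

def ric33 : R := S.Oi * S.B * (S.d1 (S.d0 S.b) + S.κ * (S.d0 S.a + S.d0 S.b) * S.d1 S.b
  + S.κ * (S.d1 S.a + S.d1 S.b) * S.d0 S.b)

def ricT : Matrix (Fin 4) (Fin 4) R :=
  !![S.ric00, S.ric01, 0, 0; S.ric01, S.ric11, 0, 0; 0, 0, S.ric22, 0; 0, 0, 0, S.ric33]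

theorem ric_eq (j l : Fin 4) : ricR S.d (fun i j k => S.Γ i j k) j l = S.ricT j l := by
  have h := S.hκ
  have h2 := S.d0A
  have h3 := S.d1A
  have h4 := S.d0B
  have h5 := S.d1B
  have k0 := S.d_κ S.d0
  have k1 := S.d_κ S.d1
  have t0 := d_two S.d0
  have t1 := d_two S.d1
  have o0 := d_inv S.d0 S.hO S.d0O
  have o1 := d_inv S.d1 S.hO S.d1O
  have hc := S.comm
  fin_cases j <;> fin_cases l <;>
    simp [ricR, riemR, Γ, d, Fin.sum_univ_four, h2, h3, h4, h5, t0, t1, k0, k1, o0, o1, hc, ricT,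
      ric00, ric11, ric01, ric22, ric33, -mul_eq_mul_left_iff] <;>
    first
    | ring1
    | linear_combination S.Oi * S.A * S.d1 (S.d0 S.a) * h
    | linear_combination S.Oi * S.B * S.d1 (S.d0 S.b) * h

/-- Only these curvature components enter αbar. -/
theorem riem_eq : ∑ m, S.g 2 m * riemR S.d (fun i j k => S.Γ i j k) m 0 2 0
      = -(S.A * (S.d0 (S.d0 S.a) + S.d0 S.a ^ 2 - 2 * S.d0 S.l * S.d0 S.a)) ∧
    ∑ m, S.g 3 m * riemR S.d (fun i j k => S.Γ i j k) m 0 3 0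
      = -(S.B * (S.d0 (S.d0 S.b) + S.d0 S.b ^ 2 - 2 * S.d0 S.l * S.d0 S.b)) ∧
    ∑ m, S.g 2 m * riemR S.d (fun i j k => S.Γ i j k) m 0 3 0 = 0 := by
  refine ⟨?_, ?_, ?_⟩ <;> simp [riemR, Γ, d, g, Fin.sum_univ_four] <;> ring

end Plane

/-- A plane symmetric metric together with a fluid: `V0`, `V1` are twice the components of the
velocity, `G = exp (2ψ)`, and `h = τ + p`, `σ = τ - p`. -/
structure Matter (R : Type*) [CommRing R] [Algebra ℝ R] extends Plane R where
  ρ : R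
  w : R
  ψ : R
  V0 : R
  V1 : R
  G : R
  Gi : R
  h : R
  σ : R
  ha : a = ρ + w
  hb : b = ρ - w
  d0G : d0 G = 2 * G * d0 ψ
  d1G : d1 G = 2 * G * d1 ψ
  hG : Gi * G = 1
  h01 : V0 * V1 = Oi
  h00 : V0 ^ 2 = Oi * G
  h11 : V1 ^ 2 = Oi * Gi

namespace Matter

open Plane

variable {R : Type*} [CommRing R] [Algebra ℝ R] (S : Matter R)

def vel : Fin 4 → R := ![S.κ * S.V0, S.κ * S.V1, 0, 0]

def velLow (μ : Fin 4) : R := ∑ ν, S.g μ ν * S.vel ν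

def p : R := S.κ * (S.h - S.σ)

def T (μ ν : Fin 4) : R := S.h * S.velLow μ * S.velLow ν + S.p * S.g μ ν

def Tup (μ ν : Fin 4) : R := S.h * S.vel μ * S.vel ν + S.p * S.gi μ ν

theorem velLow_eq (μ : Fin 4) : S.velLow μ = (![-(S.O * S.V1), -(S.O * S.V0), 0, 0] : Fin 4 → R) μ := by
  have h := S.hκ
  fin_cases μ <;> simp [velLow, vel, g, Fin.sum_univ_four]
  · linear_combination (S.O * S.V1) * h
  · linear_combination (S.O * S.V0) * h

def TT : Matrix (Fin 4) (Fin 4) R := !![S.O * S.Gi * S.h, S.O * S.σ, 0, 0;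
  S.O * S.σ, S.O * S.G * S.h, 0, 0; 0, 0, S.p * S.A, 0; 0, 0, 0, S.p * S.B]

theorem T_eq (μ ν : Fin 4) : S.T μ ν = S.TT μ ν := by
  have h := S.hκ
  have hO := S.hO
  have h01 := S.h01
  have h00 := S.h00
  have h11 := S.h11
  fin_cases μ <;> fin_cases ν <;> simp [T, velLow_eq, TT, g, p, -mul_eq_mul_right_iff]
  · linear_combination S.h * S.O ^ 2 * h11 + S.h * S.O * S.Gi * hO
  · linear_combination S.h * S.O ^ 2 * h01 + S.h * S.O * hO - S.O * (S.h - S.σ) * h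
  · linear_combination S.h * S.O ^ 2 * h01 + S.h * S.O * hO - S.O * (S.h - S.σ) * h
  · linear_combination S.h * S.O ^ 2 * h00 + S.h * S.O * S.G * hO

def TTup : Matrix (Fin 4) (Fin 4) R := !![S.κ ^ 2 * S.Oi * S.G * S.h, S.κ ^ 2 * S.Oi * S.σ, 0, 0;
  S.κ ^ 2 * S.Oi * S.σ, S.κ ^ 2 * S.Oi * S.Gi * S.h, 0, 0; 0, 0, S.p * S.Ai, 0; 0, 0, 0, S.p * S.Bi]

theorem Tup_eq (μ ν : Fin 4) : S.Tup μ ν = S.TTup μ ν := by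
  have h01 := S.h01
  have h00 := S.h00
  have h11 := S.h11
  fin_cases μ <;> fin_cases ν <;> simp [Tup, vel, TTup, gi, p, -mul_eq_mul_right_iff]
  · linear_combination S.h * S.κ ^ 2 * h00
  · linear_combination S.h * S.κ ^ 2 * h01
  · linear_combination S.h * S.κ ^ 2 * h01
  · linear_combination S.h * S.κ ^ 2 * h11

theorem norm_eq : ∑ μ, ∑ ν, S.vel μ * S.g μ ν * S.vel ν + 1 = 0 := by
  have h := S.hκ
  have hO := S.hO
  have h01 := S.h01
  simp only [vel, g, Fin.sum_univ_four, Matrix.of_apply, Matrix.cons_val]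
  linear_combination -4 * S.κ ^ 2 * S.O * h01 - 4 * S.κ ^ 2 * hO - (2 * S.κ + 1) * h

def scal : R := ∑ j, ∑ l, S.gi j l * S.ricT j l

def ein (μ ν : Fin 4) : R := S.ricT μ ν - S.κ * S.scal * S.g μ ν - S.T μ ν

def eul (μ : Fin 4) : R := ∑ α, (S.d α (S.Tup α μ)
  + ∑ β, (S.Γ α α β * S.Tup β μ + S.Γ μ α β * S.Tup α β))

def r1 : R := 2 * S.d1 (S.d0 S.ρ) + 4 * S.d0 S.ρ * S.d1 S.ρ - S.O * S.σ

def r2 : R := S.d1 (S.d0 S.w) + S.d0 S.ρ * S.d1 S.w + S.d1 S.ρ * S.d0 S.w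

def r3 : R := 2 * S.d1 (S.d0 S.l) - 2 * S.d0 S.ρ * S.d1 S.ρ + 2 * S.d0 S.w * S.d1 S.w + S.O * S.h

def ra : R := S.d0 S.σ + S.Gi * (S.d1 S.h + S.h * (2 * S.d1 S.l - 2 * S.d1 S.ψ + 2 * S.d1 S.ρ))
  + 2 * S.d0 S.ρ * S.h

def rb : R := S.d1 S.σ + S.G * (S.d0 S.h + S.h * (2 * S.d0 S.l + 2 * S.d0 S.ψ + 2 * S.d0 S.ρ))
  + 2 * S.d1 S.ρ * S.h

def r00 : R := 2 * S.d0 (S.d0 S.ρ) + 2 * S.d0 S.ρ ^ 2 - 4 * S.d0 S.l * S.d0 S.ρ + 2 * S.d0 S.w ^ 2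
  + S.O * S.Gi * S.h

def r11 : R := 2 * S.d1 (S.d1 S.ρ) + 2 * S.d1 S.ρ ^ 2 - 4 * S.d1 S.l * S.d1 S.ρ + 2 * S.d1 S.w ^ 2
  + S.O * S.G * S.h

theorem scal_eq : S.scal = S.Oi * (2 * S.d1 (S.d0 S.l) + 4 * S.d1 (S.d0 S.ρ)
    + 6 * S.d0 S.ρ * S.d1 S.ρ + 2 * S.d0 S.w * S.d1 S.w) := by
  have h := S.hκ
  have hA := S.hA
  have hB := S.hB
  simp only [scal, gi, ricT, ric00, ric01, ric11, ric22, ric33, Fin.sum_univ_four, S.ha, S.hb,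
    map_add, map_sub, Matrix.of_apply, Matrix.cons_val]
  linear_combination S.Oi * (2 * S.d1 (S.d0 S.l) + 2 * S.d1 (S.d0 S.ρ)
    + 6 * S.d0 S.ρ * S.d1 S.ρ + 2 * S.d0 S.w * S.d1 S.w) * h
    + S.Oi * (S.d1 (S.d0 S.ρ) + S.d1 (S.d0 S.w) + 2 * S.κ * (S.d0 S.ρ * (S.d1 S.ρ + S.d1 S.w)
      + S.d1 S.ρ * (S.d0 S.ρ + S.d0 S.w))) * hA
    + S.Oi * (S.d1 (S.d0 S.ρ) - S.d1 (S.d0 S.w) + 2 * S.κ * (S.d0 S.ρ * (S.d1 S.ρ - S.d1 S.w)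
      + S.d1 S.ρ * (S.d0 S.ρ - S.d0 S.w))) * hB

/-- The residuals r₁, …, r₁₁ enter linearly and undifferentiated. Any ideal containing them
therefore contains the Einstein residuals; `eul_eq` serves the Euler residuals in the same way. -/
theorem ein_eq (μ ν : Fin 4) : S.ein μ ν = (!![-S.r00, S.r1, 0, 0; S.r1, -S.r11, 0, 0;
    0, 0, S.Oi * S.A * (S.r2 - S.κ * S.r1 - S.κ * S.r3), 0;
    0, 0, 0, S.Oi * S.B * (-S.r2 - S.κ * S.r1 - S.κ * S.r3)] : Matrix (Fin 4) (Fin 4) R) μ ν := by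
  have h := S.hκ
  have hO := S.hO
  fin_cases μ <;> fin_cases ν <;> simp [ein, T_eq, scal_eq, ricT, TT, g, r00, r11, r1, r2, r3, p,
    ric00, ric01, ric11, ric22, ric33, S.ha, S.hb]
  · ring
  · linear_combination (2 * S.d1 (S.d0 S.l) + 4 * S.d1 (S.d0 S.ρ)
      + 6 * S.d0 S.ρ * S.d1 S.ρ + 2 * S.d0 S.w * S.d1 S.w) * (hO + S.O * S.Oi * h)
  · linear_combination (2 * S.d1 (S.d0 S.l) + 4 * S.d1 (S.d0 S.ρ)
      + 6 * S.d0 S.ρ * S.d1 S.ρ + 2 * S.d0 S.w * S.d1 S.w) * (hO + S.O * S.Oi * h)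
  · ring
  · linear_combination S.A * S.κ * (S.h - S.σ) * hO + S.Oi * S.A * (-S.d1 (S.d0 S.ρ)
      + S.d0 S.ρ * S.d1 S.w + S.d1 S.ρ * S.d0 S.w) * h
  · linear_combination S.B * S.κ * (S.h - S.σ) * hO + S.Oi * S.B * (-S.d1 (S.d0 S.ρ)
      - S.d0 S.ρ * S.d1 S.w - S.d1 S.ρ * S.d0 S.w) * h

theorem eul_eq (μ : Fin 4) : S.eul μ
    = (![S.κ ^ 2 * S.Oi * S.rb, S.κ ^ 2 * S.Oi * S.ra, 0, 0] : Fin 4 → R) μ := by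
  have h := S.hκ
  have hA := S.hA
  have hB := S.hB
  have k0 := S.d_κ S.d0
  have k1 := S.d_κ S.d1
  have o0 := d_inv S.d0 S.hO S.d0O
  have o1 := d_inv S.d1 S.hO S.d1O
  have g1 := d_inv S.d1 S.hG S.d1G
  have g2 := S.d0G
  fin_cases μ <;> simp [eul, Tup_eq, TTup, Plane.d, Γ, Fin.sum_univ_four, ra, rb, p, k0, k1, o0, o1,
    g1, g2, S.ha, S.hb, pow_two]
  · linear_combination S.κ ^ 2 * S.Oi * (S.h - S.σ) * ((S.d1 S.ρ + S.d1 S.w) * hA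
      + (S.d1 S.ρ - S.d1 S.w) * hB)
  · linear_combination S.κ ^ 2 * S.Oi * (S.h - S.σ) * ((S.d0 S.ρ + S.d0 S.w) * hA
      + (S.d0 S.ρ - S.d0 S.w) * hB)

end Matter

end EinsteinEuler
end

/-! ### Spacetime fields expressed in logarithmic coordinates -/

noncomputable section

namespace EinsteinEuler

open Sm

/-! ### From the plane to spacetime -/

/-- The logarithmic coordinate `x = -log (1 - u / us)`, together with `ubar`. -/
def Xi (us : ℝ) (x : Pt) : ℝ × ℝ := (-Real.log (1 - x 0 / us), x 1)

/-- `F` is given by the function `G` of the logarithmic coordinates. -/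
def Rep (us : ℝ) (F : Pt → ℝ) (G : S2) : Prop := ∀ x : Pt, x 0 < us → F x = G.1 (Xi us x)

/-- Half the logarithm of `us - u` as a function of the logarithmic coordinate. -/
def phiS (us : ℝ) : Sm ℝ := Sm.mk (fun x => (1 / 2) * (Real.log us - x)) (by fun_prop)

theorem der_phiS (us : ℝ) : der (phiS us) = Sm.const (-(1 / 2)) := by
  ext x
  have h : HasDerivAt (phiS us).1 ((1 / 2) * (0 - 1)) x :=
    ((hasDerivAt_const x (Real.log us)).sub (hasDerivAt_id x)).const_mul (1 / 2 : ℝ)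
  rw [der_apply, h.deriv]
  norm_num

theorem exp_phiS {us : ℝ} (hus : 0 < us) (x : ℝ) : (exp (2 * phiS us)).1 x = us * Real.exp (-x) := by
  have : (exp (2 * phiS us)).1 x = Real.exp (2 * ((1 / 2) * (Real.log us - x))) := rfl
  rw [this, show 2 * ((1 / 2) * (Real.log us - x)) = Real.log us + -x by ring, Real.exp_add,
    Real.exp_log hus]

/-- `∂_u` in the logarithmic coordinates. -/
def Du (us : ℝ) : Derivation ℝ S2 S2 := X (exp (-(2 * phiS us))) • dx

theorem Du_apply (us : ℝ) (f : S2) : Du us f = X (exp (-(2 * phiS us))) * dx f := rfl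

theorem X_exp_mul (us : ℝ) : X (exp (2 * phiS us)) * X (exp (-(2 * phiS us))) = 1 :=
  X_mul_eq_one (exp_mul_neg _)

theorem Du_dy (us : ℝ) (f : S2) : Du us (dy f) = dy (Du us f) := by
  rw [Du_apply, Du_apply, dy_mul, dy_X, mul_zero, add_zero, dx_dy_comm]

/-- Coordinate derivatives in the logarithmic coordinates. -/
def dS (us : ℝ) : Fin 4 → Derivation ℝ S2 S2 := ![Du us, dy, 0, 0]

theorem isOpen_u_lt (us : ℝ) : IsOpen {x : Pt | x 0 < us} :=
  _root_.isOpen_lt (continuous_apply 0) continuous_const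

section

variable {us : ℝ}

theorem one_sub_pos (hus : 0 < us) {x : Pt} (hx : x 0 < us) : 0 < 1 - x 0 / us :=
  sub_pos.2 ((div_lt_one hus).2 hx)

theorem hasFDerivAt_Xi (hus : 0 < us) {x : Pt} (hx : x 0 < us) :
    HasFDerivAt (Xi us) (((us - x 0)⁻¹ • ContinuousLinearMap.proj (R := ℝ) (φ := fun _ => ℝ) 0).prod
      (ContinuousLinearMap.proj (R := ℝ) (φ := fun _ => ℝ) (1 : Fin 4))) x := by
  have h0 : HasFDerivAt (fun y : Pt => y 0)
      (ContinuousLinearMap.proj (R := ℝ) (φ := fun _ : Fin 4 => ℝ) 0) x :=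
    (ContinuousLinearMap.proj (R := ℝ) (φ := fun _ : Fin 4 => ℝ) 0).hasFDerivAt
  have h1 : HasFDerivAt (fun y : Pt => y 1)
      (ContinuousLinearMap.proj (R := ℝ) (φ := fun _ : Fin 4 => ℝ) 1) x :=
    (ContinuousLinearMap.proj (R := ℝ) (φ := fun _ : Fin 4 => ℝ) 1).hasFDerivAt
  have hp := one_sub_pos hus hx
  have hl : HasDerivAt (fun s : ℝ => -Real.log (1 - s / us)) (us - x 0)⁻¹ (x 0) := by
    have h2 := ((((hasDerivAt_id (x 0)).div_const us).const_sub 1).log hp.ne').neg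
    have : us - x 0 ≠ 0 := by linarith
    have h3 : (1 : ℝ) - id (x 0) / us = (us - x 0) / us := by simp only [id]; field_simp
    have h4 : -(-(1 / us) / (1 - id (x 0) / us)) = (us - x 0)⁻¹ := by rw [h3]; field_simp
    rw [h4] at h2
    exact h2
  exact (hl.comp_hasFDerivAt x h0).prodMk h1

theorem Rep.hasFDerivAt (hus : 0 < us) {F : Pt → ℝ} {G : S2} (h : Rep us F G) {x : Pt}
    (hx : x 0 < us) : HasFDerivAt F ((fderiv ℝ G.1 (Xi us x)).comp
      (((us - x 0)⁻¹ • ContinuousLinearMap.proj (R := ℝ) (φ := fun _ => ℝ) 0).prod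
      (ContinuousLinearMap.proj (R := ℝ) (φ := fun _ => ℝ) (1 : Fin 4)))) x := by
  refine ((G.differentiable _).hasFDerivAt.comp x (hasFDerivAt_Xi hus hx)).congr_of_eventuallyEq ?_
  filter_upwards [(isOpen_u_lt us).mem_nhds hx] with y hy using h y hy

theorem exp_neg_phiS_Xi (hus : 0 < us) {x : Pt} (hx : x 0 < us) :
    (exp (-(2 * phiS us))).1 (Xi us x).1 = (us - x 0)⁻¹ := by
  have h1 : (exp (-(2 * phiS us))).1 (Xi us x).1 * (exp (2 * phiS us)).1 (Xi us x).1 = 1 :=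
    congrFun (congrArg Subtype.val (exp_neg_mul (2 * phiS us))) _
  rw [exp_phiS hus] at h1
  have hp := one_sub_pos hus hx
  have h2 : us * Real.exp (-(Xi us x).1) = us - x 0 := by
    rw [Xi, neg_neg, Real.exp_log hp]; field_simp
  rw [h2] at h1
  exact eq_inv_of_mul_eq_one_left h1

/-- With this, `Rep` is compatible with ring operations and with all coordinate derivatives, the
angular ones being zero. Every geometric quantity is built from the metric by these operations and
matrix inversion, so it can be evaluated in `S2`. -/
theorem Rep.pd (hus : 0 < us) {F : Pt → ℝ} {G : S2} (h : Rep us F G) (μ : Fin 4) :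
    Rep us (pd μ F) (dS us μ G) := by
  intro x hx
  rw [EinsteinEuler.pd, (h.hasFDerivAt hus hx).fderiv, ContinuousLinearMap.comp_apply,
    ContinuousLinearMap.prod_apply]
  simp only [_root_.smul_apply, ContinuousLinearMap.proj_apply]
  fin_cases μ
  · change fderiv ℝ G.1 (Xi us x) ((us - x 0)⁻¹ • (1 : ℝ), 0)
      = (exp (-(2 * phiS us))).1 (Xi us x).1 * fderiv ℝ G.1 (Xi us x) (1, 0)
    rw [exp_neg_phiS_Xi hus hx, ← smul_eq_mul (a := (us - x 0)⁻¹) (b := fderiv ℝ G.1 (Xi us x) (1, 0)),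
      ← map_smul]
    simp
  · change fderiv ℝ G.1 (Xi us x) ((us - x 0)⁻¹ • (0 : ℝ), 1) = fderiv ℝ G.1 (Xi us x) (0, 1)
    simp
  · change fderiv ℝ G.1 (Xi us x) ((us - x 0)⁻¹ • (0 : ℝ), 0) = 0
    rw [smul_zero]; exact map_zero _
  · change fderiv ℝ G.1 (Xi us x) ((us - x 0)⁻¹ • (0 : ℝ), 0) = 0
    rw [smul_zero]; exact map_zero _

theorem Rep.add {F F' : Pt → ℝ} {G G' : S2} (h : Rep us F G) (h' : Rep us F' G') :
    Rep us (fun x => F x + F' x) (G + G') := fun x hx => by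
  simp [h x hx, h' x hx]

theorem Rep.sub {F F' : Pt → ℝ} {G G' : S2} (h : Rep us F G) (h' : Rep us F' G') :
    Rep us (fun x => F x - F' x) (G - G') := fun x hx => by
  simp [h x hx, h' x hx]

theorem Rep.mul {F F' : Pt → ℝ} {G G' : S2} (h : Rep us F G) (h' : Rep us F' G') :
    Rep us (fun x => F x * F' x) (G * G') := fun x hx => by
  simp [h x hx, h' x hx]

theorem Rep.const (c : ℝ) : Rep us (fun _ => c) (Sm.const c) := fun _ _ => rfl

theorem Rep.sum {ι : Type*} {s : Finset ι} {F : ι → Pt → ℝ} {G : ι → S2}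
    (h : ∀ i, Rep us (F i) (G i)) : Rep us (fun x => ∑ i ∈ s, F i x) (∑ i ∈ s, G i) := fun x hx => by
  rw [Sm.sum_apply]; exact Finset.sum_congr rfl fun i _ => h i x hx

theorem Rep.congr {F : Pt → ℝ} {G G' : S2} (h : Rep us F G) (hG : G = G') : Rep us F G' := hG ▸ h

theorem contDiffOn_Xi (hus : 0 < us) : ContDiffOn ℝ ∞ (Xi us) {x : Pt | x 0 < us} := by
  refine ContDiffOn.prodMk (ContDiffOn.neg (ContDiffOn.log (by fun_prop)
    fun x hx => (one_sub_pos hus hx).ne')) (by fun_prop)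

theorem Rep.contDiffOn (hus : 0 < us) {F : Pt → ℝ} {G : S2} (h : Rep us F G) :
    ContDiffOn ℝ ∞ F {x : Pt | x 0 < us} :=
  (G.smooth.comp_contDiffOn (contDiffOn_Xi hus)).congr fun x hx => h x hx

/-! ### Vanishing to infinite order -/

/-- The ideal of functions all of whose derivatives vanish at a point. -/
def flat (p : ℝ × ℝ) : Ideal S2 where
  carrier := {f | ∀ n, iteratedFDeriv ℝ n f.1 p = 0}
  add_mem' {f g} hf hg n := by
    have hn : ((n : ℕ) : WithTop ℕ∞) ≤ ∞ := by exact_mod_cast le_top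
    change iteratedFDeriv ℝ n (fun x => f.1 x + g.1 x) p = 0
    rw [fun_iteratedFDeriv_add_apply (f.smooth.of_le hn).contDiffAt (g.smooth.of_le hn).contDiffAt,
      hf n, hg n, add_zero]
  zero_mem' n := by
    change iteratedFDeriv ℝ n (fun _ => (0 : ℝ)) p = 0
    rw [iteratedFDeriv_fun_zero]; rfl
  smul_mem' g f hf n := by
    have hn : ((n : ℕ) : WithTop ℕ∞) ≤ ∞ := by exact_mod_cast le_top
    rw [← norm_le_zero_iff]
    refine (norm_iteratedFDeriv_mul_le g.smooth f.smooth p hn).trans (le_of_eq ?_)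
    refine Finset.sum_eq_zero fun i _ => ?_
    rw [hf (n - i), norm_zero, mul_zero]

theorem mem_flat_of {f : S2} {p : ℝ × ℝ} (h : ∀ a b, (dx^[a] (dy^[b] f)).1 p = 0) : f ∈ flat p :=
  fun n => iteratedFDeriv_eq_zero n f p fun a b _ => h a b

theorem eq_zero_of_mem_flat {f : S2} {p : ℝ × ℝ} (h : f ∈ flat p) : f.1 p = 0 := by
  have := congrArg (fun m => m 0) (h 0)
  simpa using this

/-- The derivatives of a composition are bounded by those of the outer function at the image point,
so flatness of G at `Xi us x` is inherited at x. -/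
theorem Rep.vanishes (hus : 0 < us) {F : Pt → ℝ} {G : S2} (h : Rep us F G) {x : Pt} (hx : x 0 < us)
    (hG : G ∈ flat (Xi us x)) : VanishesToInfiniteOrder F x := by
  intro k
  have hev : F =ᶠ[nhds x] G.1 ∘ Xi us := by
    filter_upwards [(isOpen_u_lt us).mem_nhds hx] with y hy using h y hy
  rw [(hev.iteratedFDeriv ℝ k).eq_of_nhds, ← iteratedFDerivWithin_of_isOpen k (isOpen_u_lt us) hx,
    ← norm_le_zero_iff]
  -- The composition estimate asks for bounds of the form D^i on the inner derivatives; a common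
  -- bound D ≥ 1 is enough. The constant for the outer function is C = 0.
  set D : ℝ := 1 + ∑ i ∈ Finset.range (k + 1),
    ‖iteratedFDerivWithin ℝ i (Xi us) {x : Pt | x 0 < us} x‖ with hD
  have hs : ∀ i ≤ k, ‖iteratedFDerivWithin ℝ i (Xi us) {x : Pt | x 0 < us} x‖ ≤ D - 1 :=
    fun i hi => by
      rw [hD, add_sub_cancel_left]
      exact Finset.single_le_sum (f := fun i =>
        ‖iteratedFDerivWithin ℝ i (Xi us) {x : Pt | x 0 < us} x‖) (fun _ _ => norm_nonneg _)
        (Finset.mem_range.2 (by omega))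
  have hD1 : 1 ≤ D := by have := (norm_nonneg _).trans (hs 0 (Nat.zero_le k)); linarith
  have := norm_iteratedFDerivWithin_comp_le (n := k) (x := x) (C := 0) (D := D) (N := ∞)
    (G.smooth.contDiffOn (s := Set.univ)) (contDiffOn_Xi hus) (by exact_mod_cast le_top)
    uniqueDiffOn_univ (isOpen_u_lt us).uniqueDiffOn (Set.mapsTo_univ _ _) hx
    (fun i _ => by rw [iteratedFDerivWithin_univ, hG i, norm_zero])
    (fun i h1 h2 => ((hs i h2).trans (by linarith)).trans (le_self_pow₀ hD1 (by omega)))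
  simpa using this

/-! ### Curvature -/

theorem chr_rep (hus : 0 < us) {n : ℕ} (dir : Fin n → Fin 4) {h : Pt → Matrix (Fin n) (Fin n) ℝ}
    {g gi : Matrix (Fin n) (Fin n) S2} (hg : ∀ i j, Rep us (fun x => h x i j) (g i j))
    (hgi : ∀ i j, Rep us (fun x => (h x)⁻¹ i j) (gi i j)) (i j k : Fin n) :
    Rep us (christoffel dir h i j k) (chrR (Sm.const (1 / 2)) (fun i => dS us (dir i)) gi g i j k) :=
  (Rep.const _).mul (Rep.sum fun l => (hgi i l).mul
    ((((hg l k).pd hus _).add ((hg l j).pd hus _)).sub ((hg j k).pd hus _)))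

theorem riem_rep (hus : 0 < us) {n : ℕ} {dir : Fin n → Fin 4} {h : Pt → Matrix (Fin n) (Fin n) ℝ}
    {Γ : Fin n → Fin n → Fin n → S2} (hΓ : ∀ i j k, Rep us (christoffel dir h i j k) (Γ i j k))
    (i j k l : Fin n) :
    Rep us (riemannUp dir h i j k l) (riemR (fun i => dS us (dir i)) Γ i j k l) :=
  (((hΓ i l j).pd hus _).sub ((hΓ i k j).pd hus _)).add (Rep.sum fun m =>
    ((hΓ i k m).mul (hΓ m l j)).sub ((hΓ i l m).mul (hΓ m k j)))

theorem ric_rep (hus : 0 < us) {n : ℕ} {dir : Fin n → Fin 4} {h : Pt → Matrix (Fin n) (Fin n) ℝ}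
    {Γ : Fin n → Fin n → Fin n → S2} (hΓ : ∀ i j k, Rep us (christoffel dir h i j k) (Γ i j k))
    (j l : Fin n) : Rep us (ricci dir h j l) (ricR (fun i => dS us (dir i)) Γ j l) :=
  Rep.sum fun i => riem_rep hus hΓ i j i l

theorem inv_rep {n : ℕ} {h : Pt → Matrix (Fin n) (Fin n) ℝ} {g gi : Matrix (Fin n) (Fin n) S2}
    (hg : ∀ i j, Rep us (fun x => h x i j) (g i j)) (hgi : g * gi = 1) (i j : Fin n) :
    Rep us (fun x => (h x)⁻¹ i j) (gi i j) := by
  intro x hx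
  have h1 : h x * Matrix.of (fun i j => (gi i j).1 (Xi us x)) = 1 := by
    ext i j
    have := congrArg (fun m => (m i j : S2).1 (Xi us x)) hgi
    simp only [Matrix.mul_apply, Sm.sum_apply, Sm.mul_apply] at this
    rw [Matrix.mul_apply, Finset.sum_congr rfl fun k _ => congrArg (· * _) (hg i k x hx), Matrix.one_apply]
    refine this.trans ?_
    rw [Matrix.one_apply]
    split_ifs <;> rfl
  simp only [Matrix.inv_eq_right_inv h1, Matrix.of_apply]

end

end EinsteinEuler
end

noncomputable section

namespace EinsteinEuler

open Sm

/-! ### Plane symmetric fields -/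

/-- The metric of the tori. -/
def γS (Φ : Fl) : Matrix (Fin 2) (Fin 2) S2 := !![exp (2 * (Φ 0 + Φ 1)), 0; 0, exp (2 * (Φ 0 - Φ 1))]

def γiS (Φ : Fl) : Matrix (Fin 2) (Fin 2) S2 :=
  !![exp (-(2 * (Φ 0 + Φ 1))), 0; 0, exp (-(2 * (Φ 0 - Φ 1)))]

/-- The fields determined by `(ρ, w, l, t, ψ)`. -/
def fieldsOf (us : ℝ) (Φ : Fl) : Fields where
  Ω x := (exp (Φ 2)).1 (Xi us x)
  b _ _ := 0
  γ A B x := (γS Φ A B).1 (Xi us x)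
  vA _ _ := 0
  v3 x := (Sm.const (1 / 2) * exp (Φ 4 - Φ 2)).1 (Xi us x)
  v4 x := (Sm.const (1 / 2) * exp (Φ 2 - Φ 4)).1 (Xi us x)
  τ x := (exp (Φ 3)).1 (Xi us x)

theorem exp_congr {f g : S2} (h : f = g) : exp f = exp g := congrArg exp h

/-- The algebraic data of the fields. -/
def matterOf (us : ℝ) (e : Eos) (Φ : Fl) : Matter S2 where
  κ := Sm.const (1 / 2)
  d0 := Du us
  d1 := dy
  l := Φ 2
  a := Φ 0 + Φ 1
  b := Φ 0 - Φ 1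
  O := exp (2 * Φ 2)
  Oi := exp (-(2 * Φ 2))
  A := exp (2 * (Φ 0 + Φ 1))
  Ai := exp (-(2 * (Φ 0 + Φ 1)))
  B := exp (2 * (Φ 0 - Φ 1))
  Bi := exp (-(2 * (Φ 0 - Φ 1)))
  hκ := two_mul_half
  comm := Du_dy us
  hO := exp_neg_mul _
  hA := exp_neg_mul _
  hB := exp_neg_mul _
  d0O := by simp only [Du_apply, dx_exp, dx_mul, dx_ofNat]; ring
  d1O := by simp only [dy_exp, dy_mul, dy_ofNat]; ring
  d0A := by simp only [Du_apply, dx_exp, dx_mul, dx_ofNat]; ring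
  d1A := by simp only [dy_exp, dy_mul, dy_ofNat]; ring
  d0B := by simp only [Du_apply, dx_exp, dx_mul, dx_ofNat]; ring
  d1B := by simp only [dy_exp, dy_mul, dy_ofNat]; ring
  ρ := Φ 0
  w := Φ 1
  ψ := Φ 4
  V0 := exp (Φ 4 - Φ 2)
  V1 := exp (-Φ 2 - Φ 4)
  G := exp (2 * Φ 4)
  Gi := exp (-(2 * Φ 4))
  h := e.h.of (Φ 3)
  σ := e.σ.of (Φ 3)
  ha := rfl
  hb := rfl
  d0G := by simp only [Du_apply, dx_exp, dx_mul, dx_ofNat]; ring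
  d1G := by simp only [dy_exp, dy_mul, dy_ofNat]; ring
  hG := exp_neg_mul _
  h01 := by rw [← exp_add]; exact exp_congr (by ring)
  h00 := by rw [pow_two, ← exp_add, ← exp_add]; exact exp_congr (by ring)
  h11 := by rw [pow_two, ← exp_add, ← exp_add]; exact exp_congr (by ring)

section Residuals

variable (us : ℝ) (e : Eos) (Φ : Fl)

theorem dx_Ei : dx (X (exp (-(2 * phiS us)))) = X (exp (-(2 * phiS us))) := by
  have h1 : der (exp (-(2 * phiS us))) = exp (-(2 * phiS us)) * der (-(2 * phiS us)) := lie_exp _ _ _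
  have h2 : der (-(2 * phiS us)) = 1 := by
    rw [map_neg, der.leibniz, der_phiS, Sm.deriv_ofNat]
    ext x; simp
  rw [dx_X, h1, h2, mul_one]

theorem dx_phiS : dx (X (phiS us)) = -Sm.const (1 / 2) := by
  rw [dx_X, der_phiS]
  ext p; simp

/-- ∂_x = e^{2φ}∂_u with e^{2φ} = u_* - u, and `hatF` adapts the lapse and the velocity to this
change of null coordinate. So the equations in the x-gauge are powers of e^{2φ} times those in the
u-gauge: one power for each lower index u, and none for `eb`, where e^{2(ψ-φ)} already compensates
it. -/
theorem e1_hat : e1 e (hatF Φ (phiS us)) = X (exp (2 * phiS us)) * (matterOf us e Φ).r1 := by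
  simp only [e1, hatF, Matrix.cons_val, exp_two_mul_add, exp_X, Matter.r1, matterOf, Du_apply,
    dy_mul, dy_X, dx_dy_comm]
  linear_combination -(2 * dy (dx (Φ 0)) + 4 * dx (Φ 0) * dy (Φ 0)) * X_exp_mul us

theorem e2_hat : e2 (hatF Φ (phiS us)) = X (exp (2 * phiS us)) * (matterOf us e Φ).r2 := by
  simp only [e2, hatF, Matrix.cons_val, Matter.r2, matterOf, Du_apply, dy_mul, dy_X, dx_dy_comm]
  linear_combination -(dy (dx (Φ 1)) + dx (Φ 0) * dy (Φ 1) + dy (Φ 0) * dx (Φ 1)) * X_exp_mul us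

theorem e3_hat : e3 e (hatF Φ (phiS us)) = X (exp (2 * phiS us)) * (matterOf us e Φ).r3 := by
  simp only [e3, hatF, Matrix.cons_val, exp_two_mul_add, exp_X, Matter.r3, matterOf, Du_apply,
    dy_mul, dy_X, dx_dy_comm, map_add, mul_zero, add_zero]
  linear_combination -(2 * dy (dx (Φ 2)) - 2 * dx (Φ 0) * dy (Φ 0) + 2 * dx (Φ 1) * dy (Φ 1)) *
    X_exp_mul us

theorem ea_hat : ea e (hatF Φ (phiS us)) = X (exp (2 * phiS us)) * (matterOf us e Φ).ra := by
  simp only [ea, hatF, Matrix.cons_val, exp_neg_hat, Matter.ra, matterOf, Du_apply, dx_of, dy_of,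
    map_add, map_sub, dy_X, sub_zero, add_zero]
  linear_combination -((der e.σ).of (Φ 3) * dx (Φ 3) + 2 * dx (Φ 0) * e.h.of (Φ 3)) * X_exp_mul us

theorem exp_hat (f : S2) :
    exp (2 * (f - X (phiS us))) = exp (2 * f) * X (exp (-(2 * phiS us))) := by
  have h1 : exp (2 * (f - X (phiS us))) * X (exp (2 * phiS us)) = exp (2 * f) := by
    rw [← exp_X, ← exp_add]; exact exp_congr (by ring)
  linear_combination X (exp (-(2 * phiS us))) * h1
    - exp (2 * (f - X (phiS us))) * X_exp_mul us

theorem eb_hat : eb e (hatF Φ (phiS us)) = (matterOf us e Φ).rb := by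
  simp only [eb, hatF, Matrix.cons_val, exp_hat, Matter.rb, matterOf, Du_apply, dx_of, dy_of,
    map_add, map_sub]
  ring

theorem exx_hat : exx e (hatF Φ (phiS us)) = X (exp (2 * phiS us)) ^ 2 * (matterOf us e Φ).r00 := by
  have h := X_exp_mul us
  simp only [exx, hatF, Matrix.cons_val, exp_two_mul_add, exp_X, exp_neg_hat, Matter.r00, matterOf,
    Du_apply, map_add, dx_mul, dx_Ei, dx_phiS]
  linear_combination -(2 * dx (dx (Φ 0)) + 2 * dx (Φ 0) ^ 2 - 4 * dx (Φ 2) * dx (Φ 0)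
    + 2 * dx (Φ 1) ^ 2 + 2 * dx (Φ 0)) * (X (exp (2 * phiS us)) * X (exp (-(2 * phiS us))) + 1) * h
    + 2 * dx (Φ 0) * two_mul_half

theorem eyy_hat : eyy e (hatF Φ (phiS us)) = (matterOf us e Φ).r11 := by
  simp only [eyy, hatF, Matrix.cons_val, exp_two_mul_add, exp_X, exp_hat, Matter.r11, matterOf,
    map_add, dy_X, add_zero]
  linear_combination exp (2 * Φ 2) * exp (2 * Φ 4) * e.h.of (Φ 3) * X_exp_mul us

variable {us e Φ}

theorem residuals_mem {J : Ideal S2} (hev : ∀ k, evol e (hatF Φ (phiS us)) k ∈ J)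
    (hexx : exx e (hatF Φ (phiS us)) ∈ J) (heyy : eyy e (hatF Φ (phiS us)) ∈ J) :
    (matterOf us e Φ).r1 ∈ J ∧ (matterOf us e Φ).r2 ∈ J ∧ (matterOf us e Φ).r3 ∈ J ∧
    (matterOf us e Φ).ra ∈ J ∧ (matterOf us e Φ).rb ∈ J ∧ (matterOf us e Φ).r00 ∈ J ∧
    (matterOf us e Φ).r11 ∈ J := by
  have hE := (mul_comm _ _).trans (X_exp_mul us)
  have key : ∀ {f g : S2}, f = X (exp (2 * phiS us)) * g → f ∈ J → g ∈ J := fun h hf => by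
    have := Ideal.mul_mem_left _ (X (exp (-(2 * phiS us)))) hf
    rwa [h, ← mul_assoc, hE, one_mul] at this
  refine ⟨key (e1_hat us e Φ) (hev 0), key (e2_hat us e Φ) (hev 1), key (e3_hat us e Φ) (hev 2),
    key (ea_hat us e Φ) (hev 3), eb_hat us e Φ ▸ hev 4, ?_, eyy_hat us e Φ ▸ heyy⟩
  have h1 := exx_hat us e Φ
  rw [pow_two, mul_assoc] at h1
  exact key rfl (key h1 hexx)

theorem ein_eul_mem {J : Ideal S2} (hev : ∀ k, evol e (hatF Φ (phiS us)) k ∈ J)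
    (hexx : exx e (hatF Φ (phiS us)) ∈ J) (heyy : eyy e (hatF Φ (phiS us)) ∈ J) :
    (∀ μ ν, (matterOf us e Φ).ein μ ν ∈ J) ∧ ∀ μ, (matterOf us e Φ).eul μ ∈ J := by
  obtain ⟨h1, h2, h3, h4, h5, h6, h7⟩ := residuals_mem hev hexx heyy
  refine ⟨fun μ ν => ?_, fun μ => ?_⟩
  · rw [Matter.ein_eq]
    fin_cases μ <;> fin_cases ν <;>
    first
    | exact zero_mem _
    | exact neg_mem h6
    | exact h1
    | exact neg_mem h7
    | exact Ideal.mul_mem_left _ _ (sub_mem (sub_mem h2 (Ideal.mul_mem_left _ _ h1))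
        (Ideal.mul_mem_left _ _ h3))
    | exact Ideal.mul_mem_left _ _ (sub_mem (sub_mem (neg_mem h2) (Ideal.mul_mem_left _ _ h1))
        (Ideal.mul_mem_left _ _ h3))
  · rw [Matter.eul_eq]
    fin_cases μ
    exacts [Ideal.mul_mem_left _ _ h5, Ideal.mul_mem_left _ _ h4, zero_mem _, zero_mem _]

end Residuals

/-! ### Representation of the geometric quantities -/

section Geometry

variable {us : ℝ} (e : Eos) (Φ : Fl)

theorem metric_rep (μ ν : Fin 4) :
    Rep us (fun x => (fieldsOf us Φ).metric x μ ν) ((matterOf us e Φ).g μ ν) := by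
  intro x _
  simp only [Fields.metric, Fields.form, fieldsOf, Matrix.of_apply, Fin.sum_univ_two, γS, ang]
  fin_cases μ <;> fin_cases ν <;>
    simp [Plane.g, matterOf, ← Real.exp_nat_mul]

theorem metric_inv_rep (μ ν : Fin 4) :
    Rep us (fun x => ((fieldsOf us Φ).metric x)⁻¹ μ ν) ((matterOf us e Φ).gi μ ν) :=
  inv_rep (metric_rep e Φ) (matterOf us e Φ).g_mul_gi μ ν

theorem christoffel_rep (hus : 0 < us) (i j k : Fin 4) :
    Rep us (christoffel id (fieldsOf us Φ).metric i j k) ((matterOf us e Φ).Γ i j k) :=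
  (chr_rep hus id (metric_rep e Φ) (metric_inv_rep e Φ) i j k).congr
    ((matterOf us e Φ).chr_eq i j k)

theorem ricci_rep (hus : 0 < us) (j l : Fin 4) :
    Rep us (ricci id (fieldsOf us Φ).metric j l) ((matterOf us e Φ).ricT j l) :=
  (ric_rep hus (christoffel_rep e Φ hus) j l).congr ((matterOf us e Φ).ric_eq j l)

theorem scalarCurv_rep (hus : 0 < us) :
    Rep us (scalarCurv id (fieldsOf us Φ).metric) (matterOf us e Φ).scal :=
  Rep.sum fun j => Rep.sum fun l => (metric_inv_rep e Φ j l).mul (ricci_rep e Φ hus j l)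

theorem vel_rep (μ : Fin 4) : Rep us (fun x => (fieldsOf us Φ).vel x μ) ((matterOf us e Φ).vel μ) := by
  intro x _
  simp only [Fields.vel, Fields.e3, Fields.e4, Fields.eA, fieldsOf, Fin.sum_univ_two, ang]
  fin_cases μ <;> simp [Matter.vel, matterOf]
  rw [mul_assoc, mul_eq_mul_left_iff]
  left
  rw [← Real.exp_nat_mul, ← Real.exp_neg, ← Real.exp_add]
  congr 1
  push_cast
  ring

variable {e} {P : ℝ → ℝ}

/-- Compatibility of the equation of state with its logarithmic form. -/
def EosOf (P : ℝ → ℝ) (e : Eos) : Prop :=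
  ∀ t, e.h.1 t = Real.exp t + P (Real.exp t) ∧ e.σ.1 t = Real.exp t - P (Real.exp t)

theorem enthalpy_rep (he : EosOf P e) :
    Rep us (fun x => (fieldsOf us Φ).τ x + P ((fieldsOf us Φ).τ x)) (matterOf us e Φ).h :=
  fun x _ => ((he ((Φ 3).1 (Xi us x))).1).symm

theorem pressure_rep (he : EosOf P e) :
    Rep us (fun x => P ((fieldsOf us Φ).τ x)) (matterOf us e Φ).p := fun x _ => by
  have := he ((Φ 3).1 (Xi us x))
  simp [Matter.p, matterOf, fieldsOf, this.1, this.2]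
  ring

theorem velLow_rep (μ : Fin 4) :
    Rep us (fun x => (fieldsOf us Φ).velLow x μ) ((matterOf us e Φ).velLow μ) :=
  Rep.sum fun ν => (metric_rep e Φ μ ν).mul (vel_rep e Φ ν)

theorem stress_rep (he : EosOf P e) (μ ν : Fin 4) :
    Rep us (fun x => (fieldsOf us Φ).stress P x μ ν) ((matterOf us e Φ).T μ ν) :=
  (((enthalpy_rep Φ he).mul (velLow_rep Φ μ)).mul (velLow_rep Φ ν)).add
    ((pressure_rep Φ he).mul (metric_rep e Φ μ ν))

theorem stressUp_rep (he : EosOf P e) (μ ν : Fin 4) :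
    Rep us (fun x => (fieldsOf us Φ).stressUp P x μ ν) ((matterOf us e Φ).Tup μ ν) :=
  (((enthalpy_rep Φ he).mul (vel_rep e Φ μ)).mul (vel_rep e Φ ν)).add
    ((pressure_rep Φ he).mul (metric_inv_rep e Φ μ ν))

theorem einsteinRes_rep (hus : 0 < us) (he : EosOf P e) (μ ν : Fin 4) :
    Rep us ((fieldsOf us Φ).einsteinRes P μ ν) ((matterOf us e Φ).ein μ ν) :=
  ((ricci_rep e Φ hus μ ν).sub (((Rep.const (1 / 2)).mul (scalarCurv_rep e Φ hus)).mul
    (metric_rep e Φ μ ν))).sub (stress_rep Φ he μ ν)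

theorem eulerRes_rep (hus : 0 < us) (he : EosOf P e) (μ : Fin 4) :
    Rep us ((fieldsOf us Φ).eulerRes P μ) ((matterOf us e Φ).eul μ) :=
  Rep.sum fun α => ((stressUp_rep Φ he α μ).pd hus α).add (Rep.sum fun β =>
    ((christoffel_rep e Φ hus α α β).mul (stressUp_rep Φ he β μ)).add
      ((christoffel_rep e Φ hus μ α β).mul (stressUp_rep Φ he α β)))

theorem normRes_rep (e : Eos) : Rep us (fieldsOf us Φ).normRes 0 :=
  ((Rep.sum fun μ => Rep.sum fun ν => ((vel_rep e Φ μ).mul (metric_rep e Φ μ ν)).mul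
    (vel_rep e Φ ν)).add (Rep.const 1)).congr (matterOf us e Φ).norm_eq

/-- The regularity and positivity requirements hold automatically; the equations hold to infinite
order where the residuals of the reduced system do. -/
theorem isCharData_of (hus : 0 < us) {ubs : ℝ} (he : EosOf P e)
    (hl : ∀ x ∈ H0 ubs ∪ Hb0 us, (Φ 2).1 (Xi us x) = 0)
    (hflat : ∀ x ∈ H0 ubs ∪ Hb0 us, (∀ k, evol e (hatF Φ (phiS us)) k ∈ flat (Xi us x)) ∧
      exx e (hatF Φ (phiS us)) ∈ flat (Xi us x) ∧ eyy e (hatF Φ (phiS us)) ∈ flat (Xi us x)) :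
    IsCharData P us ubs (fieldsOf us Φ) := by
  have hlt : ∀ x ∈ H0 ubs ∪ Hb0 us, x 0 < us := by
    rintro x (hx | hx)
    · rw [hx.1]; exact hus
    · exact hx.2.2
  have hsm : ∀ {F : Pt → ℝ} {G : S2}, Rep us F G → ContDiffOn ℝ ∞ F (region us ubs) :=
    fun h => (h.contDiffOn hus).mono fun x hx => hx.1
  have hm := fun x hx => ein_eul_mem (hflat x hx).1 (hflat x hx).2.1 (hflat x hx).2.2
  refine
    { smooth_Ω := hsm (G := exp (Φ 2)) fun _ _ => rfl
      smooth_b := fun _ => contDiffOn_const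
      smooth_γ := fun A B => hsm (G := γS Φ A B) fun _ _ => rfl
      smooth_vA := fun _ => contDiffOn_const
      smooth_v3 := hsm (G := Sm.const (1 / 2) * exp (Φ 4 - Φ 2)) fun _ _ => rfl
      smooth_v4 := hsm (G := Sm.const (1 / 2) * exp (Φ 2 - Φ 4)) fun _ _ => rfl
      smooth_τ := hsm (G := exp (Φ 3)) fun _ _ => rfl
      periodic := fun x _ C => ?_
      symm_γ := fun A B => ?_
      pos_γ := fun x _ => ?_
      pos_τ := fun x _ => Real.exp_pos _
      pos_v := fun x _ => ⟨mul_pos (by norm_num) (Real.exp_pos _), mul_pos (by norm_num) (Real.exp_pos _)⟩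
      gauge_Ω := fun x hx => ?_
      gauge_b := fun _ _ _ => rfl
      einstein := fun x hx μ ν => (einsteinRes_rep Φ hus he μ ν).vanishes hus (hlt x hx) ((hm x hx).1 μ ν)
      euler := fun x hx μ => (eulerRes_rep Φ hus he μ).vanishes hus (hlt x hx) ((hm x hx).2 μ)
      normalized := fun x hx => (normRes_rep Φ e).vanishes hus (hlt x hx) (zero_mem _) }
  · have : Xi us (x + Pi.single (ang C) 1) = Xi us x := by
      fin_cases C <;> simp [Xi, ang]
    simp [fieldsOf, this]
  · funext x
    fin_cases A <;> fin_cases B <;> rfl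
  · have : (fieldsOf us Φ).γMat x = Matrix.diagonal
        ![Real.exp (2 * ((Φ 0).1 (Xi us x) + (Φ 1).1 (Xi us x))),
          Real.exp (2 * ((Φ 0).1 (Xi us x) - (Φ 1).1 (Xi us x)))] := by
      ext i j
      fin_cases i <;> fin_cases j <;> simp [Fields.γMat, fieldsOf, γS]
    rw [this, Matrix.posDef_diagonal_iff]
    intro i
    fin_cases i <;> exact Real.exp_pos _
  · change Real.exp ((Φ 2).1 (Xi us x)) = 1
    rw [hl x hx, Real.exp_zero]

end Geometry

end EinsteinEuler
end

noncomputable section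

namespace EinsteinEuler

open Sm

/-! ### Null second fundamental forms and null constraints -/

section Null

variable {us : ℝ} (Φ : Fl)

theorem γ_rep (A B : Fin 2) : Rep us ((fieldsOf us Φ).γ A B) (γS Φ A B) := fun _ _ => rfl

theorem γS_mul : γS Φ * γiS Φ = 1 := by
  ext i j : 2
  fin_cases i <;> fin_cases j <;> simp [γS, γiS, Matrix.mul_apply, exp_mul_neg]

theorem γi_rep (A B : Fin 2) : Rep us (fun x => ((fieldsOf us Φ).γMat x)⁻¹ A B) (γiS Φ A B) :=
  inv_rep (γ_rep Φ) (γS_mul Φ) A B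

theorem Oi_rep : Rep us (fun x => ((fieldsOf us Φ).Ω x ^ 2)⁻¹) (exp (-(2 * Φ 2))) := fun x _ => by
  simp [fieldsOf, Real.exp_neg, ← Real.exp_nat_mul]

def χS (A B : Fin 2) : S2 := Sm.const (1 / 2) * exp (-(2 * Φ 2)) * dy (γS Φ A B)

def χbS (us : ℝ) (A B : Fin 2) : S2 := Sm.const (1 / 2) * Du us (γS Φ A B)

theorem zero_rep : Rep us (fun _ => (0 : ℝ)) 0 := fun _ _ => rfl

theorem χ_rep (hus : 0 < us) (A B : Fin 2) : Rep us ((fieldsOf us Φ).χ A B) (χS Φ A B) :=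
  ((Rep.const (1 / 2)).mul (Oi_rep Φ)).mul ((γ_rep Φ A B).pd hus 1)

theorem χb_rep (hus : 0 < us) (A B : Fin 2) : Rep us ((fieldsOf us Φ).χb A B) (χbS Φ us A B) := by
  refine Rep.congr ((Rep.const (1 / 2)).mul (((γ_rep Φ A B).pd hus 0).add (Rep.sum fun C =>
    ((zero_rep.mul ((γ_rep Φ A B).pd hus (ang C))).add ((γ_rep Φ C B).mul (zero_rep.pd hus (ang A)))).add
      ((γ_rep Φ A C).mul (zero_rep.pd hus (ang B)))))) ?_
  simp [χbS, dS]

theorem ζ_rep (hus : 0 < us) (A : Fin 2) : Rep us ((fieldsOf us Φ).ζ A) 0 := by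
  refine Rep.congr (((Rep.const (-(1 / 4))).mul (Oi_rep Φ)).mul (Rep.sum fun B =>
    (γ_rep Φ A B).mul (zero_rep.pd hus 1))) ?_
  simp

theorem tr_rep {h : Fin 2 → Fin 2 → Pt → ℝ} {H : Fin 2 → Fin 2 → S2}
    (hh : ∀ A B, Rep us (h A B) (H A B)) :
    Rep us ((fieldsOf us Φ).tr h) (∑ A, ∑ B, γiS Φ A B * H A B) :=
  Rep.sum fun A => Rep.sum fun B => (γi_rep Φ A B).mul (hh A B)

theorem dy_γS : dy (γS Φ 0 0) = 2 * γS Φ 0 0 * (dy (Φ 0) + dy (Φ 1)) ∧ dy (γS Φ 0 1) = 0 ∧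
    dy (γS Φ 1 0) = 0 ∧ dy (γS Φ 1 1) = 2 * γS Φ 1 1 * (dy (Φ 0) - dy (Φ 1)) := by
  refine ⟨?_, map_zero _, map_zero _, ?_⟩ <;>
  simp only [γS, Matrix.of_apply, Matrix.cons_val, dy_exp, dy_mul, dy_ofNat, map_add, map_sub] <;>
  ring

theorem Du_γS : Du us (γS Φ 0 0) = 2 * γS Φ 0 0 * (Du us (Φ 0) + Du us (Φ 1)) ∧
    Du us (γS Φ 0 1) = 0 ∧ Du us (γS Φ 1 0) = 0 ∧
    Du us (γS Φ 1 1) = 2 * γS Φ 1 1 * (Du us (Φ 0) - Du us (Φ 1)) := by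
  refine ⟨?_, map_zero _, map_zero _, ?_⟩ <;>
  simp only [γS, Matrix.of_apply, Matrix.cons_val, Du_apply, dx_exp, dx_mul, dx_ofNat, map_add,
    map_sub] <;>
  ring

theorem γiS_mul : γiS Φ 0 0 * γS Φ 0 0 = 1 ∧ γiS Φ 1 1 * γS Φ 1 1 = 1 :=
  ⟨exp_neg_mul _, exp_neg_mul _⟩

theorem trχ_rep (hus : 0 < us) : Rep us (fieldsOf us Φ).trχ (2 * exp (-(2 * Φ 2)) * dy (Φ 0)) := by
  refine (tr_rep Φ (χ_rep Φ hus)).congr ?_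
  obtain ⟨h0, h1, h2, h3⟩ := dy_γS Φ
  obtain ⟨k0, k1⟩ := γiS_mul Φ
  simp only [Fin.sum_univ_two, χS, h0, h1, h2, h3]
  linear_combination exp (-(2 * Φ 2)) * (dy (Φ 0) + dy (Φ 1)) * (k0 + γiS Φ 0 0 * γS Φ 0 0 * two_mul_half)
    + exp (-(2 * Φ 2)) * (dy (Φ 0) - dy (Φ 1)) * (k1 + γiS Φ 1 1 * γS Φ 1 1 * two_mul_half)

theorem trχb_rep (hus : 0 < us) : Rep us (fieldsOf us Φ).trχb (2 * Du us (Φ 0)) := by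
  refine (tr_rep Φ (χb_rep Φ hus)).congr ?_
  obtain ⟨h0, h1, h2, h3⟩ := Du_γS (us := us) Φ
  obtain ⟨k0, k1⟩ := γiS_mul Φ
  simp only [Fin.sum_univ_two, χbS, h0, h1, h2, h3]
  linear_combination (Du us (Φ 0) + Du us (Φ 1)) * (k0 + γiS Φ 0 0 * γS Φ 0 0 * two_mul_half)
    + (Du us (Φ 0) - Du us (Φ 1)) * (k1 + γiS Φ 1 1 * γS Φ 1 1 * two_mul_half)

theorem normSq₂_rep {h : Fin 2 → Fin 2 → Pt → ℝ} {H : Fin 2 → Fin 2 → S2}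
    (hh : ∀ A B, Rep us (h A B) (H A B)) : Rep us ((fieldsOf us Φ).normSq₂ h)
      (∑ A, ∑ B, ∑ C, ∑ D, γiS Φ A C * γiS Φ B D * H A B * H C D) :=
  Rep.sum fun A => Rep.sum fun B => Rep.sum fun C => Rep.sum fun D =>
    (((γi_rep Φ A C).mul (γi_rep Φ B D)).mul (hh A B)).mul (hh C D)

/-- The shear is carried by w alone, so its blow-up is that of ∂_u w. -/
theorem hatχb_rep (hus : 0 < us) :
    Rep us ((fieldsOf us Φ).normSq₂ ((fieldsOf us Φ).hat (fieldsOf us Φ).χb)) (2 * Du us (Φ 1) ^ 2) := by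
  refine (normSq₂_rep Φ fun A B => (χb_rep Φ hus A B).sub (((Rep.const (1 / 2)).mul
    (trχb_rep Φ hus)).mul (γ_rep Φ A B))).congr ?_
  obtain ⟨h0, h1, h2, h3⟩ := Du_γS (us := us) Φ
  obtain ⟨k0, k1⟩ := γiS_mul Φ
  have z : γiS Φ 0 1 = 0 ∧ γiS Φ 1 0 = 0 ∧ γS Φ 0 1 = 0 ∧ γS Φ 1 0 = 0 := ⟨rfl, rfl, rfl, rfl⟩
  have e0 : Sm.const (1 / 2) * (2 * γS Φ 0 0 * (Du us (Φ 0) + Du us (Φ 1)))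
      - Sm.const (1 / 2) * (2 * Du us (Φ 0)) * γS Φ 0 0 = γS Φ 0 0 * Du us (Φ 1) := by
    linear_combination γS Φ 0 0 * Du us (Φ 1) * two_mul_half
  have e1 : Sm.const (1 / 2) * (2 * γS Φ 1 1 * (Du us (Φ 0) - Du us (Φ 1)))
      - Sm.const (1 / 2) * (2 * Du us (Φ 0)) * γS Φ 1 1 = -(γS Φ 1 1 * Du us (Φ 1)) := by
    linear_combination -(γS Φ 1 1 * Du us (Φ 1)) * two_mul_half
  simp only [Fin.sum_univ_two, χbS, h0, h3, z, e0, e1, mul_zero, zero_mul, add_zero, zero_add,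
    sub_zero, map_zero]
  linear_combination Du us (Φ 1) ^ 2 * ((γiS Φ 0 0 * γS Φ 0 0 + 1) * k0
    + (γiS Φ 1 1 * γS Φ 1 1 + 1) * k1)

theorem hatχ_rep (hus : 0 < us) :
    Rep us ((fieldsOf us Φ).normSq₂ ((fieldsOf us Φ).hat (fieldsOf us Φ).χ))
      (2 * (exp (-(2 * Φ 2)) * dy (Φ 1)) ^ 2) := by
  refine (normSq₂_rep Φ fun A B => (χ_rep Φ hus A B).sub (((Rep.const (1 / 2)).mul
    (trχ_rep Φ hus)).mul (γ_rep Φ A B))).congr ?_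
  obtain ⟨h0, h1, h2, h3⟩ := dy_γS Φ
  obtain ⟨k0, k1⟩ := γiS_mul Φ
  have z : γiS Φ 0 1 = 0 ∧ γiS Φ 1 0 = 0 ∧ γS Φ 0 1 = 0 ∧ γS Φ 1 0 = 0 := ⟨rfl, rfl, rfl, rfl⟩
  have e0 : Sm.const (1 / 2) * exp (-(2 * Φ 2)) * (2 * γS Φ 0 0 * (dy (Φ 0) + dy (Φ 1)))
      - Sm.const (1 / 2) * (2 * exp (-(2 * Φ 2)) * dy (Φ 0)) * γS Φ 0 0
      = γS Φ 0 0 * (exp (-(2 * Φ 2)) * dy (Φ 1)) := by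
    linear_combination γS Φ 0 0 * (exp (-(2 * Φ 2)) * dy (Φ 1)) * two_mul_half
  have e1 : Sm.const (1 / 2) * exp (-(2 * Φ 2)) * (2 * γS Φ 1 1 * (dy (Φ 0) - dy (Φ 1)))
      - Sm.const (1 / 2) * (2 * exp (-(2 * Φ 2)) * dy (Φ 0)) * γS Φ 1 1
      = -(γS Φ 1 1 * (exp (-(2 * Φ 2)) * dy (Φ 1))) := by
    linear_combination -(γS Φ 1 1 * (exp (-(2 * Φ 2)) * dy (Φ 1))) * two_mul_half
  simp only [Fin.sum_univ_two, χS, h0, h3, z, e0, e1, mul_zero, zero_mul, add_zero, zero_add,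
    sub_zero, map_zero]
  linear_combination (exp (-(2 * Φ 2)) * dy (Φ 1)) ^ 2 * ((γiS Φ 0 0 * γS Φ 0 0 + 1) * k0
    + (γiS Φ 1 1 * γS Φ 1 1 + 1) * k1)

theorem dS_ang (A : Fin 2) : dS us (ang A) = 0 := by
  fin_cases A <;> rfl

/-- γ does not depend on θ. The tori are flat and all angular terms of the constraints drop out. -/
theorem torus_christoffel_rep (hus : 0 < us) (i j k : Fin 2) :
    Rep us (christoffel ang (fieldsOf us Φ).γMat i j k) 0 :=
  (chr_rep hus ang (γ_rep Φ) (γi_rep Φ) i j k).congr (by simp [chrR, dS_ang])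

theorem K_rep (hus : 0 < us) : Rep us (fieldsOf us Φ).K 0 :=
  ((Rep.const (1 / 2)).mul (Rep.sum fun j => Rep.sum fun l => (γi_rep Φ j l).mul
    (ric_rep hus (torus_christoffel_rep Φ hus) j l))).congr (by simp [ricR, riemR])

theorem div₁_rep (hus : 0 < us) : Rep us ((fieldsOf us Φ).div₁ (fieldsOf us Φ).ζ) 0 :=
  (Rep.sum fun A => Rep.sum fun B => (γi_rep Φ A B).mul (((ζ_rep Φ hus B).pd hus (ang A)).sub
    (Rep.sum fun C => (torus_christoffel_rep Φ hus C A B).mul (ζ_rep Φ hus C)))).congr (by simp)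

theorem div₂_rep (hus : 0 < us) {h : Fin 2 → Fin 2 → Pt → ℝ} {H : Fin 2 → Fin 2 → S2}
    (hh : ∀ A B, Rep us (h A B) (H A B)) (A : Fin 2) : Rep us ((fieldsOf us Φ).div₂ h A) 0 :=
  (Rep.sum fun B => Rep.sum fun C => (γi_rep Φ B C).mul (((hh C A).pd hus (ang B)).sub
    (Rep.sum fun D => ((torus_christoffel_rep Φ hus D B C).mul (hh D A)).add
      ((torus_christoffel_rep Φ hus D B A).mul (hh C D))))).congr (by simp [dS_ang])

theorem normSq₁_rep (hus : 0 < us) : Rep us ((fieldsOf us Φ).normSq₁ (fieldsOf us Φ).ζ) 0 :=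
  (Rep.sum fun A => Rep.sum fun B => ((γi_rep Φ A B).mul (ζ_rep Φ hus A)).mul (ζ_rep Φ hus B)).congr
    (by simp)

variable {Φ} {e : Eos} {P : ℝ → ℝ}

/-- The trace is 3p - τ, which equals (τ + p) - 2(τ - p). -/
theorem stressTr_rep (he : EosOf P e) : Rep us ((fieldsOf us Φ).stressTr P)
    (e.h.of (Φ 3) - 2 * e.σ.of (Φ 3)) := by
  refine (Rep.sum fun μ => Rep.sum fun ν => (metric_inv_rep e Φ μ ν).mul (stress_rep Φ he μ ν)).congr ?_
  have hO := (matterOf us e Φ).hO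
  have hA := (matterOf us e Φ).hA
  have hB := (matterOf us e Φ).hB
  have hκ := (matterOf us e Φ).hκ
  simp only [Fin.sum_univ_four, Matter.T_eq]
  simp only [Plane.gi, Matter.TT, Matter.p, Matrix.of_apply, Matrix.cons_val]
  change _ = (matterOf us e Φ).h - 2 * (matterOf us e Φ).σ
  linear_combination -(2 * (matterOf us e Φ).κ * (matterOf us e Φ).σ) * hO
    + ((matterOf us e Φ).h - 2 * (matterOf us e Φ).σ) * hκ
    + (matterOf us e Φ).κ * ((matterOf us e Φ).h - (matterOf us e Φ).σ) * (hA + hB)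

/-- The Ricci tensor prescribed by the matter, in the plane. -/
def mricS (us : ℝ) (e : Eos) (Φ : Fl) (μ ν : Fin 4) : S2 := (matterOf us e Φ).TT μ ν
  - Sm.const (1 / 2) * (e.h.of (Φ 3) - 2 * e.σ.of (Φ 3)) * (matterOf us e Φ).g μ ν

theorem mric_rep (he : EosOf P e) (μ ν : Fin 4) : Rep us (fun x => (fieldsOf us Φ).stress P x μ ν
    - (1 / 2) * (fieldsOf us Φ).stressTr P x * (fieldsOf us Φ).metric x μ ν) (mricS us e Φ μ ν) :=
  ((stress_rep Φ he μ ν).congr ((matterOf us e Φ).T_eq μ ν)).sub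
    (((Rep.const (1 / 2)).mul (stressTr_rep he)).mul (metric_rep e Φ μ ν))

theorem matterRic_eq (he : EosOf P e) {x : Pt} (hx : x 0 < us) (Y Z : Fin 4 → ℝ) :
    (fieldsOf us Φ).matterRic P x Y Z
      = ∑ μ, ∑ ν, Y μ * (mricS us e Φ μ ν).1 (Xi us x) * Z ν := by
  unfold Fields.matterRic contract
  refine Finset.sum_congr rfl fun μ _ => Finset.sum_congr rfl fun ν _ => ?_
  exact congrArg (fun r => Y μ * r * Z ν) (mric_rep he μ ν x hx)

theorem matterRic_values (he : EosOf P e) {x : Pt} (hx : x 0 < us)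
    (hl : (Φ 2).1 (Xi us x) = 0) :
    (fieldsOf us Φ).matterRic P x ((fieldsOf us Φ).e3 x) ((fieldsOf us Φ).e3 x)
      = (exp (2 * Φ 2) * exp (-(2 * Φ 4)) * e.h.of (Φ 3)).1 (Xi us x) ∧
    (fieldsOf us Φ).matterRic P x ((fieldsOf us Φ).e4 x) ((fieldsOf us Φ).e4 x)
      = (exp (2 * Φ 2) * exp (2 * Φ 4) * e.h.of (Φ 3)).1 (Xi us x) ∧
    (fieldsOf us Φ).matterRic P x ((fieldsOf us Φ).e3 x) ((fieldsOf us Φ).e4 x)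
      + (fieldsOf us Φ).matterScal P x = (e.σ.of (Φ 3)).1 (Xi us x) ∧
    (fieldsOf us Φ).matterRic P x ((fieldsOf us Φ).e4 x) ((fieldsOf us Φ).e3 x)
      + (fieldsOf us Φ).matterScal P x = (e.σ.of (Φ 3)).1 (Xi us x) ∧
    ∀ A, (fieldsOf us Φ).matterRic P x ((fieldsOf us Φ).e3 x) (Fields.eA A) = 0 ∧
      (fieldsOf us Φ).matterRic P x ((fieldsOf us Φ).e4 x) (Fields.eA A) = 0 := by
  have hO : ((fieldsOf us Φ).Ω x ^ 2)⁻¹ = 1 := by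
    have : (fieldsOf us Φ).Ω x = Real.exp ((Φ 2).1 (Xi us x)) := rfl
    rw [this, hl]; simp
  have h3 : (fieldsOf us Φ).e3 x = ![1, 0, 0, 0] := rfl
  have h4 : (fieldsOf us Φ).e4 x = ![0, 1, 0, 0] := by rw [Fields.e4, hO]
  have ht : (fieldsOf us Φ).matterScal P x
      = -((e.h.of (Φ 3)).1 (Xi us x) - 2 * (e.σ.of (Φ 3)).1 (Xi us x)) := by
    rw [Fields.matterScal, stressTr_rep he x hx]; simp
  simp only [matterRic_eq he hx, h3, h4, ht]
  refine ⟨?_, ?_, ?_, ?_, fun A => ?_⟩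
  · simp [Fin.sum_univ_four, mricS, Matter.TT, Plane.g, matterOf]
  · simp [Fin.sum_univ_four, mricS, Matter.TT, Plane.g, matterOf]
  · simp [Fin.sum_univ_four, mricS, Matter.TT, Plane.g, matterOf, hl]; ring
  · simp [Fin.sum_univ_four, mricS, Matter.TT, Plane.g, matterOf, hl]; ring
  · fin_cases A <;>
    simp [Fin.sum_univ_four, mricS, Matter.TT, Plane.g, matterOf, Fields.eA, ang]

/-- The null constraint equations hold where the residuals vanish and the lapse is normalized. -/
theorem nullConstraints_of (hus : 0 < us) {ubs : ℝ} (he : EosOf P e)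
    (hl : ∀ x ∈ H0 ubs ∪ Hb0 us, (Φ 2).1 (Xi us x) = 0)
    (hlb : ∀ x ∈ Hb0 us, (Du us (Φ 2)).1 (Xi us x) = 0)
    (hl0 : ∀ x ∈ H0 ubs, (dy (Φ 2)).1 (Xi us x) = 0)
    (hr : ∀ x ∈ H0 ubs ∪ Hb0 us, (matterOf us e Φ).r1.1 (Xi us x) = 0 ∧
      (matterOf us e Φ).r00.1 (Xi us x) = 0 ∧ (matterOf us e Φ).r11.1 (Xi us x) = 0) :
    NullConstraints P us ubs (fieldsOf us Φ) := by
  have hlt : ∀ x ∈ H0 ubs ∪ Hb0 us, x 0 < us := by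
    rintro x (hx | hx)
    · rw [hx.1]; exact hus
    · exact hx.2.2
  have hL : ∀ x ∈ Hb0 us, x ∈ H0 ubs ∪ Hb0 us := fun x => Or.inr
  have hR : ∀ x ∈ H0 ubs, x ∈ H0 ubs ∪ Hb0 us := fun x => Or.inl
  refine ⟨fun x hx => ?_, fun x hx => ?_, fun x hx A => ?_, fun x hx => ?_, fun x hx => ?_,
    fun x hx A => ?_⟩
  · have h := hlt x (hL x hx)
    rw [((trχb_rep Φ hus).pd hus 0) x h, trχb_rep Φ hus x h, hatχb_rep Φ hus x h,
      (matterRic_values he h (hl x (hL x hx))).1]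
    -- With trχbar = 2∂_uρ and ∂_u l = 0, the vanishing of r₀₀ is the Raychaudhuri equation.
    have h1 := (hr x (hL x hx)).2.1
    have h2 := hlb x hx
    simp only [Matter.r00, matterOf, Sm.add_apply, Sm.sub_apply, Sm.mul_apply, h2, Sm.pow_apply,
      Sm.ofNat_apply] at h1
    have h3 : dS us 0 (2 * Du us (Φ 0)) = 2 * Du us (Du us (Φ 0)) := by
      change Du us (2 * Du us (Φ 0)) = _
      rw [Derivation.leibniz, Sm.deriv_ofNat]; simp
    rw [h3]
    simp only [Sm.mul_apply, Sm.pow_apply, Sm.ofNat_apply]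
    linarith
  · have h := hlt x (hL x hx)
    -- With K = 0, ζ = 0 and Ω = 1 the cross constraint is the equation r₁ = 0; the same residual
    -- serves on both hypersurfaces.
    have h1 := (hr x (hL x hx)).1
    have h2 := hlb x hx
    have h0 := hl x (hL x hx)
    rw [((trχ_rep Φ hus).pd hus 0) x h, trχb_rep Φ hus x h, trχ_rep Φ hus x h, K_rep Φ hus x h,
      div₁_rep Φ hus x h, normSq₁_rep Φ hus x h, (matterRic_values he h h0).2.2.1]
    have h3 : dS us 0 (2 * exp (-(2 * Φ 2)) * dy (Φ 0))
        = 2 * exp (-(2 * Φ 2)) * dy (Du us (Φ 0))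
          - 4 * exp (-(2 * Φ 2)) * Du us (Φ 2) * dy (Φ 0) := by
      change Du us (2 * exp (-(2 * Φ 2)) * dy (Φ 0)) = _
      rw [← Du_dy]
      simp only [Du_apply, dx_mul, dx_exp, map_neg, dx_ofNat]
      ring
    rw [h3]
    simp only [Matter.r1, matterOf, Sm.add_apply, Sm.sub_apply, Sm.mul_apply, h0,
      Sm.ofNat_apply, exp_apply] at h1
    simp only [Sm.sub_apply, Sm.mul_apply, Sm.ofNat_apply, exp_apply, Sm.neg_apply, h0, h2,
      Sm.zero_apply]
    simp only [mul_zero, Real.exp_zero, neg_zero] at h1 ⊢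
    linarith
  · have h := hlt x (hL x hx)
    rw [((ζ_rep Φ hus A).pd hus 0) x h, ζ_rep Φ hus A x h, div₂_rep Φ hus (χb_rep Φ hus) A x h,
      (trχb_rep Φ hus).pd hus (ang A) x h, ((matterRic_values he h (hl x (hL x hx))).2.2.2.2 A).1,
      dS_ang]
    simp
  · have h := hlt x (hR x hx)
    have h2 := hl0 x hx
    have h0 := hl x (hR x hx)
    rw [((trχ_rep Φ hus).pd hus 1) x h, trχ_rep Φ hus x h, hatχ_rep Φ hus x h,
      (matterRic_values he h h0).2.1]
    have h1 := (hr x (hR x hx)).2.2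
    have h3 : dS us 1 (2 * exp (-(2 * Φ 2)) * dy (Φ 0))
        = 2 * exp (-(2 * Φ 2)) * dy (dy (Φ 0))
          - 4 * exp (-(2 * Φ 2)) * dy (Φ 2) * dy (Φ 0) := by
      change dy (2 * exp (-(2 * Φ 2)) * dy (Φ 0)) = _
      simp only [dy_mul, dy_exp, map_neg, dy_ofNat]
      ring
    rw [h3]
    simp only [Matter.r11, matterOf, Sm.add_apply, Sm.sub_apply, Sm.mul_apply, h2, h0, Sm.pow_apply,
      Sm.ofNat_apply, exp_apply] at h1
    simp only [Sm.sub_apply, Sm.mul_apply, Sm.ofNat_apply, exp_apply, Sm.neg_apply, h0, h2,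
      Sm.pow_apply]
    simp only [mul_zero, Real.exp_zero, neg_zero] at h1 ⊢
    linarith
  · have h := hlt x (hR x hx)
    have h1 := (hr x (hR x hx)).1
    have h0 := hl x (hR x hx)
    rw [((trχb_rep Φ hus).pd hus 1) x h, trχb_rep Φ hus x h, trχ_rep Φ hus x h, K_rep Φ hus x h,
      div₁_rep Φ hus x h, normSq₁_rep Φ hus x h, (matterRic_values he h h0).2.2.2.1]
    have h3 : dS us 1 (2 * Du us (Φ 0)) = 2 * dy (Du us (Φ 0)) := by
      change dy (2 * Du us (Φ 0)) = _
      simp only [dy_mul, dy_ofNat]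
      ring
    rw [h3]
    simp only [Matter.r1, matterOf, Sm.add_apply, Sm.sub_apply, Sm.mul_apply, h0,
      Sm.ofNat_apply, exp_apply] at h1
    simp only [Sm.mul_apply, Sm.ofNat_apply, exp_apply, Sm.neg_apply, h0, Sm.zero_apply]
    simp only [mul_zero, Real.exp_zero, neg_zero] at h1 ⊢
    linarith
  · have h := hlt x (hR x hx)
    rw [((ζ_rep Φ hus A).pd hus 1) x h, ζ_rep Φ hus A x h, div₂_rep Φ hus (χ_rep Φ hus) A x h,
      (trχ_rep Φ hus).pd hus (ang A) x h, ((matterRic_values he h (hl x (hR x hx))).2.2.2.2 A).2,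
      dS_ang]
    simp

/-! ### The curvature component `αbar` -/

variable (e)

theorem riemann_rep (hus : 0 < us) (i j k l : Fin 4) :
    Rep us (riemann id (fieldsOf us Φ).metric i j k l)
      (∑ m, (matterOf us e Φ).g i m * riemR (matterOf us e Φ).d
        (fun i j k => (matterOf us e Φ).Γ i j k) m j k l) :=
  Rep.sum fun m => (metric_rep e Φ i m).mul (riem_rep hus (christoffel_rep e Φ hus) m j k l)

/-- As g₀₀ = g₀A = 0, the Weyl component is the Riemann component minus half of γ_AB Ric₀₀. The
terms in ∂_u²ρ, (∂_uρ)² and (∂_u w)² cancel and only the traceless part, linear in w, remains. -/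
theorem αb_values (hus : 0 < us) (e : Eos) {x : Pt} (hx : x 0 < us)
    (hl : (Du us (Φ 2)).1 (Xi us x) = 0) :
    (fieldsOf us Φ).αb 0 0 x = -((γS Φ 0 0).1 (Xi us x) * ((Du us (Du us (Φ 1))).1 (Xi us x)
      + 2 * (Du us (Φ 0)).1 (Xi us x) * (Du us (Φ 1)).1 (Xi us x))) ∧
    (fieldsOf us Φ).αb 1 1 x = (γS Φ 1 1).1 (Xi us x) * ((Du us (Du us (Φ 1))).1 (Xi us x)
      + 2 * (Du us (Φ 0)).1 (Xi us x) * (Du us (Φ 1)).1 (Xi us x)) ∧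
    (fieldsOf us Φ).αb 0 1 x = 0 := by
  obtain ⟨hr2, hr3, hr23⟩ := (matterOf us e Φ).riem_eq
  have hR : ∀ i j k l, riemann id (fieldsOf us Φ).metric i j k l x = _ :=
    fun i j k l => riemann_rep e hus i j k l x hx
  have hg : ∀ i j, (fieldsOf us Φ).metric x i j = _ := fun i j => metric_rep e Φ i j x hx
  have hric : ∀ i j, ricci id (fieldsOf us Φ).metric i j x = _ := fun i j => ricci_rep e Φ hus i j x hx
  have h3 : (fieldsOf us Φ).e3 x = ![1, 0, 0, 0] := rfl
  have hα : ∀ A B, (fieldsOf us Φ).αb A B x = (fieldsOf us Φ).weyl x (ang A) 0 (ang B) 0 := fun A B => by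
    simp [Fields.αb, h3, Fin.sum_univ_four]
  refine ⟨?_, ?_, ?_⟩
  · rw [hα, Fields.weyl]
    simp only [ang, Matrix.cons_val, hR, hg, hric, hr2]
    simp [Plane.g, Plane.ricT, Plane.ric00, matterOf, γS, hl]
    ring
  · rw [hα, Fields.weyl]
    simp only [ang, Matrix.cons_val, hR, hg, hric, hr3]
    simp [Plane.g, Plane.ricT, Plane.ric00, matterOf, γS, hl]
    ring
  · rw [hα, Fields.weyl]
    simp only [ang, Matrix.cons_val, hR, hg, hric, hr23]
    simp [Plane.g, Plane.ricT]

end Null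

end EinsteinEuler
end

/-! ### The equation of state and the flow with integrable weight -/

noncomputable section

namespace EinsteinEuler

open Sm

/-! ### Smooth cutoffs -/

/-- A smooth positive function equal to the identity on `[1, ∞)`. -/
def posId (r : ℝ) : ℝ := Real.smoothTransition (2 * r - 1) * r + (1 - Real.smoothTransition (2 * r - 1))

theorem posId_pos (r : ℝ) : 0 < posId r := by
  have h0 := Real.smoothTransition.nonneg (2 * r - 1)
  have h1 := Real.smoothTransition.le_one (2 * r - 1)
  unfold posId
  rcases le_or_gt (2 * r - 1) 0 with h | h
  · rw [Real.smoothTransition.zero_of_nonpos h]; norm_num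
  · rcases h0.eq_or_lt with h2 | h2
    · rw [← h2]; norm_num
    · nlinarith

theorem posId_eq {r : ℝ} (h : 1 ≤ r) : posId r = r := by
  unfold posId
  rw [Real.smoothTransition.one_of_one_le (by linarith)]; ring

theorem contDiff_posId : ContDiff ℝ ∞ posId := by
  have : ContDiff ℝ ∞ fun r : ℝ => Real.smoothTransition (2 * r - 1) :=
    Real.smoothTransition.contDiff.comp (by fun_prop)
  unfold posId
  fun_prop

/-- A smooth function equal to the logarithm on `[1/2, ∞)`. -/
def lg : Sm ℝ := Sm.mk (fun s => Real.log (posId (2 * s) / 2))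
  (ContDiff.log ((contDiff_posId.comp (by fun_prop)).div_const 2) fun s => by
    have := posId_pos (2 * s); positivity)

theorem lg_eq {s : ℝ} (h : 1 / 2 ≤ s) : lg.1 s = Real.log s := by
  change Real.log (posId (2 * s) / 2) = _
  rw [posId_eq (by linarith)]; congr 1; ring

theorem exp_lg {s : ℝ} (h : 1 / 2 ≤ s) : Real.exp (lg.1 s) = s := by
  rw [lg_eq h, Real.exp_log (by linarith)]

/-- A smooth function equal to the square root on `[1/2, ∞)`. -/
def sqS : Sm ℝ := exp (Sm.const (1 / 2) * lg)

theorem sqS_pos (s : ℝ) : 0 < sqS.1 s := Real.exp_pos _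

theorem sqS_sq {s : ℝ} (h : 1 / 2 ≤ s) : sqS.1 s ^ 2 = s := by
  change Real.exp (1 / 2 * lg.1 s) ^ 2 = s
  rw [← Real.exp_nat_mul, ← exp_lg h]
  congr 1
  rw [exp_lg h]
  push_cast
  ring

/-- A smooth function with values in `(-1/2, ∞)` equal to the identity on `[-1/4, ∞)`. -/
def clamp : Sm ℝ := Sm.mk (fun x => x * Real.smoothTransition (8 * (x + 3 / 8)))
  (contDiff_id.mul (Real.smoothTransition.contDiff.comp (by fun_prop)))

theorem clamp_eq {x : ℝ} (h : -(1 / 4) ≤ x) : clamp.1 x = x := by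
  change x * Real.smoothTransition (8 * (x + 3 / 8)) = x
  rw [Real.smoothTransition.one_of_one_le (by linarith), mul_one]

theorem neg_half_lt_clamp (x : ℝ) : -(1 / 2) < clamp.1 x := by
  change -(1 / 2) < x * Real.smoothTransition (8 * (x + 3 / 8))
  have h0 := Real.smoothTransition.nonneg (8 * (x + 3 / 8))
  have h1 := Real.smoothTransition.le_one (8 * (x + 3 / 8))
  rcases le_or_gt (8 * (x + 3 / 8)) 0 with h | h
  · rw [Real.smoothTransition.zero_of_nonpos h]; norm_num
  · nlinarith

/-! ### The equation of state -/

/-- In t = log τ one has σ' = τ(1 - p') > 0 everywhere. Positivity of h = τ + p is not available for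
small τ, but p is increasing, so h ≥ 1 as soon as τ > 1 + |P 1|. This fixes `ℓ`. -/
theorem exists_eos {P : ℝ → ℝ} (hP : ContDiffOn ℝ ∞ P (Set.Ioi 0))
    (hP' : ∀ t : ℝ, 0 < t → 0 < deriv P t ∧ deriv P t < 1) :
    ∃ e : Eos, EosOf P e := by
  have hPe : ContDiff ℝ ∞ fun t => P (Real.exp t) :=
    contDiffOn_univ.1 (hP.comp Real.contDiff_exp.contDiffOn fun t _ => Real.exp_pos t)
  have hdP : ∀ t, 0 < t → HasDerivAt P (deriv P t) t := fun t ht =>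
    ((hP.differentiableOn (by simp)).differentiableAt (isOpen_Ioi.mem_nhds ht)).hasDerivAt
  set h : Sm ℝ := Sm.mk _ (Real.contDiff_exp.add hPe) with hh
  set σ : Sm ℝ := Sm.mk _ (Real.contDiff_exp.sub hPe) with hσ
  have hσ' : ∀ t, 0 < (der σ).1 t := fun t => by
    have h1 : HasDerivAt σ.1 (Real.exp t - deriv P (Real.exp t) * Real.exp t) t :=
      (Real.hasDerivAt_exp t).sub ((hdP _ (Real.exp_pos t)).comp t (Real.hasDerivAt_exp t))
    rw [der_apply, h1.deriv]
    nlinarith [Real.exp_pos t, (hP' _ (Real.exp_pos t)).2]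
  have hmono : MonotoneOn P (Set.Ioi 0) := by
    refine monotoneOn_of_deriv_nonneg (convex_Ioi 0) hP.continuousOn ?_ ?_
    · rw [interior_Ioi]; exact hP.differentiableOn (by simp)
    · rw [interior_Ioi]; exact fun x hx => (hP' x hx).1.le
  have hge : ∀ t, Real.log (1 + |P 1|) < t → 1 ≤ h.1 t := fun t ht => by
    have h0 : 0 < 1 + |P 1| := by positivity
    have h1 : 1 + |P 1| < Real.exp t := by rwa [← Real.log_lt_iff_lt_exp h0]
    have h2 : P 1 ≤ P (Real.exp t) := hmono (Set.mem_Ioi.2 one_pos) (Set.mem_Ioi.2 (Real.exp_pos t))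
      (by linarith [abs_nonneg (P 1)])
    change 1 ≤ Real.exp t + P (Real.exp t)
    linarith [neg_abs_le (P 1)]
  refine ⟨⟨h, σ, exp (-(lg.of h)), Sm.mk _ ((der σ).smooth.inv fun t => (hσ' t).ne'),
    Real.log (1 + |P 1|), ?_, ?_⟩, fun t => ⟨rfl, rfl⟩⟩
  · ext t; exact inv_mul_cancel₀ (hσ' t).ne'
  · intro t ht
    have h1 : 1 ≤ h.1 t := hge t ht
    change Real.exp (-(lg.1 (h.1 t))) * h.1 t = 1
    rw [Real.exp_neg, exp_lg (by linarith)]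
    exact inv_mul_cancel₀ (by linarith)

/-! ### Ordinary differential equations with an integrable weight -/

section Flow

variable {E F : Type*} [NormedAddCommGroup E] [NormedSpace ℝ E]
  [NormedAddCommGroup F] [NormedSpace ℝ F]

-- The fixed point of the Picard map is sought among curves in the closed unit ball, and this
-- provides the a priori bound together with existence.
open Metric Set NNReal in
theorem exists_integral_curve [CompleteSpace E] {f : ℝ → E → E} {tmin tmax t₀ : ℝ}
    (ht₀ : t₀ ∈ Icc tmin tmax) {x₀ : E} {L K : ℝ≥0}
    (hlip : ∀ t ∈ Icc tmin tmax, LipschitzOnWith K (f t) (closedBall x₀ 1))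
    (hcont : ∀ x ∈ closedBall x₀ 1, ContinuousOn (f · x) (Icc tmin tmax))
    (hL : ∀ t ∈ Icc tmin tmax, ∀ x ∈ closedBall x₀ 1, ‖f t x‖ ≤ L)
    (hmul : L * (tmax - tmin) ≤ 1) :
    ∃ α : ℝ → E, α t₀ = x₀ ∧ (∀ t, α t ∈ closedBall x₀ 1) ∧
      ∀ t ∈ Icc tmin tmax, HasDerivWithinAt α (f t (α t)) (Icc tmin tmax) t := by
  have hf : IsPicardLindelof f (⟨t₀, ht₀⟩ : Icc tmin tmax) x₀ 1 0 L K := by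
    refine ⟨by simpa using hlip, by simpa using hcont, by simpa using hL, ?_⟩
    simp only [NNReal.coe_one, NNReal.coe_zero, sub_zero]
    refine le_trans (mul_le_mul_of_nonneg_left (max_le ?_ ?_) L.2) hmul
    · linarith [ht₀.1]
    · linarith [ht₀.2]
  have hx : x₀ ∈ closedBall x₀ ((0 : ℝ≥0) : ℝ) := by simp
  obtain ⟨α, hα⟩ := ODE.FunSpace.exists_isFixedPt_next hf hx
  refine ⟨α.compProj, ?_, fun t => by simpa using α.compProj_mem_closedBall hf.mul_max_le, fun t ht => ?_⟩
  · have := ODE.FunSpace.compProj_val (α := α) (t := ⟨t₀, ht₀⟩)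
    rw [this, ← hα, ODE.FunSpace.next_apply₀]
  · apply ODE.hasDerivWithinAt_picard_Icc ht₀ hf.continuousOn_uncurry
      α.continuous_compProj.continuousOn (fun _ _ => α.compProj_mem_closedBall hf.mul_max_le)
      x₀ ht |>.congr_of_mem _ ht
    intro t' ht'
    nth_rw 1 [← hα]
    rw [ODE.FunSpace.compProj_of_mem ht', ODE.FunSpace.next_apply]

theorem contDiffOn_of_hasDerivAt {I : Set ℝ} (hI : IsOpen I) {G : ℝ × E → E} {Y : ℝ → E}
    (hG : ContDiffOn ℝ ∞ G (I ×ˢ Set.univ)) (hY : ∀ x ∈ I, HasDerivAt Y (G (x, Y x)) x) :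
    ContDiffOn ℝ ∞ Y I := by
  rw [contDiffOn_infty]
  intro n
  induction n with
  | zero =>
    exact contDiffOn_zero.2 fun x hx => (hY x hx).continuousAt.continuousWithinAt
  | succ n ih =>
    rw [show ((n + 1 : ℕ) : WithTop ℕ∞) = (n : WithTop ℕ∞) + 1 by push_cast; rfl,
      contDiffOn_succ_iff_deriv_of_isOpen hI]
    refine ⟨fun x hx => (hY x hx).differentiableAt.differentiableWithinAt, by simp, ?_⟩
    refine ContDiffOn.congr (f := fun x => G (x, Y x)) ?_ fun x hx => (hY x hx).deriv
    exact (hG.of_le (by exact_mod_cast le_top)).comp (contDiffOn_id.prodMk ih) fun x hx => ⟨hx, trivial⟩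

open Metric Set NNReal Filter in
/-- Solutions of `Y' = T ^ (-2q) V(c, Y)`, where `T = t₀ + x`. -/
theorem exists_weighted_flow [FiniteDimensional ℝ E] [FiniteDimensional ℝ F] {q : ℝ} (hq : 1 / 2 < q)
    {V : F × E → E} (hV : ContDiff ℝ ∞ V) {Kc : Set F} (hKc : IsCompact Kc) (y₀ : E) :
    ∀ᶠ t₀ in atTop, ∀ c : ℝ → F, ContDiff ℝ ∞ c → (∀ x, c x ∈ Kc) → ∀ ys ∈ closedBall y₀ 1,
      ∃ Y : ℝ → E, ContDiff ℝ ∞ Y ∧ Y 0 = ys ∧ (∀ x, Y x ∈ closedBall ys 1) ∧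
        ∀ x, -(1 / 4) < x → HasDerivAt Y ((t₀ + x) ^ (-(2 * q)) • V (c x, Y x)) x := by
  have : CompleteSpace E := FiniteDimensional.complete ℝ E
  have : ProperSpace E := FiniteDimensional.proper ℝ E
  have hcomp : IsCompact (Kc ×ˢ closedBall y₀ 2) := hKc.prod (isCompact_closedBall y₀ 2)
  obtain ⟨K, hK⟩ := LocallyLipschitzOn.exists_lipschitzOnWith_of_compact hcomp
    ((hV.of_le (by simp)).locallyLipschitz (𝕂 := ℝ)).locallyLipschitzOn
  obtain ⟨M, hM⟩ := hcomp.exists_bound_of_continuousOn hV.continuous.continuousOn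
  obtain ⟨M', hM'⟩ : ∃ M' : ℝ≥0, (M' : ℝ) = max M 0 := ⟨⟨max M 0, le_max_right _ _⟩, rfl⟩
  have hMb : ∀ p ∈ Kc ×ˢ closedBall y₀ 2, ‖V p‖ ≤ M' := fun p hp =>
    (hM p hp).trans (by rw [hM']; exact le_max_left _ _)
  -- New time s = -T^{-a}, which maps T → ∞ to s = 0. Since ds = aT^{-a-1}dx and 2q = (a + 1) + a,
  -- the weight T^{-2q}dx becomes (-s/a)ds, bounded up to s = 0. This is where q > 1/2 enters.
  set a : ℝ := q - 1 / 2 with ha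
  have ha0 : 0 < a := by linarith
  -- Both the length of the s-interval and the size of the factor -s/a tend to zero with t₀ → ∞, so
  -- a unit ball is not left.
  have hlim : Tendsto (fun t₀ : ℝ => (t₀ - 1 / 2) ^ (-a)) atTop (nhds 0) :=
    (tendsto_rpow_neg_atTop ha0).comp (tendsto_atTop_add_const_right _ _ tendsto_id)
  have hlim2 : Tendsto (fun t₀ : ℝ => (t₀ - 1 / 2) ^ (-a) / a * M' * (t₀ - 1 / 2) ^ (-a)) atTop
      (nhds (0 / a * M' * 0)) := ((hlim.div_const a).mul_const _).mul hlim
  simp only [zero_div, zero_mul] at hlim2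
  filter_upwards [hlim2.eventually_le_const one_pos, eventually_gt_atTop 1] with t₀ hsm ht₀ c hc hcK
    ys hys
  have hball : closedBall ys 1 ⊆ closedBall y₀ 2 := closedBall_subset_closedBall' (by
    rw [mem_closedBall] at hys; linarith)
  -- Half a unit of room to the left of x = 0, so that the corner is an interior point.
  set T1 := t₀ - 1 / 2 with hT1
  have hT1p : 0 < T1 := by linarith
  have hsmin : 0 < T1 ^ (-a) := Real.rpow_pos_of_pos hT1p _
  set xs : ℝ → ℝ := fun s => (-s) ^ (-(1 / a)) - t₀ with hxs
  set f : ℝ → E → E := fun s y => (-s / a) • V (c (xs s), y) with hf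
  have hs0 : ∀ s ∈ Icc (-T1 ^ (-a)) 0, 0 ≤ -s / a ∧ -s / a ≤ T1 ^ (-a) / a := fun s hs =>
    ⟨div_nonneg (by linarith [hs.2]) ha0.le, by gcongr; linarith [hs.1]⟩
  have hVb : ∀ x, ∀ y ∈ closedBall ys 1, ‖V (c x, y)‖ ≤ M' := fun x y hy =>
    hMb _ ⟨hcK x, hball hy⟩
  have hsx : ∀ x, -(1 / 2) < x → -(t₀ + x) ^ (-a) ∈ Ioo (-T1 ^ (-a)) 0 := fun x hx => by
    have h1 : (t₀ + x) ^ (-a) < T1 ^ (-a) :=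
      Real.rpow_lt_rpow_of_neg hT1p (by linarith) (by linarith)
    have h2 : 0 < (t₀ + x) ^ (-a) := Real.rpow_pos_of_pos (by linarith) _
    exact ⟨by linarith, by linarith⟩
  obtain ⟨La, hLa⟩ : ∃ La : ℝ≥0, (La : ℝ) = T1 ^ (-a) / a := ⟨⟨_, by positivity⟩, rfl⟩
  have hL : T1 ^ (-a) / a * M' = (La * M' : ℝ≥0) := by push_cast; rw [hLa]
  obtain ⟨α, hα0, hαb, hα⟩ := exists_integral_curve (f := f) (x₀ := ys)
    (L := La * M') (K := La * K) (Ioo_subset_Icc_self (hsx 0 (by norm_num)))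
    (fun s hs => by
      refine LipschitzOnWith.of_dist_le_mul fun y hy y' hy' => ?_
      have h1 := hK.dist_le_mul _ (⟨hcK (xs s), hball hy⟩ : (c (xs s), y) ∈ Kc ×ˢ closedBall y₀ 2) _
        (⟨hcK (xs s), hball hy'⟩ : (c (xs s), y') ∈ Kc ×ˢ closedBall y₀ 2)
      have h2 : dist (c (xs s), y) (c (xs s), y') = dist y y' := by simp [Prod.dist_eq]
      rw [h2] at h1
      simp only [hf]
      rw [dist_smul₀, Real.norm_of_nonneg (hs0 s hs).1]
      calc -s / a * dist (V (c (xs s), y)) (V (c (xs s), y'))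
          ≤ T1 ^ (-a) / a * (K * dist y y') := by
            gcongr
            linarith [hs.1]
        _ = _ := by push_cast; rw [hLa, mul_assoc])
    (fun y hy s hs => by
      rcases hs.2.lt_or_eq with h | h
      · refine ContinuousAt.continuousWithinAt ?_
        have h1 : ContinuousAt xs s := by
          refine ContinuousAt.sub (ContinuousAt.rpow_const (by fun_prop) (Or.inl (by linarith)))
            continuousAt_const
        exact ContinuousAt.smul (by fun_prop) (hV.continuous.continuousAt.comp
          ((hc.continuous.continuousAt.comp h1).prodMk continuousAt_const))
      -- At s = 0, that is x = ∞, the control c need not have a limit; the factor s and the bound on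
      -- V give continuity nevertheless.
      · subst h
        refine ContinuousAt.continuousWithinAt ?_
        rw [ContinuousAt, show f 0 y = 0 by simp [hf]]
        have h1 : Tendsto (fun s : ℝ => |s| / a * (M' : ℝ)) (nhds 0) (nhds 0) := by
          have : Continuous fun s : ℝ => |s| / a * (M' : ℝ) := by fun_prop
          simpa using this.tendsto 0
        refine squeeze_zero_norm (fun s => ?_) h1
        simp only [hf]
        rw [norm_smul, norm_div, norm_neg, Real.norm_eq_abs, Real.norm_of_nonneg ha0.le]
        gcongr
        exact hVb _ y hy)
    (fun s hs y hy => by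
      simp only [hf]
      rw [norm_smul, Real.norm_of_nonneg (hs0 s hs).1, ← hL]
      exact mul_le_mul (hs0 s hs).2 (hVb _ y hy) (norm_nonneg _) (by positivity))
    (by rw [← hL]; simpa using hsm)
  set Z : ℝ → E := fun x => α (-(t₀ + x) ^ (-a)) with hZ
  have hZd : ∀ x ∈ Ioi (-(1 / 2) : ℝ), HasDerivAt Z ((t₀ + x) ^ (-(2 * q)) • V (c x, Z x)) x := by
    intro x hx
    have hT : 0 < t₀ + x := by linarith [show -(1 / 2) < x from hx]
    have h1 : HasDerivAt (fun x => -(t₀ + x) ^ (-a)) (-(1 * (-a) * (t₀ + x) ^ (-a - 1))) x :=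
      (((hasDerivAt_id x).const_add t₀).rpow_const (Or.inl hT.ne')).neg
    have h2 := (hα _ (Ioo_subset_Icc_self (hsx x hx))).hasDerivAt (Icc_mem_nhds (hsx x hx).1 (hsx x hx).2)
    have h3 := HasDerivAt.scomp x h2 h1
    have h4 : xs (-(t₀ + x) ^ (-a)) = x := by
      simp only [hxs, neg_neg]
      rw [← Real.rpow_mul hT.le, show -a * -(1 / a) = 1 by field_simp, Real.rpow_one]; ring
    refine h3.congr_deriv ?_
    simp only [hf, h4, smul_smul]
    congr 1
    have h5 : (t₀ + x) ^ (-(2 * q)) = (t₀ + x) ^ (-a - 1) * (t₀ + x) ^ (-a) := by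
      rw [← Real.rpow_add hT]; congr 1; rw [ha]; ring
    rw [h5]
    field_simp
  have hZs : ContDiffOn ℝ ∞ Z (Ioi (-(1 / 2))) := by
    refine contDiffOn_of_hasDerivAt (G := fun p => (t₀ + p.1) ^ (-(2 * q)) • V (c p.1, p.2))
      isOpen_Ioi ?_ hZd
    refine ContDiffOn.smul ?_ (hV.comp ((hc.comp contDiff_fst).prodMk contDiff_snd)).contDiffOn
    refine ContDiffOn.rpow_const_of_ne (by fun_prop) fun p hp => ?_
    have : -(1 / 2) < p.1 := hp.1
    linarith
  -- Reparametrizing by `clamp` makes the curve smooth on all of ℝ without changing it for x > -1/4.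
  refine ⟨Z ∘ clamp.1, ?_, ?_, fun x => hαb _, fun x hx => ?_⟩
  · exact contDiffOn_univ.1 (hZs.comp clamp.smooth.contDiffOn fun x _ => neg_half_lt_clamp x)
  · simp only [Function.comp_apply]
    rw [clamp_eq (by norm_num)]
    exact hα0
  · have h1 := hZd x (by rw [mem_Ioi]; linarith)
    have h2 : Z ∘ clamp.1 =ᶠ[nhds x] Z := by
      filter_upwards [Ioi_mem_nhds hx] with x' hx'
      simp only [Function.comp_apply]
      rw [clamp_eq (le_of_lt hx')]
    rw [h2.eq_of_nhds]
    exact h1.congr_of_eventuallyEq h2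

end Flow

end EinsteinEuler
end

/-! ### The controls and the transport of jets on the singular hypersurface -/

noncomputable section

namespace EinsteinEuler

open Sm

/-! ### The weights along the singular hypersurface -/

section Weights

variable (q t₀ : ℝ)

/-- `log T` with `T = t₀ + x`. -/
def lT : Sm ℝ := lg.of (Sm.const t₀ + clamp)

/-- The weight `T ^ (2q)`. -/
def θS : Sm ℝ := exp (Sm.const (2 * q) * lT t₀)

/-- The derivative of `ρ`. -/
def rS : Sm ℝ := Sm.const (t₀ ^ (-(4 * q))) * exp (-clamp) - exp (-(Sm.const (4 * q) * lT t₀))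

/-- θρ_x. The choice of `rS` vanishes at the corner, so that trχbar vanishes there in spite of the
factor u_*⁻¹, and for x > -1/4 it satisfies ρ_xx + ρ_x = -(1 - 4q/T)T^{-4q}. -/
def z0S : Sm ℝ := θS q t₀ * rS q t₀

/-- For x > -1/4 this is -θ²(ρ_xx + ρ_x + ρ_x²), which the Raychaudhuri equation equates with
(θw_x)² plus the matter term. -/
def νS : Sm ℝ := 1 - Sm.const (4 * q) * exp (-lT t₀) - z0S q t₀ ^ 2

/-- θ(u_* - u) with u_* = e^{-t₀}, the size of the matter terms relative to the weight. -/
def mS : Sm ℝ := θS q t₀ * (Sm.const (Real.exp (-t₀)) * exp (-clamp))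

def ctrl (x : ℝ) : ℝ × ℝ × ℝ := ((z0S q t₀).1 x, (νS q t₀).1 x, (mS q t₀).1 x)

theorem contDiff_ctrl : ContDiff ℝ ∞ (ctrl q t₀) :=
  (z0S q t₀).smooth.prodMk ((νS q t₀).smooth.prodMk (mS q t₀).smooth)

variable {q t₀}

theorem add_clamp_pos (h : 1 ≤ t₀) (x : ℝ) : 1 / 2 < t₀ + clamp.1 x := by
  linarith [neg_half_lt_clamp x]

theorem lT_apply (h : 1 ≤ t₀) (x : ℝ) : (lT t₀).1 x = Real.log (t₀ + clamp.1 x) :=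
  lg_eq (add_clamp_pos h x).le

theorem exp_mul_lT (h : 1 ≤ t₀) (p x : ℝ) :
    Real.exp (p * (lT t₀).1 x) = (t₀ + clamp.1 x) ^ p := by
  rw [lT_apply h, Real.rpow_def_of_pos (by linarith [add_clamp_pos h x]), mul_comm]

theorem θS_apply (h : 1 ≤ t₀) (x : ℝ) : (θS q t₀).1 x = (t₀ + clamp.1 x) ^ (2 * q) :=
  exp_mul_lT h _ x

/-- For c ≥ 0, (1 + c/t₀)^{2q} ≤ e^{2qc/t₀} ≤ e^c as soon as t₀ ≥ 2q; for c between -1/2 and 0 the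
exponential is below 2. -/
theorem exp_neg_clamp_mul_le (hq : 0 < q) (h1 : 1 ≤ t₀) (h : 2 * q ≤ t₀) (x : ℝ) :
    Real.exp (-clamp.1 x) * (t₀ + clamp.1 x) ^ (2 * q) ≤ 2 * t₀ ^ (2 * q) := by
  have ht : 0 < t₀ := by linarith
  have hT := add_clamp_pos h1 x
  have hc := neg_half_lt_clamp x
  set c := clamp.1 x
  have hp : 0 < t₀ ^ (2 * q) := Real.rpow_pos_of_pos ht _
  rcases le_or_gt 0 c with h0 | h0
  · have h2 : (t₀ + c) ^ (2 * q) ≤ t₀ ^ (2 * q) * Real.exp c := by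
      rw [show t₀ + c = t₀ * (1 + c / t₀) by field_simp, Real.mul_rpow ht.le (by positivity)]
      gcongr
      calc (1 + c / t₀) ^ (2 * q) ≤ (Real.exp (c / t₀)) ^ (2 * q) := by
            gcongr
            linarith [Real.add_one_le_exp (c / t₀)]
        _ = Real.exp (c * (2 * q / t₀)) := by rw [← Real.exp_mul]; congr 1; ring
        _ ≤ Real.exp c := by
            gcongr
            exact mul_le_of_le_one_right h0 ((div_le_one ht).2 h)
    calc Real.exp (-c) * (t₀ + c) ^ (2 * q) ≤ Real.exp (-c) * (t₀ ^ (2 * q) * Real.exp c) := by gcongr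
      _ = t₀ ^ (2 * q) := by rw [Real.exp_neg]; field_simp
      _ ≤ _ := by linarith
  · have h2 : Real.exp (-c) ≤ 2 := by
      have : Real.exp (-c) ≤ Real.exp (1 / 2) := by gcongr; linarith
      have h3 : Real.exp (1 / 2) ^ 2 = Real.exp 1 := by rw [← Real.exp_nat_mul]; norm_num
      have h4 := Real.exp_one_lt_d9
      nlinarith [Real.exp_pos (1 / 2)]
    exact mul_le_mul h2 (Real.rpow_le_rpow (by linarith) (by linarith) (by linarith))
      (Real.rpow_nonneg (by linarith) _) (by norm_num)

-- Uniformly in x, θρ_x is O(t₀^{-2q}), ν - 1 is O(t₀^{-1} + t₀^{-4q}) and m is O(t₀^{2q}e^{-t₀}).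
-- So the controls lie near (0, 1, 0) for t₀ large.
open Filter in
theorem eventually_ctrl_mem (hq : 0 < q) {δ : ℝ} (hδ : 0 < δ) :
    ∀ᶠ t₀ in atTop, ∀ x, ctrl q t₀ x ∈ Metric.closedBall (0, 1, 0) δ := by
  have hA : Tendsto (fun t₀ : ℝ => 3 * (t₀ - 1 / 2) ^ (-(2 * q))) atTop (nhds (3 * 0)) :=
    ((tendsto_rpow_neg_atTop (by linarith)).comp
      (tendsto_atTop_add_const_right _ _ tendsto_id)).const_mul 3
  have hB : Tendsto (fun t₀ : ℝ => 4 * q * (t₀ - 1 / 2)⁻¹) atTop (nhds (4 * q * 0)) :=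
    (tendsto_inv_atTop_zero.comp (tendsto_atTop_add_const_right _ _ tendsto_id)).const_mul (4 * q)
  have hM : Tendsto (fun t₀ : ℝ => 2 * (t₀ ^ (2 * q) * Real.exp (-1 * t₀))) atTop (nhds (2 * 0)) :=
    (tendsto_rpow_mul_exp_neg_mul_atTop_nhds_zero _ _ one_pos).const_mul 2
  have hAB : Tendsto (fun t₀ : ℝ => 4 * q * (t₀ - 1 / 2)⁻¹ + (3 * (t₀ - 1 / 2) ^ (-(2 * q))) ^ 2)
      atTop (nhds (4 * q * 0 + (3 * 0) ^ 2)) := hB.add (hA.pow 2)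
  norm_num only at hA hAB hM
  rw [mul_zero] at hAB
  filter_upwards [hA.eventually_le_const hδ, hAB.eventually_le_const (by simpa using hδ),
    hM.eventually_le_const hδ, eventually_ge_atTop 1, eventually_ge_atTop (2 * q)]
    with t₀ h1 h2 h3 h4 h5 x
  have ht : 0 < t₀ := by linarith
  have hT := add_clamp_pos h4 x
  have hc := neg_half_lt_clamp x
  have hexp := exp_neg_clamp_mul_le hq h4 h5 x
  have hTp : 0 < t₀ + clamp.1 x := by linarith
  have hmono : (t₀ + clamp.1 x) ^ (-(2 * q)) ≤ (t₀ - 1 / 2) ^ (-(2 * q)) :=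
    Real.rpow_le_rpow_of_nonpos (by linarith) (by linarith) (by linarith)
  have hmono' : t₀ ^ (-(2 * q)) ≤ (t₀ - 1 / 2) ^ (-(2 * q)) :=
    Real.rpow_le_rpow_of_nonpos (by linarith) (by linarith) (by linarith)
  have hz : (z0S q t₀).1 x = t₀ ^ (-(4 * q)) *
      (Real.exp (-clamp.1 x) * (t₀ + clamp.1 x) ^ (2 * q)) - (t₀ + clamp.1 x) ^ (-(2 * q)) := by
    have e1 : (rS q t₀).1 x = t₀ ^ (-(4 * q)) * Real.exp (-clamp.1 x)
        - (t₀ + clamp.1 x) ^ (-(4 * q)) := by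
      rw [← exp_mul_lT h4, neg_mul]; rfl
    have e2 : (t₀ + clamp.1 x) ^ (-(2 * q))
        = (t₀ + clamp.1 x) ^ (2 * q) * (t₀ + clamp.1 x) ^ (-(4 * q)) := by
      rw [← Real.rpow_add hTp]; congr 1; ring
    rw [z0S, Sm.mul_apply, θS_apply h4, e1, e2]; ring
  have hz1 : |(z0S q t₀).1 x| ≤ 3 * (t₀ - 1 / 2) ^ (-(2 * q)) := by
    have e1 : t₀ ^ (-(4 * q)) * (2 * t₀ ^ (2 * q)) = 2 * t₀ ^ (-(2 * q)) := by
      have : t₀ ^ (-(2 * q)) = t₀ ^ (-(4 * q)) * t₀ ^ (2 * q) := by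
        rw [← Real.rpow_add ht]; congr 1; ring
      rw [this]; ring
    have e2 : t₀ ^ (-(4 * q)) * (Real.exp (-clamp.1 x) * (t₀ + clamp.1 x) ^ (2 * q))
        ≤ 2 * t₀ ^ (-(2 * q)) := by
      rw [← e1]; gcongr
    have e3 : 0 ≤ t₀ ^ (-(4 * q)) * (Real.exp (-clamp.1 x) * (t₀ + clamp.1 x) ^ (2 * q)) := by
      positivity
    have e4 : 0 ≤ (t₀ + clamp.1 x) ^ (-(2 * q)) := by positivity
    rw [hz, abs_le]
    constructor <;> linarith
  have hν : |(νS q t₀).1 x - 1| ≤ 4 * q * (t₀ - 1 / 2)⁻¹ + (3 * (t₀ - 1 / 2) ^ (-(2 * q))) ^ 2 := by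
    have e1 : (νS q t₀).1 x = 1 - 4 * q * (t₀ + clamp.1 x)⁻¹ - (z0S q t₀).1 x ^ 2 := by
      have : Real.exp (-(lT t₀).1 x) = (t₀ + clamp.1 x)⁻¹ := by
        rw [← Real.rpow_neg_one, ← exp_mul_lT h4, neg_one_mul]
      rw [← this]; rfl
    have e2 : (t₀ + clamp.1 x)⁻¹ ≤ (t₀ - 1 / 2)⁻¹ := by
      gcongr
      · linarith
      · linarith
    have e3 : (z0S q t₀).1 x ^ 2 ≤ (3 * (t₀ - 1 / 2) ^ (-(2 * q))) ^ 2 := by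
      rw [← sq_abs]; gcongr
    have e4 : 0 ≤ 4 * q * (t₀ + clamp.1 x)⁻¹ := by positivity
    have e5 : 4 * q * (t₀ + clamp.1 x)⁻¹ ≤ 4 * q * (t₀ - 1 / 2)⁻¹ := by gcongr
    rw [e1, abs_le]
    constructor <;> nlinarith [sq_nonneg ((z0S q t₀).1 x), sq_nonneg (3 * (t₀ - 1 / 2) ^ (-(2 * q)))]
  have hm : |(mS q t₀).1 x| ≤ 2 * (t₀ ^ (2 * q) * Real.exp (-1 * t₀)) := by
    have e1 : (mS q t₀).1 x
        = Real.exp (-1 * t₀) * (Real.exp (-clamp.1 x) * (t₀ + clamp.1 x) ^ (2 * q)) := by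
      rw [← θS_apply h4]
      change (θS q t₀).1 x * (Real.exp (-t₀) * Real.exp (-clamp.1 x)) = _
      rw [neg_one_mul]; ring
    rw [e1, abs_of_nonneg (by positivity)]
    calc _ ≤ Real.exp (-1 * t₀) * (2 * t₀ ^ (2 * q)) := by gcongr
      _ = _ := by ring
  simp only [Metric.mem_closedBall, ctrl, Prod.dist_eq, Real.dist_eq, sub_zero, sup_le_iff]
  exact ⟨hz1.trans h1, hν.trans h2, hm.trans h3⟩

end Weights

/-! ### The system of ordinary differential equations for the jets -/

variable (e : Eos)

/-- The state with given jets satisfying the constraint along the hypersurface. -/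
def hbState (p : (ℝ × ℝ × ℝ) × YS) : St :=
  -- θw_x is the square root dictated by `exx`; the entry 0 for θl_x keeps Ω = 1.
  (p.2, ![p.1.1, sqS.1 (p.1.2.1 - 1 / 2 * e.h.1 (p.2 3 0) * Real.exp (-(2 * p.2 4 0)) * p.1.2.2 ^ 2), 0],
    p.1.2.2)

theorem contDiff_hbState : ContDiff ℝ ∞ (hbState e) := by
  have h1 : ContDiff ℝ ∞ fun p : (ℝ × ℝ × ℝ) × YS => e.h.1 (p.2 3 0) :=
    e.h.smooth.comp (by fun_prop)
  have h2 : ContDiff ℝ ∞ fun p : (ℝ × ℝ × ℝ) × YS =>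
      sqS.1 (p.1.2.1 - 1 / 2 * e.h.1 (p.2 3 0) * Real.exp (-(2 * p.2 4 0)) * p.1.2.2 ^ 2) :=
    sqS.smooth.comp (by fun_prop)
  refine contDiff_snd.prodMk ((contDiff_pi.2 fun i => ?_).prodMk (by fun_prop))
  fin_cases i
  · exact contDiff_fst.comp contDiff_fst
  · exact h2
  · exact contDiff_const

/-- The weighted `x`-derivatives of the unknowns. -/
def xdot : Fin 5 → Sm St := ![zc 0, zc 1, zc 2, qt e, qψ e]

/-- The weighted `x`-derivatives of the jets. The top order jets of the fluid are kept fixed. -/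
def jetField (p : (ℝ × ℝ × ℝ) × YS) : YS := fun i k =>
  -- The x-derivatives of t and ψ involve one y-derivative more, so the equation for the slot of
  -- order eight would need order nine. The evolution equations are therefore obtained to order
  -- eight only.
  if 3 ≤ i ∧ k = 8 then 0 else ((LL e)^[k] (xdot e i)).1 (hbState e p)

theorem contDiff_jetField : ContDiff ℝ ∞ (jetField e) := by
  refine contDiff_pi.2 fun i => contDiff_pi.2 fun k => ?_
  by_cases h : 3 ≤ i ∧ k = 8
  · simp only [jetField, h, and_self, if_true]; exact contDiff_const
  · simp only [jetField, h, if_false]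
    exact ((LL e)^[k] (xdot e i)).smooth.comp (contDiff_hbState e)

/-- `Y` solves the equations for the jets. -/
def JetFlow (q t₀ : ℝ) (Y : ℝ → YS) : Prop := ∀ x, -(1 / 4) < x →
  HasDerivAt Y ((t₀ + x) ^ (-(2 * q)) • jetField e (ctrl q t₀ x, Y x)) x

/-- The derivatives of `Φ` in the `y`-direction along `y = 0` are `Y`. -/
def HasJets (Φ : Fl) (Y : ℝ → YS) : Prop := ∀ i (k : Fin 9) x, (dy^[k] (Φ i)).1 (x, 0) = Y x i k

variable {e} {q t₀ : ℝ} {Y : ℝ → YS} {Φ : Fl}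

theorem JetFlow.coord (hY : JetFlow e q t₀ Y) (h1 : 1 ≤ t₀) {x : ℝ} (hx : -(1 / 4) < x) (i : Fin 5)
    (k : Fin 9) : (θS q t₀).1 x * deriv (fun x => Y x i k) x = jetField e (ctrl q t₀ x, Y x) i k := by
  have h2 : HasDerivAt (fun x => Y x i k) _ x := hasDerivAt_pi.1 (hasDerivAt_pi.1 (hY x hx) i) k
  have h3 : 0 < t₀ + x := by linarith
  rw [h2.deriv, θS_apply h1, clamp_eq hx.le, Pi.smul_apply, Pi.smul_apply, smul_eq_mul, ← mul_assoc,
    ← Real.rpow_add h3, add_neg_cancel, Real.rpow_zero, one_mul]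

theorem HasJets.dx (hJ : HasJets Φ Y) (i : Fin 5) (k : Fin 9) (x : ℝ) :
    (dx (dy^[k] (Φ i))).1 (x, 0) = deriv (fun x => Y x i k) x := by
  rw [← (hasDerivAt_fst (dy^[k] (Φ i)) x 0).deriv]
  congr 1
  funext x
  exact hJ i k x

/-- The weighted `x`-derivatives of `ρ, w, l`. -/
def zOf (q t₀ : ℝ) (Φ : Fl) (i : Fin 3) : S2 := X (θS q t₀) * dx (Φ (Fin.castLE (by omega) i))

theorem jet_eq (hY : JetFlow e q t₀ Y) (h1 : 1 ≤ t₀) (hJ : HasJets Φ Y) {x : ℝ} (hx : -(1 / 4) < x) :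
    jet Φ (zOf q t₀ Φ) (θS q t₀ * exp (2 * phiS (Real.exp (-t₀)))) (x, 0)
      = hbState e (ctrl q t₀ x, Y x) := by
  have hz : ∀ i : Fin 3, (zOf q t₀ Φ i).1 (x, 0)
      = jetField e (ctrl q t₀ x, Y x) (Fin.castLE (by omega) i) 0 := fun i => by
    rw [← hY.coord h1 hx, ← hJ.dx]; rfl
  refine Prod.ext (funext fun i => funext fun k => hJ i k x) (Prod.ext (funext fun i => ?_) ?_)
  · change (zOf q t₀ Φ i).1 (x, 0) = _
    rw [hz i]
    fin_cases i <;> rfl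
  · change (θS q t₀).1 x * (exp (2 * phiS (Real.exp (-t₀)))).1 x = (mS q t₀).1 x
    rw [exp_phiS (Real.exp_pos _), mS, Sm.mul_apply]
    simp [clamp_eq hx.le]

theorem res_of_jets (hY : JetFlow e q t₀ Y) (h1 : 1 ≤ t₀) (hJ : HasJets Φ Y) :
    (∀ i, zres e Φ (zOf q t₀ Φ) (θS q t₀ * exp (2 * phiS (Real.exp (-t₀)))) i
      ∈ van (line (Set.Ioi (-(1 / 4)))) 8) ∧
    ft e Φ (zOf q t₀ Φ) (θS q t₀) (θS q t₀ * exp (2 * phiS (Real.exp (-t₀))))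
      ∈ van (line (Set.Ioi (-(1 / 4)))) 8 ∧
    fψ e Φ (zOf q t₀ Φ) (θS q t₀) (θS q t₀ * exp (2 * phiS (Real.exp (-t₀))))
      ∈ van (line (Set.Ioi (-(1 / 4)))) 8 := by
  have key : ∀ (i : Fin 5) (k : ℕ) (hk : k < 9), ¬(3 ≤ i ∧ (⟨k, hk⟩ : Fin 9) = 8) → ∀ x, -(1 / 4) < x →
      (θS q t₀).1 x * (dx (dy^[k] (Φ i))).1 (x, 0) = ((LL e)^[k] (xdot e i)).1
        (jet Φ (zOf q t₀ Φ) (θS q t₀ * exp (2 * phiS (Real.exp (-t₀)))) (x, 0)) := by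
    intro i k hk h x hx
    have h2 := hJ.dx i ⟨k, hk⟩ x
    rw [jet_eq hY h1 hJ hx]
    simp only at h2
    rw [h2, hY.coord h1 hx, jetField, if_neg h]
  refine res_mem_of_ode (fun i => rfl) (fun i k hk x hx => ?_) (fun k hk x hx => ?_) fun k hk x hx => ?_
  · rw [key _ k (by omega) (by fin_cases i <;> simp) x hx]
    fin_cases i <;> rfl
  · exact key 3 k (by omega) (by simp [Fin.ext_iff]; omega) x hx
  · exact key 4 k (by omega) (by simp [Fin.ext_iff]; omega) x hx

theorem θS_inv : exp (-(Sm.const (2 * q) * lT t₀)) * θS q t₀ = 1 := exp_neg_mul _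

theorem evol_of_jets (hY : JetFlow e q t₀ Y) (h1 : 1 ≤ t₀) (hJ : HasJets Φ Y)
    (ht : ∀ x, e.ℓ < Y x 3 0) (k : Fin 5) :
    evol e (hatF Φ (phiS (Real.exp (-t₀)))) k ∈ van (line (Set.Ioi (-(1 / 4)))) 8 := by
  obtain ⟨h2, h3, h4⟩ := res_of_jets hY h1 hJ
  refine evol_mem_of_res θS_inv rfl rfl rfl ?_ h2 h3 h4 k
  rintro ⟨x, y⟩ ⟨-, rfl⟩
  have := hJ 3 0 x
  simp only [Fin.val_zero, Function.iterate_zero, id_eq] at this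
  rw [this]
  exact ht x

end EinsteinEuler
end

/-! ### Base data at the corner and fields along the singular hypersurface -/

noncomputable section

namespace EinsteinEuler

open Sm

/-! ### Data determined by the constraint on the regular hypersurface -/

section Base

variable (e : Eos)

/-- The coefficient of the constraint solved for the velocity. -/
def psiArg (ρ t : Sm ℝ) : Sm ℝ := -(2 * (der (der ρ) + der ρ ^ 2)) * e.hi.of t

/-- The velocity variable determined by the constraint. -/
def psiOf (ρ t : Sm ℝ) : Sm ℝ := Sm.const (1 / 2) * lg.of (psiArg e ρ t)

theorem psiOf_spec {ρ t : Sm ℝ} {y : ℝ} (h : 1 / 2 ≤ (psiArg e ρ t).1 y) (ht : e.ℓ < t.1 y) :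
    2 * (der (der ρ)).1 y + 2 * (der ρ).1 y ^ 2
      + Real.exp (2 * (psiOf e ρ t).1 y) * e.h.1 (t.1 y) = 0 := by
  have h1 : Real.exp (2 * (psiOf e ρ t).1 y) = (psiArg e ρ t).1 y := by
    rw [← exp_lg h]
    congr 1
    change 2 * (1 / 2 * lg.1 _) = _
    ring
  have h2 := e.hi_mul _ ht
  rw [h1]
  change _ + -(2 * ((der (der ρ)).1 y + (der ρ).1 y ^ 2)) * e.hi.1 (t.1 y) * e.h.1 (t.1 y) = 0
  linear_combination -(2 * ((der (der ρ)).1 y + (der ρ).1 y ^ 2)) * h2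

theorem iterate_dy_Y (d : Sm ℝ) (n : ℕ) : dy^[n] (Y d) = Y (der^[n] d) := by
  induction n with
  | zero => rfl
  | succ n ih => rw [Function.iterate_succ_apply', ih, dy_Y, Function.iterate_succ_apply']

theorem iterate_der_eq_zero {g : Sm ℝ} {y : ℝ} (h : ∀ᶠ y' in nhds y, g.1 y' = 0) (n : ℕ) :
    ∀ᶠ y' in nhds y, (der^[n] g).1 y' = 0 := by
  induction n with
  | zero => exact h
  | succ n ih =>
    filter_upwards [ih.eventually_nhds] with y' hy'
    rw [Function.iterate_succ_apply', der_apply, Filter.EventuallyEq.deriv_eq (f := fun _ => 0) hy']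
    simp

/-- The left side of the constraint for data on the regular hypersurface. -/
def eyyD (d : Fin 5 → Sm ℝ) : Sm ℝ := 2 * der (der (d 0)) + 2 * der (d 0) ^ 2
  - 4 * der (d 2) * der (d 0) + 2 * der (d 1) ^ 2 + exp (2 * d 2) * exp (2 * d 4) * e.h.of (d 3)

theorem eyy_Y (d : Fin 5 → Sm ℝ) : eyy e (fun i => Y (d i)) = Y (eyyD e d) := by
  simp only [eyy, dy_Y]
  rfl

theorem restr'_eyy (Φ : Fl) : restr' (eyy e Φ) = eyyD e fun i => restr' (Φ i) := by
  simp only [eyyD, der_restr']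
  rfl

theorem eyy_hatF (Φ : Fl) (φ : Sm ℝ) : eyy e (hatF Φ φ) = eyy e Φ := by
  simp only [eyy, hatF, Matrix.cons_val, map_add, dy_X, add_zero]
  rw [← exp_add, ← exp_add]
  congr 3
  ring

/-- The base data at the corner, with `w = s`. -/
def baseD (s : ℝ) : Fin 5 → Sm ℝ :=
  -- With this quadratic ρ the constraint at y = 0 reads e^{2ψ} = 1, so ψ starts at zero. The value
  -- t = `ℓ` + 2 leaves t above `ℓ` when the jets move by at most one.
  let ρ : Sm ℝ := Sm.mk (fun y => -(e.h.1 (e.ℓ + 2) / 4) * y ^ 2) (by fun_prop)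
  ![ρ, Sm.const s, 0, Sm.const (e.ℓ + 2), psiOf e ρ (Sm.const (e.ℓ + 2))]

/-- The jets of the base data. -/
def baseJ (s : ℝ) : YS := fun i k => (der^[k] (baseD e s i)).1 0

theorem der_base (s : ℝ) (y : ℝ) : (der (baseD e s 0)).1 y = -(e.h.1 (e.ℓ + 2) / 2) * y ∧
    (der (der (baseD e s 0))).1 y = -(e.h.1 (e.ℓ + 2) / 2) := by
  have h1 : ∀ y, HasDerivAt (fun y : ℝ => -(e.h.1 (e.ℓ + 2) / 4) * y ^ 2)
      (-(e.h.1 (e.ℓ + 2) / 2) * y) y := fun y =>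
    (((hasDerivAt_id y).pow 2).const_mul (-(e.h.1 (e.ℓ + 2) / 4))).congr_deriv (by simp; ring)
  have h2 : (der (baseD e s 0)).1 = fun y => -(e.h.1 (e.ℓ + 2) / 2) * y := funext fun y => (h1 y).deriv
  refine ⟨congrFun h2 y, ?_⟩
  rw [der_apply, h2]
  simp

theorem psiArg_base (s : ℝ) : (psiArg e (baseD e s 0) (baseD e s 3)).1 0 = 1 := by
  obtain ⟨h1, h2⟩ := der_base e s 0
  have h3 := e.hi_mul (e.ℓ + 2) (by linarith)
  change -(2 * ((der (der (baseD e s 0))).1 0 + (der (baseD e s 0)).1 0 ^ 2)) * e.hi.1 (e.ℓ + 2) = 1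
  rw [h1, h2]
  linear_combination h3

theorem der_const (r : ℝ) : der (Sm.const r) = 0 := lie_const _ _ r

theorem eyyD_eq_zero {d : Fin 5 → Sm ℝ} {y : ℝ} (h : 1 / 2 ≤ (psiArg e (d 0) (d 3)).1 y)
    (ht : e.ℓ < (d 3).1 y) (h4 : d 4 = psiOf e (d 0) (d 3)) (h2 : d 2 = 0) {s : ℝ}
    (h1 : d 1 = Sm.const s) : (eyyD e d).1 y = 0 := by
  have := psiOf_spec e h ht
  rw [← h4] at this
  simpa [eyyD, h2, h1, der_const] using this

theorem eyyD_base (s : ℝ) (n : ℕ) : (der^[n] (eyyD e (baseD e s))).1 0 = 0 := by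
  refine (iterate_der_eq_zero ?_ n).self_of_nhds
  have hc : ∀ᶠ y in nhds 0, 1 / 2 < (psiArg e (baseD e s 0) (baseD e s 3)).1 y :=
    (psiArg e (baseD e s 0) (baseD e s 3)).continuous.continuousAt.eventually_const_lt
      (by rw [psiArg_base]; norm_num)
  filter_upwards [hc] with y hy
  exact eyyD_eq_zero e hy.le (by change e.ℓ < e.ℓ + 2; linarith) rfl rfl (s := s) rfl

theorem iterate_der_const (r : ℝ) (k : ℕ) : der^[k + 1] (Sm.const r) = 0 := by
  induction k with
  | zero => exact der_const r
  | succ k ih => rw [Function.iterate_succ_apply', ih, map_zero]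

theorem baseJ_mem {s : ℝ} (hs : s ∈ Set.Icc (0 : ℝ) 1) :
    baseJ e s ∈ Metric.closedBall (baseJ e 0) 1 := by
  rw [Metric.mem_closedBall, dist_pi_le_iff zero_le_one]
  intro i
  rw [dist_pi_le_iff zero_le_one]
  intro k
  by_cases hi : i = 1
  · subst hi
    change dist ((der^[k] (Sm.const s)).1 0) ((der^[k] (Sm.const 0)).1 0) ≤ 1
    obtain ⟨k, hk⟩ := k
    rcases k with _ | k
    · simp [abs_le]; constructor <;> linarith [hs.1, hs.2]
    · simp only [iterate_der_const]; simp
  · have : baseD e s i = baseD e 0 i := by fin_cases i <;> first | rfl | exact absurd rfl hi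
    simp [baseJ, this]

end Base

/-! ### Fields with given jets -/

/-- The polynomial in `y` with given jets. -/
def polyF (Z : Fin 5 → Fin 9 → Sm ℝ) : Fl := fun i => ∑ k : Fin 9, X (Z i k) * Mu k

theorem iterate_sum {ι : Type*} (D : Derivation ℝ S2 S2) (s : Finset ι) (f : ι → S2) (n : ℕ) :
    D^[n] (∑ i ∈ s, f i) = ∑ i ∈ s, D^[n] (f i) := by
  induction n with
  | zero => rfl
  | succ n ih => simp only [Function.iterate_succ_apply', ih, map_sum]

theorem hasJets_polyF (Z : Fin 5 → Fin 9 → Sm ℝ) : HasJets (polyF Z) fun x i k => (Z i k).1 x := by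
  intro i k x
  simp only [polyF, iterate_sum, iterate_dy_X_mul, Sm.sum_apply, Sm.mul_apply, X_apply,
    iterate_dy_Mu_apply]
  simp [Fin.val_inj]

section Singular

variable {e : Eos} {q t₀ : ℝ} {Z : ℝ → YS} {Φ : Fl}

/-- The lapse variable vanishes. -/
theorem JetFlow.lapse (hZ : JetFlow e q t₀ Z) (h0 : Z 0 2 0 = 0) {x : ℝ} (hx : -(1 / 4) < x) :
    Z x 2 0 = 0 := by
  have hd : ∀ x ∈ Set.Ioi (-(1 / 4) : ℝ), HasDerivAt (fun x => Z x 2 0) 0 x := fun x hx => by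
    have h2 : HasDerivAt (fun x => Z x 2 0) _ x := hasDerivAt_pi.1 (hasDerivAt_pi.1 (hZ x hx) 2) 0
    refine h2.congr_deriv ?_
    have : jetField e (ctrl q t₀ x, Z x) 2 0 = 0 := rfl
    rw [Pi.smul_apply, Pi.smul_apply, this, smul_zero]
  rw [← h0]
  exact isOpen_Ioi.is_const_of_deriv_eq_zero (convex_Ioi _).isPreconnected
    (fun x hx => (hd x hx).differentiableAt.differentiableWithinAt) (fun x hx => (hd x hx).deriv) hx
    (by norm_num)

theorem θS_pos (x : ℝ) : 0 < (θS q t₀).1 x := Real.exp_pos _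

theorem z_values (hZ : JetFlow e q t₀ Z) (h1 : 1 ≤ t₀) (hJ : HasJets Φ Z) {x : ℝ}
    (hx : -(1 / 4) < x) :
    (dx (Φ 0)).1 (x, 0) = (rS q t₀).1 x ∧
    (θS q t₀).1 x * (dx (Φ 1)).1 (x, 0) = sqS.1 ((νS q t₀).1 x
      - 1 / 2 * e.h.1 (Z x 3 0) * Real.exp (-(2 * Z x 4 0)) * (mS q t₀).1 x ^ 2) ∧
    (dx (Φ 2)).1 (x, 0) = 0 := by
  have hj := jet_eq hZ h1 hJ hx
  have hz : ∀ i : Fin 3, (zOf q t₀ Φ i).1 (x, 0) = (hbState e (ctrl q t₀ x, Z x)).2.1 i := fun i => by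
    rw [← hj]; rfl
  have hθ : (θS q t₀).1 x ≠ 0 := (θS_pos x).ne'
  exact ⟨mul_left_cancel₀ hθ (hz 0), hz 1, mul_left_cancel₀ hθ ((hz 2).trans (by simp [hbState]))⟩

theorem rS_eq (h1 : 1 ≤ t₀) {x : ℝ} (hx : -(1 / 4) < x) :
    (rS q t₀).1 x = t₀ ^ (-(4 * q)) * Real.exp (-x) - (t₀ + x) ^ (-(4 * q)) := by
  rw [← clamp_eq hx.le, ← exp_mul_lT h1, neg_mul, clamp_eq hx.le]
  change t₀ ^ (-(4 * q)) * Real.exp (-clamp.1 x) - _ = _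
  rw [clamp_eq hx.le]
  rfl

theorem deriv_rS (h1 : 1 ≤ t₀) {x : ℝ} (hx : -(1 / 4) < x) :
    (der (rS q t₀)).1 x + (rS q t₀).1 x
      = (4 * q * (t₀ + x)⁻¹ - 1) * (t₀ + x) ^ (-(4 * q)) := by
  have hT : 0 < t₀ + x := by linarith
  have h2 : (rS q t₀).1 =ᶠ[nhds x] fun x => t₀ ^ (-(4 * q)) * Real.exp (-x) - (t₀ + x) ^ (-(4 * q)) := by
    filter_upwards [Ioi_mem_nhds hx] with x' hx' using rS_eq h1 hx'
  have h3 := ((hasDerivAt_id x).neg.exp.const_mul (t₀ ^ (-(4 * q)))).sub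
    (((hasDerivAt_id x).const_add t₀).rpow_const (p := -(4 * q)) (Or.inl hT.ne'))
  have h4 : (t₀ + x) ^ (-(4 * q) - 1) = (t₀ + x) ^ (-(4 * q)) * (t₀ + x)⁻¹ := by
    rw [Real.rpow_sub_one hT.ne']; rfl
  have h5 : deriv (fun x => t₀ ^ (-(4 * q)) * Real.exp (-x) - (t₀ + x) ^ (-(4 * q))) x = _ := h3.deriv
  rw [der_apply, h2.deriv_eq, h5, rS_eq h1 hx]
  simp only [id, h4, Pi.neg_apply]
  ring

/-- The function under the square root in the constraint is bounded below. -/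
def RootBound (e : Eos) (q t₀ : ℝ) (Z : ℝ → YS) : Prop := ∀ x, 1 / 2 ≤ (νS q t₀).1 x
  - 1 / 2 * e.h.1 (Z x 3 0) * Real.exp (-(2 * Z x 4 0)) * (mS q t₀).1 x ^ 2

/-- In the logarithmic gauge l = φ with φ_x = -1/2, so θ² `exx` equals twice the difference of
(θw_x)² and the quantity under the root. `RootBound` places the latter where `sqS` is a true square
root. -/
theorem exx_of_jets (hZ : JetFlow e q t₀ Z) (h1 : 1 ≤ t₀) (h0 : Z 0 2 0 = 0) (hJ : HasJets Φ Z)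
    (hν : RootBound e q t₀ Z) {x : ℝ} (hx : -(1 / 4) < x) :
    (exx e (hatF Φ (phiS (Real.exp (-t₀))))).1 (x, 0) = 0 := by
  obtain ⟨hr, hw, hl⟩ := z_values hZ h1 hJ hx
  have hT : 0 < t₀ + x := by linarith
  have hrr : (dx (dx (Φ 0))).1 (x, 0) = (der (rS q t₀)).1 x := by
    rw [← (hasDerivAt_fst (dx (Φ 0)) x 0).deriv, der_apply]
    refine Filter.EventuallyEq.deriv_eq ?_
    filter_upwards [Ioi_mem_nhds hx] with x' hx' using (z_values hZ h1 hJ hx').1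
  have hjv : ∀ i, (Φ i).1 (x, 0) = Z x i 0 := fun i => hJ i 0 x
  have hl0 : (Φ 2).1 (x, 0) = 0 := (hjv 2).trans (hZ.lapse h0 hx)
  set φ := phiS (Real.exp (-t₀)) with hφ
  have hm : (θS q t₀).1 x * (exp (2 * φ)).1 x = (mS q t₀).1 x := by
    rw [exp_phiS (Real.exp_pos _), mS, Sm.mul_apply]
    simp [clamp_eq hx.le]
  have hdφ : (X (der φ)).1 (x, (0 : ℝ)) = -(1 / 2) := by rw [hφ, der_phiS]; rfl
  have hsq := sqS_sq (hν x)
  rw [← hw] at hsq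
  have hE : exx e (hatF Φ φ) = 2 * dx (dx (Φ 0)) + 2 * dx (Φ 0) ^ 2
      - 4 * (dx (Φ 2) + X (der φ)) * dx (Φ 0) + 2 * dx (Φ 1) ^ 2
      + exp (2 * Φ 2) * X (exp (2 * φ)) * (exp (-(2 * Φ 4)) * X (exp (2 * φ))) * e.h.of (Φ 3) := by
    simp only [exx, hatF, Matrix.cons_val, exp_neg_hat, exp_two_mul_add, exp_X, map_add, dx_X]
  have hθ : (θS q t₀).1 x ≠ 0 := (θS_pos x).ne'
  refine (mul_eq_zero.1 ?_).resolve_left (pow_ne_zero 2 hθ)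
  rw [hE]
  simp only [Sm.add_apply, Sm.sub_apply, Sm.mul_apply, Sm.pow_apply, Sm.ofNat_apply, hrr, hr, hl, hdφ,
    X_apply, Sm.exp_apply, of_apply, hl0, Sm.neg_apply, hjv]
  simp only [Sm.exp_apply, Sm.mul_apply, Sm.ofNat_apply] at hm
  have hd := deriv_rS (q := q) h1 hx
  have hθ4 : (θS q t₀).1 x ^ 2 * (t₀ + x) ^ (-(4 * q)) = 1 := by
    rw [θS_apply h1, clamp_eq hx.le, pow_two, ← Real.rpow_add hT, ← Real.rpow_add hT,
      show 2 * q + 2 * q + -(4 * q) = 0 by ring, Real.rpow_zero]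
  have hν2 : (νS q t₀).1 x = 1 - 4 * q * (t₀ + x)⁻¹ - ((θS q t₀).1 x * (rS q t₀).1 x) ^ 2 := by
    have : Real.exp (-(lT t₀).1 x) = (t₀ + x)⁻¹ := by
      rw [← Real.rpow_neg_one, ← clamp_eq hx.le, ← exp_mul_lT h1, neg_one_mul, clamp_eq hx.le]
    rw [← this]; rfl
  rw [hν2] at hsq
  simp only [mul_zero, Real.exp_zero, zero_add]
  linear_combination 2 * (θS q t₀).1 x ^ 2 * hd + 2 * (4 * q * (t₀ + x)⁻¹ - 1) * hθ4 + 2 * hsq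
    + Real.exp (-(2 * Z x 4 0)) * e.h.1 (Z x 3 0)
      * ((θS q t₀).1 x * Real.exp (2 * φ.1 x) + (mS q t₀).1 x) * hm

theorem hatF_sub (Φ Ψ : Fl) (φ : Sm ℝ) (i : Fin 5) : hatF Φ φ i - hatF Ψ φ i = Φ i - Ψ i := by
  fin_cases i <;> simp [hatF]

theorem hatF_neg (Φ : Fl) (φ : Sm ℝ) : hatF (hatF Φ (-φ)) φ = Φ := by
  funext i
  fin_cases i <;> simp [hatF, X_neg]

theorem HasJets.of_van {Φ Ψ : Fl} (hJ : HasJets Φ Z)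
    (h : ∀ i, Ψ i - Φ i ∈ van (line Set.univ) 9) : HasJets Ψ Z := fun i k x => by
  have := h i k k.2 (x, 0) ⟨trivial, rfl⟩
  rw [iterate_sub, Sm.sub_apply, sub_eq_zero] at this
  rw [this, hJ]

/-- Fields satisfying all equations to infinite order along the singular hypersurface. -/
theorem exists_singular_fields (hZs : ContDiff ℝ ∞ Z) (hZ : JetFlow e q t₀ Z) (h1 : 1 ≤ t₀) {s : ℝ}
    (h0 : Z 0 = baseJ e s) (hν : RootBound e q t₀ Z) (ht : ∀ x, e.ℓ < Z x 3 0) :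
    ∃ Φ : Fl, HasJets Φ Z ∧ (∀ y, (Φ 1).1 (0, y) = s) ∧ (∀ y, (Φ 2).1 (0, y) = 0) ∧
      ∀ n, (∀ k, evol e (hatF Φ (phiS (Real.exp (-t₀)))) k ∈ van (line (Set.Ioi (-(1 / 4)))) n) ∧
        exx e (hatF Φ (phiS (Real.exp (-t₀)))) ∈ van (line (Set.Ioi (-(1 / 4)))) n ∧
        eyy e (hatF Φ (phiS (Real.exp (-t₀)))) ∈ van (line (Set.Ioi (-(1 / 4)))) n := by
  set φ := phiS (Real.exp (-t₀))
  have hsm : ∀ i k, ContDiff ℝ ∞ fun x => Z x i k := fun i k => contDiff_pi.1 (contDiff_pi.1 hZs i) k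
  set P := polyF fun i k => Sm.mk _ (hsm i k)
  have hP : HasJets P Z := hasJets_polyF _
  -- The polynomial has the nine jets of the base data at the corner, so the constraint, which
  -- contains two y-derivatives, holds there to order 9 - 2 = 7.
  have hbase : ∀ i, P i - Y (baseD e s i) ∈ van {(0, 0)} 9 := fun i => by
    rintro j hj p rfl
    rw [iterate_sub, Sm.sub_apply, hP i ⟨j, hj⟩ 0, h0, iterate_dy_Y]
    simp [baseJ]
  have hey : eyy e (hatF P φ) ∈ van {(0, 0)} 7 := by
    rw [eyy_hatF]
    have h2 := eyy_congr (Φ := fun i => Y (baseD e s i)) e hbase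
    have h3 : eyy e (fun i => Y (baseD e s i)) ∈ van {(0, 0)} 7 := by
      rintro j - p rfl
      rw [eyy_Y, iterate_dy_Y, Y_apply]
      exact eyyD_base e s j
    simpa using add_mem h2 h3
  -- N = 7: the evolution equations hold to order N + 1 = 8, and the extension alters only orders N
  -- + 2 = 9 and higher, so the jets Z survive.
  obtain ⟨Ψ, hΨ, hw, hl, hev, heyy⟩ := exists_extension e isOpen_Ioi (N := 7)
    (fun x _ => by
      have := hP 3 0 x
      change e.ℓ < (P 3).1 (x, 0)
      simp only [Fin.val_zero, Function.iterate_zero, id_eq] at this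
      rw [this]; exact ht x)
    (evol_of_jets hZ h1 hP ht) hey
  have hJ : HasJets (hatF Ψ (-φ)) Z := hP.of_van fun i => by
    rw [← hatF_sub _ _ φ, hatF_neg]; exact hΨ i
  have hp0 : ∀ i y, (P i).1 (0, y) = ∑ k : Fin 9, baseJ e s i k * (y ^ (k : ℕ) / (k : ℕ).factorial) :=
    fun i y => by
      rw [← h0]
      simp only [P, polyF, Sm.sum_apply, Sm.mul_apply, X_apply, Mu_apply, Sm.mk_apply]
  have hzero : ∀ r : ℝ, ∀ k : Fin 9, k ≠ 0 → (der^[(k : ℕ)] (Sm.const r)).1 0 = 0 := fun r k hk => by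
    obtain ⟨j, hj⟩ := Nat.exists_eq_succ_of_ne_zero (Fin.val_ne_of_ne hk)
    rw [hj]
    exact congrFun (congrArg Subtype.val (iterate_der_const r j)) 0
  refine ⟨hatF Ψ (-φ), hJ, fun y => ?_, fun y => ?_, fun n => ?_⟩
  · change (Ψ 1).1 (0, y) = s
    rw [hw]
    change (P 1).1 (0, y) = s
    rw [hp0, Finset.sum_eq_single 0 (fun k _ hk => by
      rw [show baseJ e s 1 k = 0 from hzero s k hk, zero_mul]) (by simp)]
    simp [baseJ, baseD]
  · change (Ψ 2).1 (0, y) + -φ.1 0 = 0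
    rw [hl]
    change (P 2).1 (0, y) + φ.1 0 + -φ.1 0 = 0
    rw [hp0, Finset.sum_eq_zero (fun k _ => ?_)]
    · ring
    · have : (baseD e s 2) = 0 := rfl
      rw [baseJ, this]
      have : der^[(k : ℕ)] (0 : Sm ℝ) = 0 := Function.iterate_fixed (map_zero der) _
      rw [this]; simp
  · rw [hatF_neg]
    refine ⟨fun k => hev n k, exx_mem_van e hev (fun n => dx_mem_van isOpen_Ioi (hev n 0)) (fun x hx => ?_) n,
      eyy_mem_van e (convex_Ioi _) (by simp) hev heyy n⟩
    rw [← hatF_neg Ψ φ]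
    exact exx_of_jets hZ h1 (by rw [h0]; rfl) hJ hν hx

end Singular

end EinsteinEuler
end

/-! ### Matching at the corner and extension along the regular hypersurface -/

noncomputable section

namespace EinsteinEuler

open Sm

/-! ### Vanishing of mixed derivatives -/

/-- All mixed partial derivatives vanish at `p`. -/
def Mixed (f : S2) (p : ℝ × ℝ) : Prop := ∀ a b, (dx^[a] (dy^[b] f)).1 p = 0

theorem iterate_dx_dy (a b : ℕ) (f : S2) : dx^[a] (dy^[b] f) = dy^[b] (dx^[a] f) := by
  induction a with
  | zero => rfl
  | succ a ih => rw [Function.iterate_succ_apply', ih, dx_iterate_dy, Function.iterate_succ_apply']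

theorem iterate_sw (a b : ℕ) (f : S2) : dx^[a] (dy^[b] (sw f)) = sw (dx^[b] (dy^[a] f)) := by
  have h1 : dy^[b] (sw f) = sw (dx^[b] f) := by
    induction b with
    | zero => rfl
    | succ b ih => rw [Function.iterate_succ_apply', ih, dy_sw, Function.iterate_succ_apply']
  have h2 : ∀ g : S2, dx^[a] (sw g) = sw (dy^[a] g) := fun g => by
    induction a with
    | zero => rfl
    | succ a ih => rw [Function.iterate_succ_apply', ih, dx_sw, Function.iterate_succ_apply']
  rw [h1, h2, iterate_dx_dy]

theorem Mixed.sw {f : S2} {x y : ℝ} (h : Mixed f (x, y)) : Mixed (sw f) (y, x) := fun a b => by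
  rw [iterate_sw, sw_apply]; exact h b a

theorem iterate_dx_mem_van {I : Set ℝ} (hI : IsOpen I) {f : S2} (h : ∀ n, f ∈ van (line I) n) (a : ℕ) :
    ∀ n, dx^[a] f ∈ van (line I) n := by
  induction a with
  | zero => exact h
  | succ a ih => intro n; rw [Function.iterate_succ_apply']; exact dx_mem_van hI (ih n)

theorem mixed_of_van {I : Set ℝ} (hI : IsOpen I) {f : S2} (h : ∀ n, f ∈ van (line I) n) {x : ℝ}
    (hx : x ∈ I) : Mixed f (x, 0) := fun a b => by
  rw [iterate_dx_dy]
  exact iterate_dx_mem_van hI h a (b + 1) b (Nat.lt_succ_self b) _ ⟨hx, rfl⟩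

theorem mixed_of_van_Ioo {b : ℝ} {f : S2} (h : ∀ n, f ∈ van (line (Set.Ioo 0 b)) n) {x : ℝ}
    (hx : x ∈ Set.Ico 0 b) : Mixed f (x, 0) := fun a c => by
  rw [iterate_dx_dy]
  exact mem_van_Ico (iterate_dx_mem_van isOpen_Ioo h a (c + 1)) c (Nat.lt_succ_self c) _ ⟨hx, rfl⟩

theorem Mixed.of_half {f g : S2} (h : f - g ∈ half) {p : ℝ × ℝ} (hp : p.1 ≤ 0) (hg : Mixed g p) :
    Mixed f p := fun a b => by
  have := iterate_mem_half h a b p hp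
  rwa [iterate_sub, iterate_sub, Sm.sub_apply, hg a b, sub_zero] at this

theorem Mixed.mem_van {f : S2} (h : Mixed f (0, 0)) (n : ℕ) : f ∈ van {(0, 0)} n := by
  rintro j - p rfl
  exact h 0 j

theorem mem_flat_iff {f : S2} {p : ℝ × ℝ} (h : Mixed f p) : f ∈ flat p := mem_flat_of h

/-! ### Jets of functions of one variable at the origin -/

theorem Y_mem_van {f : Sm ℝ} : (∀ n, Y f ∈ van {(0, 0)} n) ↔ ∀ j, (der^[j] f).1 0 = 0 := by
  constructor
  · intro h j
    have := h (j + 1) j (Nat.lt_succ_self j) (0, 0) rfl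
    rwa [iterate_dy_Y] at this
  · rintro h n j - p rfl
    rw [iterate_dy_Y]; exact h j

theorem iterate_der_restr' (f : S2) (j : ℕ) : der^[j] (restr' f) = restr' (dy^[j] f) := by
  induction j generalizing f with
  | zero => rfl
  | succ j ih => rw [Function.iterate_succ_apply, der_restr', ih]; rfl

theorem iterate_der_sub (n : ℕ) (f g : Sm ℝ) : der^[n] (f - g) = der^[n] f - der^[n] g := by
  induction n with
  | zero => rfl
  | succ n ih => simp only [Function.iterate_succ_apply', ih, map_sub]

theorem iterate_der_add (n : ℕ) (f g : Sm ℝ) : der^[n] (f + g) = der^[n] f + der^[n] g := by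
  induction n with
  | zero => rfl
  | succ n ih => simp only [Function.iterate_succ_apply', ih, map_add]

/-- A function with prescribed jet at the origin, small together with its derivatives up to the order
to which the jet vanishes. -/
theorem exists_small_jet (g : Sm ℝ) (N : ℕ) (h : ∀ k ≤ N, (der^[k] g).1 0 = 0) {η : ℝ} (hη : 0 < η) :
    ∃ f : Sm ℝ, (∀ k, (der^[k] f).1 0 = (der^[k] g).1 0) ∧ ∀ j ≤ N, ∀ y, |(der^[j] f).1 y| ≤ η := by
  obtain ⟨F, h1, -, h3⟩ := borel (fun k => Sm.const ((der^[k] g).1 0)) N hη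
  refine ⟨restr' F, fun k => ?_, fun j hj y => ?_⟩
  · have h4 := h1 (k + 1) k (Nat.lt_succ_self k) (0, 0) ⟨trivial, rfl⟩
    rw [iterate_sub, Sm.sub_apply, sub_eq_zero, iterate_sum, Sm.sum_apply] at h4
    rw [iterate_der_restr', restr'_apply, h4]
    simp [iterate_dy_X_mul, iterate_dy_Mu_apply]
  · rw [iterate_der_restr', restr'_apply]
    exact h3 (fun k hk => by ext x; simp [h k hk]) j hj y

theorem eq_on_Ici_of_der {f g : Sm ℝ} (h : ∀ y, 0 ≤ y → f.1 y = g.1 y) (n : ℕ) :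
    ∀ y, 0 ≤ y → (der^[n] f).1 y = (der^[n] g).1 y := by
  induction n with
  | zero => exact h
  | succ n ih =>
    have h1 : ∀ y ∈ Set.Ioi (0 : ℝ), (der^[n + 1] f).1 y = (der^[n + 1] g).1 y := fun y hy => by
      rw [Function.iterate_succ_apply', Function.iterate_succ_apply', der_apply, der_apply]
      refine Filter.EventuallyEq.deriv_eq ?_
      filter_upwards [Ioi_mem_nhds (Set.mem_Ioi.1 hy)] with y' hy' using ih y' (le_of_lt hy')
    intro y hy
    have h2 := Set.EqOn.closure h1 (der^[n + 1] f).continuous (der^[n + 1] g).continuous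
    rw [closure_Ioi] at h2
    exact h2 hy

section

variable (e : Eos)

theorem psiArg_congr {ρ ρ' t t' : Sm ℝ} (hρ : ∀ n, Y (ρ - ρ') ∈ van {(0, 0)} n)
    (ht : ∀ n, Y (t - t') ∈ van {(0, 0)} n) (n : ℕ) :
    Y (psiArg e ρ t) - Y (psiArg e ρ' t') ∈ van {(0, 0)} n := by
  have hY : ∀ ρ t, Y (psiArg e ρ t) = -(2 * (dy (dy (Y ρ)) + dy (Y ρ) ^ 2)) * e.hi.of (Y t) :=
    fun ρ t => by rw [dy_Y, dy_Y]; rfl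
  have h0 : Ideal.Quotient.mk (van {(0, 0)} n) (dy (Y ρ)) = Ideal.Quotient.mk _ (dy (Y ρ')) :=
    Ideal.Quotient.eq.2 (by rw [← map_sub]; exact dy_mem_van (hρ (n + 1)))
  have h1 : Ideal.Quotient.mk (van {(0, 0)} n) (dy (dy (Y ρ))) = Ideal.Quotient.mk _ (dy (dy (Y ρ'))) :=
    Ideal.Quotient.eq.2 (by
      rw [← map_sub, ← map_sub]; exact dy_mem_van (dy_mem_van (hρ (n + 2))))
  have h2 : Ideal.Quotient.mk (van {(0, 0)} n) (e.hi.of (Y t)) = Ideal.Quotient.mk _ (e.hi.of (Y t')) :=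
    Ideal.Quotient.eq.2 (of_sub_of_mem_van _ (ht n))
  rw [← Ideal.Quotient.eq, hY, hY]
  simp [h0, h1, h2, -dy_Y]

/-- The velocity determined by the constraint has the jet required by the constraint. -/
theorem psiOf_flat {Φ : Fl} {s : ℝ} (hw : ∀ y, (Φ 1).1 (0, y) = s) (hl : ∀ y, (Φ 2).1 (0, y) = 0)
    (hey : ∀ n, eyy e Φ ∈ van {(0, 0)} n) (hψ : 1 / 2 < Real.exp (2 * (Φ 4).1 (0, 0)))
    (ht : e.ℓ < (Φ 3).1 (0, 0)) {ρ t : Sm ℝ} (hρ : ∀ n, Y (ρ - restr' (Φ 0)) ∈ van {(0, 0)} n)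
    (htt : ∀ n, Y (t - restr' (Φ 3)) ∈ van {(0, 0)} n) (n : ℕ) :
    Y (psiOf e ρ t - restr' (Φ 4)) ∈ van {(0, 0)} n := by
  set d : Fin 5 → Sm ℝ := fun i => restr' (Φ i) with hd
  set E := eyyD e d with hE
  have hEv : Y E ∈ van {(0, 0)} n := by
    refine Y_mem_van.2 (fun j => ?_) n
    rw [hE, hd, ← restr'_eyy, iterate_der_restr']
    exact hey (j + 1) j (Nat.lt_succ_self j) (0, 0) rfl
  have hd1 : d 1 = Sm.const s := by ext y; exact hw y
  have hd2 : d 2 = 0 := by ext y; exact hl y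
  -- Dividing the constraint by h shows that `psiArg` and e^{2ψ} have the same jet at the corner.
  have harg : Y (psiArg e (d 0) (d 3)) - exp (2 * Y (d 4)) ∈ van {(0, 0)} n := by
    have h1 : psiArg e (d 0) (d 3) - exp (2 * d 4)
        = -(exp (2 * d 4) * (1 - e.hi * e.h).of (d 3)) - E * e.hi.of (d 3) := by
      ext y
      rw [hE]
      simp only [eyyD, hd1, hd2, der_const, map_zero, psiArg, Sm.sub_apply, Sm.mul_apply, Sm.neg_apply,
        Sm.add_apply, Sm.pow_apply, Sm.ofNat_apply, of_apply, Sm.one_apply, Sm.zero_apply, exp_apply]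
      simp only [mul_zero, Real.exp_zero, zero_pow two_ne_zero]
      ring
    have h2 : Y (psiArg e (d 0) (d 3)) - exp (2 * Y (d 4))
        = -(exp (2 * Y (d 4)) * (1 - e.hi * e.h).of (Y (d 3))) - Y E * e.hi.of (Y (d 3)) :=
      congrArg Y h1
    rw [h2]
    refine sub_mem (neg_mem (Ideal.mul_mem_left _ _ (one_sub_hi_mem n ?_))) (Ideal.mul_mem_right _ _ hEv)
    rintro p rfl
    exact ht
  -- `lg` is the logarithm only above 1/2; the value of e^{2ψ} at the corner lies in this open
  -- range.
  have hlg : lg.of (exp (2 * Y (d 4))) - 2 * Y (d 4) ∈ van {(0, 0)} n := by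
    refine of_mem_van (U := {r | 1 / 2 < Real.exp (2 * r)}) n
      (Q := lg.of (exp (2 * Sm.mk (fun r => r) contDiff_id)) - 2 * Sm.mk (fun r => r) contDiff_id)
      (f := Y (d 4)) (isOpen_lt continuous_const (by fun_prop)) (fun r hr => ?_) ?_
    · have h3 : lg.1 (Real.exp (2 * r)) = 2 * r := by rw [lg_eq (le_of_lt hr), Real.log_exp]
      change lg.1 (Real.exp (2 * r)) - 2 * r = 0
      rw [h3, sub_self]
    · rintro p rfl
      exact hψ
  have h5 := of_sub_of_mem_van lg (by
    have := add_mem (psiArg_congr e hρ htt n) harg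
    rwa [sub_add_sub_cancel] at this)
  have h6 := Ideal.mul_mem_left _ (Sm.const (1 / 2)) (add_mem h5 hlg)
  convert h6 using 1
  rw [sub_add_sub_cancel]
  change Sm.const (1 / 2) * lg.of (Y (psiArg e ρ t)) - Y (d 4) = _
  linear_combination Y (d 4) * two_mul_half

end

/-! ### Extension along the regular hypersurface -/

theorem swF_sub_mem_half {Ψ S : Fl} (h : ∀ i, Ψ i - S i ∈ half) (i : Fin 5) (p : ℝ × ℝ) (hp : p.2 ≤ 0)
    (a b : ℕ) : (dx^[a] (dy^[b] (swF Ψ i - swF S i))).1 p = 0 := by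
  obtain ⟨x, y⟩ := p
  have hm : ∀ i, Mixed (sw (Ψ i - S i)) (x, y) := fun i =>
    Mixed.sw fun a b => iterate_mem_half (h i) a b (y, x) hp
  have hi : swF Ψ i - swF S i = sw (Ψ i - S i) ∨ swF Ψ i - swF S i = -sw (Ψ i - S i) := by
    fin_cases i
    · left; rfl
    · left; rfl
    · left; rfl
    · left; rfl
    · right
      change -sw (Ψ 4) - -sw (S 4) = -(sw (Ψ 4) - sw (S 4))
      ring
  rcases hi with hi | hi
  · rw [hi]; exact hm i a b
  · rw [hi, iterate_neg, iterate_neg, Sm.neg_apply, hm i a b, neg_zero]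

theorem swF_swF (Φ : Fl) : swF (swF Φ) = Φ := by
  funext i
  fin_cases i <;> simp [swF, sw_neg]

theorem mixed_evol_swF {e : Eos} {Φ : Fl} {x y : ℝ} (h : ∀ k, Mixed (evol e Φ k) (x, y)) (k : Fin 5) :
    Mixed (evol e (swF Φ) k) (y, x) := by
  rw [evol_swF]
  fin_cases k
  · exact (h 0).sw
  · exact (h 1).sw
  · exact (h 2).sw
  · exact (h 4).sw
  · exact (h 3).sw

/-- The set `{x ≥ 0, y = 0} ∪ {x = 0, 0 ≤ y < b}`. -/
def corner (b : ℝ) : Set (ℝ × ℝ) := {p | (p.2 = 0 ∧ 0 ≤ p.1) ∨ (p.1 = 0 ∧ 0 ≤ p.2 ∧ p.2 < b)}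

/-- After exchanging x and y, `exists_extension_right` applies to the fields already built. The data
have the required jets at the corner: those of ρ and t by hypothesis, w and l because they are
constant on x = 0, ψ by `psiOf_flat`. In the exchanged variables `exx` holds by the choice of ψ and
propagates off the line, while `eyy` propagates along it from the corner. Exchanging back, nothing
changes for y ≤ 0, hence neither do the y-jets on y = 0. -/
theorem exists_regular_extension (e : Eos) {b s : ℝ} {Φ : Fl} {φ : Sm ℝ}
    (hflat : ∀ n, (∀ k, evol e (hatF Φ φ) k ∈ van (line (Set.Ioi (-(1 / 4)))) n) ∧
        exx e (hatF Φ φ) ∈ van (line (Set.Ioi (-(1 / 4)))) n ∧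
        eyy e (hatF Φ φ) ∈ van (line (Set.Ioi (-(1 / 4)))) n)
    (hw : ∀ y, (Φ 1).1 (0, y) = s) (hl : ∀ y, (Φ 2).1 (0, y) = 0)
    (hψ : 1 / 2 < Real.exp (2 * (Φ 4).1 (0, 0))) (ht : e.ℓ < (Φ 3).1 (0, 0)) {ρ t : Sm ℝ}
    (hρ : ∀ n, Y (ρ - restr' (Φ 0)) ∈ van {(0, 0)} n)
    (htt : ∀ n, Y (t - restr' (Φ 3)) ∈ van {(0, 0)} n) (htd : ∀ y ∈ Set.Ioo 0 b, e.ℓ < t.1 y)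
    (hpos : ∀ y ∈ Set.Ioo 0 b, 1 / 2 ≤ (psiArg e ρ t).1 y) (hb : 0 < b) :
    ∃ Ψ : Fl, (∀ i k x, (dy^[k] (Ψ i)).1 (x, 0) = (dy^[k] (Φ i)).1 (x, 0)) ∧
      (∀ i x y, y ≤ 0 → (Ψ i).1 (x, y) = (Φ i).1 (x, y)) ∧
      (∀ i y, 0 ≤ y → (Ψ i).1 (0, y) = ((![ρ, Sm.const s, 0, t, psiOf e ρ t] : Fin 5 → Sm ℝ) i).1 y) ∧
      ∀ p ∈ corner b, (∀ k, Mixed (evol e (hatF Ψ φ) k) p) ∧ Mixed (exx e (hatF Ψ φ)) p ∧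
        Mixed (eyy e (hatF Ψ φ)) p := by
  set G := hatF Φ φ with hG
  set S := swF G with hS
  have hGx : ∀ x, -(1 / 4) < x → (∀ k, Mixed (evol e G k) (x, 0)) ∧ Mixed (exx e G) (x, 0) ∧
      Mixed (eyy e G) (x, 0) := fun x hx =>
    ⟨fun k => mixed_of_van isOpen_Ioi (fun n => (hflat n).1 k) hx,
      mixed_of_van isOpen_Ioi (fun n => (hflat n).2.1) hx,
      mixed_of_van isOpen_Ioi (fun n => (hflat n).2.2) hx⟩
  have hSx : ∀ x, -(1 / 4) < x → (∀ k, Mixed (evol e S k) (0, x)) ∧ Mixed (exx e S) (0, x) ∧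
      Mixed (eyy e S) (0, x) := fun x hx => by
    obtain ⟨h1, h2, h3⟩ := hGx x hx
    refine ⟨mixed_evol_swF h1, ?_, ?_⟩
    · rw [hS, exx_swF]; exact h3.sw
    · rw [hS, eyy_swF]; exact h2.sw
  have hψf := psiOf_flat e hw hl (fun n => by
    rw [← eyy_hatF e Φ φ]; exact ((hGx 0 (by norm_num)).2.2).mem_van n) hψ ht hρ htt
  -- On x = 0 the gauge function is the constant φ(0). It is added to l = 0, and ψ - φ(0) changes
  -- sign under the exchange.
  set d : Fin 5 → Sm ℝ := ![ρ, Sm.const s, Sm.const (φ.1 0), t, Sm.const (φ.1 0) - psiOf e ρ t] with hd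
  have hdS : ∀ i j, (der^[j] (d i - restr (S i))).1 0 = 0 := by
    have hz : ∀ j, (der^[j] (0 : Sm ℝ)).1 0 = 0 := fun j => by
      rw [Function.iterate_fixed (map_zero der)]; rfl
    intro i j
    fin_cases i
    · exact Y_mem_van.1 hρ j
    · have : d 1 - restr (S 1) = 0 := by ext y; exact sub_eq_zero.2 (hw y).symm
      exact this ▸ hz j
    · have : d 2 - restr (S 2) = 0 := by
        ext y
        change φ.1 0 - ((Φ 2).1 (0, y) + φ.1 0) = 0
        rw [hl]; ring
      exact this ▸ hz j
    · exact Y_mem_van.1 htt j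
    · have : d 4 - restr (S 4) = restr' (Φ 4) - psiOf e ρ t := by
        ext y
        change φ.1 0 - (psiOf e ρ t).1 y - -((Φ 4).1 (0, y) - φ.1 0) = (Φ 4).1 (0, y) - (psiOf e ρ t).1 y
        ring
      change (der^[j] (d 4 - restr (S 4))).1 0 = 0
      have h2 := Y_mem_van.1 hψf j
      rw [iterate_der_sub, Sm.sub_apply, sub_eq_zero] at h2
      rw [this, iterate_der_sub, Sm.sub_apply, h2, sub_self]
  obtain ⟨Ψ, hΨ, hΨd, hev⟩ := exists_extension_right e (b := b)
    (fun k a c => (hSx 0 (by norm_num)).1 k a c) d hdS htd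
  obtain ⟨hc1, hc2, hc3⟩ := half_congr e hΨ
  have hcont : ∀ x, 0 ≤ x → (∀ k, Mixed (evol e Ψ k) (0, x)) ∧ Mixed (exx e Ψ) (0, x) ∧
      Mixed (eyy e Ψ) (0, x) := fun x hx => by
    obtain ⟨h1, h2, h3⟩ := hSx x (by linarith)
    exact ⟨fun k => (h1 k).of_half (hc1 k) le_rfl, h2.of_half hc2 le_rfl, h3.of_half hc3 le_rfl⟩
  have hexx : ∀ n, exx e Ψ ∈ van (line (Set.Ioo 0 b)) n := by
    refine exx_mem_van e hev (fun n => dx_mem_van isOpen_Ioo (hev n 0)) fun y hy => ?_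
    have hrd : ∀ i n, (der^[n] (restr (Ψ i))).1 y = (der^[n] (d i)).1 y := fun i n =>
      eq_on_Ici_of_der (fun y hy => hΨd i y hy) n y hy.1.le
    have h0 : ∀ i, (Ψ i).1 (y, 0) = (d i).1 y := fun i => hrd i 0
    have h1 : ∀ i, (dx (Ψ i)).1 (y, 0) = (der (d i)).1 y := fun i => by
      have := hrd i 1
      rwa [Function.iterate_one, der_restr] at this
    have h2 : ∀ i, (dx (dx (Ψ i))).1 (y, 0) = (der (der (d i))).1 y := fun i => by
      have := hrd i 2
      change (der (der (restr (Ψ i)))).1 y = (der (der (d i))).1 y at this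
      rwa [der_restr, der_restr] at this
    have h3 := psiOf_spec e (hpos y hy) (htd y hy)
    have h4 : Real.exp (2 * φ.1 0) * Real.exp (-(2 * (φ.1 0 - (psiOf e ρ t).1 y)))
        = Real.exp (2 * (psiOf e ρ t).1 y) := by
      rw [← Real.exp_add]; congr 1; ring
    simp only [exx, Sm.add_apply, Sm.sub_apply, Sm.mul_apply, Sm.pow_apply, Sm.ofNat_apply, h0, h1, h2,
      exp_apply, of_apply, Sm.neg_apply]
    simp only [hd, Matrix.cons_val, der_const, Sm.zero_apply, Sm.const_apply, Sm.sub_apply]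
    rw [h4]
    linear_combination h3
  have heyyb : ∀ n, eyy e Ψ ∈ van (line (Set.Ico 0 b)) n :=
    eyy_mem_van e (convex_Ico 0 b) ⟨le_rfl, hb⟩ (fun n k => mem_van_Ico (hev n k))
      fun n => (hcont 0 le_rfl).2.2.mem_van n
  have hline : line (Set.Ioo 0 b) ⊆ line (Set.Ico 0 b) := by
    rintro p ⟨h1, h2⟩
    exact ⟨Set.Ioo_subset_Ico_self h1, h2⟩
  have heyy : ∀ n, eyy e Ψ ∈ van (line (Set.Ioo 0 b)) n := fun n => van_anti hline n (heyyb n)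
  have hsub : ∀ i, hatF (swF Ψ) (-φ) i - Φ i = swF Ψ i - swF S i := fun i => by
    have : Φ i = hatF G (-φ) i := by
      have h1 := hatF_neg Φ (-φ)
      rw [neg_neg] at h1
      rw [hG, h1]
    rw [this, hatF_sub, hS, swF_swF]
  refine ⟨hatF (swF Ψ) (-φ), fun i k x => ?_, fun i x y hy => ?_, fun i y hy => ?_, fun p hp => ?_⟩
  · have h1 := swF_sub_mem_half hΨ i (x, 0) le_rfl 0 k
    rw [← hsub] at h1
    simp only [Function.iterate_zero, id_eq] at h1
    rwa [iterate_sub, Sm.sub_apply, sub_eq_zero] at h1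
  · have h1 := swF_sub_mem_half hΨ i (x, y) hy 0 0
    rw [← hsub] at h1
    exact sub_eq_zero.1 h1
  · have h1 : ∀ j, (Ψ j).1 (y, 0) = (d j).1 y := fun j => hΨd j y hy
    fin_cases i
    · exact h1 0
    · exact h1 1
    · change (Ψ 2).1 (y, 0) + -φ.1 0 = 0
      rw [h1 2]; simp [hd]
    · exact h1 3
    · change -(Ψ 4).1 (y, 0) - -φ.1 0 = (psiOf e ρ t).1 y
      rw [h1 4]; simp [hd]
  · rw [hatF_neg, exx_swF, eyy_swF]
    obtain ⟨x, y⟩ := p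
    have hm : (∀ k, Mixed (evol e Ψ k) (y, x)) ∧ Mixed (exx e Ψ) (y, x) ∧ Mixed (eyy e Ψ) (y, x) := by
      rcases hp with ⟨h1, h2⟩ | ⟨h1, h2⟩
      · simp only at h1 h2; subst h1; exact hcont x h2
      · simp only at h1 h2; subst h1
        exact ⟨fun k => mixed_of_van_Ioo (fun n => hev n k) h2, mixed_of_van_Ioo hexx h2,
          mixed_of_van_Ioo heyy h2⟩
    exact ⟨mixed_evol_swF hm.1, hm.2.2.sw, hm.2.1.sw⟩

end EinsteinEuler
end

/-! ### Compactness bounds for jets on both hypersurfaces -/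

noncomputable section

namespace EinsteinEuler

open Sm

/-! ### Bounded jets -/

/-- The slots of order less than seven, the `x`-derivatives and the weight are bounded by `C`. -/
def InK (C : ℝ) (p : St) : Prop := ∃ p', Sim 7 p p' ∧ ‖p'‖ ≤ C

theorem InK.of_coords {C : ℝ} (hC : 0 ≤ C) {p : St} (h1 : ∀ i, ∀ k : Fin 9, (k : ℕ) < 7 → |p.1 i k| ≤ C)
    (h2 : ∀ i, |p.2.1 i| ≤ C) (h3 : |p.2.2| ≤ C) : InK C p := by
  refine ⟨trunc 7 p, ⟨fun i k hk => by rw [trunc_apply]; simp [hk], by rw [trunc_apply]⟩, ?_⟩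
  rw [trunc_apply, Prod.norm_def, Prod.norm_def, sup_le_iff, sup_le_iff]
  refine ⟨?_, (pi_norm_le_iff_of_nonneg hC).2 h2, h3⟩
  refine (pi_norm_le_iff_of_nonneg hC).2 fun i => (pi_norm_le_iff_of_nonneg hC).2 fun k => ?_
  simp only
  split_ifs with h
  · exact h1 i k h
  · simpa using hC

theorem exists_bound_InK (C : ℝ) {g : Sm St} (hg : Dep 7 g) : ∃ M, ∀ p, InK C p → |g.1 p| ≤ M := by
  obtain ⟨M, hM⟩ := (isCompact_closedBall (0 : St) C).exists_bound_of_continuousOn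
    g.continuous.continuousOn
  refine ⟨M, fun p ⟨p', h1, h2⟩ => ?_⟩
  rw [hg p p' h1]
  exact hM p' (by simpa using h2)

theorem exists_bound_iterate (e : Eos) (C : ℝ) {s : ℕ} (hs : 1 ≤ s) {g : Sm St} (hg : Dep s g) :
    ∃ M, 0 ≤ M ∧ ∀ k, s + k ≤ 7 → ∀ p, InK C p → |((LL e)^[k] g).1 p| ≤ M := by
  have h : ∀ k : ℕ, ∃ M, s + k ≤ 7 → ∀ p, InK C p → |((LL e)^[k] g).1 p| ≤ M := fun k => by
    by_cases hk : s + k ≤ 7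
    · obtain ⟨M, hM⟩ := exists_bound_InK C ((hg.iterate hs k (e := e)).mono hk)
      exact ⟨M, fun _ => hM⟩
    · exact ⟨0, fun h => absurd h hk⟩
  choose M hM using h
  refine ⟨∑ k ∈ Finset.range 8, |M k|, Finset.sum_nonneg fun k _ => abs_nonneg _, fun k hk p hp => ?_⟩
  refine (hM k hk p hp).trans ((le_abs_self _).trans ?_)
  exact Finset.single_le_sum (f := fun k => |M k|) (fun k _ => abs_nonneg _)
    (Finset.mem_range.2 (by omega))

section

variable (e : Eos)

/-- The velocity determined by the constraint as a function of jets. -/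
def psiJet : Sm St := Sm.const (1 / 2) * lg.of (-(2 * (yc 0 2 + yc 0 1 ^ 2)) * e.hi.of (yc 3 0))

theorem dep_psiJet : Dep 3 (psiJet e) := by
  intro p p' hp
  have h0 := fun i => hp.1 i 0 (by simp)
  have h1 := fun i => hp.1 i 1 (by simp)
  have h2 := fun i => hp.1 i 2 (by simp)
  simp [psiJet, h0, h1, h2]

theorem pull_psiJet (Φ : Fl) (z : Fin 3 → S2) (m : Sm ℝ) : pull Φ z m (psiJet e)
    = Sm.const (1 / 2) * lg.of (-(2 * (dy (dy (Φ 0)) + dy (Φ 0) ^ 2)) * e.hi.of (Φ 3)) := rfl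

/-- ψ contains two derivatives of ρ, so eight derivatives of ρ and t control six of ψ; hence the
threshold seven in `InK`. Each derivative is a fixed continuous function of the jets, bounded on
balls. -/
theorem exists_psiOf_bound (B : ℝ) : ∃ C, ∀ (ρ t : Sm ℝ) (y : ℝ), (∀ k ≤ 8, |(der^[k] ρ).1 y| ≤ B) →
    (∀ k ≤ 8, |(der^[k] t).1 y| ≤ B) → ∀ k ≤ 6, |(der^[k] (psiOf e ρ t)).1 y| ≤ C := by
  have h : ∀ k : ℕ, ∃ M, ∀ p : St, ‖p‖ ≤ B → |((LL e)^[k] (psiJet e)).1 p| ≤ M := fun k => by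
    obtain ⟨M, hM⟩ := (isCompact_closedBall (0 : St) B).exists_bound_of_continuousOn
      ((LL e)^[k] (psiJet e)).continuous.continuousOn
    exact ⟨M, fun p hp => hM p (by simpa using hp)⟩
  choose M hM using h
  refine ⟨∑ k ∈ Finset.range 7, |M k|, fun ρ t y hρ ht k hk => ?_⟩
  have hB : 0 ≤ B := (abs_nonneg _).trans (hρ 0 (by omega))
  set Φ : Fl := ![Y ρ, 0, 0, Y t, 0] with hΦ
  have hpull : pull Φ 0 0 (psiJet e) = Y (psiOf e ρ t) := by
    rw [pull_psiJet]
    change Sm.const (1 / 2) * lg.of (-(2 * (dy (dy (Y ρ)) + dy (Y ρ) ^ 2)) * e.hi.of (Y t)) = _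
    rw [dy_Y, dy_Y]
    rfl
  -- For z = 0 and m = 0 the residuals vanish identically, and `LL` is the true y-derivative along
  -- the auxiliary fields.
  have hres : ∀ i, zres e Φ 0 0 i ∈ van (Set.univ : Set (ℝ × ℝ)) 8 := fun i => by
    have hX : X 0 = 0 := rfl
    have : zres e Φ 0 0 i = 0 := by
      fin_cases i
      · change zres e Φ 0 0 0 = 0
        rw [zres, pull_zdot_zero, hX]; simp
      · change zres e Φ 0 0 1 = 0
        rw [zres, pull_zdot_one]; simp
      · change zres e Φ 0 0 2 = 0
        rw [zres, pull_zdot_two, hX]; simp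
    rw [this]; exact zero_mem _
  have h1 := iterate_dy_pull_apply hres (by omega) (dep_psiJet e) k (by omega)
    (Set.mem_univ ((0, y) : ℝ × ℝ))
  rw [hpull, iterate_dy_Y, Y_apply] at h1
  simp only at h1
  rw [h1]
  refine (hM k _ ?_).trans ((le_abs_self _).trans (Finset.single_le_sum (f := fun k => |M k|)
    (fun k _ => abs_nonneg _) (Finset.mem_range.2 (by omega))))
  have hz : ∀ k, dy^[k] (0 : S2) = 0 := fun k => iterate_zero' dy k
  rw [Prod.norm_def, Prod.norm_def, sup_le_iff, sup_le_iff]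
  refine ⟨(pi_norm_le_iff_of_nonneg hB).2 fun i => (pi_norm_le_iff_of_nonneg hB).2 fun k => ?_, ?_, ?_⟩
  · change |(dy^[(k : ℕ)] (Φ i)).1 (0, y)| ≤ B
    have hk9 : (k : ℕ) ≤ 8 := by omega
    fin_cases i
    · change |(dy^[(k : ℕ)] (Y ρ)).1 (0, y)| ≤ B
      rw [iterate_dy_Y]; exact hρ k hk9
    · change |(dy^[(k : ℕ)] (0 : S2)).1 (0, y)| ≤ B
      rw [hz]; simpa using hB
    · change |(dy^[(k : ℕ)] (0 : S2)).1 (0, y)| ≤ B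
      rw [hz]; simpa using hB
    · change |(dy^[(k : ℕ)] (Y t)).1 (0, y)| ≤ B
      rw [iterate_dy_Y]; exact ht k hk9
    · change |(dy^[(k : ℕ)] (0 : S2)).1 (0, y)| ≤ B
      rw [hz]; simpa using hB
  · exact (pi_norm_le_iff_of_nonneg hB).2 fun i => by simpa [jet] using hB
  · simpa [jet] using hB

/-! ### Bounds along the regular hypersurface -/

/-- The part `{x = 0, 0 ≤ y < b}` of the axis. -/
def axis (b : ℝ) : Set (ℝ × ℝ) := {p | p.1 = 0 ∧ 0 ≤ p.2 ∧ p.2 < b}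

theorem jets_axis {Ψ : Fl} {d : Fin 5 → Sm ℝ} (hd : ∀ i y, 0 ≤ y → (Ψ i).1 (0, y) = (d i).1 y)
    (i : Fin 5) (k : ℕ) {y : ℝ} (hy : 0 ≤ y) : (dy^[k] (Ψ i)).1 (0, y) = (der^[k] (d i)).1 y := by
  rw [← restr'_apply, ← iterate_der_restr']
  exact eq_on_Ici_of_der (fun y hy => hd i y hy) k y hy

theorem abs_le_of_deriv_le {f : Sm ℝ} {b M : ℝ} (hb1 : b ≤ 1) (hM : 0 ≤ M) (h0 : f.1 0 = 0)
    (h : ∀ y, 0 ≤ y → y < b → |(der f).1 y| ≤ M) {y : ℝ} (hy0 : 0 ≤ y) (hyb : y < b) : |f.1 y| ≤ M := by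
  have := (convex_Ico 0 b).norm_image_sub_le_of_norm_deriv_le (f := f.1) (C := M)
    (fun x _ => (f.differentiable x)) (fun x hx => h x hx.1 hx.2)
    (⟨le_rfl, hy0.trans_lt hyb⟩ : (0 : ℝ) ∈ Set.Ico 0 b) (⟨hy0, hyb⟩ : y ∈ Set.Ico 0 b)
  rw [h0, sub_zero, sub_zero, Real.norm_eq_abs, Real.norm_eq_abs, abs_of_nonneg hy0] at this
  exact this.trans (mul_le_of_le_one_right hM (by linarith))

/-- On x = 0 the unknowns are explicit and only their x-derivatives need bounds. There l = 0, w is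
constant and m = 1, so (e^{2ρ}z₀)_y = e^{2ρ}σ/2 and (z₂)_y = ρ_y z₀ - h/2. Both start from zero at
the corner and are integrated over a length at most one. The constant does not depend on u_*. -/
theorem exists_axis_bound (B : ℝ) : ∃ C, ∀ (b s : ℝ) (Ψ : Fl) (ρ t m : Sm ℝ) (z : Fin 3 → S2),
    b ≤ 1 → |s| ≤ 1 →
    (∀ i y, 0 ≤ y → (Ψ i).1 (0, y) = ((![ρ, Sm.const s, 0, t, psiOf e ρ t] : Fin 5 → Sm ℝ) i).1 y) →
    (∀ k ≤ 8, ∀ y, 0 ≤ y → y < b → |(der^[k] ρ).1 y| ≤ B) →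
    (∀ k ≤ 8, ∀ y, 0 ≤ y → y < b → |(der^[k] t).1 y| ≤ B) →
    (∀ i, zres e Ψ z m i ∈ van (axis b) 8) → z 1 = 0 → (z 0).1 (0, 0) = 0 → (z 2).1 (0, 0) = 0 →
    m.1 0 = 1 → ∀ p ∈ axis b, InK C (jet Ψ z m p) := by
  obtain ⟨Cψ, hψ⟩ := exists_psiOf_bound e B
  obtain ⟨Cσ, hσ⟩ := (isCompact_Icc (a := -B) (b := B)).exists_bound_of_continuousOn
    e.σ.continuous.continuousOn
  obtain ⟨Ch, hh⟩ := (isCompact_Icc (a := -B) (b := B)).exists_bound_of_continuousOn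
    e.h.continuous.continuousOn
  set M1 := 1 / 2 * (Real.exp (2 * B) * |Cσ|) with hM1
  set M2 := Real.exp (2 * B) * M1 with hM2
  set M3 := |B| * M2 + 1 / 2 * |Ch| with hM3
  have hM1p : 0 ≤ M1 := by positivity
  have hM2p : 0 ≤ M2 := by positivity
  have hM3p : 0 ≤ M3 := by positivity
  refine ⟨|B| + |Cψ| + M2 + M3 + 1, fun b s Ψ ρ t m z hb1 hs hd hρ ht hres hz1 hz00 hz20 hm => ?_⟩
  have hj := fun i k {y} (hy : 0 ≤ y) => jets_axis hd i k hy
  have hρ0 : ∀ y, 0 ≤ y → y < b → |ρ.1 y| ≤ B := fun y h1 h2 => hρ 0 (by omega) y h1 h2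
  have hρ1 : ∀ y, 0 ≤ y → y < b → |(der ρ).1 y| ≤ B := fun y h1 h2 => hρ 1 (by omega) y h1 h2
  have ht0 : ∀ y, 0 ≤ y → y < b → t.1 y ∈ Set.Icc (-B) B := fun y h1 h2 =>
    abs_le.1 (ht 0 (by omega) y h1 h2)
  have v0 : ∀ y, 0 ≤ y → (Ψ 0).1 (0, y) = ρ.1 y := fun y hy => hd 0 y hy
  have v1 : ∀ y, 0 ≤ y → (dy (Ψ 0)).1 (0, y) = (der ρ).1 y := fun y hy => hj 0 1 hy
  have vw : ∀ y, 0 ≤ y → (dy (Ψ 1)).1 (0, y) = 0 := fun y hy => by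
    have := hj 1 1 hy
    change (dy (Ψ 1)).1 (0, y) = (der (Sm.const s)).1 y at this
    rw [this, der_const]; rfl
  have v2 : ∀ y, 0 ≤ y → (Ψ 2).1 (0, y) = 0 := fun y hy => hd 2 y hy
  have v3 : ∀ y, 0 ≤ y → (Ψ 3).1 (0, y) = t.1 y := fun y hy => hd 3 y hy
  have r0 : ∀ y, 0 ≤ y → y < b → (dy (z 0)).1 (0, y)
      = -(2 * (z 0).1 (0, y) * (der ρ).1 y) + 1 / 2 * e.σ.1 (t.1 y) := fun y h1 h2 => by
    have := hres 0 0 (by omega) (0, y) ⟨rfl, h1, h2⟩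
    rw [zres, pull_zdot_zero] at this
    simp only [Function.iterate_zero, id_eq, Sm.sub_apply, Sm.add_apply, Sm.neg_apply, Sm.mul_apply,
      Sm.ofNat_apply, Sm.const_apply, X_apply, exp_apply, of_apply, v1 y h1, v2 y h1, v3 y h1, hm] at this
    simp only [mul_zero, Real.exp_zero, mul_one] at this
    linarith
  have r2 : ∀ y, 0 ≤ y → y < b → (dy (z 2)).1 (0, y)
      = (der ρ).1 y * (z 0).1 (0, y) - 1 / 2 * e.h.1 (t.1 y) := fun y h1 h2 => by
    have := hres 2 0 (by omega) (0, y) ⟨rfl, h1, h2⟩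
    rw [zres, pull_zdot_two] at this
    simp only [Function.iterate_zero, id_eq, Sm.sub_apply, Sm.mul_apply,
      Sm.ofNat_apply, Sm.const_apply, X_apply, exp_apply, of_apply, v1 y h1, v2 y h1, v3 y h1, hm,
      vw y h1] at this
    simp only [mul_zero, zero_mul, Real.exp_zero, mul_one, sub_zero] at this
    linarith
  have b0 : ∀ y, 0 ≤ y → y < b → |(z 0).1 (0, y)| ≤ M2 := fun y h1 h2 => by
    have hF : |(restr' (exp (2 * Ψ 0) * z 0)).1 y| ≤ M1 := by
      refine abs_le_of_deriv_le hb1 hM1p ?_ (fun y h1 h2 => ?_) h1 h2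
      · rw [restr'_apply, Sm.mul_apply, hz00, mul_zero]
      · rw [der_restr', restr'_apply, dy_mul, dy_exp, dy_mul, dy_ofNat]
        simp only [Sm.add_apply, Sm.mul_apply, Sm.ofNat_apply, Sm.zero_apply, exp_apply, v0 y h1, v1 y h1,
          r0 y h1 h2]
        have e1 : ∀ a b c d : ℝ, a * (-(2 * b * c) + 1 / 2 * d) + b * (a * (2 * c + ρ.1 y * 0))
            = 1 / 2 * (a * d) := fun a b c d => by ring
        rw [e1, abs_mul, abs_mul, Real.abs_exp, abs_of_pos (by norm_num : (0 : ℝ) < 1 / 2), hM1]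
        have := (abs_le.1 (hρ0 y h1 h2)).2
        have h3 := (hσ _ (ht0 y h1 h2)).trans (le_abs_self Cσ)
        rw [Real.norm_eq_abs] at h3
        gcongr
    have e1 : (z 0).1 (0, y) = Real.exp (-(2 * ρ.1 y)) * (restr' (exp (2 * Ψ 0) * z 0)).1 y := by
      simp only [restr'_apply, Sm.mul_apply, exp_apply, Sm.ofNat_apply, v0 y h1]
      rw [← mul_assoc, ← Real.exp_add, neg_add_cancel, Real.exp_zero, one_mul]
    rw [e1, abs_mul, Real.abs_exp, hM2]
    have := (abs_le.1 (hρ0 y h1 h2)).1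
    gcongr
    linarith
  have b2 : ∀ y, 0 ≤ y → y < b → |(z 2).1 (0, y)| ≤ M3 := fun y h1 h2 => by
    refine abs_le_of_deriv_le (f := restr' (z 2)) hb1 hM3p hz20 (fun y h1 h2 => ?_) h1 h2
    rw [der_restr', restr'_apply, r2 y h1 h2]
    refine (abs_sub _ _).trans ?_
    rw [abs_mul, abs_mul, abs_of_pos (by norm_num : (0 : ℝ) < 1 / 2), hM3]
    have h3 := (hh _ (ht0 y h1 h2)).trans (le_abs_self Ch)
    rw [Real.norm_eq_abs] at h3
    have h4 := (hρ1 y h1 h2).trans (le_abs_self B)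
    have h5 := b0 y h1 h2
    gcongr
  rintro ⟨x, y⟩ ⟨rfl, h1, h2⟩
  simp only at h1 h2
  have hBp := abs_nonneg B
  have hψp := abs_nonneg Cψ
  have hle := le_abs_self B
  have hleψ := le_abs_self Cψ
  refine InK.of_coords (by positivity) (fun i k hk => ?_) (fun i => ?_) ?_
  · change |(dy^[(k : ℕ)] (Ψ i)).1 (0, y)| ≤ _
    rw [hj i k h1]
    fin_cases i
    · exact (hρ k (by omega) y h1 h2).trans (by linarith)
    · obtain ⟨k, hk9⟩ := k
      rcases k with _ | k
      · change |s| ≤ _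
        linarith
      · change |(der^[k + 1] (Sm.const s)).1 y| ≤ _
        rw [iterate_der_const, Sm.zero_apply, abs_zero]; positivity
    · change |(der^[(k : ℕ)] (0 : Sm ℝ)).1 y| ≤ _
      rw [Function.iterate_fixed (map_zero der), Sm.zero_apply, abs_zero]; positivity
    · exact (ht k (by omega) y h1 h2).trans (by linarith)
    · exact (hψ ρ t y (fun k hk => hρ k hk y h1 h2) (fun k hk => ht k hk y h1 h2) k (by omega)).trans
        (by linarith)
  · change |(z i).1 (0, y)| ≤ _
    fin_cases i
    · exact (b0 y h1 h2).trans (by linarith)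
    · change |(z 1).1 (0, y)| ≤ _
      rw [hz1, Sm.zero_apply, abs_zero]; positivity
    · exact (b2 y h1 h2).trans (by linarith)
  · change |m.1 0| ≤ _
    rw [hm, abs_one]; linarith

/-! ### Bounds along the singular hypersurface -/

theorem exists_hbState_bound : ∃ C, ∀ c ∈ Metric.closedBall ((0, 1, 0) : ℝ × ℝ × ℝ) 1,
    ∀ y ∈ Metric.closedBall (baseJ e 0) 2, InK C (hbState e (c, y)) := by
  obtain ⟨C, hC⟩ := ((isCompact_closedBall ((0, 1, 0) : ℝ × ℝ × ℝ) 1).prod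
    (isCompact_closedBall (baseJ e 0) 2)).exists_bound_of_continuousOn
      (contDiff_hbState e).continuous.continuousOn
  exact ⟨C, fun c hc y hy => ⟨_, ⟨fun _ _ _ => rfl, rfl⟩, hC (c, y) ⟨hc, hy⟩⟩⟩

/-- The constraint is solvable for data close to the base data. -/
theorem exists_psiArg_bound : ∃ δ, 0 < δ ∧ δ ≤ 1 ∧ ∀ (ρ t : Sm ℝ) (y : ℝ),
    |(der (der ρ)).1 y + e.h.1 (e.ℓ + 2) / 2| ≤ δ → |(der ρ).1 y| ≤ δ → |t.1 y - (e.ℓ + 2)| ≤ δ →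
    1 / 2 ≤ (psiArg e ρ t).1 y := by
  have hc : Continuous fun r : ℝ × ℝ × ℝ => -(2 * (r.1 + r.2.1 ^ 2)) * e.hi.1 r.2.2 :=
    Continuous.mul (by fun_prop) (e.hi.continuous.comp (by fun_prop))
  have h3 := e.hi_mul (e.ℓ + 2) (by linarith)
  have h1 : ∀ᶠ r : ℝ × ℝ × ℝ in nhds (-(e.h.1 (e.ℓ + 2) / 2), 0, e.ℓ + 2),
      1 / 2 < -(2 * (r.1 + r.2.1 ^ 2)) * e.hi.1 r.2.2 := by
    refine hc.continuousAt.eventually_const_lt ?_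
    have : -(2 * (-(e.h.1 (e.ℓ + 2) / 2) + (0 : ℝ) ^ 2)) * e.hi.1 (e.ℓ + 2) = 1 := by
      linear_combination h3
    change (1 / 2 : ℝ) < -(2 * (-(e.h.1 (e.ℓ + 2) / 2) + (0 : ℝ) ^ 2)) * e.hi.1 (e.ℓ + 2)
    rw [this]; norm_num
  obtain ⟨r, hr, hball⟩ := Metric.eventually_nhds_iff_ball.1 h1
  refine ⟨min (r / 2) 1, by positivity, min_le_right _ _, fun ρ t y h1 h2 h3 => ?_⟩
  refine (hball ((der (der ρ)).1 y, (der ρ).1 y, t.1 y) ?_).le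
  have hlt : min (r / 2) 1 < r := (min_le_left _ _).trans_lt (by linarith)
  rw [Metric.mem_ball, Prod.dist_eq, Prod.dist_eq]
  simp only [Real.dist_eq, sub_neg_eq_add, sub_zero, sup_lt_iff]
  exact ⟨h1.trans_lt hlt, h2.trans_lt hlt, h3.trans_lt hlt⟩

/-- The bound for the function under the square root in the constraint. -/
theorem exists_root_bound : ∃ δ, 0 < δ ∧ δ ≤ 1 ∧ ∀ c ∈ Metric.closedBall ((0, 1, 0) : ℝ × ℝ × ℝ) δ,
    ∀ y ∈ Metric.closedBall (baseJ e 0) 2,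
      |c.2.1 - 1 / 2 * e.h.1 (y 3 0) * Real.exp (-(2 * y 4 0)) * c.2.2 ^ 2 - 1| ≤ 1 / 2 := by
  obtain ⟨M, hM⟩ := (isCompact_closedBall (baseJ e 0) 2).exists_bound_of_continuousOn
    (f := fun y : YS => e.h.1 (y 3 0) * Real.exp (-(2 * y 4 0))) (Continuous.continuousOn
      ((e.h.continuous.comp (by fun_prop)).mul (by fun_prop)))
  set N := |M| + 1 with hN
  have hNp : 0 < N := by positivity
  -- This gives |ν - 1| ≤ 1/4 and a matter term of at most 1/8, together below 1/2.
  refine ⟨1 / (4 * N), by positivity, ?_, fun c hc y hy => ?_⟩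
  · rw [div_le_one (by positivity)]; linarith [abs_nonneg M]
  · have h1 := hM y hy
    rw [Real.norm_eq_abs] at h1
    have h2 : |e.h.1 (y 3 0) * Real.exp (-(2 * y 4 0))| ≤ N := h1.trans (by
      linarith [le_abs_self M])
    rw [Metric.mem_closedBall, Prod.dist_eq, Prod.dist_eq] at hc
    simp only [Real.dist_eq, sub_zero, sup_le_iff] at hc
    obtain ⟨-, hc1, hc2⟩ := hc
    have h3 : 1 / (4 * N) ≤ 1 / 4 := by
      rw [div_le_div_iff₀ (by positivity) (by norm_num)]; linarith [abs_nonneg M]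
    have h4 : |c.2.2| ^ 2 ≤ 1 / (4 * N) := by
      have : |c.2.2| ≤ 1 := hc2.trans (h3.trans (by norm_num))
      nlinarith [abs_nonneg c.2.2]
    have h5 : |1 / 2 * e.h.1 (y 3 0) * Real.exp (-(2 * y 4 0)) * c.2.2 ^ 2| ≤ 1 / 8 := by
      rw [show 1 / 2 * e.h.1 (y 3 0) * Real.exp (-(2 * y 4 0)) * c.2.2 ^ 2
        = 1 / 2 * ((e.h.1 (y 3 0) * Real.exp (-(2 * y 4 0))) * c.2.2 ^ 2) by ring, abs_mul, abs_mul,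
        abs_of_pos (by norm_num : (0 : ℝ) < 1 / 2), abs_pow]
      calc (1 : ℝ) / 2 * (|e.h.1 (y 3 0) * Real.exp (-(2 * y 4 0))| * |c.2.2| ^ 2)
          ≤ 1 / 2 * (N * (1 / (4 * N))) := by gcongr
        _ = 1 / 8 := by field_simp; norm_num
    rw [show c.2.1 - 1 / 2 * e.h.1 (y 3 0) * Real.exp (-(2 * y 4 0)) * c.2.2 ^ 2 - 1
      = (c.2.1 - 1) - 1 / 2 * e.h.1 (y 3 0) * Real.exp (-(2 * y 4 0)) * c.2.2 ^ 2 by ring]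
    refine (abs_sub _ _).trans ?_
    linarith

end

end EinsteinEuler
end

/-! ### From jet bounds to the norms of the data -/

noncomputable section

namespace EinsteinEuler

open Sm

/-! ### Bounds for the fields in terms of jets -/

/-- The jets of `Φ` are bounded on `A` and satisfy the weighted equations. -/
structure JetsBdd (e : Eos) (C : ℝ) (A : Set (ℝ × ℝ)) (Φ : Fl) (z : Fin 3 → S2) (θ m : Sm ℝ) :
    Prop where
  res : ∀ i, zres e Φ z m i ∈ van A 8
  ft : ft e Φ z θ m ∈ van A 8
  fψ : fψ e Φ z θ m ∈ van A 8
  z0 : z 0 = X θ * dx (Φ 0)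
  z2 : z 2 = X θ * dx (Φ 2)
  jet : ∀ p ∈ A, InK C (jet Φ z m p)

/-- The `y`-derivatives of `f` of order at most `n` are bounded by `M` on `A`. -/
def DerBdd (A : Set (ℝ × ℝ)) (n : ℕ) (M : ℝ) (f : S2) : Prop :=
  ∀ k ≤ n, ∀ p ∈ A, |(dy^[k] f).1 p| ≤ M

theorem DerBdd.mono {A : Set (ℝ × ℝ)} {n n' : ℕ} {M M' : ℝ} {f : S2} (h : DerBdd A n M f) (hn : n' ≤ n)
    (hM : M ≤ M') : DerBdd A n' M' f := fun k hk p hp => (h k (hk.trans hn) p hp).trans hM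

theorem derBdd_zero (A : Set (ℝ × ℝ)) (n : ℕ) {M : ℝ} (hM : 0 ≤ M) : DerBdd A n M 0 := fun k _ p _ => by
  rw [iterate_zero' dy k]; simpa using hM

/-- A field given by a function g of the slots of order less than s has k-th y-derivative `LL`^k g,
a function of the slots of order less than s + k. For s + k ≤ 7 it is bounded on the compact set
behind `InK`. -/
theorem exists_derBdd (e : Eos) (C : ℝ) {s : ℕ} (hs : 1 ≤ s) (hs7 : s ≤ 7) {g : Sm St}
    (hg : Dep s g) : ∃ M, ∀ {A Φ z θ m}, JetsBdd e C A Φ z θ m → ∀ f, f - pull Φ z m g ∈ van A 8 →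
      DerBdd A (7 - s) M f := by
  obtain ⟨M, -, hM⟩ := exists_bound_iterate e C hs hg
  refine ⟨M, fun {A Φ z θ m} h f hf k hk p hp => ?_⟩
  have h1 := hf k (by omega) p hp
  rw [iterate_sub, Sm.sub_apply, sub_eq_zero] at h1
  rw [h1, iterate_dy_pull_apply h.res hs hg k (by omega) hp]
  exact hM k (by omega) _ (h.jet p hp)

/-- The metric of the tori as a function of jets. -/
def gγ (A B : Fin 2) : Sm St :=
  !![exp (2 * (yc 0 0 + yc 1 0)), 0; 0, exp (2 * (yc 0 0 - yc 1 0))] A B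

def gχ (A B : Fin 2) : Sm St := Sm.const (1 / 2) * exp (-(2 * yc 2 0)) *
  !![2 * exp (2 * (yc 0 0 + yc 1 0)) * (yc 0 1 + yc 1 1), 0;
    0, 2 * exp (2 * (yc 0 0 - yc 1 0)) * (yc 0 1 - yc 1 1)] A B

def gχb (A B : Fin 2) : Sm St := Sm.const (1 / 2) *
  !![2 * exp (2 * (yc 0 0 + yc 1 0)) * (zc 0 + zc 1), 0;
    0, 2 * exp (2 * (yc 0 0 - yc 1 0)) * (zc 0 - zc 1)] A B

def gv3 : Sm St := Sm.const (1 / 2) * exp (yc 4 0 - yc 2 0)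

def gv4 : Sm St := Sm.const (1 / 2) * exp (yc 2 0 - yc 4 0)

theorem dep_gγ (A B : Fin 2) : Dep 1 (gγ A B) := by
  intro p p' hp
  have h0 := fun i => hp.1 i 0 (by simp)
  fin_cases A <;> fin_cases B <;> simp [gγ, h0]

theorem dep_gχ (A B : Fin 2) : Dep 2 (gχ A B) := by
  intro p p' hp
  have h0 := fun i => hp.1 i 0 (by simp)
  have h1 := fun i => hp.1 i 1 (by simp)
  fin_cases A <;> fin_cases B <;> simp [gχ, h0, h1]

theorem dep_gχb (A B : Fin 2) : Dep 2 (gχb A B) := by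
  intro p p' hp
  have h0 := fun i => hp.1 i 0 (by simp)
  have hz : ∀ j, p.2.1 j = p'.2.1 j := fun j => by rw [hp.2]
  fin_cases A <;> fin_cases B <;> simp [gχb, h0, hz]

theorem dep_yc (i : Fin 5) : Dep 2 (yc i 0) := fun p p' hp => by simp [hp.1 i 0 (by simp)]

theorem dep_zc (i : Fin 3) : Dep 2 (zc i) := fun p p' hp => by simp [hp.2]

theorem dep_gv3 : Dep 2 gv3 := fun p p' hp => by simp [gv3, fun i => hp.1 i 0 (by simp)]

theorem dep_gv4 : Dep 2 gv4 := fun p p' hp => by simp [gv4, fun i => hp.1 i 0 (by simp)]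

theorem Dep.mul {s : ℕ} {g g' : Sm St} (h : Dep s g) (h' : Dep s g') : Dep s (g * g') :=
  fun p p' hp => by simp [h p p' hp, h' p p' hp]

theorem Dep.sub {s : ℕ} {g g' : Sm St} (h : Dep s g) (h' : Dep s g') : Dep s (g - g') :=
  fun p p' hp => by simp [h p p' hp, h' p p' hp]

theorem dep_gtrχ : Dep 2 (2 * exp (-(2 * yc 2 0)) * yc 0 1) := fun p p' hp => by
  simp [fun i => hp.1 i 0 (by simp), fun i => hp.1 i 1 (by simp)]

/-- The velocity components and the logarithmic density, in the plane. -/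
def flS (Φ : Fl) : Fin 3 → S2 :=
  ![Sm.const (1 / 2) * exp (Φ 4 - Φ 2), Sm.const (1 / 2) * exp (Φ 2 - Φ 4), Φ 3]

theorem exists_field_bound (e : Eos) (C : ℝ) : ∃ M, 1 ≤ M ∧
    ∀ {A Φ z θ m}, JetsBdd e C A Φ z θ m →
      (∀ a b, DerBdd A 6 M (γS Φ a b)) ∧ (∀ a b, DerBdd A 5 M (χS Φ a b)) ∧
      DerBdd A 5 M (2 * exp (-(2 * Φ 2)) * dy (Φ 0)) ∧ DerBdd A 5 M (X θ * dx (2 * Φ 0)) ∧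
      (∀ i, DerBdd A 5 M (flS Φ i)) ∧ (∀ i, DerBdd A 5 M (X θ * dx (flS Φ i))) ∧
      (z 1 = X θ * dx (Φ 1) → ∀ a b, DerBdd A 5 M (X θ * dx (Sm.const (1 / 2) * γS Φ a b))) := by
  choose Mγ hγ using fun a b => exists_derBdd e C le_rfl (by omega) (dep_gγ a b)
  choose Mχ hχ using fun a b => exists_derBdd e C (by omega) (by omega) (dep_gχ a b)
  choose Mχb hχb using fun a b => exists_derBdd e C (by omega) (by omega) (dep_gχb a b)
  obtain ⟨M1, h1⟩ := exists_derBdd e C (by omega) (by omega) dep_gtrχ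
  have dz0 : Dep 2 (2 * zc 0) := fun p p' hp => by simp [hp.2]
  obtain ⟨M2, h2⟩ := exists_derBdd e C (by omega) (by omega) dz0
  obtain ⟨M3, h3⟩ := exists_derBdd e C (by omega) (by omega) dep_gv3
  obtain ⟨M4, h4⟩ := exists_derBdd e C (by omega) (by omega) dep_gv4
  obtain ⟨M5, h5⟩ := exists_derBdd e C (by omega) (by omega) (dep_yc 3)
  obtain ⟨M6, h6⟩ := exists_derBdd e C (by omega) (by omega) (dep_gv3.mul ((dep_qψ e).sub (dep_zc 2)))
  obtain ⟨M7, h7⟩ := exists_derBdd e C (by omega) (by omega) (dep_gv4.mul ((dep_zc 2).sub (dep_qψ e)))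
  obtain ⟨M8, h8⟩ := exists_derBdd e C (by omega) (by omega) (dep_qt e)
  set N1 := ∑ a, ∑ b, (|Mγ a b| + |Mχ a b| + |Mχb a b|) with hN1
  have hN : ∀ a b, |Mγ a b| + |Mχ a b| + |Mχb a b| ≤ N1 := fun a b =>
    (Finset.single_le_sum (f := fun b => |Mγ a b| + |Mχ a b| + |Mχb a b|) (fun _ _ => by positivity)
      (Finset.mem_univ b)).trans (Finset.single_le_sum
      (f := fun a => ∑ b, (|Mγ a b| + |Mχ a b| + |Mχb a b|))
      (fun _ _ => Finset.sum_nonneg fun _ _ => by positivity) (Finset.mem_univ a))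
  set N := 1 + N1 + |M1| + |M2| + |M3| + |M4| + |M5| + |M6| + |M7| + |M8| with hNdef
  have hN1p : 0 ≤ N1 := by positivity
  have p1 := abs_nonneg M1
  have p2 := abs_nonneg M2
  have p3 := abs_nonneg M3
  have p4 := abs_nonneg M4
  have p5 := abs_nonneg M5
  have p6 := abs_nonneg M6
  have p7 := abs_nonneg M7
  have p8 := abs_nonneg M8
  refine ⟨N, by rw [hNdef]; linarith, fun {A Φ z θ m} h => ⟨fun a b => ?_, fun a b => ?_, ?_, ?_,
    fun i => ?_, fun i => ?_, fun hz1 a b => ?_⟩⟩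
  · refine (hγ a b h (γS Φ a b) ?_).mono le_rfl (by
      linarith [hN a b, le_abs_self (Mγ a b), abs_nonneg (Mχ a b), abs_nonneg (Mχb a b)])
    have : γS Φ a b = pull Φ z m (gγ a b) := by fin_cases a <;> fin_cases b <;> rfl
    rw [this, sub_self]; exact zero_mem _
  · refine (hχ a b h (χS Φ a b) ?_).mono le_rfl (by
      linarith [hN a b, le_abs_self (Mχ a b), abs_nonneg (Mγ a b), abs_nonneg (Mχb a b)])
    obtain ⟨k0, k1, k2, k3⟩ := dy_γS Φ
    have : χS Φ a b = pull Φ z m (gχ a b) := by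
      fin_cases a <;> fin_cases b <;> simp only [χS, Fin.zero_eta, Fin.mk_one, k0, k1, k2, k3] <;> rfl
    rw [this, sub_self]; exact zero_mem _
  · refine (h1 h (2 * exp (-(2 * Φ 2)) * dy (Φ 0)) ?_).mono le_rfl (by linarith [le_abs_self M1])
    have : 2 * exp (-(2 * Φ 2)) * dy (Φ 0) = pull Φ z m (2 * exp (-(2 * yc 2 0)) * yc 0 1) := rfl
    rw [this, sub_self]; exact zero_mem _
  · refine (h2 h (X θ * dx (2 * Φ 0)) ?_).mono le_rfl (by linarith [le_abs_self M2])
    have : X θ * dx (2 * Φ 0) = pull Φ z m (2 * zc 0) := by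
      change _ = 2 * z 0
      rw [h.z0, dx_mul, dx_ofNat]; ring
    rw [this, sub_self]; exact zero_mem _
  · fin_cases i
    · refine (h3 h (flS Φ 0) ?_).mono le_rfl (by linarith [le_abs_self M3])
      have : flS Φ 0 = pull Φ z m gv3 := rfl
      rw [this, sub_self]; exact zero_mem _
    · refine (h4 h (flS Φ 1) ?_).mono le_rfl (by linarith [le_abs_self M4])
      have : flS Φ 1 = pull Φ z m gv4 := rfl
      rw [this, sub_self]; exact zero_mem _
    · refine (h5 h (flS Φ 2) ?_).mono le_rfl (by linarith [le_abs_self M5])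
      have : flS Φ 2 = pull Φ z m (yc 3 0) := rfl
      rw [this, sub_self]; exact zero_mem _
  · fin_cases i
    · refine (h6 h (X θ * dx (flS Φ 0)) ?_).mono le_rfl (by linarith [le_abs_self M6])
      have : X θ * dx (flS Φ 0) - pull Φ z m (gv3 * (qψ e - zc 2))
          = flS Φ 0 * fψ e Φ z θ m := by
        change _ - flS Φ 0 * (pull Φ z m (qψ e) - z 2) = _
        rw [h.z2, EinsteinEuler.fψ]
        simp only [flS, Matrix.cons_val, dx_mul, dx_exp, dx_const, map_sub]
        ring
      rw [this]; exact Ideal.mul_mem_left _ _ h.fψ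
    · refine (h7 h (X θ * dx (flS Φ 1)) ?_).mono le_rfl (by linarith [le_abs_self M7])
      have : X θ * dx (flS Φ 1) - pull Φ z m (gv4 * (zc 2 - qψ e))
          = -flS Φ 1 * fψ e Φ z θ m := by
        change _ - flS Φ 1 * (z 2 - pull Φ z m (qψ e)) = _
        rw [h.z2, EinsteinEuler.fψ]
        simp only [flS, Matrix.cons_val, dx_mul, dx_exp, dx_const, map_sub]
        ring
      rw [this]; exact Ideal.mul_mem_left _ _ h.fψ
    · exact (h8 h (X θ * dx (flS Φ 2)) h.ft).mono le_rfl (by linarith [le_abs_self M8])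
  · refine (hχb a b h (X θ * dx (Sm.const (1 / 2) * γS Φ a b)) ?_).mono le_rfl (by
      linarith [hN a b, le_abs_self (Mχb a b), abs_nonneg (Mγ a b), abs_nonneg (Mχ a b)])
    have : X θ * dx (Sm.const (1 / 2) * γS Φ a b) = pull Φ z m (gχb a b) := by
      have e0 : pull Φ z m (gχb 0 0)
          = Sm.const (1 / 2) * (2 * exp (2 * (Φ 0 + Φ 1)) * (z 0 + z 1)) := rfl
      have e1 : pull Φ z m (gχb 0 1) = Sm.const (1 / 2) * 0 := rfl
      have e2 : pull Φ z m (gχb 1 0) = Sm.const (1 / 2) * 0 := rfl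
      have e3 : pull Φ z m (gχb 1 1)
          = Sm.const (1 / 2) * (2 * exp (2 * (Φ 0 - Φ 1)) * (z 0 - z 1)) := rfl
      fin_cases a <;> fin_cases b <;>
        simp only [Fin.zero_eta, Fin.mk_one, e0, e1, e2, e3, h.z0, hz1, γS, Matrix.of_apply,
          Matrix.cons_val, dx_mul, dx_exp, dx_const, dx_ofNat, map_add, map_sub, map_zero] <;> ring
    rw [this, sub_self]; exact zero_mem _

/-! ### Norms -/

section Norms

variable {us : ℝ}

theorem Rep.iterate_pd (hus : 0 < us) {F : Pt → ℝ} {G : S2} (h : Rep us F G) (μ : Fin 4) (n : ℕ) :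
    Rep us ((EinsteinEuler.pd μ)^[n] F) ((dS us μ)^[n] G) := by
  induction n with
  | zero => exact h
  | succ n ih => rw [Function.iterate_succ_apply', Function.iterate_succ_apply']; exact ih.pd hus μ

/-- Angular derivatives annihilate plane symmetric functions, and the powers of ε ≤ 1 only help, so
only pure y-derivatives remain. -/
theorem abs_dν_le (hus : 0 < us) {F : Pt → ℝ} {G : S2} (h : Rep us F G) {ε : ℝ} (hε : 0 < ε)
    (hε1 : ε ≤ 1) (a : Fin 3 → ℕ) {i : ℕ} (ha : a ∈ Finset.Nat.antidiagonalTuple 3 i) {x : Pt}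
    (hx : x 0 < us) {B : ℝ} (hB : ∀ k ≤ i, |(dy^[k] G).1 (Xi us x)| ≤ B) : |dν ε a F x| ≤ B := by
  have h1 := (((h.iterate_pd hus 3 (a 2)).iterate_pd hus 2 (a 1)).iterate_pd hus 1 (a 0)) x hx
  have hB0 : 0 ≤ B := (abs_nonneg _).trans (hB 0 (Nat.zero_le _))
  rw [Finset.Nat.mem_antidiagonalTuple, Fin.sum_univ_three] at ha
  rw [dν, h1]
  have hz : ∀ (n : ℕ) (g : S2), n ≠ 0 → (0 : Derivation ℝ S2 S2)^[n] g = 0 := fun n g hn => by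
    obtain ⟨n, rfl⟩ := Nat.exists_eq_succ_of_ne_zero hn
    rw [Function.iterate_succ_apply']; rfl
  have e1 : dS us 1 = dy := rfl
  have e2 : dS us 2 = 0 := rfl
  have e3 : dS us 3 = 0 := rfl
  rw [e1, e2, e3]
  have hzero : (dy^[a 0] (0 : S2)) = 0 := iterate_zero' dy _
  by_cases h2 : a 2 = 0
  · by_cases h3 : a 1 = 0
    · rw [h2, h3, abs_mul, abs_pow, abs_of_pos hε]
      simp only [Function.iterate_zero, id_eq]
      calc _ ≤ 1 * B := mul_le_mul (pow_le_one₀ hε.le hε1) (hB _ (by omega)) (abs_nonneg _) zero_le_one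
        _ = B := one_mul B
    · rw [hz (a 1) _ h3, hzero]; simpa using hB0
  · rw [hz (a 2) _ h2]
    have : (0 : Derivation ℝ S2 S2)^[a 1] (0 : S2) = 0 := iterate_zero' _ _
    rw [this, hzero]; simpa using hB0

theorem card_antidiagonalTuple_le {i : ℕ} (hi : i ≤ 5) :
    (Finset.Nat.antidiagonalTuple 3 i).card ≤ 21 := by
  interval_cases i <;> decide

/-- A pointwise bound for the components gives a bound for the norm. -/
theorem l2S_le {X : Fields} {ε : ℝ} {i : ℕ} (hi : i ≤ 5) {φ : List (Pt → ℝ)} (hφ : φ.length ≤ 8)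
    {u ub M B : ℝ} (hM : 1 ≤ M) (hB : 0 ≤ B)
    (h : ∀ ψ ∈ φ, ∀ a ∈ Finset.Nat.antidiagonalTuple 3 i, ∀ θ, |dν ε a ψ (pt u ub θ)| ≤ B)
    (hdet : ∀ θ, (X.γMat (pt u ub θ)).det ≤ M ^ 2) :
    l2S X ε i φ u ub ≤ ENNReal.ofReal (13 * M * B) := by
  have hint : ∀ θ : ℝ × ℝ, ENNReal.ofReal
      ((φ.map fun ψ => ∑ a ∈ Finset.Nat.antidiagonalTuple 3 i, dν ε a ψ (pt u ub θ) ^ 2).sum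
        * Real.sqrt (X.γMat (pt u ub θ)).det) ≤ ENNReal.ofReal ((13 * M * B) ^ 2) := by
    intro θ
    refine ENNReal.ofReal_le_ofReal ?_
    have h1 : Real.sqrt (X.γMat (pt u ub θ)).det ≤ M :=
      Real.sqrt_le_iff.2 ⟨by linarith, hdet θ⟩
    have h2 : ∀ ψ ∈ φ, ∑ a ∈ Finset.Nat.antidiagonalTuple 3 i, dν ε a ψ (pt u ub θ) ^ 2
        ≤ 21 * B ^ 2 := fun ψ hψ => by
      refine (Finset.sum_le_card_nsmul _ _ (B ^ 2) fun a ha => ?_).trans ?_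
      · rw [← sq_abs]
        exact pow_le_pow_left₀ (abs_nonneg _) (h ψ hψ a ha θ) 2
      · rw [nsmul_eq_mul]
        have : ((Finset.Nat.antidiagonalTuple 3 i).card : ℝ) ≤ 21 := by
          exact_mod_cast card_antidiagonalTuple_le hi
        gcongr
    -- At most 8 components with at most 21 multi-indices each: 168 ≤ 13², which is the origin of
    -- the constant 13.
    have h3 : (φ.map fun ψ => ∑ a ∈ Finset.Nat.antidiagonalTuple 3 i, dν ε a ψ (pt u ub θ) ^ 2).sum
        ≤ 168 * B ^ 2 := by
      refine (List.sum_le_card_nsmul _ (21 * B ^ 2) ?_).trans ?_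
      · intro r hr
        obtain ⟨ψ, hψ, rfl⟩ := List.mem_map.1 hr
        exact h2 ψ hψ
      · rw [List.length_map, nsmul_eq_mul]
        have : (φ.length : ℝ) ≤ 8 := by exact_mod_cast hφ
        nlinarith [sq_nonneg B]
    refine (mul_le_mul h3 h1 (Real.sqrt_nonneg _) (by positivity)).trans ?_
    have h4 : M ≤ M ^ 2 := le_self_pow₀ hM (by norm_num)
    calc 168 * B ^ 2 * M ≤ 169 * B ^ 2 * M ^ 2 := by gcongr; norm_num
      _ = (13 * M * B) ^ 2 := by ring
  have hvol : MeasureTheory.volume (Set.Icc (0 : ℝ) 1 ×ˢ Set.Icc (0 : ℝ) 1) = 1 := by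
    rw [MeasureTheory.Measure.volume_eq_prod, MeasureTheory.Measure.prod_prod]
    simp
  have hr : 0 ≤ 13 * M * B := by positivity
  calc l2S X ε i φ u ub ≤ (∫⁻ _ in Set.Icc (0 : ℝ) 1 ×ˢ Set.Icc (0 : ℝ) 1,
        ENNReal.ofReal ((13 * M * B) ^ 2)) ^ (1 / 2 : ℝ) :=
        ENNReal.rpow_le_rpow (MeasureTheory.lintegral_mono hint) (by norm_num)
    _ = ENNReal.ofReal (13 * M * B) := by
        rw [MeasureTheory.setLIntegral_const, hvol, mul_one,
          ENNReal.ofReal_rpow_of_nonneg (by positivity) (by norm_num), ← Real.sqrt_eq_rpow,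
          Real.sqrt_sq hr]

/-- The component `F` is given by a function whose `y`-derivatives, of order at most `n`, are bounded
by `B` at the point corresponding to `x`. -/
def RepBdd (us : ℝ) (n : ℕ) (B : ℝ) (x : ℝ × ℝ) (F : Pt → ℝ) : Prop :=
  ∃ G : S2, Rep us F G ∧ ∀ k ≤ n, |(dy^[k] G).1 x| ≤ B

theorem l2S_le_of_repBdd (hus : 0 < us) {X : Fields} {ε : ℝ} (hε : 0 < ε) (hε1 : ε ≤ 1) {n i : ℕ}
    (hn : n ≤ 5) (hi : i ≤ n) {φ : List (Pt → ℝ)} (hφ : φ.length ≤ 8) {u ub M B : ℝ} (hM : 1 ≤ M)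
    (hB : 0 ≤ B) (hu : u < us) (h : ∀ ψ ∈ φ, RepBdd us n B (Xi us (pt u ub 0)) ψ)
    (hdet : ∀ θ, (X.γMat (pt u ub θ)).det ≤ M ^ 2) :
    l2S X ε i φ u ub ≤ ENNReal.ofReal (13 * M * B) := by
  refine l2S_le (hi.trans hn) hφ hM hB (fun ψ hψ a ha θ => ?_) hdet
  obtain ⟨G, hG, hb⟩ := h ψ hψ
  exact abs_dν_le hus hG hε hε1 a ha (x := pt u ub θ) hu fun k hk => hb k (hk.trans hi)

theorem normHb0_le (hus : 0 < us) {X : Fields} {ε : ℝ} (hε : 0 < ε) (hε1 : ε ≤ 1) {n : ℕ} (hn : n ≤ 5)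
    {φ : List (Pt → ℝ)} (hφ : φ.length ≤ 8) {M : ℝ} (hM : 1 ≤ M) {w : ℝ → ℝ}
    (hw : ∀ u ∈ Set.Ico 0 us, 0 < w u)
    (h : ∀ u ∈ Set.Ico 0 us, ∀ ψ ∈ φ, RepBdd us n (M / w u) (Xi us (pt u 0 0)) ψ)
    (hdet : ∀ u ∈ Set.Ico 0 us, ∀ θ, (X.γMat (pt u 0 θ)).det ≤ M ^ 2) :
    normHb0 X ε us w n φ ≤ ENNReal.ofReal (78 * M ^ 2) := by
  have h1 : ∀ i ∈ Finset.range (n + 1), (⨆ u ∈ Set.Ico 0 us, ENNReal.ofReal (w u) * l2S X ε i φ u 0)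
      ≤ ENNReal.ofReal (13 * M ^ 2) := fun i hi => by
    refine iSup₂_le fun u hu => ?_
    have hwu := hw u hu
    refine (mul_le_mul_right (l2S_le_of_repBdd hus hε hε1 hn (Nat.lt_succ_iff.1 (Finset.mem_range.1 hi))
      hφ hM (by positivity) hu.2 (h u hu) (hdet u hu)) _).trans ?_
    rw [← ENNReal.ofReal_mul hwu.le]
    refine ENNReal.ofReal_le_ofReal (le_of_eq ?_)
    field_simp
  -- At most six orders of differentiation: 6 · 13 = 78.
  refine (Finset.sum_le_card_nsmul _ _ _ h1).trans ?_
  rw [Finset.card_range, nsmul_eq_mul, ← ENNReal.ofReal_natCast, ← ENNReal.ofReal_mul (by positivity)]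
  refine ENNReal.ofReal_le_ofReal ?_
  have : ((n + 1 : ℕ) : ℝ) ≤ 6 := by exact_mod_cast (by omega : n + 1 ≤ 6)
  nlinarith [sq_nonneg M]

theorem normH0_le (hus : 0 < us) {X : Fields} {ε : ℝ} (hε : 0 < ε) (hε1 : ε ≤ 1) {n : ℕ} (hn : n ≤ 5)
    {φ : List (Pt → ℝ)} (hφ : φ.length ≤ 8) {M ubs : ℝ} (hM : 1 ≤ M)
    (h : ∀ ub ∈ Set.Ico 0 ubs, ∀ ψ ∈ φ, RepBdd us n M (Xi us (pt 0 ub 0)) ψ)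
    (hdet : ∀ ub ∈ Set.Ico 0 ubs, ∀ θ, (X.γMat (pt 0 ub θ)).det ≤ M ^ 2) :
    normH0 X ε ubs n φ ≤ ENNReal.ofReal (78 * M ^ 2) := by
  have h1 : ∀ i ∈ Finset.range (n + 1), (⨆ ub ∈ Set.Ico 0 ubs, l2S X ε i φ 0 ub)
      ≤ ENNReal.ofReal (13 * M ^ 2) := fun i hi => by
    refine iSup₂_le fun u hu => ?_
    refine (l2S_le_of_repBdd hus hε hε1 hn (Nat.lt_succ_iff.1 (Finset.mem_range.1 hi))
      hφ hM (by positivity) hus (h u hu) (hdet u hu)).trans ?_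
    refine ENNReal.ofReal_le_ofReal (le_of_eq ?_)
    ring
  refine (Finset.sum_le_card_nsmul _ _ _ h1).trans ?_
  rw [Finset.card_range, nsmul_eq_mul, ← ENNReal.ofReal_natCast, ← ENNReal.ofReal_mul (by positivity)]
  refine ENNReal.ofReal_le_ofReal ?_
  have : ((n + 1 : ℕ) : ℝ) ≤ 6 := by exact_mod_cast (by omega : n + 1 ≤ 6)
  nlinarith [sq_nonneg M]

end Norms

end EinsteinEuler
end

noncomputable section

namespace EinsteinEuler

open Sm

/-! ### The quantitative bounds on the data -/

section DataBounds

variable {us : ℝ} {Φ : Fl}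

theorem DerBdd.repBdd {A : Set (ℝ × ℝ)} {n : ℕ} {M : ℝ} {G : S2} (h : DerBdd A n M G) {F : Pt → ℝ}
    (hF : Rep us F G) {p : ℝ × ℝ} (hp : p ∈ A) : RepBdd us n M p F := ⟨G, hF, fun k hk => h k hk p hp⟩

theorem RepBdd.mono {n n' : ℕ} {B B' : ℝ} {p : ℝ × ℝ} {F : Pt → ℝ} (h : RepBdd us n B p F) (hn : n' ≤ n)
    (hB : B ≤ B') : RepBdd us n' B' p F :=
  let ⟨G, hG, hb⟩ := h
  ⟨G, hG, fun k hk => (hb k (hk.trans hn)).trans hB⟩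

/-- The last hypothesis says W∂_u = θ∂_x at the point. On the singular hypersurface W is f² and θ is
T^{2q}; on the regular one W = 1 and θ = u_*⁻¹. -/
theorem DerBdd.repBdd_Du {A : Set (ℝ × ℝ)} {n : ℕ} {M W : ℝ} {f : S2} {θ : Sm ℝ}
    (h : DerBdd A n M (X θ * dx f)) {F : Pt → ℝ} (hF : Rep us F (Du us f)) {p : ℝ × ℝ} (hp : p ∈ A)
    (hW : 0 < W) (hθ : (exp (-(2 * phiS us))).1 p.1 * W = θ.1 p.1) : RepBdd us n (M / W) p F := by
  refine ⟨_, hF, fun k hk => ?_⟩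
  have h1 := h k hk p hp
  rw [iterate_dy_X_mul, Sm.mul_apply, X_apply, ← hθ] at h1
  rw [Du_apply, iterate_dy_X_mul, Sm.mul_apply, X_apply, le_div_iff₀ hW]
  calc _ = |(exp (-(2 * phiS us))).1 p.1 * W * (dy^[k] (dx f)).1 p| := by
        rw [abs_mul, abs_mul, abs_mul, abs_of_pos hW]; ring
    _ ≤ M := h1

theorem repBdd_zero {n : ℕ} {B : ℝ} (hB : 0 ≤ B) (p : ℝ × ℝ) : RepBdd us n B p fun _ => 0 :=
  (derBdd_zero {p} n hB).repBdd zero_rep rfl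

theorem det_γ_eq (x : Pt) : ((fieldsOf us Φ).γMat x).det
    = (γS Φ 0 0).1 (Xi us x) * (γS Φ 1 1).1 (Xi us x) := by
  rw [Matrix.det_fin_two]
  change (γS Φ 0 0).1 (Xi us x) * (γS Φ 1 1).1 (Xi us x) - 0 * 0 = _
  ring

theorem det_γ_le {A : Set (ℝ × ℝ)} {M : ℝ} (h : ∀ a b, DerBdd A 6 M (γS Φ a b)) {x : Pt}
    (hx : Xi us x ∈ A) : ((fieldsOf us Φ).γMat x).det ≤ M ^ 2 := by
  rw [det_γ_eq, pow_two]
  have h0 := h 0 0 0 (by omega) _ hx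
  have h1 := h 1 1 0 (by omega) _ hx
  simp only [Function.iterate_zero, id_eq] at h0 h1
  refine (le_abs_self _).trans ?_
  rw [abs_mul]
  exact mul_le_mul h0 h1 (abs_nonneg _) ((abs_nonneg _).trans h0)

theorem logτ_rep : Rep us (fieldsOf us Φ).logτ (Φ 3) := fun _ _ => Real.log_exp _

theorem fluid_repBdd {n : ℕ} {B : ℝ} (hB : 0 ≤ B) {p : ℝ × ℝ}
    (h : ∀ i F, Rep us F (flS Φ i) → RepBdd us n B p F) :
    ∀ ψ ∈ fluid (fieldsOf us Φ), RepBdd us n B p ψ := by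
  intro ψ hψ
  simp only [fluid, List.mem_cons, List.not_mem_nil, or_false] at hψ
  rcases hψ with rfl | rfl | rfl | rfl | rfl
  · exact repBdd_zero hB p
  · exact repBdd_zero hB p
  · exact h 0 _ fun _ _ => rfl
  · exact h 1 _ fun _ _ => rfl
  · exact h 2 _ logτ_rep

theorem fluid_u_repBdd (hus : 0 < us) {n : ℕ} {B : ℝ} (hB : 0 ≤ B) {p : ℝ × ℝ}
    (h : ∀ i F, Rep us F (Du us (flS Φ i)) → RepBdd us n B p F) :
    ∀ ψ ∈ (fluid (fieldsOf us Φ)).map (pd 0), RepBdd us n B p ψ := by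
  intro ψ hψ
  simp only [fluid, List.map_cons, List.map_nil, List.mem_cons, List.not_mem_nil, or_false] at hψ
  have h0 : RepBdd us n B p (pd 0 fun _ => 0) := by
    have : Rep us (pd 0 fun _ => 0) 0 := (zero_rep.pd hus 0).congr (map_zero _)
    exact (derBdd_zero {p} n hB).repBdd this rfl
  rcases hψ with rfl | rfl | rfl | rfl | rfl
  · exact h0
  · exact h0
  · exact h 0 _ (Rep.pd hus (G := flS Φ 0) (fun _ _ => rfl) 0)
  · exact h 1 _ (Rep.pd hus (G := flS Φ 1) (fun _ _ => rfl) 0)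
  · exact h 2 _ (logτ_rep.pd hus 0)

theorem comps_repBdd {h : Fin 2 → Fin 2 → Pt → ℝ} {n : ℕ} {B : ℝ} {p : ℝ × ℝ}
    (hh : ∀ a b, RepBdd us n B p (h a b)) : ∀ ψ ∈ comps h, RepBdd us n B p ψ := by
  intro ψ hψ
  simp only [comps, List.mem_cons, List.not_mem_nil, or_false] at hψ
  rcases hψ with rfl | rfl | rfl | rfl <;> exact hh _ _

theorem ricci_repBdd (hus : 0 < us) {n : ℕ} {B : ℝ} (hB : 0 ≤ B) {p : ℝ × ℝ} {F : Pt → ℝ}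
    (hF : RepBdd us n B p F) (hfl : ∀ ψ ∈ fluid (fieldsOf us Φ), RepBdd us n B p ψ) :
    ∀ ψ ∈ [(fieldsOf us Φ).ζ 0, (fieldsOf us Φ).ζ 1, F] ++ fluid (fieldsOf us Φ),
      RepBdd us n B p ψ := by
  intro ψ hψ
  have h0 : ∀ A, RepBdd us n B p ((fieldsOf us Φ).ζ A) := fun A =>
    (derBdd_zero {p} n hB).repBdd (ζ_rep Φ hus A) rfl
  rcases List.mem_append.1 hψ with h | h
  · simp only [List.mem_cons, List.not_mem_nil, or_false] at h
    rcases h with rfl | rfl | rfl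
    · exact h0 0
    · exact h0 1
    · exact hF
  · exact hfl ψ h

/-- Pointwise bounds from `exists_field_bound` on each hypersurface, with the weights adapted to it.
As ρ = 0 at the corner, det γ = e^{4ρ} = 1 there; the constant 156M² is the sum of two norms bounded
by 78M². -/
theorem exists_dataBounds (e : Eos) (C : ℝ) : ∃ M, 1 ≤ M ∧
    ∀ {q ε us ubs : ℝ} {Φ : Fl} {z z' : Fin 3 → S2} {θ m θ' m' : Sm ℝ}, 0 < ε → ε ≤ 1 → 0 < us → 0 < ubs →
      (Φ 0).1 (0, 0) = 0 →
      JetsBdd e C (axis ubs) Φ z' θ' m' → θ'.1 0 = us⁻¹ →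
      JetsBdd e C (line (Set.Ici 0)) Φ z θ m → z 1 = X θ * dx (Φ 1) →
      (∀ u ∈ Set.Ico 0 us, 0 < wt q us u ∧
        θ.1 (-Real.log (1 - u / us)) = (us - u)⁻¹ * wt q us u ^ 2) →
      DataBounds q ε us ubs 1 (156 * M ^ 2) (fieldsOf us Φ) := by
  obtain ⟨M, hM, hb⟩ := exists_field_bound e C
  refine ⟨M, hM, fun {q ε us ubs Φ z z' θ m θ' m'} hε hε1 hus hubs h00 h0 hθ' h1 hz1 hw => ?_⟩
  obtain ⟨a1, a2, a3, a4, a5, a6, -⟩ := hb h0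
  obtain ⟨b1, b2, b3, b4, b5, b6, b7⟩ := hb h1
  have b7 := b7 hz1
  have hM0 : 0 ≤ M := by linarith
  have hMM : M ≤ 156 * M ^ 2 := by nlinarith
  have hX0 : ∀ ub θ, Xi us (pt 0 ub θ) = (0, ub) := fun ub θ => by
    change (-Real.log (1 - 0 / us), ub) = _
    simp
  have hX1 : ∀ u θ, Xi us (pt u 0 θ) = (-Real.log (1 - u / us), 0) := fun u θ => rfl
  have hA0 : ∀ ub ∈ Set.Ico 0 ubs, ∀ θ, Xi us (pt 0 ub θ) ∈ axis ubs := fun ub hub θ => by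
    rw [hX0]; exact ⟨rfl, hub.1, hub.2⟩
  have hA1 : ∀ u ∈ Set.Ico 0 us, ∀ θ, Xi us (pt u 0 θ) ∈ line (Set.Ici 0) := fun u hu θ => by
    rw [hX1]
    refine ⟨?_, rfl⟩
    have h2 : 0 < 1 - u / us := one_sub_pos hus (x := pt u 0 0) hu.2
    have h3 : u / us ≥ 0 := div_nonneg hu.1 hus.le
    have := Real.log_nonpos h2.le (by linarith)
    change 0 ≤ -Real.log (1 - u / us)
    linarith
  have hE0 : ∀ ub ∈ Set.Ico 0 ubs, (exp (-(2 * phiS us))).1 (Xi us (pt 0 ub 0)).1 * 1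
      = θ'.1 (Xi us (pt 0 ub 0)).1 := fun ub hub => by
    rw [exp_neg_phiS_Xi hus (x := pt 0 ub 0) hus, hX0, hθ', mul_one]
    congr 1
    exact sub_zero us
  have hE1 : ∀ u ∈ Set.Ico 0 us, (exp (-(2 * phiS us))).1 (Xi us (pt u 0 0)).1 * wt q us u ^ 2
      = θ.1 (Xi us (pt u 0 0)).1 := fun u hu => by
    rw [exp_neg_phiS_Xi hus (x := pt u 0 0) hu.2, hX1, (hw u hu).2]
    rfl
  have hd0 : ∀ ub ∈ Set.Ico 0 ubs, ∀ θ, ((fieldsOf us Φ).γMat (pt 0 ub θ)).det ≤ M ^ 2 :=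
    fun ub hub θ => det_γ_le a1 (hA0 ub hub θ)
  have hd1 : ∀ u ∈ Set.Ico 0 us, ∀ θ, ((fieldsOf us Φ).γMat (pt u 0 θ)).det ≤ M ^ 2 :=
    fun u hu θ => det_γ_le b1 (hA1 u hu θ)
  have fl0 : ∀ ub ∈ Set.Ico 0 ubs, ∀ ψ ∈ fluid (fieldsOf us Φ),
      RepBdd us 5 M (Xi us (pt 0 ub 0)) ψ := fun ub hub =>
    fluid_repBdd hM0 fun i F hF => (a5 i).repBdd hF (hA0 ub hub 0)
  have fl1 : ∀ u ∈ Set.Ico 0 us, ∀ ψ ∈ fluid (fieldsOf us Φ),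
      RepBdd us 5 (M / 1) (Xi us (pt u 0 0)) ψ := fun u hu =>
    fluid_repBdd (by simpa) fun i F hF => (((b5 i).repBdd hF (hA1 u hu 0))).mono le_rfl (by simp)
  have hlen : (fluid (fieldsOf us Φ)).length = 5 := rfl
  have hW : ∀ u ∈ Set.Ico 0 us, 0 < wt q us u ^ 2 := fun u hu => pow_pos (hw u hu).1 2
  have hsum : ENNReal.ofReal (78 * M ^ 2) + ENNReal.ofReal (78 * M ^ 2)
      = ENNReal.ofReal (156 * M ^ 2) := by
    rw [← ENNReal.ofReal_add (by positivity) (by positivity)]; congr 1; ring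
  have hle : ENNReal.ofReal (78 * M ^ 2) ≤ ENNReal.ofReal (156 * M ^ 2) :=
    ENNReal.ofReal_le_ofReal (by nlinarith)
  have hDu2 : Rep us (fieldsOf us Φ).trχb (Du us (2 * Φ 0)) := (trχb_rep Φ hus).congr (by
    rw [Du_apply, Du_apply, dx_mul, dx_ofNat]; ring)
  have hDuχ : ∀ a b, Rep us ((fieldsOf us Φ).χb a b) (Du us (Sm.const (1 / 2) * γS Φ a b)) :=
    fun a b => (χb_rep Φ hus a b).congr (by
      rw [χbS, Du_apply, Du_apply, dx_mul, dx_const]; ring)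
  have mono4 : ∀ {B : ℝ} {p : ℝ × ℝ} {l : List (Pt → ℝ)}, (∀ ψ ∈ l, RepBdd us 5 B p ψ) →
      ∀ ψ ∈ l, RepBdd us 4 B p ψ := fun h ψ hψ => (h ψ hψ).mono (by omega) le_rfl
  refine ⟨fun θ => ?_, fun i hi a ha A B θ => ?_, ?_, ?_, ?_, ?_, ?_, ?_⟩
  · have : ((fieldsOf us Φ).γMat (pt 0 0 θ)).det = 1 := by
      rw [det_γ_eq, hX0]
      change Real.exp (2 * ((Φ 0).1 (0, 0) + (Φ 1).1 (0, 0)))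
        * Real.exp (2 * ((Φ 0).1 (0, 0) - (Φ 1).1 (0, 0))) = 1
      rw [← Real.exp_add, h00]
      ring_nf
      exact Real.exp_zero
    rw [this]
    exact ⟨le_rfl, by nlinarith⟩
  · exact (abs_dν_le hus (γ_rep Φ A B) hε hε1 a ha (x := pt 0 0 θ) hus fun k hk =>
      a1 A B k (hk.trans hi) _ (hA0 0 ⟨le_rfl, hubs⟩ θ)).trans hMM
  · rw [← hsum]
    refine add_le_add (normH0_le hus hε hε1 le_rfl (by simp [comps]) hM (fun ub hub => ?_) hd0)
      (normH0_le hus hε hε1 (by omega) (by simp [hlen]) hM (fun ub hub => ?_) hd0)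
    · exact comps_repBdd fun a b => (a2 a b).repBdd (χ_rep Φ hus a b) (hA0 ub hub 0)
    · refine mono4 (ricci_repBdd hus hM0 ?_ (fl0 ub hub))
      have := a4.repBdd_Du hDu2 (hA0 ub hub 0) one_pos (hE0 ub hub)
      rwa [div_one] at this
  · rw [← hsum]
    refine add_le_add (normHb0_le hus hε hε1 le_rfl (by simp [comps]) hM hW (fun u hu => ?_) hd1)
      (normHb0_le hus hε hε1 (by omega) (by simp [hlen]) hM (fun _ _ => one_pos) (fun u hu => ?_) hd1)
    · exact comps_repBdd fun a b => (b7 a b).repBdd_Du (hDuχ a b) (hA1 u hu 0) (hW u hu) (hE1 u hu)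
    · refine mono4 (ricci_repBdd hus (by simpa) ?_ (fl1 u hu))
      exact (b3.repBdd (trχ_rep Φ hus) (hA1 u hu 0)).mono le_rfl (by simp)
  · refine (normH0_le hus hε hε1 (by omega) (by simp [hlen]) hM (fun ub hub => ?_) hd0).trans hle
    refine mono4 (fluid_u_repBdd hus hM0 fun i F hF => ?_)
    have := (a6 i).repBdd_Du hF (hA0 ub hub 0) one_pos (hE0 ub hub)
    rwa [div_one] at this
  · exact (normH0_le hus hε hε1 le_rfl (by simp [hlen]) hM (fun ub hub => fl0 ub hub) hd0).trans hle
  · refine (normHb0_le hus hε hε1 (by omega) (by simp [hlen]) hM hW (fun u hu => ?_) hd1).trans hle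
    exact mono4 (fluid_u_repBdd hus (div_nonneg hM0 (hW u hu).le) fun i F hF =>
      (b6 i).repBdd_Du hF (hA1 u hu 0) (hW u hu) (hE1 u hu))
  · exact (normHb0_le hus hε hε1 le_rfl (by simp [hlen]) hM (fun _ _ => one_pos)
      (fun u hu => fl1 u hu) hd1).trans hle

end DataBounds

end EinsteinEuler
end

/-! ### Lower bound for the second derivative of the shear variable -/

noncomputable section

namespace EinsteinEuler

open Sm

/-! ### Derivatives of the weights -/

section

variable {q t₀ : ℝ}

theorem hasDerivAt_θS (h1 : 1 ≤ t₀) {x : ℝ} (hx : -(1 / 4) < x) :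
    HasDerivAt (θS q t₀).1 (2 * q * (t₀ + x)⁻¹ * (θS q t₀).1 x) x := by
  have hT : 0 < t₀ + x := by linarith
  have h2 : (θS q t₀).1 =ᶠ[nhds x] fun x => (t₀ + x) ^ (2 * q) := by
    filter_upwards [Ioi_mem_nhds hx] with x' hx'
    rw [θS_apply h1, clamp_eq (le_of_lt hx')]
  have h3 := ((hasDerivAt_id x).const_add t₀).rpow_const (p := 2 * q) (Or.inl hT.ne')
  refine (h3.congr_of_eventuallyEq h2).congr_deriv ?_
  rw [h2.eq_of_nhds]
  simp only [id]
  rw [Real.rpow_sub_one hT.ne']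
  ring

theorem hasDerivAt_mS (h1 : 1 ≤ t₀) {x : ℝ} (hx : -(1 / 4) < x) :
    HasDerivAt (mS q t₀).1 ((2 * q * (t₀ + x)⁻¹ - 1) * (mS q t₀).1 x) x := by
  have h2 : (mS q t₀).1 =ᶠ[nhds x] fun x => (θS q t₀).1 x * (Real.exp (-t₀) * Real.exp (-x)) := by
    filter_upwards [Ioi_mem_nhds hx] with x' hx'
    change (θS q t₀).1 x' * (Real.exp (-t₀) * Real.exp (-clamp.1 x')) = _
    rw [clamp_eq (le_of_lt hx')]
  have h3 := (hasDerivAt_θS (q := q) h1 hx).mul ((hasDerivAt_id x).neg.exp.const_mul (Real.exp (-t₀)))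
  refine (h3.congr_of_eventuallyEq h2).congr_deriv ?_
  rw [h2.eq_of_nhds]
  simp only [id, Pi.neg_apply]
  ring

theorem hasDerivAt_z0S (h1 : 1 ≤ t₀) {x : ℝ} (hx : -(1 / 4) < x) :
    HasDerivAt (z0S q t₀).1 ((2 * q * (t₀ + x)⁻¹ - 1) * (z0S q t₀).1 x
      + (4 * q * (t₀ + x)⁻¹ - 1) * (t₀ + x) ^ (-(2 * q))) x := by
  have hT : 0 < t₀ + x := by linarith
  have h2 := (hasDerivAt_θS (q := q) h1 hx).mul ((rS q t₀).differentiable x).hasDerivAt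
  refine h2.congr_deriv ?_
  have h3 := deriv_rS (q := q) h1 hx
  rw [der_apply] at h3
  have h4 : (θS q t₀).1 x * (t₀ + x) ^ (-(4 * q)) = (t₀ + x) ^ (-(2 * q)) := by
    rw [θS_apply h1, clamp_eq hx.le, ← Real.rpow_add hT]; congr 1; ring
  have h5 : (z0S q t₀).1 x = (θS q t₀).1 x * (rS q t₀).1 x := rfl
  rw [h5]
  linear_combination (θS q t₀).1 x * h3 + (4 * q * (t₀ + x)⁻¹ - 1) * h4

theorem hasDerivAt_νS (h1 : 1 ≤ t₀) {x : ℝ} (hx : -(1 / 4) < x) :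
    HasDerivAt (νS q t₀).1 (4 * q * ((t₀ + x)⁻¹) ^ 2 - 2 * (z0S q t₀).1 x *
      ((2 * q * (t₀ + x)⁻¹ - 1) * (z0S q t₀).1 x
        + (4 * q * (t₀ + x)⁻¹ - 1) * (t₀ + x) ^ (-(2 * q)))) x := by
  have hT : 0 < t₀ + x := by linarith
  have h2 : (νS q t₀).1 =ᶠ[nhds x] fun x => 1 - 4 * q * (t₀ + x)⁻¹ - (z0S q t₀).1 x ^ 2 := by
    filter_upwards [Ioi_mem_nhds hx] with x' hx'
    have : Real.exp (-(lT t₀).1 x') = (t₀ + x')⁻¹ := by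
      rw [← Real.rpow_neg_one, ← neg_one_mul, exp_mul_lT h1, clamp_eq (le_of_lt hx')]
    rw [← this]; rfl
  have h3 := ((((hasDerivAt_id x).const_add t₀).inv hT.ne').const_mul (4 * q)).const_sub 1 |>.sub
    ((hasDerivAt_z0S (q := q) h1 hx).pow 2)
  refine (h3.congr_of_eventuallyEq h2).congr_deriv ?_
  simp only [id]
  field_simp
  ring

end

/-! ### The rate of blow-up -/

section Rates

variable {e : Eos} {q t₀ : ℝ} {Z : ℝ → YS} {Φ : Fl}

/-- The function under the square root in the constraint. -/
def root (e : Eos) (q t₀ : ℝ) (Z : ℝ → YS) (x : ℝ) : ℝ :=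
  (νS q t₀).1 x - 1 / 2 * e.h.1 (Z x 3 0) * Real.exp (-(2 * Z x 4 0)) * (mS q t₀).1 x ^ 2

theorem exists_enthalpy_bound (e : Eos) : ∃ M, 0 ≤ M ∧ ∀ {q t₀ : ℝ} {Z : ℝ → YS}, 0 < q → 1 ≤ t₀ →
    JetFlow e q t₀ Z → (∀ x, Z x ∈ Metric.closedBall (baseJ e 0) 2) →
    (∀ x, ctrl q t₀ x ∈ Metric.closedBall (0, 1, 0) 1) → ∀ x, 0 ≤ x →
      ∃ g', HasDerivAt (fun x => e.h.1 (Z x 3 0) * Real.exp (-(2 * Z x 4 0))) g' x ∧ |g'| ≤ M ∧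
        |e.h.1 (Z x 3 0) * Real.exp (-(2 * Z x 4 0))| ≤ M := by
  set G : YS → ℝ := fun y => e.h.1 (y 3 0) * Real.exp (-(2 * y 4 0)) with hG
  have hGs : ContDiff ℝ ∞ G := (e.h.smooth.comp (by fun_prop)).mul (by fun_prop)
  have hc : Continuous fun p : (ℝ × ℝ × ℝ) × YS => fderiv ℝ G p.2 (jetField e p) :=
    ((hGs.continuous_fderiv (by simp)).comp continuous_snd).clm_apply (contDiff_jetField e).continuous
  obtain ⟨M1, h1⟩ := ((isCompact_closedBall ((0, 1, 0) : ℝ × ℝ × ℝ) 1).prod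
    (isCompact_closedBall (baseJ e 0) 2)).exists_bound_of_continuousOn hc.continuousOn
  obtain ⟨M2, h2⟩ := (isCompact_closedBall (baseJ e 0) 2).exists_bound_of_continuousOn
    hGs.continuous.continuousOn
  refine ⟨|M1| + |M2|, by positivity, fun {q t₀ Z} hq ht hZ hb hctrl x hx => ?_⟩
  have h3 := (hGs.differentiable (by simp) (Z x)).hasFDerivAt.comp_hasDerivAt x (hZ x (by linarith))
  refine ⟨_, h3, ?_, (h2 _ (hb x)).trans (by linarith [le_abs_self M2, abs_nonneg M1])⟩
  have h4 := h1 (ctrl q t₀ x, Z x) ⟨hctrl x, hb x⟩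
  rw [Real.norm_eq_abs] at h4
  have hT : 1 ≤ t₀ + x := by linarith
  have h5 : (t₀ + x) ^ (-(2 * q)) ≤ 1 := Real.rpow_le_one_of_one_le_of_nonpos hT (by linarith)
  have h6 : 0 ≤ (t₀ + x) ^ (-(2 * q)) := Real.rpow_nonneg (by linarith) _
  rw [map_smul, smul_eq_mul, abs_mul, abs_of_nonneg h6]
  calc _ ≤ 1 * |M1| := mul_le_mul h5 (h4.trans (le_abs_self _)) (abs_nonneg _) zero_le_one
    _ ≤ _ := by linarith [abs_nonneg M2]

/-- Every term of the derivative contains a factor 1/T, θρ_x or m, all of which are small for t₀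
large; the derivative of the matter factor is bounded along the flow by compactness. -/
theorem exists_root_deriv_bound (e : Eos) {q : ℝ} (hq : 0 < q) : ∃ δ, 0 < δ ∧ δ ≤ 1 ∧
    ∀ {t₀ : ℝ} {Z : ℝ → YS}, 1 ≤ t₀ → 64 * q ≤ t₀ →
    JetFlow e q t₀ Z → (∀ x, Z x ∈ Metric.closedBall (baseJ e 0) 2) →
    (∀ x, ctrl q t₀ x ∈ Metric.closedBall (0, 1, 0) δ) → ∀ x, 0 ≤ x →
      ∃ r', HasDerivAt (root e q t₀ Z) r' x ∧ |r'| ≤ 1 / 4 := by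
  obtain ⟨M, hM0, hM⟩ := exists_enthalpy_bound e
  have hMp : 0 < M + 4 := by linarith
  -- The total is at most 1/16 from 4q/T², 4δ from (θρ_x)² and 2Mδ from the matter term; with (M +
  -- 4)δ = 1/16 this stays below 1/4.
  refine ⟨1 / (16 * (M + 4)), by positivity, ?_, fun {t₀ Z} h1 hqt hZ hb hctrl x hx => ?_⟩
  · rw [div_le_one (by positivity)]; linarith
  set δ := 1 / (16 * (M + 4)) with hδ
  have hδM : (M + 4) * δ = 1 / 16 := by rw [hδ]; field_simp
  have hδ0 : 0 < δ := by positivity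
  have hδ1 : δ ≤ 1 / 64 := by nlinarith
  obtain ⟨g', hg, hg', hgM⟩ := hM hq h1 hZ hb (fun x => Metric.closedBall_subset_closedBall
    (by linarith) (hctrl x)) x hx
  have hx' : -(1 / 4) < x := by linarith
  have hc := hctrl x
  simp only [Metric.mem_closedBall, ctrl, Prod.dist_eq, Real.dist_eq, sub_zero, sup_le_iff] at hc
  obtain ⟨hz, -, hm⟩ := hc
  have hT : 1 ≤ t₀ + x := by linarith
  have hqT : q * (t₀ + x)⁻¹ ≤ 1 / 64 := by
    rw [← div_eq_mul_inv, div_le_iff₀ (by linarith)]; linarith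
  have hqT0 : 0 < q * (t₀ + x)⁻¹ := by positivity
  have hTi : (t₀ + x)⁻¹ ≤ 1 := inv_le_one_of_one_le₀ hT
  have hTi0 : 0 < (t₀ + x)⁻¹ := by positivity
  have hp : (t₀ + x) ^ (-(2 * q)) ≤ 1 := Real.rpow_le_one_of_one_le_of_nonpos hT (by linarith)
  have hp0 : 0 ≤ (t₀ + x) ^ (-(2 * q)) := Real.rpow_nonneg (by linarith) _
  have hd := (hasDerivAt_νS (q := q) h1 hx').sub
    ((hg.mul ((hasDerivAt_mS (q := q) h1 hx').pow 2)).const_mul (1 / 2))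
  have hroot : root e q t₀ Z = (νS q t₀).1 - fun x => 1 / 2 *
      (((fun x => e.h.1 (Z x 3 0) * Real.exp (-(2 * Z x 4 0))) * (mS q t₀).1 ^ 2) x) := by
    funext x
    simp only [root, Pi.sub_apply, Pi.mul_apply, Pi.pow_apply]
    ring
  rw [hroot]
  refine ⟨_, hd, ?_⟩
  set z := (z0S q t₀).1 x
  set m := (mS q t₀).1 x
  set g := e.h.1 (Z x 3 0) * Real.exp (-(2 * Z x 4 0))
  set a := q * (t₀ + x)⁻¹ with ha
  have b1 : |4 * q * ((t₀ + x)⁻¹) ^ 2| ≤ 1 / 16 := by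
    rw [abs_of_nonneg (by positivity), show 4 * q * ((t₀ + x)⁻¹) ^ 2 = 4 * a * (t₀ + x)⁻¹ by
      rw [ha]; ring]
    nlinarith
  have b2 : |(2 * a - 1) * z + (4 * a - 1) * (t₀ + x) ^ (-(2 * q))| ≤ 2 := by
    refine (abs_add_le _ _).trans ?_
    rw [abs_mul, abs_mul, abs_of_nonneg hp0]
    have c1 : |2 * a - 1| ≤ 1 := abs_le.2 ⟨by linarith, by linarith⟩
    have c2 : |4 * a - 1| ≤ 1 := abs_le.2 ⟨by linarith, by linarith⟩
    have c3 : |2 * a - 1| * |z| ≤ 1 * 1 := mul_le_mul c1 (by linarith) (abs_nonneg _) zero_le_one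
    have c4 : |4 * a - 1| * (t₀ + x) ^ (-(2 * q)) ≤ 1 * 1 := mul_le_mul c2 hp hp0 zero_le_one
    linarith
  have b3 : |2 * z * ((2 * a - 1) * z + (4 * a - 1) * (t₀ + x) ^ (-(2 * q)))| ≤ 4 * δ := by
    rw [abs_mul, abs_mul, abs_two]
    calc _ ≤ 2 * δ * 2 := by gcongr
      _ = 4 * δ := by ring
  have b4 : |m ^ 2| ≤ δ := by
    rw [abs_pow]
    nlinarith [abs_nonneg m]
  have b5 : |2 * m ^ 1 * ((2 * a - 1) * m)| ≤ 2 * δ := by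
    have c1 : |2 * a - 1| ≤ 1 := abs_le.2 ⟨by linarith, by linarith⟩
    rw [show 2 * m ^ 1 * ((2 * a - 1) * m) = 2 * ((2 * a - 1) * m ^ 2) by ring, abs_mul, abs_mul, abs_two]
    have : |2 * a - 1| * |m ^ 2| ≤ 1 * δ := mul_le_mul c1 b4 (abs_nonneg _) zero_le_one
    linarith
  have b6 : |1 / 2 * (g' * m ^ 2 + g * (2 * m ^ 1 * ((2 * a - 1) * m)))| ≤ 2 * (M * δ) := by
    rw [abs_mul, abs_of_pos (by norm_num : (0 : ℝ) < 1 / 2)]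
    have c1 : |g' * m ^ 2| ≤ M * δ := by
      rw [abs_mul]; exact mul_le_mul hg' b4 (abs_nonneg _) hM0
    have c2 : |g * (2 * m ^ 1 * ((2 * a - 1) * m))| ≤ M * (2 * δ) := by
      rw [abs_mul]; exact mul_le_mul hgM b5 (abs_nonneg _) hM0
    have := abs_add_le (g' * m ^ 2) (g * (2 * m ^ 1 * ((2 * a - 1) * m)))
    nlinarith [mul_nonneg hM0 hδ0.le]
  have e1 : ∀ r : ℝ, 2 * q * (t₀ + x)⁻¹ - r = 2 * a - r := fun r => by rw [ha]; ring
  have e2 : ∀ r : ℝ, 4 * q * (t₀ + x)⁻¹ - r = 4 * a - r := fun r => by rw [ha]; ring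
  have e3 : (((2 : ℕ) : ℝ)) = 2 := by norm_num
  simp only [e1, e2, e3, Pi.pow_apply, show 2 - 1 = 1 from rfl]
  have t1 := abs_sub (4 * q * ((t₀ + x)⁻¹) ^ 2
    - 2 * z * ((2 * a - 1) * z + (4 * a - 1) * (t₀ + x) ^ (-(2 * q))))
    (1 / 2 * (g' * m ^ 2 + g * (2 * m ^ 1 * ((2 * a - 1) * m))))
  have t2 := abs_sub (4 * q * ((t₀ + x)⁻¹) ^ 2)
    (2 * z * ((2 * a - 1) * z + (4 * a - 1) * (t₀ + x) ^ (-(2 * q))))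
  refine t1.trans ?_
  nlinarith

/-- The combination of second derivatives which determines the curvature is bounded below. -/
theorem le_curvature (hq : 0 < q) (h1 : 1 ≤ t₀) (hqt : 64 * q ≤ t₀) (hZ : JetFlow e q t₀ Z)
    (hJ : HasJets Φ Z) (hν : RootBound e q t₀ Z) {δ : ℝ} (hδ : δ ≤ 1 / 16)
    (hctrl : ∀ x, ctrl q t₀ x ∈ Metric.closedBall (0, 1, 0) δ) {x : ℝ} (hx : 0 ≤ x) {r' : ℝ}
    (hr : HasDerivAt (root e q t₀ Z) r' x) (hr' : |r'| ≤ 1 / 4) :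
    1 / 4 ≤ (θS q t₀).1 x * ((dx (dx (Φ 1))).1 (x, 0) + (dx (Φ 1)).1 (x, 0)
      + 2 * (dx (Φ 0)).1 (x, 0) * (dx (Φ 1)).1 (x, 0)) := by
  have hx' : -(1 / 4) < x := by linarith
  obtain ⟨v0, v1, -⟩ := z_values hZ h1 hJ hx'
  have hT : 1 ≤ t₀ + x := by linarith
  have hT0 : 0 < t₀ + x := by linarith
  set S := sqS.1 (root e q t₀ Z x) with hS
  have hv1 : (θS q t₀).1 x * (dx (Φ 1)).1 (x, 0) = S := v1
  have hSp : 0 < S := sqS_pos _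
  have hSsq : S ^ 2 = root e q t₀ Z x := sqS_sq (hν x)
  have hSh : 1 / 2 ≤ S ^ 2 := by rw [hSsq]; exact hν x
  have hev : (fun x => (θS q t₀).1 x * (dx (Φ 1)).1 (x, 0)) =ᶠ[nhds x]
      fun x => sqS.1 (root e q t₀ Z x) := by
    filter_upwards [Ioi_mem_nhds hx'] with y hy using (z_values hZ h1 hJ hy).2.1
  have hsq : (fun x => ((θS q t₀).1 x * (dx (Φ 1)).1 (x, 0)) ^ 2) =ᶠ[nhds x] root e q t₀ Z := by
    filter_upwards [hev] with y hy
    rw [hy]; exact sqS_sq (hν y)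
  have hd := ((hasDerivAt_θS (q := q) h1 hx').mul (hasDerivAt_fst (dx (Φ 1)) x 0)).pow 2
  have hd2 := (hd.congr_of_eventuallyEq (f₁ := root e q t₀ Z) hsq.symm).unique hr
  simp only [Pi.mul_apply] at hd2
  set θ := (θS q t₀).1 x
  set w := (dx (Φ 1)).1 (x, 0)
  set w2 := (dx (dx (Φ 1))).1 (x, 0)
  set a := q * (t₀ + x)⁻¹ with ha
  have hqT : a ≤ 1 / 64 := by
    rw [ha, ← div_eq_mul_inv, div_le_iff₀ (by linarith)]; linarith
  have ha0 : 0 < a := by positivity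
  -- Differentiating (θw_x)² = `root` and using θ' = 2qθ/T shows that θw_xx differs from the small
  -- derivative of S only by 2aS.
  have hder : 2 * S * (2 * a * S + θ * w2) = r' := by
    rw [← hd2, ha, ← hv1]
    push_cast
    ring
  have hθ1 : 1 ≤ θ := by
    change 1 ≤ (θS q t₀).1 x
    rw [θS_apply h1, clamp_eq hx'.le]
    exact Real.one_le_rpow hT (by linarith)
  have hrb : |(dx (Φ 0)).1 (x, 0)| ≤ 1 / 16 := by
    have hc := hctrl x
    simp only [Metric.mem_closedBall, ctrl, Prod.dist_eq, Real.dist_eq, sub_zero, sup_le_iff] at hc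
    have h2 : (z0S q t₀).1 x = θ * (rS q t₀).1 x := rfl
    have h3 := hc.1.trans hδ
    rw [h2, abs_mul, abs_of_pos (by linarith : 0 < θ)] at h3
    rw [v0]
    exact (le_mul_of_one_le_left (abs_nonneg _) hθ1).trans h3
  set r := (dx (Φ 0)).1 (x, 0)
  have hre : θ * (w2 + w + 2 * r * w) = θ * w2 + S * (1 + 2 * r) := by rw [← hv1]; ring
  rw [hre]
  obtain ⟨r1, r2⟩ := abs_le.1 hrb
  obtain ⟨r3, r4⟩ := abs_le.1 hr'
  -- S² ≥ 1/2. The main term S(1 + 2r) then dominates the errors -1/5 and 2aS.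
  have hS7 : 7 / 10 ≤ S := by nlinarith
  have hX : -(1 / 4) ≤ 2 * S * (2 * a * S + θ * w2) := by rw [hder]; exact r3
  have hY : -(1 / 5) ≤ 2 * a * S + θ * w2 := by
    by_contra hcon
    push Not at hcon
    nlinarith
  have k1 : a * S ≤ 1 / 64 * S := by gcongr
  have k2 : -(1 / 16) * S ≤ r * S := by gcongr
  nlinarith

end Rates

end EinsteinEuler
end

/-! ### Blow-up rates and assembly of the fields -/

noncomputable section

namespace EinsteinEuler

open Sm

/-! ### Blow-up along the singular hypersurface -/

section Blowup

variable {e : Eos} {q t₀ : ℝ} {Z : ℝ → YS} {Φ : Fl}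

/-- The logarithmic coordinate and the weight on the singular hypersurface. -/
theorem wt_values (h1 : 1 ≤ t₀) {u : ℝ} (hu : u ∈ Set.Ico 0 (Real.exp (-t₀))) :
    0 ≤ -Real.log (1 - u / Real.exp (-t₀)) ∧
    Real.log (1 / (Real.exp (-t₀) - u)) = t₀ + -Real.log (1 - u / Real.exp (-t₀)) ∧
    0 < wt q (Real.exp (-t₀)) u ∧
    (θS q t₀).1 (-Real.log (1 - u / Real.exp (-t₀)))
      = (Real.exp (-t₀) - u)⁻¹ * wt q (Real.exp (-t₀)) u ^ 2 := by
  set us := Real.exp (-t₀) with hus'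
  have hus : 0 < us := Real.exp_pos _
  have h2 : 0 < 1 - u / us := one_sub_pos hus (x := pt u 0 0) hu.2
  have h3 : 0 ≤ u / us := div_nonneg hu.1 hus.le
  have hx : 0 ≤ -Real.log (1 - u / us) := by
    have := Real.log_nonpos h2.le (by linarith)
    linarith
  have hsub : us - u = us * (1 - u / us) := by field_simp
  have hp : 0 < us - u := sub_pos.2 hu.2
  have hlog : Real.log (1 / (us - u)) = t₀ + -Real.log (1 - u / us) := by
    rw [one_div, Real.log_inv, hsub, Real.log_mul hus.ne' h2.ne', hus', Real.log_exp]
    ring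
  have hT : 0 < t₀ + -Real.log (1 - u / us) := by linarith
  refine ⟨hx, hlog, ?_, ?_⟩
  · rw [wt, hlog]
    exact mul_pos (Real.rpow_pos_of_pos hp _) (Real.rpow_pos_of_pos hT _)
  · rw [θS_apply h1, clamp_eq (by linarith), wt, hlog, mul_pow, ← Real.rpow_natCast, ← Real.rpow_natCast,
      ← Real.rpow_mul hp.le, ← Real.rpow_mul hT.le]
    norm_num
    rw [mul_comm q 2, inv_mul_cancel_left₀ hp.ne']

/-- |χbar-hat|² is 2 · `root` · f^{-4} with `root` between 1/2 and 3/2, so |χbar-hat| f² lies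
between 1 and √3. -/
theorem exactBlowup_of (h1 : 1 ≤ t₀) (hZ : JetFlow e q t₀ Z) (hJ : HasJets Φ Z)
    (hν : ∀ x, |root e q t₀ Z x - 1| ≤ 1 / 2) {c C : ℝ} (hc0 : 0 ≤ c) (hc : c ≤ 1) (hC : 2 ≤ C) :
    ExactBlowup q (Real.exp (-t₀)) c C (fieldsOf (Real.exp (-t₀)) Φ) := by
  intro u hu θ
  obtain ⟨hx, -, hw, hwt⟩ := wt_values (q := q) h1 hu
  have hus := Real.exp_pos (-t₀)
  rw [hatχb_rep Φ hus (pt u 0 θ) hu.2]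
  set us := Real.exp (-t₀) with hus'
  set x := -Real.log (1 - u / us) with hxd
  have hXi : Xi us (pt u 0 θ) = (x, 0) := rfl
  obtain ⟨-, v1, -⟩ := z_values hZ h1 hJ (by linarith : -(1 / 4) < x)
  obtain ⟨b1, b2⟩ := abs_le.1 (hν x)
  have hS : sqS.1 (root e q t₀ Z x) ^ 2 = root e q t₀ Z x := sqS_sq (by linarith)
  have hE : (exp (-(2 * phiS us))).1 x = (us - u)⁻¹ := exp_neg_phiS_Xi hus (x := pt u 0 θ) hu.2
  have hW : 0 < wt q us u ^ 2 := by positivity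
  have hval : (Du us (Φ 1)).1 (x, 0) = sqS.1 (root e q t₀ Z x) * (wt q us u ^ 2)⁻¹ := by
    rw [Du_apply, Sm.mul_apply, X_apply, hE, eq_mul_inv_iff_mul_eq₀ hW.ne']
    change _ = sqS.1 ((νS q t₀).1 x - _)
    rw [← v1, hwt]
    ring
  have hsq : (2 * Du us (Φ 1) ^ 2).1 (Xi us (pt u 0 θ))
      = 2 * root e q t₀ Z x * ((wt q us u ^ 2)⁻¹) ^ 2 := by
    rw [hXi]
    change 2 * (Du us (Φ 1)).1 (x, 0) ^ 2 = _
    rw [hval, mul_pow, hS]; ring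
  rw [hsq]
  have hWi : 0 < (wt q us u ^ 2)⁻¹ := by positivity
  constructor
  · refine Real.le_sqrt_of_sq_le ?_
    rw [mul_pow]
    gcongr
    nlinarith
  · refine Real.sqrt_le_iff.2 ⟨by positivity, ?_⟩
    rw [mul_pow]
    gcongr
    nlinarith

/-- ∂_u² = (u_* - u)^{-2}(∂_x² + ∂_x), so the bracket in αbar is (u_* - u)^{-2} times the expression
bounded in `hcurv`. The factor e^{-8} bounds γ_AA = e^{2(ρ±w)} from below, as |ρ| and |w| are at
most 2. The off-diagonal component vanishes identically. -/
theorem curvatureBlowup_of (h1 : 1 ≤ t₀) (hZ : JetFlow e q t₀ Z) (hJ : HasJets Φ Z)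
    (hb : ∀ x, Z x ∈ Metric.closedBall (baseJ e 0) 2)
    (hcurv : ∀ x, 0 ≤ x → 1 / 4 ≤ (θS q t₀).1 x * ((dx (dx (Φ 1))).1 (x, 0) + (dx (Φ 1)).1 (x, 0)
      + 2 * (dx (Φ 0)).1 (x, 0) * (dx (Φ 1)).1 (x, 0))) {C : ℝ} (hC : 0 ≤ C) :
    CurvatureBlowup q (Real.exp (-t₀)) (Real.exp (-8) / 4) C (fieldsOf (Real.exp (-t₀)) Φ) := by
  intro u hu θ
  obtain ⟨hx, hlog, hw, hwt⟩ := wt_values (q := q) h1 hu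
  have hus := Real.exp_pos (-t₀)
  rw [hlog]
  set us := Real.exp (-t₀) with hus'
  set x := -Real.log (1 - u / us) with hxd
  have hXi : Xi us (pt u 0 θ) = (x, 0) := rfl
  obtain ⟨-, -, v2⟩ := z_values hZ h1 hJ (by linarith : -(1 / 4) < x)
  have hp : 0 < us - u := sub_pos.2 hu.2
  have hT : 0 < t₀ + x := by linarith
  have hE : (exp (-(2 * phiS us))).1 x = (us - u)⁻¹ := exp_neg_phiS_Xi hus (x := pt u 0 θ) hu.2
  have hl : (Du us (Φ 2)).1 (Xi us (pt u 0 θ)) = 0 := by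
    rw [hXi, Du_apply, Sm.mul_apply, v2, mul_zero]
  obtain ⟨a0, a1, a2⟩ := αb_values hus e (x := pt u 0 θ) hu.2 hl
  have hDD : (Du us (Du us (Φ 1))).1 (x, 0)
      + 2 * (Du us (Φ 0)).1 (x, 0) * (Du us (Φ 1)).1 (x, 0) = ((us - u) ^ 2)⁻¹ *
      ((dx (dx (Φ 1))).1 (x, 0) + (dx (Φ 1)).1 (x, 0)
      + 2 * (dx (Φ 0)).1 (x, 0) * (dx (Φ 1)).1 (x, 0)) := by
    simp only [Du_apply, dx_mul, dx_Ei, Sm.mul_apply, Sm.add_apply, X_apply, hE]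
    rw [inv_pow (us - u) 2 |>.symm]
    ring
  rw [hXi, hDD] at a0 a1
  set V := (dx (dx (Φ 1))).1 (x, 0) + (dx (Φ 1)).1 (x, 0)
      + 2 * (dx (Φ 0)).1 (x, 0) * (dx (Φ 1)).1 (x, 0)
  have hTq : 0 < (t₀ + x) ^ (2 * q) := Real.rpow_pos_of_pos hT _
  have hV : 1 / 4 * ((t₀ + x) ^ (2 * q))⁻¹ ≤ V := by
    have := hcurv x hx
    rw [θS_apply h1, clamp_eq (by linarith)] at this
    rw [← div_eq_mul_inv, div_le_iff₀ hTq]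
    linarith
  have hγ : ∀ r : ℝ, -4 ≤ r → ∀ α : ℝ, |α| = Real.exp (2 * r) * (((us - u) ^ 2)⁻¹ * V) →
      Real.exp (-8) / 4 / ((us - u) ^ 2 * (t₀ + x) ^ (2 * q)) ≤ |α| := by
    intro r hr α hα
    rw [hα, div_eq_mul_inv, mul_inv]
    calc Real.exp (-8) / 4 * (((us - u) ^ 2)⁻¹ * ((t₀ + x) ^ (2 * q))⁻¹)
        = Real.exp (-8) * (((us - u) ^ 2)⁻¹ * (1 / 4 * ((t₀ + x) ^ (2 * q))⁻¹)) := by ring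
      _ ≤ _ := by gcongr; linarith
  have hV0 : 0 ≤ V := le_trans (by positivity) hV
  have hj : ∀ i, |Z x i 0 - baseJ e 0 i 0| ≤ 2 := fun i => by
    have h2 := hb x
    rw [Metric.mem_closedBall, dist_pi_le_iff (by norm_num)] at h2
    have h3 := h2 i
    rw [dist_pi_le_iff (by norm_num)] at h3
    exact h3 0
  have hv : ∀ i, (Φ i).1 (x, 0) = Z x i 0 := fun i => hJ i 0 x
  have b0 : baseJ e 0 0 0 = 0 := by
    change -(e.h.1 (e.ℓ + 2) / 4) * (0 : ℝ) ^ 2 = 0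
    ring
  have b1 : baseJ e 0 1 0 = 0 := rfl
  obtain ⟨c1, c2⟩ := abs_le.1 (hj 0)
  obtain ⟨c3, c4⟩ := abs_le.1 (hj 1)
  rw [b0] at c1 c2
  rw [b1] at c3 c4
  refine ⟨fun A => ?_, ?_⟩
  · fin_cases A
    · refine hγ ((Φ 0).1 (x, 0) + (Φ 1).1 (x, 0)) (by rw [hv, hv]; linarith) _ ?_
      change |(fieldsOf us Φ).αb 0 0 (pt u 0 θ)| = _
      rw [a0, abs_neg]
      exact abs_of_nonneg (mul_nonneg (Real.exp_pos (2 * ((Φ 0).1 (x, 0) + (Φ 1).1 (x, 0)))).le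
        (by positivity))
    · refine hγ ((Φ 0).1 (x, 0) - (Φ 1).1 (x, 0)) (by rw [hv, hv]; linarith) _ ?_
      change |(fieldsOf us Φ).αb 1 1 (pt u 0 θ)| = _
      rw [a1]
      exact abs_of_nonneg (mul_nonneg (Real.exp_pos (2 * ((Φ 0).1 (x, 0) - (Φ 1).1 (x, 0)))).le
        (by positivity))
  · rw [a2, abs_zero]
    have : 0 < (t₀ + x) ^ (4 * q) := Real.rpow_pos_of_pos hT _
    positivity

end Blowup

/-! ### Construction of the fields -/

theorem Mixed.mem_van_of {f : S2} {A : Set (ℝ × ℝ)} (h : ∀ p ∈ A, Mixed f p) (n : ℕ) : f ∈ van A n :=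
  fun j _ p hp => h p hp 0 j

theorem InK.mono {C C' : ℝ} (h : C ≤ C') {p : St} (hp : InK C p) : InK C' p :=
  let ⟨p', h1, h2⟩ := hp
  ⟨p', h1, h2.trans h⟩

/-- Fields with jets `Z` on the singular hypersurface and satisfying all equations to infinite order,
with bounded data on the regular hypersurface. -/
theorem exists_fields (e : Eos) : ∃ b B, 0 < b ∧ b ≤ 1 ∧ ∀ {q t₀ s : ℝ} {Z : ℝ → YS},
    ContDiff ℝ ∞ Z → JetFlow e q t₀ Z → 1 ≤ t₀ → Z 0 = baseJ e s → RootBound e q t₀ Z →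
    (∀ x, e.ℓ < Z x 3 0) → ∃ (Ψ : Fl) (ρ t : Sm ℝ), HasJets Ψ Z ∧
      (∀ i y, 0 ≤ y → (Ψ i).1 (0, y) = ((![ρ, Sm.const s, 0, t, psiOf e ρ t] : Fin 5 → Sm ℝ) i).1 y) ∧
      (∀ k ≤ 8, ∀ y, 0 ≤ y → y < b → |(der^[k] ρ).1 y| ≤ B) ∧
      (∀ k ≤ 8, ∀ y, 0 ≤ y → y < b → |(der^[k] t).1 y| ≤ B) ∧
      (∀ y, e.ℓ < t.1 y) ∧
      ∀ p ∈ corner b, (∀ k, Mixed (evol e (hatF Ψ (phiS (Real.exp (-t₀)))) k) p) ∧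
        Mixed (exx e (hatF Ψ (phiS (Real.exp (-t₀))))) p ∧
        Mixed (eyy e (hatF Ψ (phiS (Real.exp (-t₀))))) p := by
  obtain ⟨δ, hδ, hδ1, hpsi⟩ := exists_psiArg_bound e
  set h := e.h.1 (e.ℓ + 2) with hh
  -- For y < b the base value |ρ_y| = |h|y/2 is at most δ/2, which leaves δ/2 for the correction.
  set b := min 1 (δ / (|h| + 1)) with hb
  have hb0 : 0 < b := lt_min one_pos (by positivity)
  have hb1 : b ≤ 1 := min_le_left _ _
  have hbh : |h| * b ≤ δ := by
    have h2 : b * (|h| + 1) ≤ δ := (le_div_iff₀ (by positivity)).1 (min_le_right _ _)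
    nlinarith
  choose Bρ hBρ using fun k : ℕ => (isCompact_Icc (a := (0 : ℝ)) (b := 1)).exists_bound_of_continuousOn
    (der^[k] (baseD e 0 0)).continuous.continuousOn
  choose Bt hBt using fun k : ℕ => (isCompact_Icc (a := (0 : ℝ)) (b := 1)).exists_bound_of_continuousOn
    (der^[k] (Sm.const (e.ℓ + 2) : Sm ℝ)).continuous.continuousOn
  set B := 1 + ∑ k ∈ Finset.range 9, (|Bρ k| + |Bt k|) with hB
  have hBk : ∀ k ≤ 8, |Bρ k| + |Bt k| + 1 ≤ B := fun k hk => by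
    have := Finset.single_le_sum (f := fun k => |Bρ k| + |Bt k|) (fun _ _ => by positivity)
      (Finset.mem_range.2 (by omega : k < 9))
    rw [hB]; linarith
  refine ⟨b, B, hb0, hb1, fun {q t₀ s Z} hZs hZ h1 h0 hν ht => ?_⟩
  obtain ⟨Φ, hJ, hw, hl, hflat⟩ := exists_singular_fields hZs hZ h1 h0 hν ht
  have hjet : ∀ i, ∀ k ≤ 8, (der^[k] (restr' (Φ i) - baseD e s i)).1 0 = 0 := fun i k hk => by
    rw [iterate_der_sub, iterate_der_restr', Sm.sub_apply, restr'_apply, hJ i ⟨k, by omega⟩ 0, h0]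
    exact sub_self _
  -- The corner jets of order at least nine come from the formal series and are not controlled. The
  -- corrections carry only these, so their first eight derivatives can be made small and B depends
  -- on the base data alone.
  obtain ⟨f0, hf0, hs0⟩ := exists_small_jet _ 8 (hjet 0) (half_pos hδ)
  obtain ⟨f3, hf3, hs3⟩ := exists_small_jet _ 8 (hjet 3) (half_pos hδ)
  have hvan : ∀ (i : Fin 5) (f : Sm ℝ), (∀ k, (der^[k] f).1 0 = (der^[k] (restr' (Φ i) - baseD e s i)).1 0) →
      ∀ n, Y (baseD e s i + f - restr' (Φ i)) ∈ van {(0, 0)} n := fun i f hf =>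
    Y_mem_van.2 fun j => by
      rw [iterate_der_sub, iterate_der_add, Sm.sub_apply, Sm.add_apply, hf, iterate_der_sub, Sm.sub_apply]
      ring
  have htd : ∀ y, |(baseD e s 3 + f3).1 y - (e.ℓ + 2)| ≤ δ := fun y => by
    have : (baseD e s 3 + f3).1 y - (e.ℓ + 2) = f3.1 y := by
      change e.ℓ + 2 + f3.1 y - _ = _
      ring
    rw [this]
    exact (hs3 0 (by omega) y).trans (by linarith)
  have htl : ∀ y, e.ℓ < (baseD e s 3 + f3).1 y := fun y => by
    have := (abs_le.1 (htd y)).1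
    linarith
  have hpos : ∀ y ∈ Set.Ioo 0 b, 1 / 2 ≤ (psiArg e (baseD e s 0 + f0) (baseD e s 3 + f3)).1 y := by
    intro y hy
    obtain ⟨d1, d2⟩ := der_base e s y
    refine hpsi _ _ y ?_ ?_ (htd y)
    · have e1 : (der (der (baseD e s 0 + f0))).1 y + e.h.1 (e.ℓ + 2) / 2 = (der^[2] f0).1 y := by
        rw [map_add, map_add, Sm.add_apply, d2]
        change -(e.h.1 (e.ℓ + 2) / 2) + (der^[2] f0).1 y + _ = _
        ring
      rw [e1]
      exact (hs0 2 (by omega) y).trans (by linarith)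
    · rw [map_add, Sm.add_apply, d1]
      refine (abs_add_le _ _).trans ?_
      have e1 : |(der f0).1 y| ≤ δ / 2 := hs0 1 (by omega) y
      have e2 : |-(e.h.1 (e.ℓ + 2) / 2) * y| ≤ δ / 2 := by
        rw [abs_mul, abs_neg, abs_div, abs_two, abs_of_pos hy.1]
        have : |h| * y ≤ |h| * b := by gcongr; exact hy.2.le
        change |h| / 2 * y ≤ _
        linarith
      linarith
  have h4 : 1 / 2 < Real.exp (2 * (Φ 4).1 (0, 0)) := by
    have e1 : (Φ 4).1 (0, 0) = (psiOf e (baseD e s 0) (baseD e s 3)).1 0 := (hJ 4 0 0).trans (by rw [h0]; rfl)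
    have e2 : 2 * (psiOf e (baseD e s 0) (baseD e s 3)).1 0 = lg.1 1 := by
      change 2 * (1 / 2 * lg.1 ((psiArg e (baseD e s 0) (baseD e s 3)).1 0)) = _
      rw [psiArg_base]; ring
    rw [e1, e2, exp_lg (by norm_num)]
    norm_num
  obtain ⟨Ψ, hΨ1, -, hΨ3, hΨ4⟩ := exists_regular_extension e hflat hw hl h4
    (by have := hJ 3 0 0; simp only [Fin.val_zero, Function.iterate_zero, id_eq] at this; rw [this]; exact ht 0)
    (hvan 0 f0 hf0) (hvan 3 f3 hf3) (fun y _ => htl y) hpos hb0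
  refine ⟨Ψ, _, _, fun i k x => (hΨ1 i k x).trans (hJ i k x), hΨ3, fun k hk y hy0 hyb => ?_,
    fun k hk y hy0 hyb => ?_, htl, hΨ4⟩
  · rw [iterate_der_add, Sm.add_apply]
    refine (abs_add_le _ _).trans ?_
    have e1 : |(der^[k] (baseD e s 0)).1 y| ≤ Bρ k := hBρ k y ⟨hy0, by linarith⟩
    linarith [hBk k hk, hs0 k hk y, le_abs_self (Bρ k), abs_nonneg (Bt k)]
  · rw [iterate_der_add, Sm.add_apply]
    refine (abs_add_le _ _).trans ?_
    have e1 : |(der^[k] (baseD e s 3)).1 y| ≤ Bt k := hBt k y ⟨hy0, by linarith⟩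
    linarith [hBk k hk, hs3 k hk y, le_abs_self (Bt k), abs_nonneg (Bρ k)]

end EinsteinEuler
end

/-! ### Choice of constants and the one-parameter family -/

noncomputable section

namespace EinsteinEuler

open Sm

/-! ### The family of data -/

/-- The weighted equations along the regular hypersurface. -/
theorem jetsBdd_axis {e : Eos} {C b us : ℝ} (hus : 0 < us) {Ψ : Fl} {d : Fin 5 → Sm ℝ} {s : ℝ}
    (hd : ∀ i y, 0 ≤ y → (Ψ i).1 (0, y) = (d i).1 y) (h1 : d 1 = Sm.const s)
    (ht : ∀ y, e.ℓ < (d 3).1 y) (hev : ∀ p ∈ axis b, ∀ k, Mixed (evol e (hatF Ψ (phiS us)) k) p)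
    (hx0 : (dx (Ψ 0)).1 (0, 0) = 0) (hx2 : (dx (Ψ 2)).1 (0, 0) = 0)
    (hK : ∀ (z : Fin 3 → S2) (m : Sm ℝ), (∀ i, zres e Ψ z m i ∈ van (axis b) 8) → z 1 = 0 →
      (z 0).1 (0, 0) = 0 → (z 2).1 (0, 0) = 0 → m.1 0 = 1 → ∀ p ∈ axis b, InK C (jet Ψ z m p)) :
    JetsBdd e C (axis b) Ψ
      ![X (Sm.const us⁻¹) * dx (Ψ 0), 0, X (Sm.const us⁻¹) * dx (Ψ 2)] (Sm.const us⁻¹)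
      (Sm.const us⁻¹ * exp (2 * phiS us)) := by
  set z : Fin 3 → S2 := ![X (Sm.const us⁻¹) * dx (Ψ 0), 0, X (Sm.const us⁻¹) * dx (Ψ 2)] with hz
  have htA : ∀ p ∈ axis b, e.ℓ < (Ψ 3).1 p := by
    rintro ⟨x, y⟩ ⟨rfl, hy, -⟩
    rw [hd 3 y hy]; exact ht y
  have hw : dy (Ψ 1) ∈ van (axis b) 8 := by
    rintro j - ⟨x, y⟩ ⟨rfl, hy, -⟩
    rw [← Function.iterate_succ_apply, jets_axis hd 1 (j + 1) hy, h1, iterate_der_const]; rfl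
  obtain ⟨r1, r2, r3⟩ := res_mem_of_evol (z := z) (θ := Sm.const us⁻¹) rfl rfl rfl htA hw
    (fun k => Mixed.mem_van_of (fun p hp => hev p hp k) 8)
  refine ⟨r1, r2, r3, rfl, rfl, hK _ _ r1 rfl ?_ ?_ ?_⟩
  · change us⁻¹ * (dx (Ψ 0)).1 (0, 0) = 0
    rw [hx0, mul_zero]
  · change us⁻¹ * (dx (Ψ 2)).1 (0, 0) = 0
    rw [hx2, mul_zero]
  · rw [Sm.mul_apply, exp_phiS hus, neg_zero, Real.exp_zero, mul_one]
    exact inv_mul_cancel₀ hus.ne'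

/-- The weighted equations along the singular hypersurface. -/
theorem jetsBdd_line {e : Eos} {C q t₀ : ℝ} {Z : ℝ → YS} {Ψ : Fl} (hZ : JetFlow e q t₀ Z) (h1 : 1 ≤ t₀)
    (hJ : HasJets Ψ Z) (hK : ∀ x, InK C (hbState e (ctrl q t₀ x, Z x))) :
    JetsBdd e C (line (Set.Ici 0)) Ψ (zOf q t₀ Ψ) (θS q t₀)
      (θS q t₀ * exp (2 * phiS (Real.exp (-t₀)))) := by
  have hsub : line (Set.Ici (0 : ℝ)) ⊆ line (Set.Ioi (-(1 / 4))) := fun p hp =>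
    ⟨by have : 0 ≤ p.1 := hp.1
        change -(1 / 4) < p.1
        linarith, hp.2⟩
  obtain ⟨r1, r2, r3⟩ := res_of_jets hZ h1 hJ
  refine ⟨fun i => van_anti hsub 8 (r1 i), van_anti hsub 8 r2, van_anti hsub 8 r3, rfl, rfl, ?_⟩
  rintro ⟨x, y⟩ ⟨hx, rfl⟩
  have hx' : (0 : ℝ) ≤ x := hx
  rw [jet_eq hZ h1 hJ (by linarith)]
  exact hK x

/-- The data for a given value of the parameter. -/
theorem exists_data {P : ℝ → ℝ} {e : Eos} (he : EosOf P e) {q : ℝ} (hq : 1 / 2 < q) :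
    ∃ D C ε₀ : ℝ, 1 ≤ D ∧ 0 < C ∧ 0 < ε₀ ∧ ε₀ < 1 ∧
      ∀ ε us ubs : ℝ, 0 < ε → ε ≤ ε₀ → 0 < us → us ≤ ε → 0 < ubs → ubs ≤ ε → ∀ s ∈ Set.Icc (0 : ℝ) 1,
        ∃ Ψ : Fl, (Ψ 0).1 (0, 0) = 0 ∧ (Ψ 1).1 (0, 0) = s ∧ IsCharData P us ubs (fieldsOf us Ψ) ∧
          NullConstraints P us ubs (fieldsOf us Ψ) ∧ DataBounds q ε us ubs 1 D (fieldsOf us Ψ) ∧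
          ExactBlowup q us (Real.exp (-8) / 4) C (fieldsOf us Ψ) ∧
          CurvatureBlowup q us (Real.exp (-8) / 4) C (fieldsOf us Ψ) := by
  obtain ⟨b, B, hb0, hb1, hfields⟩ := exists_fields e
  obtain ⟨C₁, hC₁⟩ := exists_axis_bound e B
  obtain ⟨C₂, hC₂⟩ := exists_hbState_bound e
  obtain ⟨M, hM, hbounds⟩ := exists_dataBounds e (max C₁ C₂)
  obtain ⟨δ₁, hδ₁, hδ₁1, hroot⟩ := exists_root_bound e
  obtain ⟨δ₂, hδ₂, hδ₂1, hderiv⟩ := exists_root_deriv_bound e (q := q) (by linarith)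
  set δ := min (min δ₁ δ₂) (1 / 16) with hδ
  have hδ0 : 0 < δ := lt_min (lt_min hδ₁ hδ₂) (by norm_num)
  have hev := (exists_weighted_flow hq (contDiff_jetField e)
    (isCompact_closedBall ((0, 1, 0) : ℝ × ℝ × ℝ) 1) (baseJ e 0)).and
    ((eventually_ctrl_mem (q := q) (by linarith) hδ0).and
      ((Filter.eventually_ge_atTop 1).and (Filter.eventually_ge_atTop (64 * q))))
  obtain ⟨T, hT⟩ := Filter.eventually_atTop.1 hev
  -- u_* ≤ e^{-T} means t₀ ≥ T, beyond all thresholds in t₀; ubar_* ≤ b keeps to the interval where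
  -- the data on the regular hypersurface are controlled.
  refine ⟨156 * M ^ 2, 2, min (Real.exp (-T)) (min b (1 / 2)), by nlinarith, by norm_num, by positivity,
    (min_le_right _ _).trans_lt ((min_le_right _ _).trans_lt (by norm_num)),
    fun ε us ubs hε hε₀ hus husε hubs hubsε s hs => ?_⟩
  have hεT : ε ≤ Real.exp (-T) := hε₀.trans (min_le_left _ _)
  have hεb : ε ≤ b := hε₀.trans ((min_le_right _ _).trans (min_le_left _ _))
  obtain ⟨t₀, rfl⟩ : ∃ t₀, us = Real.exp (-t₀) := ⟨-Real.log us, by rw [neg_neg, Real.exp_log hus]⟩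
  have htT : T ≤ t₀ := by
    have := Real.exp_le_exp.1 (husε.trans hεT)
    linarith
  obtain ⟨hflow, hctrl, h1, hqt⟩ := hT t₀ htT
  have hcball : ∀ {r : ℝ}, δ ≤ r → ∀ x, ctrl q t₀ x ∈ Metric.closedBall (0, 1, 0) r := fun hr x =>
    Metric.closedBall_subset_closedBall hr (hctrl x)
  have hδa : δ ≤ δ₁ := (min_le_left _ _).trans (min_le_left _ _)
  have hδb : δ ≤ δ₂ := (min_le_left _ _).trans (min_le_right _ _)
  have hδc : δ ≤ 1 / 16 := min_le_right _ _
  obtain ⟨Z, hZs, hZ0, hZb, hZ⟩ := hflow (ctrl q t₀) (contDiff_ctrl q t₀) (hcball (by linarith))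
    (baseJ e s) (baseJ_mem e hs)
  have hJF : JetFlow e q t₀ Z := hZ
  have hZ2 : ∀ x, Z x ∈ Metric.closedBall (baseJ e 0) 2 := fun x => by
    have h2 := hZb x
    have h3 := baseJ_mem e hs
    rw [Metric.mem_closedBall] at h2 h3 ⊢
    linarith [dist_triangle (Z x) (baseJ e s) (baseJ e 0)]
  have hroot1 : ∀ x, |root e q t₀ Z x - 1| ≤ 1 / 2 := fun x =>
    hroot (ctrl q t₀ x) (hcball hδa x) (Z x) (hZ2 x)
  have hRB : RootBound e q t₀ Z := fun x => by
    have := (abs_le.1 (hroot1 x)).1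
    unfold root at this
    linarith
  -- t starts at `ℓ` + 2 and moves by at most one.
  have hZt : ∀ x, e.ℓ < Z x 3 0 := fun x => by
    have h2 := hZb x
    rw [Metric.mem_closedBall, dist_pi_le_iff zero_le_one] at h2
    have h3 := h2 3
    rw [dist_pi_le_iff zero_le_one] at h3
    have h4 := (abs_le.1 (h3 0)).1
    have h5 : baseJ e s 3 0 = e.ℓ + 2 := rfl
    linarith
  obtain ⟨Ψ, ρ, t, hJ, hd, hρ, ht, htl, hflat⟩ := hfields hZs hJF h1 hZ0 hRB hZt
  have haxis : axis ubs ⊆ axis b := fun p hp => ⟨hp.1, hp.2.1, hp.2.2.trans_le (hubsε.trans hεb)⟩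
  have hv : ∀ i x, (Ψ i).1 (x, 0) = Z x i 0 := fun i x => hJ i 0 x
  obtain ⟨v0, -, v2⟩ := z_values hJF h1 hJ (by norm_num : -(1 / 4) < (0 : ℝ))
  -- ρ_x vanishes at the corner by the choice of `rS`. Without this, ∂_uρ = u_*⁻¹ρ_x on the regular
  -- hypersurface would not be bounded uniformly in u_*.
  have hdx0 : (dx (Ψ 0)).1 (0, 0) = 0 := by
    rw [v0, rS_eq h1 (by norm_num)]; simp
  have h00 : (Ψ 0).1 (0, 0) = 0 := by
    rw [hv, hZ0]
    change -(e.h.1 (e.ℓ + 2) / 4) * (0 : ℝ) ^ 2 = 0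
    ring
  have h10 : (Ψ 1).1 (0, 0) = s := hd 1 0 le_rfl
  have hX0 : ∀ x ∈ H0 ubs, Xi (Real.exp (-t₀)) x = (0, x 1) := fun x hx => by
    change (-Real.log (1 - x 0 / Real.exp (-t₀)), x 1) = _
    rw [hx.1]; simp
  have hX1 : ∀ x ∈ Hb0 (Real.exp (-t₀)), ∃ y, 0 ≤ y ∧ Xi (Real.exp (-t₀)) x = (y, 0) := fun x hx =>
    ⟨_, (wt_values (q := q) h1 ⟨hx.2.1, hx.2.2⟩).1, Prod.ext rfl hx.1⟩
  have hcorner : ∀ x ∈ H0 ubs ∪ Hb0 (Real.exp (-t₀)), Xi (Real.exp (-t₀)) x ∈ corner b := by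
    rintro x (hx | hx)
    · rw [hX0 x hx]
      exact Or.inr ⟨rfl, hx.2.1, hx.2.2.trans_le (hubsε.trans hεb)⟩
    · obtain ⟨y, hy, hxy⟩ := hX1 x hx
      rw [hxy]
      exact Or.inl ⟨rfl, hy⟩
  have hl : ∀ x ∈ H0 ubs ∪ Hb0 (Real.exp (-t₀)), (Ψ 2).1 (Xi (Real.exp (-t₀)) x) = 0 := by
    rintro x (hx | hx)
    · rw [hX0 x hx]; exact hd 2 _ hx.2.1
    · obtain ⟨y, hy, hxy⟩ := hX1 x hx
      rw [hxy, hv]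
      exact hJF.lapse (by rw [hZ0]; rfl) (by linarith)
  have hfl : ∀ x ∈ H0 ubs ∪ Hb0 (Real.exp (-t₀)),
      (∀ k, evol e (hatF Ψ (phiS (Real.exp (-t₀)))) k ∈ flat (Xi (Real.exp (-t₀)) x)) ∧
      exx e (hatF Ψ (phiS (Real.exp (-t₀)))) ∈ flat (Xi (Real.exp (-t₀)) x) ∧
      eyy e (hatF Ψ (phiS (Real.exp (-t₀)))) ∈ flat (Xi (Real.exp (-t₀)) x) := fun x hx =>
    have h := hflat _ (hcorner x hx)
    ⟨fun k => mem_flat_iff (h.1 k), mem_flat_iff h.2.1, mem_flat_iff h.2.2⟩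
  refine ⟨Ψ, h00, h10, isCharData_of Ψ hus he hl hfl, nullConstraints_of hus he hl ?_ ?_ ?_, ?_, ?_, ?_⟩
  · intro x hx
    obtain ⟨y, hy, hxy⟩ := hX1 x hx
    rw [hxy, Du_apply, Sm.mul_apply, (z_values hJF h1 hJ (by linarith : -(1 / 4) < y)).2.2, mul_zero]
  · intro x hx
    rw [hX0 x hx]
    have := jets_axis hd 2 1 hx.2.1
    simp only [Function.iterate_one] at this
    rw [this]
    change (der (0 : Sm ℝ)).1 _ = 0
    rw [map_zero]; rfl
  · intro x hx
    obtain ⟨h2, h3, h4⟩ := hfl x hx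
    obtain ⟨k1, -, -, -, -, k6, k7⟩ := residuals_mem h2 h3 h4
    exact ⟨eq_zero_of_mem_flat k1, eq_zero_of_mem_flat k6, eq_zero_of_mem_flat k7⟩
  · refine hbounds hε (by linarith [hεb]) hus hubs h00 (jetsBdd_axis hus hd rfl htl
      (fun p hp => ?_) hdx0 v2 fun z m hz z1 z0 z2 hm p hp => ?_) rfl
      (jetsBdd_line hJF h1 hJ fun x => (hC₂ _ (hcball (by linarith) x) _ (hZ2 x)).mono (le_max_right _ _))
      rfl fun u hu => ?_
    · exact (hflat p (Or.inr (haxis hp))).1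
    · refine (hC₁ ubs s Ψ ρ t m z (by linarith) (abs_le.2 ⟨by linarith [hs.1], hs.2⟩) hd
        (fun k hk y h2 h3 => hρ k hk y h2 (by linarith)) (fun k hk y h2 h3 => ht k hk y h2 (by linarith))
        hz z1 z0 z2 hm p hp).mono (le_max_left _ _)
    · obtain ⟨-, -, h3, h4⟩ := wt_values (q := q) h1 hu
      exact ⟨h3, h4⟩
  · refine exactBlowup_of h1 hJF hJ hroot1 (by positivity) ?_ le_rfl
    have : Real.exp (-8) ≤ 1 := Real.exp_le_one_iff.2 (by norm_num)
    linarith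
  · refine curvatureBlowup_of h1 hJF hJ hZ2 (fun x hx => ?_) (by norm_num)
    obtain ⟨r', h2, h3⟩ := hderiv h1 hqt hJF hZ2 (hcball hδb) x hx
    exact le_curvature (by linarith) h1 hqt hJF hJ hRB hδc hctrl hx h2 h3

/-- At the corner ρ = 0 and γ₁₁ = e^{2w}, so the value of w there is read off from the metric. -/
theorem dataDiffer_of {us ubs : ℝ} (hubs : 0 < ubs) {Φ Ψ : Fl} (h0 : (Φ 0).1 (0, 0) = 0)
    (h0' : (Ψ 0).1 (0, 0) = 0) (h1 : (Φ 1).1 (0, 0) ≠ (Ψ 1).1 (0, 0)) :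
    DataDiffer us ubs (fieldsOf us Φ) (fieldsOf us Ψ) := by
  refine ⟨pt 0 0 0, Or.inl ⟨rfl, le_rfl, hubs⟩, Or.inl ⟨0, 0, fun h => h1 ?_⟩⟩
  have hX : Xi us (pt 0 0 0) = (0, 0) := by
    change (-Real.log (1 - 0 / us), (0 : ℝ)) = _
    simp
  change Real.exp (2 * ((Φ 0).1 (Xi us (pt 0 0 0)) + (Φ 1).1 (Xi us (pt 0 0 0))))
    = Real.exp (2 * ((Ψ 0).1 (Xi us (pt 0 0 0)) + (Ψ 1).1 (Xi us (pt 0 0 0)))) at h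
  rw [hX, h0, h0'] at h
  have := Real.exp_injective h
  linarith

end EinsteinEuler

end

theorem proposition3p1
    (q : ℝ) (hq : 1 / 2 < q)
    (P : ℝ → ℝ) (hP : ContDiffOn ℝ ∞ P (Set.Ioi 0))
    (hP' : ∀ t : ℝ, 0 < t → 0 < deriv P t ∧ deriv P t < 1) :
    ∃ d D c C ε₀ : ℝ, 0 < d ∧ d ≤ D ∧ 0 < c ∧ 0 < C ∧ 0 < ε₀ ∧ ε₀ < 1 ∧
      ∀ ε us ubs : ℝ, 0 < ε → ε ≤ ε₀ → 0 < us → us ≤ ε → 0 < ubs → ubs ≤ ε →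
        Real.sqrt (∫ u in Set.Ioo 0 us, (EinsteinEuler.wt q us u ^ 2)⁻¹) < ε →
        ∃ X : Set.Icc (0 : ℝ) 1 → EinsteinEuler.Fields,
          (∀ s, EinsteinEuler.IsCharData P us ubs (X s) ∧
            EinsteinEuler.NullConstraints P us ubs (X s) ∧
            EinsteinEuler.DataBounds q ε us ubs d D (X s) ∧
            EinsteinEuler.ExactBlowup q us c C (X s) ∧
            EinsteinEuler.CurvatureBlowup q us c C (X s)) ∧
          ∀ s t, s ≠ t → EinsteinEuler.DataDiffer us ubs (X s) (X t) := by
  obtain ⟨e, he⟩ := EinsteinEuler.exists_eos hP hP'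
  obtain ⟨D, C, ε₀, hD, hC, h0, h1, h⟩ := EinsteinEuler.exists_data he hq
  refine ⟨1, D, Real.exp (-8) / 4, C, ε₀, one_pos, hD, by positivity, hC, h0, h1,
    fun ε us ubs hε hε₀ hus husε hubs hubsε _ => ?_⟩
  choose Ψ hΨ using fun s : Set.Icc (0 : ℝ) 1 => h ε us ubs hε hε₀ hus husε hubs hubsε s s.2
  refine ⟨fun s => EinsteinEuler.fieldsOf us (Ψ s), fun s => (hΨ s).2.2, fun s t hst => ?_⟩
  refine EinsteinEuler.dataDiffer_of hubs (hΨ s).1 (hΨ t).1 ?_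
  rw [(hΨ s).2.1, (hΨ t).2.1]
  exact fun h => hst (Subtype.ext h)
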